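/- **Setting.** Let $m,\sigma,R,T_w>0$, let $\mathcal S\ge 0$ be continuous on an interval $\mathcal U\ni 0$ of $\mathbb R$, and let $I\subset\mathbb R$ be an open time interval. Let $\Omega\subset\mathbb R^3$ be either a bounded domain $D$ with $C^1$ boundary (outward unit normal $n$) or, for a periodic gas, $\Omega=\mathbb R^3$; $\chi$ is the indicator of $\Omega$ and $\theta$ the Heaviside function ($\theta(0)=1$). Write $\langle\cdot\rangle=\int_{\mathbb R^3}\cdot\,d\xi$ and, for a velocity distribution $f=f(t,X,\xi)$ (the argument $t$ is suppressed), $$\rho=\langle f\rangle,\quad v=\tfrac1\rho\langle\xi f\rangle,\quad \mathcal R(X)=\tfrac1m\int_\Omega\rho(Y)\theta(\sigma-|Y-X|)\,dY,\quad g(X,Y)=[\mathcal S(\mathcal R(X))+\mathcal S(\mathcal R(Y))]\chi(X)\chi(Y).$$ For $\alpha\in\mathbb S^2$ put $V_\alpha=(\xi_*-\xi)\cdot\alpha$, $\xi'=\xi+V_\alpha\alpha$, $\xi_*'=\xi_*-V_\alpha\alpha$. The Enskog(–Vlasov) equation is $$\partial_t f+\xi\cdot\nabla_Xf+\mathcal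 K\cdot\nabla_\xi f=J(f),\qquad t\in I,\ X\in\Omega,$$ $$J(f)=\tfrac{\sigma^2}{m}\iint\big[g(X+\sigma\alpha,X)f(X+\sigma\alpha,\xi_*')f(X,\xi')-g(X-\sigma\alpha,X)f(X-\sigma\alpha,\xi_*)f(X,\xi)\big]V_\alpha\theta(V_\alpha)\,d\Omega(\alpha)d\xi_*,$$ with $\mathcal K=0$, or, with the Vlasov term, $\mathcal K(X)=-\int_\Omega\nabla_X\Phi(|Y-X|)\rho(Y)\,dY$; here $\Phi$ is locally Lipschitz on $(0,\infty)$, $r^2\Phi'(r)$ is integrable on $(0,r_0)$ for all $r_0>0$, and, in the periodic case, on $(0,\infty)$. A *classical solution* is a positive $f$, of class $C^1$ on $I\times\Omega\times\mathbb R^3$, satisfying the equation pointwise, with $\mathcal R\in\mathcal U$ on $\overline\Omega$, such that, for $t$ in compact subsets of $I$: $f$ and $\partial_tf$ decay faster than every power of $|\xi|$ uniformly in $X\in\Omega$; $\nabla_Xf,\nabla_\xi f$ do so uniformly for $X$ in compact subsets of $\Omega$; and $|\ln f|$ is bounded by a polynomial in $|\xi|$ uniformly in $X\in\Omega$. If $\Omega=D$,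 $f$ is moreover continuous on $I\times\overline D\times\mathbb R^3$ except possibly at $X\in\partial D$, $\xi\cdot n(X)=0$. **Functions and fluxes.** With $f_w(\xi)=\exp(-|\xi|^2/(2RT_w))$, $$H=\langle f\ln f\rangle+H^{(c)},\qquad H^{(c)}=\rho\int_0^{\mathcal R(X)}\mathcal S(x)\,dx,\qquad F=RT_w\big(\langle f\ln(f/f_w)\rangle+H^{(c)}\big).$$ The local flux of $H$ is $J^H=\langle\xi f\ln f\rangle+J^{(k)}+J^{(c)}$. With $Y_\tau=X+\tau\sigma\alpha$ and $Z_\tau=X+(\tau-1)\sigma\alpha$, $$J^{(k)}=\tfrac{\sigma^3}{2m}\iiint\!\int_0^1\alpha\,g(Y_\tau,Z_\tau)\ln\frac{f(Y_\tau,\xi')}{f(Y_\tau,\xi)}f(Y_\tau,\xi)f(Z_\tau,\xi_*)V_\alpha\theta(V_\alpha)\,d\tau\,d\Omega(\alpha)d\xi_*d\xi,$$ $$J^{(c)}=H^{(c)}v-\tfrac{\sigma^3}{2m}\int\!\int_0^1\alpha\,\big([v(Y_\tau)-v(Z_\tau)]\cdot\alpha\big)\rho(Y_\tau)\rho(Z_\tau)\mathcal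 S(\mathcal R(Y_\tau))\chi(Y_\tau)\chi(Z_\tau)\,d\tau\,d\Omega(\alpha).$$ The flux of the earlier global theorem is $\langle\xi f\ln f\rangle+H^{(c)}v+\rho v\int_\Omega\frac{\rho(Y)}m\theta(\sigma-|Y-X|)\mathcal S(\mathcal R(Y))\,dY$. Let $\Delta$ be $J^H$ minus this flux. The local flux of $F$ is $J^F=RT_wJ^H+\rho v(e^{(k)}+\frac12|v|^2)+(p^{(k)}+p^{(c)})v+q^{(k)}+q^{(c)}$. Here, with $c=\xi-v(X)$ and $c_*=\xi_*-v(X)$, $$e^{(k)}=\tfrac1{2\rho}\langle|c|^2f\rangle,\quad p^{(k)}_{ij}=\langle c_ic_jf\rangle,\quad q^{(k)}=\tfrac12\langle c|c|^2f\rangle,$$ $$p^{(c)}_{ij}=\tfrac{\sigma^2}{2m}\iiint\!\int_0^\sigma\alpha_i\alpha_j\,G\,d\lambda\,d\Omega(\alpha)d\xi_*d\xi,\qquad q^{(c)}_i=\tfrac{\sigma^2}{4m}\iiint\!\int_0^\sigma\alpha_i[(c+c_*)\cdot\alpha]\,G\,d\lambda\,d\Omega(\alpha)d\xi_*d\xi,$$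 $$G=V_\alpha^2\theta(V_\alpha)\,g(X+\lambda\alpha,X+(\lambda-\sigma)\alpha)\,f(X+(\lambda-\sigma)\alpha,\xi_*)\,f(X+\lambda\alpha,\xi).$$ With the Vlasov term, $\widetilde F=F+\rho e^{(v)}$ and the additional flux is $W=p^{(v)}v+q^{(v)}+\rho e^{(v)}v$, where $$e^{(v)}=\tfrac12\int_D\Phi(|Y-X|)\rho(Y)\,dY,\qquad p^{(v)}_{ij}=-\tfrac12\int\frac{r_ir_j}{|r|}\Phi'(|r|)\int_0^1(\chi\rho)(X+\lambda r)(\chi\rho)(X+(\lambda-1)r)\,d\lambda\,dr,$$ $$q^{(v)}=\rho e^{(v)}v-p^{(v)}v+\tfrac12\iint_0^1 r\,\Phi(|r|)(\chi\partial_t\rho)(X+(\lambda-1)r)(\chi\rho)(X+\lambda r)\,d\lambda\,dr.$$ "$V$ has zero divergence integral over $C$" means: the distributional divergence of $V$ in $\Omega$ is a locally integrable function that is integrable over $C$, and $\int_C\operatorname{div}V\,dX=0$. **Theorem.** Let $f$ be a classical solution, without or with the Vlasov term. (i) *Periodic domain.* If $\Omega=\mathbb R^3$ and $f$ is periodic in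 $X$ with respect to a lattice with fundamental cell $D$, then for all $t\in I$ the flux difference $\Delta$ has zero divergence integral over $D$ and $H$ is integrable over $D$; and $\mathcal H(t)=\int_DH\,dX$ is non-increasing on $I$. (ii) *Specular reflection.* The same conclusions hold if $\Omega=D$ and $f(t,X,\xi)=f(t,X,\xi-2(\xi\cdot n)n)$ for $X\in\partial D$, $\xi\cdot n<0$. (iii) *Impermeable heat-bath surface.* Let $\Omega=D$. For each $X\in\partial D$ let $\kappa_X$ be a Markov kernel on $\mathbb R^3$ that maps the outgoing flux measure $(\xi\cdot n)_+f_w\,d\xi$ to the incoming one $(\xi\cdot n)_-f_w\,d\xi$, and assume that for all $t\in I$ it maps $(\xi\cdot n)_+f(t,X,\xi)\,d\xi$ to $(\xi\cdot n)_-f(t,X,\xi)\,d\xi$. Then, for all $t\in I$, both $\Delta$ and $J^F-RT_wJ^H+RT_w\langle\xi f\ln f_w\rangle$ have zero divergence integral over $D$. Without the Vlasov term, $F$ is integrable over $D$ and $\mathcal F(t)=\int_DF\,dX$ is non-increasing on $I$. With the Vlasov term, $W$ also has zero divergence integral over $D$, $\widetilde F$ is integrable over $D$, and $\widetilde{\mathcal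 F}(t)=\int_D\widetilde F\,dX$ is non-increasing on $I$. -/

import Mathlib

open MeasureTheory ProbabilityTheory Set

noncomputable section

namespace Enskog

/-- Physical space and velocity space `ℝ³` with the Euclidean norm. -/
abbrev V3 := EuclideanSpace ℝ (Fin 3)

/-- The unit sphere `𝕊²`. -/
abbrev S2 := Metric.sphere (0 : V3) 1

/-- The solid-angle (surface) measure on the unit sphere, of total mass `4π`. -/
abbrev solidAngle : Measure S2 := (volume : Measure V3).toSphere

/-- Data of the hard-sphere gas: molecular mass `m`, diameter `σ`, and the non-negative continuous
function `S` entering the Enskog factor. `S` is considered on an interval `dom` containing `0`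
(for instance `S x = 1 / (2 - x)` on `x < 2`). -/
structure Gas where
  m : ℝ
  σ : ℝ
  S : ℝ → ℝ
  dom : Set ℝ
  m_pos : 0 < m
  σ_pos : 0 < σ
  zero_mem : (0 : ℝ) ∈ dom
  dom_ordConnected : dom.OrdConnected
  S_continuousOn : ContinuousOn S dom
  S_nonneg : ∀ x ∈ dom, 0 ≤ S x

/-- Heaviside function, with `θ 0 = 1`. -/
def theta (x : ℝ) : ℝ := if 0 ≤ x then 1 else 0

/-- Indicator function of a region. -/
def chi (Ω : Set V3) (X : V3) : ℝ := Ω.indicator (fun _ => (1 : ℝ)) X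

/-! ### Macroscopic quantities of a velocity distribution `u X ξ` at a fixed time -/

/-- Density `ρ = ⟨f⟩`. -/
def dens (u : V3 → V3 → ℝ) (X : V3) : ℝ := ∫ ξ, u X ξ

/-- Flow velocity `v = ⟨ξ f⟩ / ρ`. -/
def vel (u : V3 → V3 → ℝ) (X : V3) : V3 := (dens u X)⁻¹ • ∫ ξ, u X ξ • ξ

/-- `e⁽ᵏ⁾ = ⟨|ξ - v|² f⟩ / (2ρ)`. -/
def kinEnergy (u : V3 → V3 → ℝ) (X : V3) : ℝ :=
  1 / (2 * dens u X) * ∫ ξ, ‖ξ - vel u X‖ ^ 2 * u X ξ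

/-- `p⁽ᵏ⁾ᵢⱼ`. -/
def kinStress (u : V3 → V3 → ℝ) (X : V3) (i j : Fin 3) : ℝ :=
  ∫ ξ, (ξ i - vel u X i) * (ξ j - vel u X j) * u X ξ

/-- `q⁽ᵏ⁾`. -/
def kinHeatFlux (u : V3 → V3 → ℝ) (X : V3) : V3 :=
  (1 / 2 : ℝ) • ∫ ξ, (‖ξ - vel u X‖ ^ 2 * u X ξ) • (ξ - vel u X)

/-- The vector with components `∑ⱼ pᵢⱼ wⱼ`. -/
def applyStress (p : Fin 3 → Fin 3 → ℝ) (w : V3) : V3 :=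
  WithLp.toLp 2 (fun i => ∑ j, p i j * w j)

/-! ### Enskog factor and collision operator

`Ω` is the set on which the gas lives: the physical domain `D`, or all of `ℝ³` for a spatially
periodic gas. -/

/-- `𝓡(X) = (1/m) ∫_Ω ρ(Y) θ(σ - |Y - X|) dY`. -/
def crowd (G : Gas) (Ω : Set V3) (u : V3 → V3 → ℝ) (X : V3) : ℝ :=
  1 / G.m * ∫ Y in Ω, dens u Y * theta (G.σ - ‖Y - X‖)

/-- The factor `g(X,Y) = [S(𝓡(X)) + S(𝓡(Y))] χ(X) χ(Y)`. -/
def gFactor (G : Gas) (Ω : Set V3) (u : V3 → V3 → ℝ) (X Y : V3) : ℝ :=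
  (G.S (crowd G Ω u X) + G.S (crowd G Ω u Y)) * chi Ω X * chi Ω Y

/-- `V_α = (ξ_* - ξ) · α`. -/
def Va (ξ ξs α : V3) : ℝ := inner ℝ (ξs - ξ) α

/-- Post-collisional velocity `ξ' = ξ + V_α α`. -/
def post (ξ ξs α : V3) : V3 := ξ + Va ξ ξs α • α

/-- Post-collisional velocity `ξ_*' = ξ_* - V_α α`. -/
def postStar (ξ ξs α : V3) : V3 := ξs - Va ξ ξs α • α

/-- Gain term `J^G(f)`. -/
def gain (G : Gas) (Ω : Set V3) (u : V3 → V3 → ℝ) (X ξ : V3) : ℝ :=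
  G.σ ^ 2 / G.m * ∫ ξs : V3, ∫ α : S2,
    gFactor G Ω u (X + G.σ • (α : V3)) X
      * u (X + G.σ • (α : V3)) (postStar ξ ξs α) * u X (post ξ ξs α)
      * (Va ξ ξs α * theta (Va ξ ξs α)) ∂solidAngle

/-- Loss term `J^L(f)`. -/
def loss (G : Gas) (Ω : Set V3) (u : V3 → V3 → ℝ) (X ξ : V3) : ℝ :=
  G.σ ^ 2 / G.m * ∫ ξs : V3, ∫ α : S2,
    gFactor G Ω u (X - G.σ • (α : V3)) X
      * u (X - G.σ • (α : V3)) ξs * u X ξ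
      * (Va ξ ξs α * theta (Va ξ ξs α)) ∂solidAngle

/-- Collision operator `J(f) = J^G(f) - J^L(f)`. -/
def collision (G : Gas) (Ω : Set V3) (u : V3 → V3 → ℝ) (X ξ : V3) : ℝ :=
  gain G Ω u X ξ - loss G Ω u X ξ

/-- `p⁽ᶜ⁾ᵢⱼ`. -/
def colStress (G : Gas) (Ω : Set V3) (u : V3 → V3 → ℝ) (X : V3) (i j : Fin 3) : ℝ :=
  G.σ ^ 2 / (2 * G.m) * ∫ ξ : V3, ∫ ξs : V3, ∫ α : S2, (∫ l in (0 : ℝ)..G.σ,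
    (α : V3) i * (α : V3) j * Va ξ ξs α ^ 2 * theta (Va ξ ξs α)
      * gFactor G Ω u (X + l • (α : V3)) (X + (l - G.σ) • (α : V3))
      * u (X + (l - G.σ) • (α : V3)) ξs * u (X + l • (α : V3)) ξ) ∂solidAngle

/-- `q⁽ᶜ⁾`. -/
def colHeatFlux (G : Gas) (Ω : Set V3) (u : V3 → V3 → ℝ) (X : V3) : V3 :=
  (G.σ ^ 2 / (4 * G.m)) • ∫ ξ : V3, ∫ ξs : V3, ∫ α : S2, (∫ l in (0 : ℝ)..G.σ,
    (inner ℝ ((ξ - vel u X) + (ξs - vel u X)) (α : V3) * Va ξ ξs α ^ 2 * theta (Va ξ ξs α)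
      * gFactor G Ω u (X + l • (α : V3)) (X + (l - G.σ) • (α : V3))
      * u (X + (l - G.σ) • (α : V3)) ξs * u (X + l • (α : V3)) ξ) • (α : V3)) ∂solidAngle

/-! ### Local H function, free energy, and their fluxes -/

/-- `H⁽ᵏ⁾ = ⟨f ln f⟩`. -/
def Hk (u : V3 → V3 → ℝ) (X : V3) : ℝ := ∫ ξ, u X ξ * Real.log (u X ξ)

/-- `H⁽ᶜ⁾ = ρ ∫₀^𝓡 S(x) dx`. -/
def Hc (G : Gas) (Ω : Set V3) (u : V3 → V3 → ℝ) (X : V3) : ℝ :=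
  dens u X * ∫ x in (0 : ℝ)..(crowd G Ω u X), G.S x

/-- `H = H⁽ᵏ⁾ + H⁽ᶜ⁾`. -/
def Hfun (G : Gas) (Ω : Set V3) (u : V3 → V3 → ℝ) (X : V3) : ℝ := Hk u X + Hc G Ω u X

/-- `⟨ξ f ln f⟩`. -/
def HkFlux (u : V3 → V3 → ℝ) (X : V3) : V3 := ∫ ξ, (u X ξ * Real.log (u X ξ)) • ξ

/-- `J⁽ᵏ⁾`. -/
def Jk (G : Gas) (Ω : Set V3) (u : V3 → V3 → ℝ) (X : V3) : V3 :=
  (G.σ ^ 3 / (2 * G.m)) • ∫ ξ : V3, ∫ ξs : V3, ∫ α : S2, (∫ τ in (0 : ℝ)..1,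
    (gFactor G Ω u (X + (τ * G.σ) • (α : V3)) (X + ((τ - 1) * G.σ) • (α : V3))
      * (Real.log (u (X + (τ * G.σ) • (α : V3)) (post ξ ξs α) / u (X + (τ * G.σ) • (α : V3)) ξ)
        * u (X + (τ * G.σ) • (α : V3)) ξ * u (X + ((τ - 1) * G.σ) • (α : V3)) ξs)
      * (Va ξ ξs α * theta (Va ξ ξs α))) • (α : V3)) ∂solidAngle

/-- `J⁽ᶜ⁾`. -/
def Jc (G : Gas) (Ω : Set V3) (u : V3 → V3 → ℝ) (X : V3) : V3 :=
  Hc G Ω u X • vel u X - (G.σ ^ 3 / (2 * G.m)) • ∫ α : S2, (∫ τ in (0 : ℝ)..1,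
    (inner ℝ (vel u (X + (τ * G.σ) • (α : V3)) - vel u (X + ((τ - 1) * G.σ) • (α : V3))) (α : V3)
      * dens u (X + (τ * G.σ) • (α : V3)) * dens u (X + ((τ - 1) * G.σ) • (α : V3))
      * G.S (crowd G Ω u (X + (τ * G.σ) • (α : V3)))
      * chi Ω (X + ((τ - 1) * G.σ) • (α : V3)) * chi Ω (X + (τ * G.σ) • (α : V3)))
      • (α : V3)) ∂solidAngle

/-- The local flux `J^H = ⟨ξ f ln f⟩ + J⁽ᵏ⁾ + J⁽ᶜ⁾`. -/
def JH (G : Gas) (Ω : Set V3) (u : V3 → V3 → ℝ) (X : V3) : V3 :=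
  HkFlux u X + Jk G Ω u X + Jc G Ω u X

/-- The flux of the global theorem, `⟨ξ f ln f⟩ + H⁽ᶜ⁾ v + ρ v ∫_Ω (ρ(Y)/m) θ(σ-|Y-X|) S(𝓡(Y)) dY`. -/
def globalFlux (G : Gas) (Ω : Set V3) (u : V3 → V3 → ℝ) (X : V3) : V3 :=
  HkFlux u X + (Hc G Ω u X • vel u X
    + (dens u X * ∫ Y in Ω, dens u Y / G.m * theta (G.σ - ‖Y - X‖) * G.S (crowd G Ω u Y)) • vel u X)

/-- `Δ`: the local flux minus the flux of the global theorem. -/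
def fluxDiff (G : Gas) (Ω : Set V3) (u : V3 → V3 → ℝ) (X : V3) : V3 :=
  JH G Ω u X - globalFlux G Ω u X

/-- `f_w(ξ) = exp (-|ξ|² / (2 R T_w))`. -/
def wallMaxwellian (Rg Tw : ℝ) (ξ : V3) : ℝ := Real.exp (-‖ξ‖ ^ 2 / (2 * Rg * Tw))

/-- `F = R T_w (⟨f ln (f / f_w)⟩ + H⁽ᶜ⁾)`. -/
def freeEnergy (G : Gas) (Rg Tw : ℝ) (Ω : Set V3) (u : V3 → V3 → ℝ) (X : V3) : ℝ :=
  Rg * Tw * ((∫ ξ, u X ξ * Real.log (u X ξ / wallMaxwellian Rg Tw ξ)) + Hc G Ω u X)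

/-- `J^F = R T_w J^H + ρ v (e + |v|²/2) + p v + q`, where `e = e⁽ᵏ⁾`, `p = p⁽ᵏ⁾ + p⁽ᶜ⁾`,
`q = q⁽ᵏ⁾ + q⁽ᶜ⁾`. -/
def JF (G : Gas) (Rg Tw : ℝ) (Ω : Set V3) (u : V3 → V3 → ℝ) (X : V3) : V3 :=
  (Rg * Tw) • JH G Ω u X
    + (dens u X * (kinEnergy u X + ‖vel u X‖ ^ 2 / 2)) • vel u X
    + applyStress (fun i j => kinStress u X i j + colStress G Ω u X i j) (vel u X)
    + (kinHeatFlux u X + colHeatFlux G Ω u X)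

/-- `J^F - R T_w J^H + R T_w ⟨ξ f ln f_w⟩`: what remains of the difference between `J^F` and
`R T_w J^H` once the contribution of `⟨ξ f ln f_w⟩` is taken out. -/
def freeFluxRemainder (G : Gas) (Rg Tw : ℝ) (Ω : Set V3) (u : V3 → V3 → ℝ) (X : V3) : V3 :=
  JF G Rg Tw Ω u X - (Rg * Tw) • JH G Ω u X
    + (Rg * Tw) • ∫ ξ, (u X ξ * Real.log (wallMaxwellian Rg Tw ξ)) • ξ

/-! ### Vlasov term -/

/-- Isotropic potentials: `Φ` is locally Lipschitz on `(0, ∞)` and the force is integrable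
near the origin of `ℝ³`. -/
structure IsPotential (Φ : ℝ → ℝ) : Prop where
  locallyLipschitz : LocallyLipschitzOn (Ioi 0) Φ
  integrable_force : ∀ r₀ > 0, IntegrableOn (fun r => r ^ 2 * deriv Φ r) (Ioc 0 r₀)

/-- `F(X) = -∫_Ω ∇_X Φ(|Y - X|) ρ(Y) dY`. -/
def vlasovForce (Ω : Set V3) (Φ : ℝ → ℝ) (u : V3 → V3 → ℝ) (X : V3) : V3 :=
  -∫ Y in Ω, dens u Y • gradient (fun Z => Φ ‖Y - Z‖) X

/-- `e⁽ᵛ⁾ = ½ ∫_Ω Φ(|Y - X|) ρ(Y) dY`. -/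
def vlasovEnergy (Ω : Set V3) (Φ : ℝ → ℝ) (u : V3 → V3 → ℝ) (X : V3) : ℝ :=
  1 / 2 * ∫ Y in Ω, Φ ‖Y - X‖ * dens u Y

/-- `p⁽ᵛ⁾ᵢⱼ`. -/
def vlasovStress (Ω : Set V3) (Φ : ℝ → ℝ) (u : V3 → V3 → ℝ) (X : V3) (i j : Fin 3) : ℝ :=
  -(1 / 2) * ∫ r : V3, r i * r j / ‖r‖ * deriv Φ ‖r‖ * ∫ l in (0 : ℝ)..1,
    dens u (X + l • r) * chi Ω (X + l • r)
      * dens u (X + (l - 1) • r) * chi Ω (X + (l - 1) • r)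

/-- `q⁽ᵛ⁾` at time `t`. -/
def vlasovHeatFlux (Ω : Set V3) (Φ : ℝ → ℝ) (f : ℝ → V3 → V3 → ℝ) (t : ℝ) (X : V3) : V3 :=
  (dens (f t) X * vlasovEnergy Ω Φ (f t) X) • vel (f t) X
    - applyStress (vlasovStress Ω Φ (f t) X) (vel (f t) X)
    + (1 / 2 : ℝ) • ∫ r : V3, ∫ l in (0 : ℝ)..1,
        (Φ ‖r‖ * deriv (fun s => dens (f s) (X + (l - 1) • r)) t * dens (f t) (X + l • r)
          * chi Ω (X + (l - 1) • r) * chi Ω (X + l • r)) • r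

/-- The additional flux `p⁽ᵛ⁾ v + q⁽ᵛ⁾ + ρ e⁽ᵛ⁾ v` at time `t`. -/
def vlasovFlux (Ω : Set V3) (Φ : ℝ → ℝ) (f : ℝ → V3 → V3 → ℝ) (t : ℝ) (X : V3) : V3 :=
  applyStress (vlasovStress Ω Φ (f t) X) (vel (f t) X) + vlasovHeatFlux Ω Φ f t X
    + (dens (f t) X * vlasovEnergy Ω Φ (f t) X) • vel (f t) X

/-- `F̃ = F + ρ e⁽ᵛ⁾`. -/
def freeEnergyVlasov (G : Gas) (Rg Tw : ℝ) (Ω : Set V3) (Φ : ℝ → ℝ) (u : V3 → V3 → ℝ)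
    (X : V3) : ℝ :=
  freeEnergy G Rg Tw Ω u X + dens u X * vlasovEnergy Ω Φ u X

/-! ### Classical solutions -/

/-- `f` is a positive classical solution of the Enskog equation
`∂ₜ f + ξ·∇_X f + F·∇_ξ f = J(f)` for `t ∈ I`, `X ∈ Ω`, `ξ ∈ ℝ³` with force field `F`:
`f` is `C¹`, `f` and `∂ₜ f` decay rapidly in `ξ` uniformly in `X ∈ Ω` and locally uniformly in `t`,
the other first derivatives do so locally uniformly in `(t, X)`, `ln f` grows at most polynomially
in `ξ`, and `𝓡` takes values in the interval on which `S` is given. -/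
structure IsClassicalSolution (G : Gas) (I : Set ℝ) (Ω : Set V3) (F : ℝ → V3 → V3)
    (f : ℝ → V3 → V3 → ℝ) : Prop where
  pos : ∀ t ∈ I, ∀ X ∈ Ω, ∀ ξ, 0 < f t X ξ
  contDiffOn : ContDiffOn ℝ 1 (fun p : ℝ × V3 × V3 => f p.1 p.2.1 p.2.2) (I ×ˢ Ω ×ˢ univ)
  decay : ∀ K ⊆ I, IsCompact K → ∀ n : ℕ, ∃ C : ℝ, ∀ t ∈ K, ∀ X ∈ Ω, ∀ ξ,
    (1 + ‖ξ‖) ^ n * f t X ξ ≤ C ∧ (1 + ‖ξ‖) ^ n * |deriv (fun s => f s X ξ) t| ≤ C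
  decay_gradient : ∀ K ⊆ I, IsCompact K → ∀ L ⊆ Ω, IsCompact L → ∀ n : ℕ, ∃ C : ℝ,
    ∀ t ∈ K, ∀ X ∈ L, ∀ ξ,
      (1 + ‖ξ‖) ^ n * ‖gradient (fun Y => f t Y ξ) X‖ ≤ C ∧
      (1 + ‖ξ‖) ^ n * ‖gradient (fun η => f t X η) ξ‖ ≤ C
  log_growth : ∀ K ⊆ I, IsCompact K → ∃ (n : ℕ) (C : ℝ), ∀ t ∈ K, ∀ X ∈ Ω, ∀ ξ,
    |Real.log (f t X ξ)| ≤ C * (1 + ‖ξ‖) ^ n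
  crowd_mem : ∀ t ∈ I, ∀ X ∈ closure Ω, crowd G Ω (f t) X ∈ G.dom
  equation : ∀ t ∈ I, ∀ X ∈ Ω, ∀ ξ,
    deriv (fun s => f s X ξ) t + inner ℝ ξ (gradient (fun Y => f t Y ξ) X)
      + inner ℝ (F t X) (gradient (fun η => f t X η) ξ) = collision G Ω (f t) X ξ

/-! ### Domains and boundary conditions -/

/-- `D` is a bounded open set with `C¹` boundary, with defining function `ψ`. -/
structure IsC1Domain (D : Set V3) (ψ : V3 → ℝ) : Prop where
  bounded : Bornology.IsBounded D
  contDiff : ContDiff ℝ 1 ψ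
  eq_sublevel : D = {X | ψ X < 0}
  gradient_ne_zero : ∀ X, ψ X = 0 → gradient ψ X ≠ 0

/-- Outward unit normal. -/
def normal (ψ : V3 → ℝ) (X : V3) : V3 := ‖gradient ψ X‖⁻¹ • gradient ψ X

/-- `f` attains its boundary values continuously, except possibly for velocities tangent to the
boundary. -/
def HasBoundaryValues (I : Set ℝ) (D : Set V3) (ψ : V3 → ℝ) (f : ℝ → V3 → V3 → ℝ) : Prop :=
  ContinuousOn (fun p : ℝ × V3 × V3 => f p.1 p.2.1 p.2.2)
    {p | p.1 ∈ I ∧ p.2.1 ∈ closure D ∧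
      (p.2.1 ∈ frontier D → inner ℝ p.2.2 (normal ψ p.2.1) ≠ 0)}

/-- Specular reflection. -/
def IsSpecular (I : Set ℝ) (D : Set V3) (ψ : V3 → ℝ) (f : ℝ → V3 → V3 → ℝ) : Prop :=
  ∀ t ∈ I, ∀ X ∈ frontier D, ∀ ξ : V3, inner ℝ ξ (normal ψ X) < 0 →
    f t X ξ = f t X (ξ - (2 * inner ℝ ξ (normal ψ X)) • normal ψ X)

/-- The flux measure `(ξ·n)₊ h(ξ) dξ` of molecules leaving through a surface element with outward
normal `n`. -/
def outFlux (n : V3) (h : V3 → ℝ) : Measure V3 :=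
  volume.withDensity (fun ξ => ENNReal.ofReal (max (inner ℝ ξ n) 0 * h ξ))

/-- The flux measure `(ξ·n)₋ h(ξ) dξ` of molecules entering through that element. -/
def inFlux (n : V3) (h : V3 → ℝ) : Measure V3 :=
  volume.withDensity (fun ξ => ENNReal.ofReal (max (-inner ℝ ξ n) 0 * h ξ))

/-- The scattering kernels `κ X` describe an impermeable wall of a heat bath of temperature `T_w`:
an impinging molecule of velocity `ξ_*` is re-emitted with velocity distributed by the probability
measure `κ X ξ_*`, and the wall Maxwellian is left invariant. -/
def IsHeatBathWall (Rg Tw : ℝ) (D : Set V3) (ψ : V3 → ℝ) (κ : V3 → Kernel V3 V3) : Prop :=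
  ∀ X ∈ frontier D, IsMarkovKernel (κ X) ∧
    (outFlux (normal ψ X) (wallMaxwellian Rg Tw)).bind (κ X)
      = inFlux (normal ψ X) (wallMaxwellian Rg Tw)

/-- The boundary condition defined by the scattering kernels `κ X`. -/
def IsScattered (I : Set ℝ) (D : Set V3) (ψ : V3 → ℝ) (κ : V3 → Kernel V3 V3)
    (f : ℝ → V3 → V3 → ℝ) : Prop :=
  ∀ t ∈ I, ∀ X ∈ frontier D,
    (outFlux (normal ψ X) (f t X)).bind (κ X) = inFlux (normal ψ X) (f t X)

/-! ### Integrated divergence -/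

/-- `d` is the divergence of `V` in the open set `Ω`, in the sense of distributions. -/
def HasWeakDivergence (Ω : Set V3) (V : V3 → V3) (d : V3 → ℝ) : Prop :=
  LocallyIntegrableOn V Ω ∧ LocallyIntegrableOn d Ω ∧
    ∀ φ : V3 → ℝ, ContDiff ℝ (⊤ : ℕ∞) φ → HasCompactSupport φ → tsupport φ ⊆ Ω →
      ∫ X in Ω, inner ℝ (V X) (gradient φ X) = -∫ X in Ω, φ X * d X

/-- `∫_C div V dX = 0`: the divergence of `V` in `Ω` is a (locally integrable) function, it is
integrable over `C`, and its integral over `C` vanishes. -/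
def ZeroDivergenceIntegral (Ω C : Set V3) (V : V3 → V3) : Prop :=
  (∃ d, HasWeakDivergence Ω V d) ∧
    ∀ d, HasWeakDivergence Ω V d → IntegrableOn d C ∧ ∫ X in C, d X = 0

end Enskog

end

open Enskog

/-! Fix a time, write `u` for the distribution and `w` for its time derivative, and multiply the
kinetic equation by `1 + log u + β|ξ|²` before integrating over velocity and over the cell. The
value `β = 0` yields `H`; the value `β = 1/(2RT_w)` yields `F/(RT_w)`, because `log f_w = -β|ξ|²`.
Four contributions have to be understood.

Collisions. Inverse collisions, the exchange of the two molecules and the reversal of `α` preserve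
the measure `dΩ(α) dξ dξ_*`, and a translation interchanges the positions of the partners. After
symmetrisation, `p (log q - log p) ≤ q - p` applies to the products `p`, `q` of the two distribution
values before and after the collision, while conservation of energy removes the term in `β`. Since
the partners sit at different points, the integral of the right-hand side does not vanish as it does
for the Boltzmann equation: gain and loss occur with opposite `α`, and `max V 0 - max (-V) 0 = V`
leaves an integral that is linear in the relative velocity. It equals, up to sign, the integral of
the momentum density against a sphere average of `S(𝓡)` and `ρ` (`GasData.collision_entropy_le`,
`IsState.integral_transfer`).

The correction `H⁽ᶜ⁾`. By the divergence theorem on balls that sphere average is the gradient of the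
potential `K = ∫₀^𝓡 S + ∫ (ρ/m) θ S(𝓡)` (`IsState.hasWeakGrad_transfer`). The kernel of `𝓡` being
symmetric, the derivative of `∫ H⁽ᶜ⁾` is `∫ K ∂ₜρ`; conservation of mass and the absence of a mass
flux through the boundary turn this into `∫ ∇K · ρv`. The collisional excess and the change of
`H⁽ᶜ⁾` therefore compensate exactly (`IsState.entropy_balance`, and
`IsClassicalSolution.hasDerivAt_entropy` for the derivative in time).

The boundary. All that is required is that no mass leaves and that the flux of `u (log u + β|ξ|²)`
points outward on average (`NonnegFlux`). Both fluxes vanish for a periodic gas and for specular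
reflection, where the integrand is odd in the normal velocity. At a heat bath the outward sign is
Jensen's inequality for `x log x` along the scattering kernel, applied to the density relative to
the wall Maxwellian, which the kernel leaves invariant (`integral_mul_log_le_of_bind_eq`).

The force. Integration by parts in velocity leaves `2β ∫ A · ρv`: nothing for `H`, and the work `∫ A
· ρv` for `F`. The derivative of the potential energy `∫ ρ e⁽ᵛ⁾` is the opposite of that work.

The fluxes with zero divergence integral are sums of two types. One is an average of a two-point
function `w(Y, Z)` along segments; its divergence is `w(X + r, X) - w(X, X - r)`, averaged over `r`,
and it integrates to zero by translation (`weakDiv_lineAvg`, `hasZeroFlux_lineAvg`). The other is a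
potential times the momentum density, whose normal component vanishes with the mass flux
(`IsState.hasZeroFlux_potential`). The work consists in cancelling all other terms.

Derivatives in space are weak throughout: the densities are cut off at the boundary, `Φ` is only
locally Lipschitz, and gradients of `u` are controlled only in the interior. Weak gradients of `𝓡`
and of the Vlasov potential come from convolution, the chain rule for `∫₀^𝓡 S` from the almost
everywhere differentiability of Lipschitz functions, and the divergence theorem on a `C¹` domain
from cutoffs in boundary layers of volume `O(ε)`. A bounded domain and a period cell are treated
together through `IsCell`. -/

open Filter Topology Metric

namespace Enskog

/-! ### Polynomial weights in velocity space -/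

/-- The weight `(1 + ‖ξ‖)⁻ⁿ`. -/
noncomputable def wgt (n : ℕ) (ξ : V3) : ℝ := ((1 + ‖ξ‖) ^ n)⁻¹

lemma one_le_one_add_norm (ξ : V3) : 1 ≤ 1 + ‖ξ‖ := by linarith [norm_nonneg ξ]

lemma one_add_norm_pos (ξ : V3) : 0 < 1 + ‖ξ‖ := by linarith [norm_nonneg ξ]

lemma wgt_pos (n : ℕ) (ξ : V3) : 0 < wgt n ξ := inv_pos.2 (pow_pos (one_add_norm_pos ξ) n)

lemma wgt_add_mul (n k : ℕ) (ξ : V3) : wgt (n + k) ξ * (1 + ‖ξ‖) ^ k = wgt n ξ := by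
  have := (pow_pos (one_add_norm_pos ξ) k).ne'
  have := (pow_pos (one_add_norm_pos ξ) n).ne'
  unfold wgt; rw [pow_add]; field_simp

/-- The exponent has to exceed the dimension 3. This is why velocity integrals below are controlled
by the weight of order 4, and by order 5 when a factor `ξ` has to be paid for. -/
lemma integrable_wgt {n : ℕ} (hn : 4 ≤ n) : Integrable (wgt n) (volume : Measure V3) := by
  have h := integrable_one_add_norm (E := V3) (μ := volume) (r := (n : ℝ)) (by
    simp only [finrank_euclideanSpace, Fintype.card_fin]
    have : (4 : ℝ) ≤ n := by exact_mod_cast hn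
    push_cast; linarith)
  refine h.congr (Eventually.of_forall fun ξ => ?_)
  simp only [wgt, Real.rpow_neg (one_add_norm_pos ξ).le, Real.rpow_natCast]

lemma le_wgt_of_mul_le {n : ℕ} {ξ : V3} {x C : ℝ} (h : (1 + ‖ξ‖) ^ n * x ≤ C) :
    x ≤ C * wgt n ξ := by
  rw [wgt, ← div_eq_mul_inv, le_div_iff₀ (pow_pos (one_add_norm_pos ξ) n)]; linarith

/-! ### Lower-order facts on integrals depending on a parameter -/

lemma theta_nonneg (x : ℝ) : 0 ≤ theta x := by unfold theta; split_ifs <;> simp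

lemma measurable_theta : Measurable theta :=
  Measurable.ite (measurableSet_le measurable_const measurable_id) measurable_const
    measurable_const

lemma chi_of_mem {Ω : Set V3} {X : V3} (h : X ∈ Ω) : chi Ω X = 1 := by simp [chi, h]

lemma chi_of_notMem {Ω : Set V3} {X : V3} (h : X ∉ Ω) : chi Ω X = 0 := by simp [chi, h]

lemma measurable_chi {Ω : Set V3} (h : MeasurableSet Ω) : Measurable (chi Ω) :=
  measurable_const.indicator h

open Classical in
/-- The product of an indicator and a function continuous on the corresponding open set is
measurable. -/
lemma measurable_chi_mul {Ω : Set V3} (hΩ : IsOpen Ω) {u : V3 → V3 → ℝ}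
    (hu : ContinuousOn (fun p : V3 × V3 => u p.1 p.2) (Ω ×ˢ univ)) :
    Measurable (fun p : V3 × V3 => chi Ω p.1 * u p.1 p.2) := by
  have hm : MeasurableSet (Ω ×ˢ (univ : Set V3)) := hΩ.measurableSet.prod MeasurableSet.univ
  have h := (hu.measurable_piecewise (g := fun _ => (0 : ℝ)) continuousOn_const hm)
  convert h using 1
  ext p
  by_cases hp : p.1 ∈ Ω
  · simp [chi, hp, Set.piecewise]
  · simp [chi, hp, Set.piecewise]

open Classical in
/-! ### Weak divergence tested against `C¹` functions -/

/-- `d` is the divergence of `V` in `Ω`, tested against `C¹` functions of compact support. -/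
structure WeakDiv (Ω : Set V3) (V : V3 → V3) (d : V3 → ℝ) : Prop where
  field : LocallyIntegrableOn V Ω
  div : LocallyIntegrableOn d Ω
  test : ∀ φ : V3 → ℝ, ContDiff ℝ 1 φ → HasCompactSupport φ → tsupport φ ⊆ Ω →
    ∫ X in Ω, inner ℝ (V X) (gradient φ X) = -∫ X in Ω, φ X * d X

/-- The theorem tests with smooth functions only. `WeakDiv` admits all `C¹` test functions because
the cutoffs made later from the defining function `ψ` are no smoother than `ψ` itself. -/
lemma WeakDiv.hasWeakDivergence {Ω : Set V3} {V : V3 → V3} {d : V3 → ℝ} (h : WeakDiv Ω V d) :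
    HasWeakDivergence Ω V d :=
  ⟨h.field, h.div, fun φ hφ hc hs => h.test φ (hφ.of_le (by exact_mod_cast le_top)) hc hs⟩

lemma inner_gradient (φ : V3 → ℝ) (X v : V3) :
    inner ℝ v (gradient φ X) = fderiv ℝ φ X v := by
  rw [real_inner_comm, gradient, InnerProductSpace.toDual_symm_apply]

lemma continuous_gradient {φ : V3 → ℝ} (h : ContDiff ℝ 1 φ) : Continuous (gradient φ) := by
  unfold gradient
  exact (LinearIsometryEquiv.continuous _).comp (h.continuous_fderiv (by simp))

lemma tsupport_gradient_subset (φ : V3 → ℝ) : tsupport (gradient φ) ⊆ tsupport φ := by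
  refine closure_minimal (fun X hX => ?_) isClosed_closure
  by_contra h
  apply hX
  have : φ =ᶠ[𝓝 X] fun _ => 0 := notMem_tsupport_iff_eventuallyEq.1 h
  have h2 : fderiv ℝ φ X = 0 := by rw [this.fderiv_eq]; simp
  simp [gradient, h2]

lemma gradient_hasCompactSupport {φ : V3 → ℝ} (hc : HasCompactSupport φ) :
    HasCompactSupport (gradient φ) :=
  hc.mono' ((subset_tsupport _).trans (tsupport_gradient_subset φ))

/-- A locally integrable function times a continuous function supported in a compact part of the
domain is integrable. -/
lemma integrableOn_mul_of_tsupport {Ω : Set V3} {d φ : V3 → ℝ}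
    (hd : LocallyIntegrableOn d Ω) (hφ : Continuous φ) (hc : HasCompactSupport φ)
    (hs : tsupport φ ⊆ Ω) : IntegrableOn (fun X => φ X * d X) Ω := by
  have hK : IsCompact (tsupport φ) := hc
  have h1 : IntegrableOn d (tsupport φ) := hd.integrableOn_compact_subset hs hK
  have h2 : IntegrableOn (fun X => φ X * d X) (tsupport φ) :=
    h1.continuousOn_mul hφ.continuousOn hK
  have h3 : Integrable (fun X => φ X * d X) := by
    rwa [← integrableOn_iff_integrable_of_support_subset]
    intro X hX
    exact subset_tsupport _ (fun h0 => hX (by simp [h0]))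
  exact h3.integrableOn

lemma integrableOn_inner_of_tsupport {Ω : Set V3} {V W : V3 → V3}
    (hV : LocallyIntegrableOn V Ω) (hW : Continuous W) (hc : HasCompactSupport W)
    (hs : tsupport W ⊆ Ω) : IntegrableOn (fun X => inner ℝ (V X) (W X)) Ω := by
  have hK : IsCompact (tsupport W) := hc
  obtain ⟨c, hcb⟩ := hc.exists_bound_of_continuous hW
  have h1 : IntegrableOn V (tsupport W) := hV.integrableOn_compact_subset hs hK
  have h2 : IntegrableOn (fun X => inner ℝ (V X) (W X)) (tsupport W) := by
    refine Integrable.mono' (h1.norm.mul_const c)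
      (h1.aestronglyMeasurable.inner hW.aestronglyMeasurable) (Eventually.of_forall fun X => ?_)
    exact (norm_inner_le_norm _ _).trans
      (mul_le_mul_of_nonneg_left (hcb X) (norm_nonneg _))
  have h3 : Integrable (fun X => inner ℝ (V X) (W X)) := by
    rwa [← integrableOn_iff_integrable_of_support_subset]
    intro X hX
    exact subset_tsupport _ (fun h0 => hX (by simp [h0]))
  exact h3.integrableOn

lemma WeakDiv.congr {Ω : Set V3} (hΩ : MeasurableSet Ω) {V V' : V3 → V3} {d d' : V3 → ℝ}
    (h : WeakDiv Ω V d) (hV : ∀ X ∈ Ω, V' X = V X) (hd : ∀ X ∈ Ω, d' X = d X) :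
    WeakDiv Ω V' d' := by
  have key : ∀ {F : Type} [NormedAddCommGroup F] {p q : V3 → F}, LocallyIntegrableOn p Ω →
      (∀ X ∈ Ω, q X = p X) → LocallyIntegrableOn q Ω := by
    intro F _ p q hp hpq X hX
    obtain ⟨U, hU, hi⟩ := hp X hX
    refine ⟨U ∩ Ω, inter_mem hU self_mem_nhdsWithin, ?_⟩
    have h2 : ∀ᵐ Y ∂(volume.restrict Ω), p Y = q Y :=
      (ae_restrict_iff' hΩ).2 (Eventually.of_forall fun Y hY => (hpq Y hY).symm)
    exact (hi.mono_set inter_subset_left).congr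
      (ae_restrict_of_ae_restrict_of_subset inter_subset_right h2)
  refine ⟨key h.field hV, key h.div hd, fun φ h1 h2 h3 => ?_⟩
  rw [setIntegral_congr_fun hΩ (g := fun X => inner ℝ (V X) (gradient φ X))
    (fun X hX => by simp only [hV X hX]), h.test φ h1 h2 h3,
    setIntegral_congr_fun hΩ (f := fun X => φ X * d' X) (g := fun X => φ X * d X)
      (fun X hX => by simp only [hd X hX])]

lemma WeakDiv.add {Ω : Set V3} {V V' : V3 → V3} {d d' : V3 → ℝ} (h : WeakDiv Ω V d)
    (h' : WeakDiv Ω V' d') : WeakDiv Ω (fun X => V X + V' X) (fun X => d X + d' X) := by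
  refine ⟨h.field.add h'.field, h.div.add h'.div, fun φ h1 h2 h3 => ?_⟩
  have hg := gradient_hasCompactSupport h2
  have hgs := (tsupport_gradient_subset φ).trans h3
  simp only [inner_add_left, mul_add]
  rw [integral_add (integrableOn_inner_of_tsupport h.field (continuous_gradient h1) hg hgs)
    (integrableOn_inner_of_tsupport h'.field (continuous_gradient h1) hg hgs),
    integral_add (integrableOn_mul_of_tsupport h.div h1.continuous h2 h3)
    (integrableOn_mul_of_tsupport h'.div h1.continuous h2 h3), h.test φ h1 h2 h3,
    h'.test φ h1 h2 h3]
  ring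

lemma WeakDiv.const_smul {Ω : Set V3} {V : V3 → V3} {d : V3 → ℝ} (h : WeakDiv Ω V d) (c : ℝ) :
    WeakDiv Ω (fun X => c • V X) (fun X => c * d X) := by
  refine ⟨h.field.smul c, h.div.smul c, fun φ h1 h2 h3 => ?_⟩
  simp only [real_inner_smul_left]
  rw [integral_const_mul, h.test φ h1 h2 h3, mul_neg, ← integral_const_mul]
  congr 1
  exact integral_congr_ae (Eventually.of_forall fun X => by simp only; ring)

/-- Weak divergences are unique almost everywhere. -/
lemma hasWeakDivergence_unique {Ω : Set V3} (hΩ : IsOpen Ω) {V : V3 → V3} {d d' : V3 → ℝ}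
    (h : HasWeakDivergence Ω V d) (h' : HasWeakDivergence Ω V d') :
    ∀ᵐ X, X ∈ Ω → d X = d' X := by
  have : ∀ᵐ X, X ∈ Ω → (fun X => d X - d' X) X = 0 := by
    refine hΩ.ae_eq_zero_of_integral_contDiff_smul_eq_zero (h.2.1.sub h'.2.1) fun g h1 h2 h3 => ?_
    have e : ∫ X, g X • (d X - d' X) = ∫ X in Ω, g X • (d X - d' X) := by
      rw [setIntegral_eq_integral_of_forall_compl_eq_zero]
      intro X hX
      rw [image_eq_zero_of_notMem_tsupport (fun hx => hX (h3 hx)), zero_smul]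
    rw [e]
    simp only [smul_eq_mul, mul_sub]
    rw [integral_sub (integrableOn_mul_of_tsupport h.2.1 h1.continuous h2 h3)
      (integrableOn_mul_of_tsupport h'.2.1 h1.continuous h2 h3)]
    have e1 := h.2.2 g h1 h2 h3
    have e2 := h'.2.2 g h1 h2 h3
    linarith
  filter_upwards [this] with X hX hXΩ
  exact sub_eq_zero.1 (hX hXΩ)

/-- The definition speaks of every weak divergence. Since these agree almost everywhere, it is
enough to exhibit one whose integral vanishes. -/
lemma WeakDiv.zeroDivergenceIntegral {Ω C : Set V3} (hΩ : IsOpen Ω) (hC : MeasurableSet C)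
    (hCΩ : C ⊆ Ω) {V : V3 → V3} {d : V3 → ℝ} (h : WeakDiv Ω V d) (hi : IntegrableOn d C)
    (h0 : ∫ X in C, d X = 0) : ZeroDivergenceIntegral Ω C V := by
  refine ⟨⟨d, h.hasWeakDivergence⟩, fun d' hd' => ?_⟩
  have hae : d =ᵐ[volume.restrict C] d' := by
    rw [EventuallyEq, ae_restrict_iff' hC]
    filter_upwards [hasWeakDivergence_unique hΩ h.hasWeakDivergence hd'] with X hX hXC
    exact hX (hCΩ hXC)
  exact ⟨hi.congr hae, by rw [← h0]; exact (integral_congr_ae hae).symm⟩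

/-! ### The space of collision configurations `(α, ξ, ξ_*)` -/

/-- Configurations `(α, ξ, ξ_*)` of a binary collision. -/
abbrev Coll := S2 × V3 × V3

/-- The measure `dΩ(α) dξ dξ_*`. -/
noncomputable abbrev collMeas : Measure Coll := solidAngle.prod (volume.prod volume)

lemma norm_coe_S2 (α : S2) : ‖(α : V3)‖ = 1 := by simp

lemma inner_coe_S2 (α : S2) : inner ℝ (α : V3) (α : V3) = (1 : ℝ) := by
  rw [real_inner_self_eq_norm_sq, norm_coe_S2]; norm_num

instance : IsFiniteMeasure solidAngle := by unfold solidAngle; infer_instance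

/-- The sphere measure of a set is a multiple of the volume of the cone over it, and `x ↦ -x`
preserves Lebesgue measure. -/
lemma measurePreserving_neg_S2 : MeasurePreserving (fun α : S2 => -α) solidAngle solidAngle := by
  have hm : Measurable (fun α : S2 => -α) := continuous_neg.measurable
  refine ⟨hm, Measure.ext fun s hs => ?_⟩
  rw [Measure.map_apply hm hs, Measure.toSphere_apply' _ (hm hs), Measure.toSphere_apply' _ hs]
  congr 1
  rw [← Measure.measure_preimage_neg (volume : Measure V3)]
  congr 1
  ext x
  simp only [Set.mem_smul, Set.mem_image, Set.mem_preimage]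
  constructor
  · rintro ⟨r, hr, _, ⟨α, hα, rfl⟩, h⟩
    exact ⟨r, hr, _, ⟨-α, hα, rfl⟩, by rw [coe_neg_sphere, smul_neg, h, neg_neg]⟩
  · rintro ⟨r, hr, _, ⟨α, hα, rfl⟩, rfl⟩
    exact ⟨r, hr, _, ⟨-α, by simpa using hα, rfl⟩, by rw [coe_neg_sphere, smul_neg]⟩

lemma Va_post (α : S2) (ξ ξs : V3) : Va (post ξ ξs α) (postStar ξ ξs α) α = -Va ξ ξs α := by
  have h := inner_coe_S2 α
  simp only [Va, post, postStar] at *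
  rw [show ξs - inner ℝ (ξs - ξ) (α : V3) • (α : V3) - (ξ + inner ℝ (ξs - ξ) (α : V3) • (α : V3))
    = (ξs - ξ) - (2 * inner ℝ (ξs - ξ) (α : V3)) • (α : V3) by module, inner_sub_left,
    real_inner_smul_left, h]
  ring

lemma post_post (α : S2) (ξ ξs : V3) : post (post ξ ξs α) (postStar ξ ξs α) α = ξ := by
  rw [post, Va_post, post]; module

lemma postStar_postStar (α : S2) (ξ ξs : V3) :
    postStar (post ξ ξs α) (postStar ξ ξs α) α = ξs := by
  rw [postStar, Va_post, postStar]; module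

lemma Va_neg (ξ ξs α : V3) : Va ξ ξs (-α) = -Va ξ ξs α := by simp [Va]

lemma Va_swap (ξ ξs α : V3) : Va ξs ξ α = -Va ξ ξs α := by
  simp only [Va]; rw [← inner_neg_left]; congr 1; abel

lemma post_neg (ξ ξs α : V3) : post ξ ξs (-α) = post ξ ξs α := by simp [post, Va_neg]

lemma postStar_neg (ξ ξs α : V3) : postStar ξ ξs (-α) = postStar ξ ξs α := by
  simp [postStar, Va_neg]

lemma post_swap (ξ ξs α : V3) : post ξs ξ α = postStar ξ ξs α := by
  rw [post, Va_swap, postStar]; module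

/-- Conservation of energy. It makes the terms `β‖ξ‖²` drop out of the entropy production, and it
bounds outgoing velocities by incoming ones. -/
lemma norm_post_sq_add (α : S2) (ξ ξs : V3) :
    ‖post ξ ξs α‖ ^ 2 + ‖postStar ξ ξs α‖ ^ 2 = ‖ξ‖ ^ 2 + ‖ξs‖ ^ 2 := by
  simp only [post, postStar]
  rw [norm_add_sq_real, norm_sub_sq_real, norm_smul, norm_coe_S2, real_inner_smul_right,
    real_inner_smul_right]
  have : Va ξ ξs α = inner ℝ ξs (α : V3) - inner ℝ ξ (α : V3) := by simp [Va, inner_sub_left]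
  simp only [mul_one, Real.norm_eq_abs, sq_abs]
  rw [this]; ring

lemma continuous_Va : Continuous fun e : Coll => Va e.2.1 e.2.2 e.1 := by
  unfold Va; fun_prop

lemma continuous_post : Continuous fun e : Coll => post e.2.1 e.2.2 e.1 := by
  unfold post
  exact (continuous_fst.comp continuous_snd).add
    (continuous_Va.smul (continuous_subtype_val.comp continuous_fst))

lemma continuous_postStar : Continuous fun e : Coll => postStar e.2.1 e.2.2 e.1 := by
  unfold postStar
  exact (continuous_snd.comp continuous_snd).sub
    (continuous_Va.smul (continuous_subtype_val.comp continuous_fst))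

/-- The collision transformation `(ξ, ξ_*) ↦ (ξ', ξ_*')` as a linear map. -/
noncomputable def collLin (α : V3) : V3 × V3 →ₗ[ℝ] V3 × V3 where
  toFun p := (post p.1 p.2 α, postStar p.1 p.2 α)
  map_add' p q := by
    simp only [post, postStar, Va, Prod.fst_add, Prod.snd_add, Prod.mk_add_mk,
      inner_sub_left, inner_add_left]
    congr 1 <;> module
  map_smul' c p := by
    simp only [post, postStar, Va, Prod.smul_fst, Prod.smul_snd, Prod.smul_mk,
      inner_sub_left, real_inner_smul_left, RingHom.id_apply]
    congr 1 <;> module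

lemma collLin_involutive (α : S2) : collLin α ∘ₗ collLin α = LinearMap.id := by
  refine LinearMap.ext fun p => ?_
  change (post (post p.1 p.2 α) (postStar p.1 p.2 α) α,
    postStar (post p.1 p.2 α) (postStar p.1 p.2 α) α) = p
  rw [post_post, postStar_postStar]

/-- A linear involution has determinant `±1`, hence preserves Lebesgue measure. -/
lemma map_collLin (α : S2) :
    Measure.map (collLin α) ((volume : Measure V3).prod volume) = volume.prod volume := by
  have h : LinearMap.det (collLin α) * LinearMap.det (collLin α) = 1 := by
    rw [← LinearMap.det_comp, collLin_involutive, LinearMap.det_id]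
  have h1 : |LinearMap.det (collLin α)| = 1 := by
    have := abs_mul_abs_self (LinearMap.det (collLin α))
    rw [h] at this
    nlinarith [abs_nonneg (LinearMap.det (collLin α))]
  have h0 : LinearMap.det (collLin α) ≠ 0 := fun h2 => by simp [h2] at h1
  have := Measure.map_linearMap_addHaar_eq_smul_addHaar ((volume : Measure V3).prod volume) h0
  rw [this, abs_inv, h1]; simp

/-- The transformation `(α, ξ, ξ_*) ↦ (α, ξ', ξ_*')`. -/
noncomputable def collMap (e : Coll) : Coll :=
  (e.1, post e.2.1 e.2.2 e.1, postStar e.2.1 e.2.2 e.1)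

lemma measurePreserving_collMap : MeasurePreserving collMap collMeas collMeas := by
  refine MeasurePreserving.skew_product (MeasurePreserving.id solidAngle)
    (g := fun (α : S2) (p : V3 × V3) => (post p.1 p.2 (α : V3), postStar p.1 p.2 (α : V3))) ?_ ?_
  · exact (continuous_post.prodMk continuous_postStar).measurable
  · exact Eventually.of_forall fun α => map_collLin α

/-- The reversal `α ↦ -α`. -/
noncomputable def flipMap (e : Coll) : Coll := (-e.1, e.2.1, e.2.2)

lemma measurePreserving_flipMap : MeasurePreserving flipMap collMeas collMeas :=
  measurePreserving_neg_S2.prod (MeasurePreserving.id _)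

/-- The exchange of the two molecules. -/
noncomputable def exchMap (e : Coll) : Coll := (-e.1, e.2.2, e.2.1)

lemma measurePreserving_exchMap : MeasurePreserving exchMap collMeas collMeas :=
  measurePreserving_neg_S2.prod Measure.measurePreserving_swap

lemma collMap_collMap (e : Coll) : collMap (collMap e) = e := by
  simp only [collMap, post_post, postStar_postStar]

lemma flipMap_flipMap (e : Coll) : flipMap (flipMap e) = e := by simp [flipMap]

lemma exchMap_exchMap (e : Coll) : exchMap (exchMap e) = e := by simp [exchMap]

/-- An involution is its own measurable inverse, hence a measurable embedding; this is why nothing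
at all is required of `F`. -/
lemma integral_comp_involution {E : Type*} [MeasurableSpace E] {μ : Measure E} {T : E → E}
    (hT : MeasurePreserving T μ μ) (hTT : ∀ e, T (T e) = e) (F : E → ℝ) :
    ∫ e, F (T e) ∂μ = ∫ e, F e ∂μ := by
  let eq : E ≃ᵐ E := ⟨⟨T, T, hTT, hTT⟩, hT.measurable, hT.measurable⟩
  exact hT.integral_comp eq.measurableEmbedding F

/-- The weight `(1 + ‖ξ‖)(1 + ‖ξ_*‖)`. -/
noncomputable def pw (e : Coll) : ℝ := (1 + ‖e.2.1‖) * (1 + ‖e.2.2‖)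

lemma one_le_pw (e : Coll) : 1 ≤ pw e :=
  one_le_mul_of_one_le_of_one_le (one_le_one_add_norm _) (one_le_one_add_norm _)

lemma pw_pos (e : Coll) : 0 < pw e := lt_of_lt_of_le one_pos (one_le_pw e)

lemma one_add_norm_le_pw (e : Coll) : 1 + ‖e.2.1‖ ≤ pw e :=
  le_mul_of_one_le_right (one_add_norm_pos _).le (one_le_one_add_norm _)

lemma one_add_norm_star_le_pw (e : Coll) : 1 + ‖e.2.2‖ ≤ pw e :=
  le_mul_of_one_le_left (one_add_norm_pos _).le (one_le_one_add_norm _)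

/-- Conservation of energy gives `‖ξ'‖ ≤ ‖ξ‖ + ‖ξ_*‖`, and `1 + a + b ≤ (1 + a)(1 + b)`. -/
lemma one_add_norm_post_le_pw (e : Coll) : 1 + ‖post e.2.1 e.2.2 e.1‖ ≤ pw e := by
  have h := norm_post_sq_add e.1 e.2.1 e.2.2
  have : ‖post e.2.1 e.2.2 e.1‖ ≤ ‖e.2.1‖ + ‖e.2.2‖ := by
    refine abs_le_of_sq_le_sq' ?_ (by positivity) |>.2
    nlinarith [norm_nonneg e.2.1, norm_nonneg e.2.2, sq_nonneg ‖postStar e.2.1 e.2.2 e.1‖]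
  unfold pw
  nlinarith [norm_nonneg e.2.1, norm_nonneg e.2.2]

lemma one_add_norm_postStar_le_pw (e : Coll) : 1 + ‖postStar e.2.1 e.2.2 e.1‖ ≤ pw e := by
  have h := norm_post_sq_add e.1 e.2.1 e.2.2
  have : ‖postStar e.2.1 e.2.2 e.1‖ ≤ ‖e.2.1‖ + ‖e.2.2‖ := by
    refine abs_le_of_sq_le_sq' ?_ (by positivity) |>.2
    nlinarith [norm_nonneg e.2.1, norm_nonneg e.2.2, sq_nonneg ‖post e.2.1 e.2.2 e.1‖]
  unfold pw
  nlinarith [norm_nonneg e.2.1, norm_nonneg e.2.2]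

lemma pw_collMap_le (e : Coll) : pw (collMap e) ≤ pw e ^ 2 := by
  rw [sq]
  exact mul_le_mul (one_add_norm_post_le_pw e) (one_add_norm_postStar_le_pw e)
    (one_add_norm_pos _).le (pw_pos e).le

lemma abs_Va_le_pw (e : Coll) : |Va e.2.1 e.2.2 e.1| ≤ pw e := by
  have h1 : |Va e.2.1 e.2.2 e.1| ≤ ‖e.2.2 - e.2.1‖ * ‖(e.1 : V3)‖ := abs_real_inner_le_norm _ _
  rw [norm_coe_S2, mul_one] at h1
  have := norm_sub_le e.2.2 e.2.1
  unfold pw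
  nlinarith [norm_nonneg e.2.1, norm_nonneg e.2.2]

lemma integrable_pw_inv {n : ℕ} (hn : 4 ≤ n) : Integrable (fun e => (pw e ^ n)⁻¹) collMeas := by
  have h := ((integrable_wgt hn).mul_prod (integrable_wgt hn)).comp_snd solidAngle
  refine h.congr (Eventually.of_forall fun e => ?_)
  simp only [wgt, pw, mul_pow, mul_inv]

/-- The fluxes and the collision operator integrate over `α` innermost, whereas `collMeas` lists `α`
first. Fubini after a swap of the two blocks reconciles the conventions. -/
lemma integral_iterated_coll {F : Type*} [NormedAddCommGroup F] [NormedSpace ℝ F]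
    {k : Coll → F} (hk : Integrable k collMeas) :
    ∫ ξ : V3, ∫ ξs : V3, ∫ α : S2, k (α, ξ, ξs) ∂solidAngle = ∫ e, k e ∂collMeas := by
  have h1 : ∫ e, k e ∂collMeas = ∫ p : (V3 × V3) × S2, k p.swap ∂(volume.prod solidAngle) :=
    (integral_prod_swap k).symm
  have h2 : Integrable (fun p : (V3 × V3) × S2 => k p.swap) (volume.prod solidAngle) := hk.swap
  rw [h1, integral_prod _ h2]
  exact (integral_prod _ h2.integral_prod_left).symm

lemma locallyIntegrable_of_bounded {F : Type*} [NormedAddCommGroup F] {V : V3 → F}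
    (hm : AEStronglyMeasurable V volume) {c : ℝ} (hc : ∀ X, ‖V X‖ ≤ c) :
    LocallyIntegrable V volume :=
  (locallyIntegrable_const c).mono hm (Eventually.of_forall fun X =>
    (hc X).trans (le_abs_self c))

lemma setIntegral_inner_gradient {Ω : Set V3} {V : V3 → V3} {φ : V3 → ℝ} (hs : tsupport φ ⊆ Ω) :
    ∫ X in Ω, inner ℝ (V X) (gradient φ X) = ∫ X, fderiv ℝ φ X (V X) := by
  rw [setIntegral_eq_integral_of_forall_compl_eq_zero]
  · simp only [inner_gradient]
  · intro X hX
    have : gradient φ X = 0 := image_eq_zero_of_notMem_tsupport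
      fun h => hX (hs (tsupport_gradient_subset φ h))
    rw [this, inner_zero_right]

lemma setIntegral_mul_of_tsupport {Ω : Set V3} {φ d : V3 → ℝ} (hs : tsupport φ ⊆ Ω) :
    ∫ X in Ω, φ X * d X = ∫ X, φ X * d X := by
  rw [setIntegral_eq_integral_of_forall_compl_eq_zero]
  intro X hX
  rw [image_eq_zero_of_notMem_tsupport (fun h => hX (hs h)), zero_mul]

/-! ### Weak divergence of averages along segments -/

section LineAverage

variable {E : Type*} [MeasurableSpace E] {μ : Measure E} [SFinite μ] {r : E → V3}
  {w : E → V3 → V3 → ℝ} {b : E → ℝ}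

/-- Average of a two-point function along the segments `[X - r, X + r]`. -/
noncomputable def lineAvg (r : E → V3) (w : E → V3 → V3 → ℝ) (e : E) (X : V3) : ℝ :=
  ∫ τ in (0 : ℝ)..1, w e (X + τ • r e) (X + (τ - 1) • r e)

lemma measurable_lineAvg (hr : Measurable r)
    (hw : Measurable fun p : E × V3 × V3 => w p.1 p.2.1 p.2.2) :
    StronglyMeasurable fun p : V3 × E => lineAvg r w p.2 p.1 := by
  unfold lineAvg
  simp only [intervalIntegral.integral_of_le zero_le_one]
  refine StronglyMeasurable.integral_prod_right (f := fun (p : V3 × E) (τ : ℝ) =>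
    w p.2 (p.1 + τ • r p.2) (p.1 + (τ - 1) • r p.2)) ?_
  refine (hw.comp (f := fun q : (V3 × E) × ℝ =>
    (q.1.2, q.1.1 + q.2 • r q.1.2, q.1.1 + (q.2 - 1) • r q.1.2)) ?_).stronglyMeasurable
  fun_prop

omit [MeasurableSpace E] in
lemma abs_lineAvg_le (hwb : ∀ e Y Z, |w e Y Z| ≤ b e) (e : E) (X : V3) :
    |lineAvg r w e X| ≤ b e := by
  have := intervalIntegral.norm_integral_le_of_norm_le_const (a := (0 : ℝ)) (b := 1)
    (f := fun τ => w e (X + τ • r e) (X + (τ - 1) • r e)) (C := b e) fun τ _ => hwb e _ _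
  simpa [lineAvg] using this

lemma integral_fderiv_segment {φ : V3 → ℝ} (hφ : ContDiff ℝ 1 φ) (X r : V3) :
    ∫ τ in (0 : ℝ)..1, fderiv ℝ φ (X + (1 - τ) • r) r = φ (X + r) - φ X := by
  have hd : ∀ τ ∈ uIcc (0 : ℝ) 1, HasDerivAt (fun τ : ℝ => -φ (X + (1 - τ) • r))
      (fderiv ℝ φ (X + (1 - τ) • r) r) τ := by
    intro τ _
    have h1 : HasDerivAt (fun τ : ℝ => X + (1 - τ) • r) ((-1 : ℝ) • r) τ :=
      (((hasDerivAt_id τ).const_sub 1).smul_const r).const_add X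
    have h2 := (hφ.differentiable (by simp) (X + (1 - τ) • r)).hasFDerivAt.comp_hasDerivAt τ h1
    have h3 := h2.neg
    simp only [neg_smul, one_smul, map_neg, neg_neg] at h3
    exact h3
  rw [intervalIntegral.integral_eq_sub_of_hasDerivAt hd]
  · simp; ring
  · refine Continuous.intervalIntegrable ?_ _ _
    exact ((hφ.continuous_fderiv (by simp)).comp (by fun_prop)).clm_apply continuous_const

variable (hr : Measurable r) (hw : Measurable fun p : E × V3 × V3 => w p.1 p.2.1 p.2.2)
  (hb : Integrable b μ) (hbr : Integrable (fun e => b e * ‖r e‖) μ)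
  (hwb : ∀ e Y Z, |w e Y Z| ≤ b e)
include hr hw hbr hwb

/-- Replacing `X` by `X + (1 - τ) r` pins the two points to `X + r` and `X`, so that `w` no longer
depends on `τ`. Only the derivative of `φ` is left to integrate along the segment, and it gives `φ
(X + r) - φ X`. -/
lemma integral_lineAvg_test {φ : V3 → ℝ} (hφ : ContDiff ℝ 1 φ) (hc : HasCompactSupport φ) :
    ∫ X, fderiv ℝ φ X (∫ e, lineAvg r w e X • r e ∂μ)
      = ∫ e, (∫ X, w e (X + r e) X * (φ (X + r e) - φ X)) ∂μ := by
  have hcd : Continuous (fderiv ℝ φ) := hφ.continuous_fderiv (by simp)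
  set ν : Measure ℝ := volume.restrict (Ioc 0 1) with hν
  let G : (E × ℝ) × V3 → ℝ := fun q =>
    w q.1.1 (q.2 + q.1.2 • r q.1.1) (q.2 + (q.1.2 - 1) • r q.1.1) * fderiv ℝ φ q.2 (r q.1.1)
  have hGm : Measurable G := by
    refine Measurable.mul ?_ ?_
    · exact hw.comp (f := fun q : (E × ℝ) × V3 => (q.1.1, q.2 + q.1.2 • r q.1.1,
        q.2 + (q.1.2 - 1) • r q.1.1)) (by fun_prop)
    · simp only [← inner_gradient]
      have h1 : Measurable (gradient φ) := (continuous_gradient hφ).measurable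
      exact Measurable.inner (by fun_prop) (h1.comp measurable_snd)
  have hDi : Integrable (fun X => ‖fderiv ℝ φ X‖) :=
    (hcd.integrable_of_hasCompactSupport (hc.fderiv ℝ)).norm
  have hGi : Integrable G ((μ.prod ν).prod volume) := by
    have h1 : Integrable (fun q : E × ℝ => b q.1 * ‖r q.1‖) (μ.prod ν) := hbr.comp_fst ν
    refine Integrable.mono' (h1.mul_prod hDi) hGm.aestronglyMeasurable
      (Eventually.of_forall fun q => ?_)
    rw [norm_mul, mul_assoc]
    refine mul_le_mul (hwb _ _ _) ?_ (norm_nonneg _) ((abs_nonneg _).trans (hwb q.1.1 0 0))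
    rw [mul_comm]; exact (fderiv ℝ φ q.2).le_opNorm _
  let T : (E × ℝ) × V3 → (E × ℝ) × V3 := fun q => (q.1, q.2 + (1 - q.1.2) • r q.1.1)
  have hT : MeasurePreserving T ((μ.prod ν).prod volume) ((μ.prod ν).prod volume) := by
    refine MeasurePreserving.skew_product (MeasurePreserving.id _)
      (g := fun (q : E × ℝ) (X : V3) => X + (1 - q.2) • r q.1) ?_ ?_
    · unfold Function.uncurry; fun_prop
    · exact Eventually.of_forall fun q => (measurePreserving_add_right volume _).map_eq
  have hL : ∫ X, fderiv ℝ φ X (∫ e, lineAvg r w e X • r e ∂μ)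
      = ∫ q, G q ∂((μ.prod ν).prod volume) := by
    rw [integral_prod_symm _ hGi]
    refine integral_congr_ae ?_
    filter_upwards [hGi.prod_left_ae] with X hX
    rw [integral_prod _ hX, ← ContinuousLinearMap.integral_comp_comm]
    · refine integral_congr_ae (Eventually.of_forall fun e => ?_)
      simp only [map_smul, smul_eq_mul, lineAvg]
      rw [intervalIntegral.integral_of_le zero_le_one, ← integral_mul_const]
    · refine Integrable.mono' hbr ?_ (Eventually.of_forall fun e => ?_)
      · exact ((measurable_lineAvg hr hw).comp_measurable
          measurable_prodMk_left).aestronglyMeasurable.smul hr.aestronglyMeasurable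
      · rw [norm_smul]
        exact mul_le_mul_of_nonneg_right (abs_lineAvg_le hwb e X) (norm_nonneg _)
  have hGT : Integrable (fun q => G (T q)) ((μ.prod ν).prod volume) :=
    hT.integrable_comp_of_integrable hGi
  have hGe : ∀ q, G (T q) = w q.1.1 (q.2 + r q.1.1) q.2
      * fderiv ℝ φ (q.2 + (1 - q.1.2) • r q.1.1) (r q.1.1) := by
    intro q
    simp only [G, T]
    congr 2 <;> module
  have hR : ∫ q, G q ∂((μ.prod ν).prod volume)
      = ∫ q, G (T q) ∂((μ.prod ν).prod volume) := by
    conv_lhs => rw [← hT.map_eq]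
    exact integral_map hT.measurable.aemeasurable hGm.aestronglyMeasurable
  rw [hL, hR]
  have hassoc : MeasurePreserving (MeasurableEquiv.prodAssoc : (E × ℝ) × V3 ≃ᵐ E × ℝ × V3)
    ((μ.prod ν).prod volume) (μ.prod (ν.prod volume)) := measurePreserving_prodAssoc _ _ _
  have hGT' : Integrable (fun q : E × ℝ × V3 => G (T ((q.1, q.2.1), q.2.2)))
      (μ.prod (ν.prod volume)) := by
    rw [← hassoc.integrable_comp_emb (MeasurableEquiv.measurableEmbedding _)]
    exact hGT
  have hE : ∫ q, G (T q) ∂((μ.prod ν).prod volume)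
      = ∫ q : E × ℝ × V3, G (T ((q.1, q.2.1), q.2.2)) ∂(μ.prod (ν.prod volume)) := by
    rw [← hassoc.integral_comp (MeasurableEquiv.measurableEmbedding _)]
    rfl
  rw [hE, integral_prod _ hGT']
  refine integral_congr_ae ?_
  filter_upwards [hGT'.prod_right_ae] with e he
  rw [integral_prod_symm _ he]
  refine integral_congr_ae (Eventually.of_forall fun X => ?_)
  simp only [hGe]
  rw [integral_const_mul, ← integral_fderiv_segment hφ,
    intervalIntegral.integral_of_le zero_le_one]

include hb

omit [SFinite μ] hbr in
lemma integrable_lineDiv {φ : V3 → ℝ} {ν : Measure V3} [SFinite ν] (hφ : Integrable φ ν) :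
    Integrable (fun p : V3 × E => φ p.1 * (w p.2 (p.1 + r p.2) p.1 - w p.2 p.1 (p.1 - r p.2)))
      (ν.prod μ) := by
  refine Integrable.mono' (hφ.norm.mul_prod (hb.const_mul 2)) ?_ (Eventually.of_forall fun p => ?_)
  · refine hφ.1.comp_fst.mul (Measurable.aestronglyMeasurable (Measurable.sub ?_ ?_))
    · exact hw.comp (f := fun p : V3 × E => (p.2, p.1 + r p.2, p.1)) (by fun_prop)
    · exact hw.comp (f := fun p : V3 × E => (p.2, p.1, p.1 - r p.2)) (by fun_prop)
  · rw [norm_mul]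
    refine mul_le_mul_of_nonneg_left ?_ (norm_nonneg _)
    have h1 := hwb p.2 (p.1 + r p.2) p.1
    have h2 := hwb p.2 p.1 (p.1 - r p.2)
    rw [Real.norm_eq_abs]
    exact (abs_sub _ _).trans (by linarith)

/-- The weak divergence of a field given by averages along segments. -/
lemma weakDiv_lineAvg (Ω : Set V3) :
    WeakDiv Ω (fun X => ∫ e, lineAvg r w e X • r e ∂μ)
      (fun X => ∫ e, (w e (X + r e) X - w e X (X - r e)) ∂μ) := by
  have hb0 : ∀ e, 0 ≤ b e := fun e => (abs_nonneg _).trans (hwb e 0 0)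
  have hsm : StronglyMeasurable
      (fun p : V3 × E => w p.2 (p.1 + r p.2) p.1 - w p.2 p.1 (p.1 - r p.2)) := by
    refine (Measurable.sub ?_ ?_).stronglyMeasurable
    · exact hw.comp (f := fun p : V3 × E => (p.2, p.1 + r p.2, p.1)) (by fun_prop)
    · exact hw.comp (f := fun p : V3 × E => (p.2, p.1, p.1 - r p.2)) (by fun_prop)
  refine ⟨LocallyIntegrable.locallyIntegrableOn (locallyIntegrable_of_bounded
    (c := ∫ e, b e * ‖r e‖ ∂μ) ?_ fun X => ?_) Ω,
    LocallyIntegrable.locallyIntegrableOn (locallyIntegrable_of_bounded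
      (c := ∫ e, 2 * b e ∂μ) ?_ fun X => ?_) Ω, fun φ h1 h2 h3 => ?_⟩
  · refine StronglyMeasurable.aestronglyMeasurable (StronglyMeasurable.integral_prod_right
      (f := fun (X : V3) (e : E) => lineAvg r w e X • r e) ?_)
    exact (measurable_lineAvg hr hw).smul (hr.comp measurable_snd).stronglyMeasurable
  · refine norm_integral_le_of_norm_le hbr (Eventually.of_forall fun e => ?_)
    rw [norm_smul]
    exact mul_le_mul_of_nonneg_right (abs_lineAvg_le hwb e X) (norm_nonneg _)
  · exact StronglyMeasurable.aestronglyMeasurable (StronglyMeasurable.integral_prod_right hsm)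
  · refine norm_integral_le_of_norm_le (hb.const_mul 2) (Eventually.of_forall fun e => ?_)
    rw [Real.norm_eq_abs]
    exact (abs_sub _ _).trans (by linarith [hwb e (X + r e) X, hwb e X (X - r e)])
  · have hφi : Integrable φ := h1.continuous.integrable_of_hasCompactSupport h2
    rw [setIntegral_inner_gradient h3, setIntegral_mul_of_tsupport h3,
      integral_lineAvg_test hr hw hbr hwb h1 h2]
    have hi := integrable_lineDiv hr hw hb hwb hφi
    have e1 : ∫ X, φ X * ∫ e, (w e (X + r e) X - w e X (X - r e)) ∂μ
        = ∫ e, (∫ X, φ X * (w e (X + r e) X - w e X (X - r e))) ∂μ := by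
      rw [← integral_integral_swap hi]
      exact integral_congr_ae (Eventually.of_forall fun X => (integral_const_mul _ _).symm)
    rw [e1, ← integral_neg]
    refine integral_congr_ae (Eventually.of_forall fun e => ?_)
    have hm1 : Measurable fun X => w e (X + r e) X :=
      hw.comp (f := fun X : V3 => (e, X + r e, X)) (by fun_prop)
    have hm2 : Measurable fun X => w e X (X - r e) :=
      hw.comp (f := fun X : V3 => (e, X, X - r e)) (by fun_prop)
    have i1 : Integrable fun X => φ X * w e (X + r e) X := by
      simpa [mul_comm] using hφi.bdd_mul (c := b e) hm1.aestronglyMeasurable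
        (Eventually.of_forall fun X => hwb e _ _)
    have i2 : Integrable fun X => φ X * w e X (X - r e) := by
      simpa [mul_comm] using hφi.bdd_mul (c := b e) hm2.aestronglyMeasurable
        (Eventually.of_forall fun X => hwb e _ _)
    have i3 : Integrable fun X => φ (X + r e) * w e (X + r e) X := by
      simpa using i2.comp_add_right (r e)
    -- Summation by parts: a translation by `r e` moves the increment from `φ` to `w`.
    have e3 : ∫ X, φ (X + r e) * w e (X + r e) X = ∫ X, φ X * w e X (X - r e) := by
      have := integral_add_right_eq_self (μ := (volume : Measure V3))
        (fun X => φ X * w e X (X - r e)) (r e)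
      simpa using this
    simp only [mul_sub]
    rw [integral_sub i1 i2, neg_sub, ← e3, ← integral_sub i3 i1]
    exact integral_congr_ae (Eventually.of_forall fun X => by simp only; ring)

end LineAverage

/-! ### Regions with a translation-invariant pairing of points -/

/-- Abstract properties common to a bounded domain (`C = Ω`, no periods) and to all of space with
a fundamental cell `C` of a lattice (`P` a set of periods generating it). -/
structure IsCell (Ω C P : Set V3) : Prop where
  isOpen : IsOpen Ω
  subset : C ⊆ Ω
  measurableSet : MeasurableSet C
  bounded : Bornology.IsBounded C
  add_mem : ∀ p ∈ P, ∀ X, X + p ∈ Ω ↔ X ∈ Ω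
  -- The form of translation invariance that makes the divergence of every segment average integrate
  -- to zero. In a bounded domain it rests on the vanishing of `w` outside, in a period cell on
  -- periodicity.
  swap : ∀ w : V3 → V3 → ℝ, (∀ Y Z, Y ∉ Ω ∨ Z ∉ Ω → w Y Z = 0) →
    (∀ p ∈ P, ∀ Y Z, w (Y + p) (Z + p) = w Y Z) →
    ∀ r, ∫ X in C, w (X + r) X = ∫ X in C, w X (X - r)
  -- A compact set of representatives modulo the periods. It may reach the boundary of `Ω`, and
  -- serves to find a point where the crowding function is largest.
  cover : ∃ Q, IsCompact Q ∧ Q ⊆ closure Ω ∧ ∀ X ∈ Ω, ∃ Y ∈ Q,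
    ∀ g : V3 → ℝ, (∀ p ∈ P, ∀ X, g (X + p) = g X) → g X = g Y

lemma IsCell.measure_lt_top {Ω C P : Set V3} (h : IsCell Ω C P) : volume C < ⊤ :=
  h.bounded.measure_lt_top

/-- For `swap`: since `w` vanishes unless both points lie in `D`, both integrals extend to the whole
space, where a translation by `r` carries one into the other. -/
lemma isCell_of_bounded {D : Set V3} (hD : IsOpen D) (hb : Bornology.IsBounded D) :
    IsCell D D ∅ where
  isOpen := hD
  subset := subset_rfl
  measurableSet := hD.measurableSet
  bounded := hb
  add_mem := fun _ h => absurd h (notMem_empty _)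
  swap := fun w h0 _ r => by
    rw [setIntegral_eq_integral_of_forall_compl_eq_zero (fun X hX => h0 _ _ (Or.inr hX)),
      setIntegral_eq_integral_of_forall_compl_eq_zero (fun X hX => h0 _ _ (Or.inl hX))]
    have := integral_add_right_eq_self (μ := (volume : Measure V3)) (fun X => w X (X - r)) r
    simpa using this
  cover := ⟨closure D, hb.isCompact_closure, subset_rfl, fun X hX =>
    ⟨X, subset_closure hX, fun _ _ => rfl⟩⟩

lemma periodic_of_mem_span {b : Module.Basis (Fin 3) ℝ V3} {F : Type*} {g : V3 → F}
    (hg : ∀ i X, g (X + b i) = g X) {v : V3} (hv : v ∈ Submodule.span ℤ (range b)) :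
    Function.Periodic g v := by
  induction hv using Submodule.span_induction with
  | mem x h => obtain ⟨i, rfl⟩ := h; exact hg i
  | zero => intro X; simp
  | add x y _ _ hx hy => exact hx.add_period hy
  | smul a x _ hx => exact hx.zsmul a

-- A translate of a fundamental domain is again a fundamental domain, and a periodic function has
-- the same integral over any two of them.
open scoped Pointwise in
lemma setIntegral_fundamentalDomain_add (b : Module.Basis (Fin 3) ℝ V3) {F : Type*}
    [NormedAddCommGroup F] [NormedSpace ℝ F] {g : V3 → F}
    (hg : ∀ i X, g (X + b i) = g X) (r : V3) :
    ∫ X in ZSpan.fundamentalDomain b, g (X + r) = ∫ X in ZSpan.fundamentalDomain b, g X := by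
  have : Countable (Submodule.span ℤ (range b)).toAddSubgroup :=
    inferInstanceAs (Countable (Submodule.span ℤ (range b)))
  have h1 := ZSpan.isAddFundamentalDomain' b (volume : Measure V3)
  have h2 := h1.vadd_of_comm r
  have h3 := h2.setIntegral_eq h1 (f := g) fun v x => by
    have := periodic_of_mem_span hg v.2 x
    rwa [add_comm] at this
  rw [← h3]
  have h4 := (measurePreserving_add_right (volume : Measure V3) r).setIntegral_image_emb
    (measurableEmbedding_addRight r) g (ZSpan.fundamentalDomain b)
  rw [← h4]
  congr 2
  ext x
  simp only [Set.mem_vadd_set, Set.mem_image, vadd_eq_add, add_comm]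

lemma isCell_fundamentalDomain (b : Module.Basis (Fin 3) ℝ V3) :
    IsCell univ (ZSpan.fundamentalDomain b) (range b) where
  isOpen := isOpen_univ
  subset := subset_univ _
  measurableSet := ZSpan.fundamentalDomain_measurableSet b
  bounded := ZSpan.fundamentalDomain_isBounded b
  add_mem := fun _ _ _ => by simp
  swap := fun w _ hp r => by
    have := setIntegral_fundamentalDomain_add b (g := fun X => w X (X - r)) (fun i X => by
      have := hp (b i) ⟨i, rfl⟩ X (X - r)
      rwa [show X - r + b i = X + b i - r by abel] at this) r
    simpa using this
  cover := by
    refine ⟨closure (ZSpan.fundamentalDomain b),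
      (ZSpan.fundamentalDomain_isBounded b).isCompact_closure, by simp, fun X _ => ?_⟩
    refine ⟨ZSpan.fract b X, subset_closure (ZSpan.fract_mem_fundamentalDomain b X),
      fun g hg => ?_⟩
    have := periodic_of_mem_span (fun i X => hg (b i) ⟨i, rfl⟩ X) (ZSpan.floor b X).2
      (ZSpan.fract b X)
    rwa [ZSpan.fract_apply, sub_add_cancel] at this

/-! ### Weak gradients -/

/-- `B` is the weak gradient of `K`, both being measurable and locally bounded. -/
structure HasWeakGrad (K : V3 → ℝ) (B : V3 → V3) : Prop where
  measurable_fun : Measurable K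
  bounded_fun : ∀ L, IsCompact L → ∃ c, ∀ X ∈ L, |K X| ≤ c
  measurable : Measurable B
  bounded : ∀ L, IsCompact L → ∃ c, ∀ X ∈ L, ‖B X‖ ≤ c
  test : ∀ Ψ : V3 → ℝ, ContDiff ℝ 1 Ψ → HasCompactSupport Ψ → ∀ e : V3,
    ∫ X, K X * fderiv ℝ Ψ X e = -∫ X, inner ℝ (B X) e * Ψ X

lemma exists_lipschitz_of_compactSupport {Ψ : V3 → ℝ} (h : ContDiff ℝ 1 Ψ)
    (hc : HasCompactSupport Ψ) : ∃ D, LipschitzWith D Ψ :=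
  h.lipschitzWith_of_hasCompactSupport hc (by simp)

lemma integral_lipschitz_mul_fderiv {K : V3 → ℝ} {c : NNReal} (hK : LipschitzWith c K)
    {Ψ : V3 → ℝ} (h : ContDiff ℝ 1 Ψ) (hc : HasCompactSupport Ψ) (e : V3) :
    ∫ X, K X * fderiv ℝ Ψ X e = -∫ X, lineDeriv ℝ K X e * Ψ X := by
  obtain ⟨D, hD⟩ := exists_lipschitz_of_compactSupport h hc
  rw [hK.integral_lineDeriv_mul_eq hD hc e, ← integral_neg]
  refine integral_congr_ae (Eventually.of_forall fun X => ?_)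
  simp only
  rw [(h.differentiable (by simp) X).lineDeriv_eq_fderiv, map_neg]
  ring

lemma hasWeakGrad_one : HasWeakGrad (fun _ => 1) (fun _ => 0) where
  measurable_fun := measurable_const
  bounded_fun := fun _ _ => ⟨1, by simp⟩
  measurable := measurable_const
  bounded := fun _ _ => ⟨0, by simp⟩
  test := fun Ψ h hc e => by
    rw [integral_lipschitz_mul_fderiv (LipschitzWith.const (1 : ℝ)) h hc e]
    have : ∀ X : V3, lineDeriv ℝ (fun _ : V3 => (1 : ℝ)) X e = 0 := fun X => by simp [lineDeriv]
    simp [this]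

lemma integrable_weakGrad_mul {B : V3 → V3} (hm : Measurable B)
    (hb : ∀ L, IsCompact L → ∃ c, ∀ X ∈ L, ‖B X‖ ≤ c) {Ψ : V3 → ℝ} (h : Continuous Ψ)
    (hc : HasCompactSupport Ψ) (e : V3) : Integrable fun X => inner ℝ (B X) e * Ψ X := by
  obtain ⟨c, hcb⟩ := hb _ hc
  refine Integrable.mono' ((h.integrable_of_hasCompactSupport hc).norm.const_mul (c * ‖e‖))
    ((hm.inner_const).mul h.measurable).aestronglyMeasurable (Eventually.of_forall fun X => ?_)
  rw [norm_mul]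
  by_cases hX : X ∈ tsupport Ψ
  · refine mul_le_mul_of_nonneg_right ?_ (norm_nonneg _)
    exact (norm_inner_le_norm _ _).trans (mul_le_mul_of_nonneg_right (hcb X hX) (norm_nonneg _))
  · simp [image_eq_zero_of_notMem_tsupport hX]

lemma exists_bound_of_continuous {K : V3 → ℝ} (hK : Continuous K) (L : Set V3)
    (hL : IsCompact L) : ∃ c, ∀ X ∈ L, |K X| ≤ c :=
  hL.exists_bound_of_continuousOn hK.continuousOn

lemma integrable_mul_of_locally_bounded {K Ψ : V3 → ℝ} (hm : Measurable K)
    (hb : ∀ L, IsCompact L → ∃ c, ∀ X ∈ L, |K X| ≤ c) (h : Continuous Ψ)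
    (hc : HasCompactSupport Ψ) : Integrable fun X => K X * Ψ X := by
  obtain ⟨c, hcb⟩ := hb _ hc
  refine Integrable.mono' ((h.integrable_of_hasCompactSupport hc).norm.const_mul c)
    (hm.mul h.measurable).aestronglyMeasurable (Eventually.of_forall fun X => ?_)
  rw [norm_mul]
  by_cases hX : X ∈ tsupport Ψ
  · exact mul_le_mul_of_nonneg_right (hcb X hX) (norm_nonneg _)
  · simp [image_eq_zero_of_notMem_tsupport hX]

lemma integrable_mul_fderiv {K Ψ : V3 → ℝ} (hm : Measurable K)
    (hb : ∀ L, IsCompact L → ∃ c, ∀ X ∈ L, |K X| ≤ c) (h : ContDiff ℝ 1 Ψ)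
    (hc : HasCompactSupport Ψ) (e : V3) : Integrable fun X => K X * fderiv ℝ Ψ X e :=
  integrable_mul_of_locally_bounded hm hb
    ((h.continuous_fderiv (by simp)).clm_apply continuous_const) (hc.fderiv_apply ℝ e)

lemma HasWeakGrad.add {K K' : V3 → ℝ} {B B' : V3 → V3} (h : HasWeakGrad K B)
    (h' : HasWeakGrad K' B') : HasWeakGrad (fun X => K X + K' X) (fun X => B X + B' X) where
  measurable_fun := h.measurable_fun.add h'.measurable_fun
  bounded_fun := fun L hL => by
    obtain ⟨c, hc⟩ := h.bounded_fun L hL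
    obtain ⟨c', hc'⟩ := h'.bounded_fun L hL
    exact ⟨c + c', fun X hX => (abs_add_le _ _).trans (add_le_add (hc X hX) (hc' X hX))⟩
  measurable := h.measurable.add h'.measurable
  bounded := fun L hL => by
    obtain ⟨c, hc⟩ := h.bounded L hL
    obtain ⟨c', hc'⟩ := h'.bounded L hL
    exact ⟨c + c', fun X hX => (norm_add_le _ _).trans (add_le_add (hc X hX) (hc' X hX))⟩
  test := fun Ψ h1 h2 e => by
    simp only [add_mul, inner_add_left]
    rw [integral_add (integrable_mul_fderiv h.measurable_fun h.bounded_fun h1 h2 e)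
      (integrable_mul_fderiv h'.measurable_fun h'.bounded_fun h1 h2 e), h.test Ψ h1 h2 e, h'.test Ψ h1 h2 e,
      integral_add (integrable_weakGrad_mul h.measurable h.bounded h1.continuous h2 e)
      (integrable_weakGrad_mul h'.measurable h'.bounded h1.continuous h2 e)]
    ring

/-- The almost everywhere defined line derivative of a Lipschitz function is also its distributional
derivative, and distributional derivatives are unique. Pointwise calculus thus becomes available for
`B`. -/
lemma HasWeakGrad.lineDeriv_ae_eq {K : V3 → ℝ} {B : V3 → V3} (h : HasWeakGrad K B) {c : NNReal}
    (hK : LipschitzWith c K) (e : V3) : ∀ᵐ X, lineDeriv ℝ K X e = inner ℝ (B X) e := by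
  refine ae_eq_of_integral_contDiff_smul_eq (hK.locallyIntegrable_lineDeriv e) ?_ fun g hg hgc => ?_
  · rw [locallyIntegrable_iff]
    intro L hL
    obtain ⟨a, ha⟩ := h.bounded L hL
    refine Measure.integrableOn_of_bounded (M := a * ‖e‖) hL.measure_lt_top.ne
      h.measurable.inner_const.aestronglyMeasurable ?_
    filter_upwards [ae_restrict_mem hL.measurableSet] with X hX
    exact (norm_inner_le_norm _ _).trans (mul_le_mul_of_nonneg_right (ha X hX) (norm_nonneg _))
  · have hg1 : ContDiff ℝ 1 g := hg.of_le (by exact_mod_cast le_top)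
    have e1 := integral_lipschitz_mul_fderiv hK hg1 hgc e
    have e2 := h.test g hg1 hgc e
    simp only [smul_eq_mul, mul_comm (g _)]
    linarith

/-- Chain rule for weak gradients of Lipschitz functions. -/
lemma HasWeakGrad.comp {K : V3 → ℝ} {B : V3 → V3} (h : HasWeakGrad K B) {c : NNReal}
    (hK : LipschitzWith c K) {P p : ℝ → ℝ} (hP : ∀ x, HasDerivAt P (p x) x)
    (hp : Continuous p) {a : NNReal} (hpa : ∀ x, ‖p x‖₊ ≤ a) :
    HasWeakGrad (fun X => P (K X)) (fun X => p (K X) • B X) where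
  measurable_fun := by
    have : Continuous P := continuous_iff_continuousAt.2 fun x => (hP x).continuousAt
    exact (this.comp hK.continuous).measurable
  bounded_fun := by
    have : Continuous P := continuous_iff_continuousAt.2 fun x => (hP x).continuousAt
    exact exists_bound_of_continuous (this.comp hK.continuous)
  measurable := (hp.comp hK.continuous).measurable.smul h.measurable
  bounded := fun L hL => by
    obtain ⟨c, hc⟩ := h.bounded L hL
    refine ⟨a * c, fun X hX => ?_⟩
    rw [norm_smul]
    exact mul_le_mul (hpa _) (hc X hX) (norm_nonneg _) a.2
  test := fun Ψ h1 h2 e => by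
    -- The composition is Lipschitz as well, so its weak derivative may be computed at the points
    -- where `K` is differentiable, which are almost all; there the classical chain rule holds.
    have hPL : LipschitzWith a P := lipschitzWith_of_nnnorm_deriv_le
      (fun x => (hP x).differentiableAt) fun x => by rw [(hP x).deriv]; exact hpa x
    refine (integral_lipschitz_mul_fderiv (hPL.comp hK) h1 h2 e).trans ?_
    congr 1
    refine integral_congr_ae ?_
    filter_upwards [h.lineDeriv_ae_eq hK e, hK.ae_differentiableAt] with X hX hd
    congr 1
    have h3 : HasDerivAt (fun t : ℝ => K (X + t • e)) (lineDeriv ℝ K X e) 0 :=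
      hd.lineDifferentiableAt.hasLineDerivAt
    have h4 : HasDerivAt P (p (K X)) (K (X + (0 : ℝ) • e)) := by simpa using hP (K X)
    have h5 : HasLineDerivAt ℝ (P ∘ K) (p (K X) * lineDeriv ℝ K X e) X e := h4.comp 0 h3
    rw [h5.lineDeriv, hX, real_inner_smul_left]

/-! ### Polar coordinates and radial functions -/

lemma integrable_polar {F : V3 → ℝ} (hF : Integrable F) :
    Integrable (fun p : S2 × Ioi (0 : ℝ) => F (p.2.1 • (p.1 : V3)))
      (solidAngle.prod (Measure.volumeIoiPow 2)) := by
  have hp := (volume : Measure V3).measurePreserving_homeomorphUnitSphereProd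
  rw [finrank_euclideanSpace, Fintype.card_fin] at hp
  rw [← hp.integrable_comp_emb (Homeomorph.measurableEmbedding _)]
  have h2 : Integrable (fun x : ({(0)}ᶜ : Set V3) => F x.1) (volume.comap Subtype.val) := by
    have := (integrableOn_iff_comap_subtypeVal (μ := (volume : Measure V3)) (f := F)
      (measurableSet_singleton (0 : V3)).compl).1 hF.integrableOn
    exact this
  refine h2.congr (Eventually.of_forall fun x => ?_)
  simp only [Function.comp]
  congr 1
  exact congrArg Subtype.val ((homeomorphUnitSphereProd V3).symm_apply_apply x).symm

lemma integral_polar {F : V3 → ℝ} (hF : Integrable F) :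
    ∫ x, F x = ∫ r in Ioi (0 : ℝ), r ^ 2 * ∫ α : S2, F (r • (α : V3)) ∂solidAngle := by
  have hp := (volume : Measure V3).measurePreserving_homeomorphUnitSphereProd
  rw [finrank_euclideanSpace, Fintype.card_fin] at hp
  have h1 : ∫ x, F x = ∫ x : ({(0)}ᶜ : Set V3), F x.1 ∂(volume.comap Subtype.val) := by
    rw [integral_subtype_comap (measurableSet_singleton _).compl F, restrict_compl_singleton]
  have h2 : ∫ x : ({(0)}ᶜ : Set V3), F x.1 ∂(volume.comap Subtype.val)
      = ∫ p : S2 × Ioi (0 : ℝ), F (p.2.1 • (p.1 : V3))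
        ∂(solidAngle.prod (Measure.volumeIoiPow 2)) := by
    rw [← hp.integral_comp (Homeomorph.measurableEmbedding _)]
    refine integral_congr_ae (Eventually.of_forall fun x => ?_)
    simp only
    congr 1
    exact congrArg Subtype.val ((homeomorphUnitSphereProd V3).symm_apply_apply x).symm
  rw [h1, h2, integral_prod_symm _ (integrable_polar hF)]
  simp only [Measure.volumeIoiPow, ENNReal.ofReal]
  rw [integral_withDensity_eq_integral_smul,
    integral_subtype_comap measurableSet_Ioi
      fun a => Real.toNNReal (a ^ 2) • ∫ α : S2, F (a • (α : V3)) ∂solidAngle]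
  · refine setIntegral_congr_fun measurableSet_Ioi fun x _ => ?_
    simp only [NNReal.smul_def, Real.coe_toNNReal _ (sq_nonneg x), smul_eq_mul]
  · exact (measurable_subtype_coe.pow_const _).real_toNNReal

lemma hasFDerivAt_norm {x : V3} (hx : x ≠ 0) :
    HasFDerivAt (fun y : V3 => ‖y‖) (‖x‖⁻¹ • innerSL ℝ x) x := by
  have h1 : HasFDerivAt (fun y : V3 => ‖y‖ ^ 2) (2 • innerSL ℝ x) x :=
    (hasStrictFDerivAt_norm_sq x).hasFDerivAt
  have hn : ‖x‖ ≠ 0 := norm_ne_zero_iff.2 hx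
  have h2 := h1.sqrt (by positivity)
  have e : (fun y : V3 => √(‖y‖ ^ 2)) = fun y => ‖y‖ := by
    ext y; exact Real.sqrt_sq (norm_nonneg y)
  rw [e] at h2
  convert! h2 using 1
  ext v
  simp [Real.sqrt_sq (norm_nonneg x)]
  field_simp

/-- A radial function that is differentiable at `x ≠ 0` has a differentiable profile there. -/
lemma differentiableAt_profile {φ : ℝ → ℝ} {x : V3} (hx : x ≠ 0)
    (h : DifferentiableAt ℝ (fun y : V3 => φ ‖y‖) x) : DifferentiableAt ℝ φ ‖x‖ := by
  have hn : 0 < ‖x‖ := norm_pos_iff.2 hx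
  have h1 : DifferentiableAt ℝ (fun s : ℝ => (s / ‖x‖) • x) ‖x‖ := by fun_prop
  have h2 : DifferentiableAt ℝ (fun s : ℝ => φ ‖(s / ‖x‖) • x‖) ‖x‖ := by
    have h3 : DifferentiableAt ℝ (fun y : V3 => φ ‖y‖) ((‖x‖ / ‖x‖) • x) := by
      rw [div_self hn.ne', one_smul]; exact h
    exact DifferentiableAt.comp (g := fun y : V3 => φ ‖y‖) (f := fun s : ℝ => (s / ‖x‖) • x)
      ‖x‖ h3 h1
  refine h2.congr_of_eventuallyEq ?_
  filter_upwards [Ioi_mem_nhds hn] with s hs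
  have hs' : 0 < s := hs
  rw [norm_smul, Real.norm_of_nonneg (by positivity), div_mul_cancel₀ _ hn.ne']

lemma hasFDerivAt_radial {φ : ℝ → ℝ} {x : V3} (hx : x ≠ 0) (h : DifferentiableAt ℝ φ ‖x‖) :
    HasFDerivAt (fun y : V3 => φ ‖y‖) ((deriv φ ‖x‖ * ‖x‖⁻¹) • innerSL ℝ x) x := by
  have := h.hasDerivAt.comp_hasFDerivAt x (hasFDerivAt_norm hx)
  rwa [smul_smul] at this

lemma ae_ne_zero : ∀ᵐ x : V3, x ≠ 0 := by
  simp [ae_iff]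

/-- Integration by parts for radial Lipschitz functions. -/
lemma integral_radial_mul_fderiv {φ : ℝ → ℝ} {c : NNReal} (hφ : LipschitzWith c φ)
    {Ψ : V3 → ℝ} (h : ContDiff ℝ 1 Ψ) (hc : HasCompactSupport Ψ) (e : V3) :
    ∫ x, φ ‖x‖ * fderiv ℝ Ψ x e
      = -∫ x, deriv φ ‖x‖ * ‖x‖⁻¹ * inner ℝ x e * Ψ x := by
  have hL : LipschitzWith (c * 1) fun x : V3 => φ ‖x‖ := hφ.comp lipschitzWith_one_norm
  rw [integral_lipschitz_mul_fderiv hL h hc e]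
  congr 1
  refine integral_congr_ae ?_
  filter_upwards [hL.ae_differentiableAt, ae_ne_zero] with x hd hx
  congr 1
  rw [hd.lineDeriv_eq_fderiv, (hasFDerivAt_radial hx (differentiableAt_profile hx hd)).fderiv]
  simp

/-! ### Averages over balls and their weak gradients -/

/-- A piecewise affine approximation of the indicator of `(-∞, σ]`. -/
noncomputable def ramp (σ ε r : ℝ) : ℝ := max 0 (min 1 (1 - ε⁻¹ * (r - σ)))

lemma ramp_lipschitz (σ : ℝ) {ε : ℝ} (hε : 0 < ε) :
    LipschitzWith ⟨ε⁻¹, (inv_pos.2 hε).le⟩ (ramp σ ε) := by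
  have h : LipschitzWith ⟨ε⁻¹, (inv_pos.2 hε).le⟩ fun r : ℝ => 1 - ε⁻¹ * (r - σ) := by
    refine LipschitzWith.of_dist_le_mul fun x y => ?_
    rw [Real.dist_eq, Real.dist_eq]
    have : 1 - ε⁻¹ * (x - σ) - (1 - ε⁻¹ * (y - σ)) = -(ε⁻¹ * (x - y)) := by ring
    rw [this, abs_neg, abs_mul, abs_of_pos (inv_pos.2 hε)]
    rfl
  exact (h.const_min 1).const_max 0

lemma ramp_of_le {σ ε r : ℝ} (hε : 0 < ε) (h : r ≤ σ) : ramp σ ε r = 1 := by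
  have : 0 ≤ ε⁻¹ * (σ - r) := mul_nonneg (inv_pos.2 hε).le (by linarith)
  rw [ramp, min_eq_left (by linarith), max_eq_right zero_le_one]

lemma ramp_of_ge {σ ε r : ℝ} (hε : 0 < ε) (h : σ + ε ≤ r) : ramp σ ε r = 0 := by
  have : 1 ≤ ε⁻¹ * (r - σ) := by
    rw [inv_mul_eq_div, le_div_iff₀ hε]; linarith
  exact max_eq_left ((min_le_right _ _).trans (by linarith))

lemma ramp_of_mem {σ ε r : ℝ} (hε : 0 < ε) (h : r ∈ Icc σ (σ + ε)) :
    ramp σ ε r = 1 - ε⁻¹ * (r - σ) := by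
  have h1 : 0 ≤ ε⁻¹ * (r - σ) := mul_nonneg (inv_pos.2 hε).le (by linarith [h.1])
  have h2 : ε⁻¹ * (r - σ) ≤ 1 := by
    rw [inv_mul_eq_div, div_le_iff₀ hε]; linarith [h.2]
  rw [ramp, min_eq_right (by linarith), max_eq_right (by linarith)]

lemma abs_ramp_le {σ ε r : ℝ} : |ramp σ ε r| ≤ 1 := by
  rw [abs_of_nonneg (le_max_left _ _)]
  exact max_le zero_le_one (min_le_left _ _)

lemma deriv_ramp {σ ε : ℝ} (hε : 0 < ε) {r : ℝ} (h1 : r ≠ σ) (h2 : r ≠ σ + ε) :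
    deriv (ramp σ ε) r = (Ioc σ (σ + ε)).indicator (fun _ => -ε⁻¹) r := by
  rcases lt_or_gt_of_ne h1 with h | h
  · have : ramp σ ε =ᶠ[𝓝 r] fun _ => 1 := by
      filter_upwards [Iio_mem_nhds h] with s hs using ramp_of_le hε (le_of_lt hs)
    rw [this.deriv_eq, indicator_of_notMem fun hm => absurd hm.1 (not_lt.2 h.le)]
    simp
  rcases lt_or_gt_of_ne h2 with h' | h'
  · have : ramp σ ε =ᶠ[𝓝 r] fun s => 1 - ε⁻¹ * (s - σ) := by
      filter_upwards [Ioo_mem_nhds h h'] with s hs using ramp_of_mem hε ⟨hs.1.le, hs.2.le⟩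
    have hd : HasDerivAt (fun s : ℝ => 1 - ε⁻¹ * (s - σ)) (-ε⁻¹) r := by
      simpa using (((hasDerivAt_id r).sub_const σ).const_mul ε⁻¹).const_sub 1
    rw [this.deriv_eq, indicator_of_mem (show r ∈ Ioc σ (σ + ε) from ⟨h, h'.le⟩), hd.deriv]
  · have : ramp σ ε =ᶠ[𝓝 r] fun _ => 0 := by
      filter_upwards [Ioi_mem_nhds h'] with s hs using ramp_of_ge hε (le_of_lt hs)
    rw [this.deriv_eq, indicator_of_notMem fun hm => absurd hm.2 (not_le.2 h')]
    simp

/-- In polar coordinates the derivative of the ramp is `-ε⁻¹` on the shell from `σ` to `σ + ε` and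
zero elsewhere, so integration by parts leaves the mean over the shell of the sphere integrals. -/
lemma integral_ramp_mul_fderiv {σ ε : ℝ} (hσ : 0 < σ) (hε : 0 < ε) {Ψ : V3 → ℝ}
    (h : ContDiff ℝ 1 Ψ) (hc : HasCompactSupport Ψ) (e : V3) :
    ∫ x, ramp σ ε ‖x‖ * fderiv ℝ Ψ x e = ε⁻¹ * ∫ r in σ..(σ + ε),
      r ^ 2 * ∫ α : S2, inner ℝ (α : V3) e * Ψ (r • (α : V3)) ∂solidAngle := by
  rw [integral_radial_mul_fderiv (ramp_lipschitz σ hε) h hc e]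
  set F : V3 → ℝ := fun x => deriv (ramp σ ε) ‖x‖ * ‖x‖⁻¹ * inner ℝ x e * Ψ x with hF
  have hFi : Integrable F := by
    refine Integrable.mono' ((h.continuous.integrable_of_hasCompactSupport hc).norm.const_mul
      (ε⁻¹ * ‖e‖)) ?_ (Eventually.of_forall fun x => ?_)
    · refine Measurable.aestronglyMeasurable (((Measurable.mul ?_ ?_).mul ?_).mul ?_)
      · exact (measurable_deriv _).comp measurable_norm
      · exact measurable_norm.inv
      · exact measurable_id.inner_const
      · exact h.continuous.measurable
    · have h1 : |deriv (ramp σ ε) ‖x‖| ≤ ε⁻¹ :=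
        norm_deriv_le_of_lipschitz (ramp_lipschitz σ hε)
      have h2 : ‖x‖⁻¹ * |inner ℝ x e| ≤ ‖e‖ := by
        rcases eq_or_ne x 0 with rfl | hx
        · simp
        · rw [inv_mul_le_iff₀ (norm_pos_iff.2 hx)]; exact abs_real_inner_le_norm _ _
      rw [hF]
      simp only [norm_mul, norm_inv, Real.norm_eq_abs, abs_norm]
      rw [mul_assoc |deriv _ _|]
      exact mul_le_mul_of_nonneg_right (mul_le_mul h1 h2 (by positivity) (inv_pos.2 hε).le)
        (abs_nonneg _)
  set A : ℝ → ℝ := fun r => ∫ α : S2, inner ℝ (α : V3) e * Ψ (r • (α : V3)) ∂solidAngle with hA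
  have e1 : ∀ r ∈ Ioi (0 : ℝ), r ^ 2 * ∫ α : S2, F (r • (α : V3)) ∂solidAngle
      = r ^ 2 * (deriv (ramp σ ε) r * A r) := by
    intro r hr
    have hr' : 0 < r := hr
    congr 1
    rw [hA, ← integral_const_mul]
    refine integral_congr_ae (Eventually.of_forall fun α => ?_)
    simp only [hF, norm_smul, norm_coe_S2, mul_one, Real.norm_of_nonneg hr'.le,
      real_inner_smul_left]
    field_simp
  rw [integral_polar hFi, setIntegral_congr_fun measurableSet_Ioi e1]
  have e2 : ∫ r in Ioi (0 : ℝ), r ^ 2 * (deriv (ramp σ ε) r * A r)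
      = ∫ r in Ioi (0 : ℝ), (Ioc σ (σ + ε)).indicator (fun r => -ε⁻¹ * (r ^ 2 * A r)) r := by
    refine integral_congr_ae (ae_restrict_of_ae ?_)
    have h1 : ∀ᵐ r : ℝ, r ≠ σ := by simp [ae_iff]
    have h2 : ∀ᵐ r : ℝ, r ≠ σ + ε := by simp [ae_iff]
    filter_upwards [h1, h2] with r hr1 hr2
    rw [deriv_ramp hε hr1 hr2]
    by_cases hm : r ∈ Ioc σ (σ + ε)
    · rw [indicator_of_mem hm, indicator_of_mem hm]; ring
    · rw [indicator_of_notMem hm, indicator_of_notMem hm]; ring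
  rw [e2, setIntegral_indicator measurableSet_Ioc,
    inter_eq_self_of_subset_right (show Ioc σ (σ + ε) ⊆ Ioi 0 from fun r hr => hσ.trans hr.1),
    integral_const_mul, intervalIntegral.integral_of_le (by linarith)]
  ring

lemma continuous_sphereMean {Ψ : V3 → ℝ} (h : Continuous Ψ) (hc : HasCompactSupport Ψ) (e : V3) :
    Continuous fun r : ℝ => ∫ α : S2, inner ℝ (α : V3) e * Ψ (r • (α : V3)) ∂solidAngle := by
  obtain ⟨c, hcb⟩ := hc.exists_bound_of_continuous h
  refine continuous_of_dominated (bound := fun _ => ‖e‖ * c) (fun r => ?_) (fun r => ?_)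
    (integrable_const _) (Eventually.of_forall fun α => by fun_prop)
  · exact Continuous.aestronglyMeasurable (by fun_prop)
  · refine Eventually.of_forall fun α => ?_
    rw [norm_mul]
    refine mul_le_mul ?_ (hcb _) (norm_nonneg _) (norm_nonneg _)
    have := norm_inner_le_norm (𝕜 := ℝ) (α : V3) e
    rwa [norm_coe_S2, one_mul] at this

/-- The divergence theorem on a ball for compactly supported functions. -/
lemma integral_ball_fderiv {σ : ℝ} (hσ : 0 < σ) {Ψ : V3 → ℝ}
    (h : ContDiff ℝ 1 Ψ) (hc : HasCompactSupport Ψ) (e : V3) :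
    ∫ x : V3, theta (σ - ‖x‖) * fderiv ℝ Ψ x e
      = σ ^ 2 * ∫ α : S2, inner ℝ (α : V3) e * Ψ (σ • (α : V3)) ∂solidAngle := by
  set A : ℝ → ℝ := fun r =>
    r ^ 2 * ∫ α : S2, inner ℝ (α : V3) e * Ψ (r • (α : V3)) ∂solidAngle with hA
  have hAc : Continuous A := (continuous_pow 2).mul (continuous_sphereMean h.continuous hc e)
  have hcd : Continuous fun x => fderiv ℝ Ψ x e :=
    (h.continuous_fderiv (by simp)).clm_apply continuous_const
  have hεt : Tendsto (fun n : ℕ => (1 : ℝ) / (n + 1)) atTop (𝓝[≠] 0) := by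
    refine tendsto_nhdsWithin_iff.2 ⟨tendsto_one_div_add_atTop_nhds_zero_nat,
      Eventually.of_forall fun n => ?_⟩
    have : (0 : ℝ) < 1 / (n + 1) := by positivity
    exact this.ne'
  have h1 : Tendsto (fun n : ℕ => ∫ x : V3, ramp σ (1 / (n + 1)) ‖x‖ * fderiv ℝ Ψ x e) atTop
      (𝓝 (∫ x : V3, theta (σ - ‖x‖) * fderiv ℝ Ψ x e)) := by
    refine tendsto_integral_of_dominated_convergence (fun x => ‖fderiv ℝ Ψ x e‖) (fun n => ?_)
      (hcd.integrable_of_hasCompactSupport (hc.fderiv_apply ℝ e)).norm (fun n => ?_) ?_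
    · exact (((ramp_lipschitz σ (by positivity)).continuous.comp continuous_norm).mul
        hcd).aestronglyMeasurable
    · refine Eventually.of_forall fun x => ?_
      rw [norm_mul]
      exact mul_le_of_le_one_left (norm_nonneg _) abs_ramp_le
    · refine Eventually.of_forall fun x => Tendsto.mul_const _ ?_
      refine tendsto_const_nhds.congr' ?_
      rcases le_or_gt ‖x‖ σ with hx | hx
      · refine Eventually.of_forall fun n => ?_
        simp only
        rw [ramp_of_le (by positivity) hx, theta, if_pos (by linarith)]
      · have := (tendsto_one_div_add_atTop_nhds_zero_nat (𝕜 := ℝ)).eventually_lt_const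
          (sub_pos.2 hx)
        filter_upwards [this] with n hn
        rw [ramp_of_ge (by positivity) (by linarith), theta, if_neg (by linarith)]
  -- The mean over the shell is the difference quotient at `σ` of a primitive of `A`, so it tends to
  -- `A σ`.
  have h2 : Tendsto (fun n : ℕ => ∫ x : V3, ramp σ (1 / (n + 1)) ‖x‖ * fderiv ℝ Ψ x e) atTop
      (𝓝 (A σ)) := by
    have hd : HasDerivAt (fun u => ∫ r in σ..u, A r) (A σ) σ :=
      intervalIntegral.integral_hasDerivAt_right (hAc.intervalIntegrable _ _)
        (hAc.stronglyMeasurableAtFilter _ _) hAc.continuousAt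
    have := hd.tendsto_slope_zero.comp hεt
    refine this.congr fun n => ?_
    simp only [Function.comp, intervalIntegral.integral_same, sub_zero, smul_eq_mul]
    rw [integral_ramp_mul_fderiv hσ (by positivity) h hc e]
  exact tendsto_nhds_unique h1 h2

/-- `∫ h(Y) θ(σ - |Y - X|) dY`. -/
noncomputable def ballConv (σ : ℝ) (h : V3 → ℝ) (X : V3) : ℝ :=
  ∫ Y, h Y * theta (σ - ‖Y - X‖)

/-- The gradient of `ballConv σ h`. -/
noncomputable def ballConvGrad (σ : ℝ) (h : V3 → ℝ) (X : V3) : V3 :=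
  σ ^ 2 • ∫ α : S2, h (X + σ • (α : V3)) • (α : V3) ∂solidAngle

section BallConv

variable {σ : ℝ} {h : V3 → ℝ} {c : ℝ} (hm : Measurable h) (hb : ∀ X, |h X| ≤ c)

lemma theta_sub_norm (σ : ℝ) (X Y : V3) :
    theta (σ - ‖Y - X‖) = (closedBall X σ).indicator (fun _ => (1 : ℝ)) Y := by
  by_cases hY : Y ∈ closedBall X σ
  · rw [indicator_of_mem hY, theta, if_pos]
    rw [mem_closedBall, dist_eq_norm] at hY; linarith
  · rw [indicator_of_notMem hY, theta, if_neg]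
    rw [mem_closedBall, dist_eq_norm] at hY; linarith

lemma integrable_theta_sub_norm (σ : ℝ) (X : V3) :
    Integrable fun Y : V3 => theta (σ - ‖Y - X‖) := by
  simp only [theta_sub_norm]
  exact (integrable_indicator_iff measurableSet_closedBall).2
    (integrableOn_const measure_closedBall_lt_top.ne)

include hm hb

lemma integrable_ballConv (X : V3) : Integrable fun Y => h Y * theta (σ - ‖Y - X‖) :=
  (integrable_theta_sub_norm σ X).bdd_mul hm.aestronglyMeasurable (Eventually.of_forall hb)

-- From `σ³ - (σ - d)³ ≤ 3σ²d`. When `d > σ` the whole ball already obeys the bound.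
omit hm hb in
lemma volume_shell_le (hσ : 0 < σ) (X : V3) {d : ℝ} (hd : 0 ≤ d) :
    volume.real (closedBall X σ \ closedBall X (σ - d))
      ≤ 3 * σ ^ 2 * volume.real (ball (0 : V3) 1) * d := by
  have hv : 0 ≤ volume.real (ball (0 : V3) 1) := measureReal_nonneg
  have hB : volume.real (closedBall X σ) = σ ^ 3 * volume.real (ball (0 : V3) 1) := by
    rw [Measure.real, Measure.addHaar_closedBall _ _ hσ.le]
    simp [Measure.real, ENNReal.toReal_mul, ENNReal.toReal_ofReal (pow_nonneg hσ.le 3)]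
  rcases le_or_gt d σ with h | h
  · have hB' : volume.real (closedBall X (σ - d))
        = (σ - d) ^ 3 * volume.real (ball (0 : V3) 1) := by
      rw [Measure.real, Measure.addHaar_closedBall _ _ (sub_nonneg.2 h)]
      simp [Measure.real, ENNReal.toReal_mul, ENNReal.toReal_ofReal (pow_nonneg (sub_nonneg.2 h) 3)]
    rw [measureReal_sdiff (closedBall_subset_closedBall (by linarith)) measurableSet_closedBall
      measure_closedBall_lt_top.ne, hB, hB', ← sub_mul]
    have : σ ^ 3 - (σ - d) ^ 3 ≤ 3 * σ ^ 2 * d := by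
      nlinarith [mul_nonneg hd (mul_nonneg hd hd),
        mul_nonneg (mul_nonneg hd hd) (sub_nonneg.2 h), mul_nonneg hd hd]
    calc _ ≤ (3 * σ ^ 2 * d) * volume.real (ball (0 : V3) 1) :=
          mul_le_mul_of_nonneg_right this hv
      _ = _ := by ring
  · refine (measureReal_mono sdiff_subset measure_closedBall_lt_top.ne).trans ?_
    rw [hB]
    have : σ ^ 3 ≤ 3 * σ ^ 2 * d := by nlinarith [sq_nonneg σ, mul_pos hσ hσ]
    calc _ ≤ (3 * σ ^ 2 * d) * volume.real (ball (0 : V3) 1) :=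
          mul_le_mul_of_nonneg_right this hv
      _ = _ := by ring

/-- Two balls whose centres are at distance `d` differ only within the outer shells of thickness
`d`, whose volume is `O(d)`. No regularity of `h` beyond boundedness enters. -/
lemma ballConv_lipschitz (hσ : 0 < σ) : ∃ a : NNReal, LipschitzWith a (ballConv σ h) := by
  have hc0 : 0 ≤ c := (abs_nonneg _).trans (hb 0)
  refine ⟨⟨c * (2 * (3 * σ ^ 2 * volume.real (ball (0 : V3) 1))), by positivity⟩,
    LipschitzWith.of_dist_le_mul fun X X' => ?_⟩
  set d := dist X X' with hd
  set S : V3 → Set V3 := fun X => closedBall X σ \ closedBall X (σ - d) with hS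
  have hSm : ∀ X, MeasurableSet (S X) := fun X =>
    measurableSet_closedBall.diff measurableSet_closedBall
  have hSf : ∀ X, volume (S X) ≠ ⊤ := fun X =>
    ((measure_mono sdiff_subset).trans_lt measure_closedBall_lt_top).ne
  have hi : ∀ X, Integrable ((S X).indicator fun _ => (1 : ℝ)) := fun X =>
    (integrable_indicator_iff (hSm X)).2 (integrableOn_const (hSf X))
  rw [Real.dist_eq, ballConv, ballConv,
    ← integral_sub (integrable_ballConv hm hb X) (integrable_ballConv hm hb X')]
  have key : ∀ Y, ‖h Y * theta (σ - ‖Y - X‖) - h Y * theta (σ - ‖Y - X'‖)‖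
      ≤ c * ((S X).indicator (fun _ => (1 : ℝ)) Y + (S X').indicator (fun _ => (1 : ℝ)) Y) := by
    intro Y
    rw [← mul_sub, norm_mul]
    refine mul_le_mul (hb Y) ?_ (norm_nonneg _) hc0
    simp only [theta_sub_norm]
    have n1 : ∀ Z, 0 ≤ (S Z).indicator (fun _ => (1 : ℝ)) Y := fun Z =>
      indicator_nonneg (fun _ _ => zero_le_one) _
    by_cases h1 : Y ∈ closedBall X σ <;> by_cases h2 : Y ∈ closedBall X' σ
    · rw [indicator_of_mem h1, indicator_of_mem h2, sub_self, norm_zero]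
      exact add_nonneg (n1 X) (n1 X')
    · have : Y ∈ S X := by
        refine ⟨h1, fun h3 => h2 ?_⟩
        rw [mem_closedBall] at *
        linarith [dist_triangle Y X X']
      rw [indicator_of_mem h1, indicator_of_notMem h2, indicator_of_mem this]
      simpa using n1 X'
    · have : Y ∈ S X' := by
        refine ⟨h2, fun h3 => h1 ?_⟩
        rw [mem_closedBall] at *
        linarith [dist_triangle Y X' X, dist_comm X X']
      rw [indicator_of_notMem h1, indicator_of_mem h2, indicator_of_mem this]
      simpa using n1 X
    · rw [indicator_of_notMem h1, indicator_of_notMem h2, sub_self, norm_zero]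
      exact add_nonneg (n1 X) (n1 X')
  refine (norm_integral_le_of_norm_le (((hi X).add (hi X')).const_mul c)
    (Eventually.of_forall key)).trans ?_
  rw [integral_const_mul]
  have e : ∫ Y, ((S X).indicator (fun _ => (1 : ℝ)) + (S X').indicator (fun _ => (1 : ℝ))) Y
      = volume.real (S X) + volume.real (S X') := by
    simp only [Pi.add_apply]
    rw [integral_add (hi X) (hi X'), integral_indicator_const _ (hSm X),
      integral_indicator_const _ (hSm X'), smul_eq_mul, smul_eq_mul, mul_one, mul_one]
  rw [e]
  have v1 := volume_shell_le hσ X (dist_nonneg : 0 ≤ d)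
  have v2 := volume_shell_le hσ X' (dist_nonneg : 0 ≤ d)
  calc c * (volume.real (S X) + volume.real (S X'))
      ≤ c * (3 * σ ^ 2 * volume.real (ball (0 : V3) 1) * d
        + 3 * σ ^ 2 * volume.real (ball (0 : V3) 1) * d) :=
        mul_le_mul_of_nonneg_left (add_le_add v1 v2) hc0
    _ = c * (2 * (3 * σ ^ 2 * volume.real (ball (0 : V3) 1))) * d := by ring

omit hb in
lemma stronglyMeasurable_ballConvGrad_integrand :
    StronglyMeasurable fun p : V3 × S2 => h (p.1 + σ • (p.2 : V3)) • (p.2 : V3) := by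
  have h1 : Measurable fun p : V3 × S2 => h (p.1 + σ • (p.2 : V3)) :=
    hm.comp (f := fun p : V3 × S2 => p.1 + σ • (p.2 : V3)) (by fun_prop)
  exact (h1.smul (by fun_prop)).stronglyMeasurable

lemma integrable_ballConvGrad (X : V3) :
    Integrable (fun α : S2 => h (X + σ • (α : V3)) • (α : V3)) solidAngle := by
  refine Integrable.mono' (integrable_const c) ?_ (Eventually.of_forall fun α => ?_)
  · exact ((stronglyMeasurable_ballConvGrad_integrand hm).comp_measurable
      measurable_prodMk_left).aestronglyMeasurable
  · rw [norm_smul, norm_coe_S2, mul_one]; exact hb _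

omit hm in
lemma norm_ballConvGrad_le (X : V3) :
    ‖ballConvGrad σ h X‖ ≤ σ ^ 2 * (c * solidAngle.real univ) := by
  rw [ballConvGrad, norm_smul, Real.norm_of_nonneg (sq_nonneg σ)]
  refine mul_le_mul_of_nonneg_left ?_ (sq_nonneg σ)
  refine norm_integral_le_of_norm_le_const (Eventually.of_forall fun α => ?_)
  rw [norm_smul, norm_coe_S2, mul_one]; exact hb _

/-- Fubini reduces the left side to the divergence theorem on the balls centred at `Y`. The
substitution `X = Y + σα` and the reversal of `α` move the sphere average from the test function to
`h`. -/
lemma integral_ballConv_mul_fderiv (hσ : 0 < σ) {Ψ : V3 → ℝ} (h1 : ContDiff ℝ 1 Ψ)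
    (h2 : HasCompactSupport Ψ) (e : V3) :
    ∫ X, ballConv σ h X * fderiv ℝ Ψ X e = -∫ X, inner ℝ (ballConvGrad σ h X) e * Ψ X := by
  have hc0 : 0 ≤ c := (abs_nonneg _).trans (hb 0)
  have hcd : Continuous fun x => fderiv ℝ Ψ x e :=
    (h1.continuous_fderiv (by simp)).clm_apply continuous_const
  obtain ⟨R, hR⟩ := h2.isBounded.subset_closedBall (0 : V3)
  have hR' : ∀ X, Ψ X ≠ 0 → ‖X‖ ≤ R := fun X hX => by
    simpa using hR (subset_tsupport _ hX)
  have hR'' : ∀ X, fderiv ℝ Ψ X e ≠ 0 → ‖X‖ ≤ R := fun X hX => by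
    have : X ∈ tsupport Ψ := by
      by_contra h3
      exact hX (by rw [image_eq_zero_of_notMem_tsupport
        (fun h4 => h3 (tsupport_fderiv_subset ℝ h4))]; simp)
    simpa using hR this
  obtain ⟨M, hM⟩ := h2.exists_bound_of_continuous h1.continuous
  have hM0 : 0 ≤ M := (norm_nonneg _).trans (hM 0)
  have hind : Integrable ((closedBall (0 : V3) (R + σ)).indicator fun _ => (1 : ℝ)) :=
    (integrable_indicator_iff measurableSet_closedBall).2
      (integrableOn_const measure_closedBall_lt_top.ne)
  have hn1 : ∀ Y, 0 ≤ (closedBall (0 : V3) (R + σ)).indicator (fun _ => (1 : ℝ)) Y := fun Y =>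
    indicator_nonneg (fun _ _ => zero_le_one) _
  -- first exchange of integrals
  have i1 : Integrable (fun p : V3 × V3 => h p.2 * theta (σ - ‖p.2 - p.1‖) * fderiv ℝ Ψ p.1 e)
      (volume.prod volume) := by
    refine Integrable.mono' (((hcd.integrable_of_hasCompactSupport
      (h2.fderiv_apply ℝ e)).norm.mul_prod hind).const_mul c) ?_ (Eventually.of_forall fun p => ?_)
    · refine Measurable.aestronglyMeasurable (((hm.comp measurable_snd).mul
        (measurable_theta.comp (by fun_prop))).mul (hcd.measurable.comp measurable_fst))
    · by_cases h3 : fderiv ℝ Ψ p.1 e = 0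
      · simp [h3]
      · have h4 := hR'' _ h3
        suffices h7 : ‖theta (σ - ‖p.2 - p.1‖)‖
            ≤ (closedBall (0 : V3) (R + σ)).indicator (fun _ => (1 : ℝ)) p.2 by
          rw [norm_mul, norm_mul]
          calc _ ≤ c * (closedBall (0 : V3) (R + σ)).indicator (fun _ => (1 : ℝ)) p.2
                * ‖fderiv ℝ Ψ p.1 e‖ := mul_le_mul_of_nonneg_right
                  (mul_le_mul (hb _) h7 (norm_nonneg _) hc0) (norm_nonneg _)
            _ = _ := by ring
        rw [theta_sub_norm]
        by_cases h5 : p.2 ∈ closedBall p.1 σ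
        · have h6 : p.2 ∈ closedBall (0 : V3) (R + σ) := by
            rw [mem_closedBall] at *
            have := dist_triangle p.2 p.1 0
            rw [dist_zero_right p.1] at this
            linarith
          rw [indicator_of_mem h5, indicator_of_mem h6]; simp
        · rw [indicator_of_notMem h5, norm_zero]; exact hn1 _
  have e1 : ∫ X, ballConv σ h X * fderiv ℝ Ψ X e
      = ∫ Y, h Y * (σ ^ 2 * ∫ α : S2, inner ℝ (α : V3) e * Ψ (Y + σ • (α : V3)) ∂solidAngle) := by
    simp only [ballConv, ← integral_mul_const]
    rw [integral_integral_swap i1]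
    refine integral_congr_ae (Eventually.of_forall fun Y => ?_)
    simp only [mul_assoc]
    rw [integral_const_mul]
    congr 1
    have h3 : ContDiff ℝ 1 fun x => Ψ (Y + x) := h1.comp (contDiff_const.add contDiff_id)
    have h4 : HasCompactSupport fun x => Ψ (Y + x) :=
      h2.comp_homeomorph (Homeomorph.addLeft Y)
    rw [← integral_ball_fderiv hσ h3 h4 e,
      ← integral_add_left_eq_self (μ := (volume : Measure V3)) _ Y]
    refine integral_congr_ae (Eventually.of_forall fun x => ?_)
    simp only [fderiv_comp_add_left]
    rw [show Y - (Y + x) = -x by abel, norm_neg]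
  -- second exchange of integrals
  have i2 : Integrable (fun p : V3 × S2 => h p.1 * (inner ℝ (p.2 : V3) e * Ψ (p.1 + σ • (p.2 : V3))))
      (volume.prod solidAngle) := by
    refine Integrable.mono' ((hind.comp_fst solidAngle).const_mul (c * (‖e‖ * M))) ?_
      (Eventually.of_forall fun p => ?_)
    · refine Measurable.aestronglyMeasurable ((hm.comp measurable_fst).mul
        (Measurable.mul (by fun_prop) ?_))
      exact h1.continuous.measurable.comp (by fun_prop)
    · by_cases h3 : Ψ (p.1 + σ • (p.2 : V3)) = 0
      · simp only [h3, mul_zero, norm_zero]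
        exact mul_nonneg (by positivity) (hn1 _)
      · have h4 := hR' _ h3
        have h5 : p.1 ∈ closedBall (0 : V3) (R + σ) := by
          rw [mem_closedBall, dist_zero_right]
          have := norm_sub_le (p.1 + σ • (p.2 : V3)) (σ • (p.2 : V3))
          rw [add_sub_cancel_right, norm_smul, norm_coe_S2, Real.norm_of_nonneg hσ.le] at this
          linarith
        rw [indicator_of_mem h5, mul_one, norm_mul, norm_mul]
        have h6 := norm_inner_le_norm (𝕜 := ℝ) (p.2 : V3) e
        rw [norm_coe_S2, one_mul] at h6
        exact mul_le_mul (hb _) (mul_le_mul h6 (hM _) (norm_nonneg _) (norm_nonneg _))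
          (by positivity) hc0
  have i3 : Integrable (fun p : V3 × S2 => h (p.1 + σ • (p.2 : V3)) * inner ℝ (p.2 : V3) e * Ψ p.1)
      (volume.prod solidAngle) := by
    refine Integrable.mono' (((h1.continuous.integrable_of_hasCompactSupport h2).norm.comp_fst
      solidAngle).const_mul (c * ‖e‖)) ?_ (Eventually.of_forall fun p => ?_)
    · refine Measurable.aestronglyMeasurable ((Measurable.mul (hm.comp (by fun_prop))
        (by fun_prop)).mul (h1.continuous.measurable.comp measurable_fst))
    · rw [norm_mul, norm_mul]
      have h6 := norm_inner_le_norm (𝕜 := ℝ) (p.2 : V3) e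
      rw [norm_coe_S2, one_mul] at h6
      exact mul_le_mul_of_nonneg_right (mul_le_mul (hb _) h6 (norm_nonneg _) hc0) (norm_nonneg _)
  have e2 : ∫ Y, h Y * (σ ^ 2 * ∫ α : S2, inner ℝ (α : V3) e * Ψ (Y + σ • (α : V3)) ∂solidAngle)
      = σ ^ 2 * ∫ α : S2, (∫ Y, h Y * (inner ℝ (α : V3) e * Ψ (Y + σ • (α : V3)))) ∂solidAngle := by
    rw [← integral_integral_swap i2, ← integral_const_mul]
    refine integral_congr_ae (Eventually.of_forall fun Y => ?_)
    simp only
    rw [integral_const_mul]; ring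
  have e3 : ∀ α : S2, ∫ Y, h Y * (inner ℝ (α : V3) e * Ψ (Y + σ • (α : V3)))
      = -∫ X, h (X + σ • ((-α : S2) : V3)) * inner ℝ ((-α : S2) : V3) e * Ψ X := by
    intro α
    rw [← integral_neg, ← integral_add_right_eq_self (μ := (volume : Measure V3))
      (fun X => -(h (X + σ • ((-α : S2) : V3)) * inner ℝ ((-α : S2) : V3) e * Ψ X))
      (σ • (α : V3))]
    refine integral_congr_ae (Eventually.of_forall fun Y => ?_)
    simp only [coe_neg_sphere, smul_neg, inner_neg_left, add_neg_cancel_right]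
    ring
  have e4 : ∫ α : S2, (∫ Y, h Y * (inner ℝ (α : V3) e * Ψ (Y + σ • (α : V3)))) ∂solidAngle
      = -∫ α : S2, (∫ X, h (X + σ • (α : V3)) * inner ℝ (α : V3) e * Ψ X) ∂solidAngle := by
    simp only [e3]
    rw [integral_neg, integral_comp_involution measurePreserving_neg_S2 neg_neg
      (fun α : S2 => ∫ X, h (X + σ • (α : V3)) * inner ℝ (α : V3) e * Ψ X)]
  rw [e1, e2, e4, ← integral_integral_swap i3, mul_neg, ← integral_const_mul]
  congr 1
  refine integral_congr_ae (Eventually.of_forall fun X => ?_)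
  simp only [ballConvGrad]
  rw [integral_mul_const, real_inner_smul_left, real_inner_comm,
    ← integral_inner (integrable_ballConvGrad hm hb X)]
  simp only [real_inner_smul_right, real_inner_comm e]
  ring

lemma hasWeakGrad_ballConv (hσ : 0 < σ) : HasWeakGrad (ballConv σ h) (ballConvGrad σ h) where
  measurable_fun := (ballConv_lipschitz hm hb hσ).choose_spec.continuous.measurable
  bounded_fun := exists_bound_of_continuous (ballConv_lipschitz hm hb hσ).choose_spec.continuous
  measurable := by
    have := (StronglyMeasurable.integral_prod_right (ν := solidAngle)
      (f := fun (X : V3) (α : S2) => h (X + σ • (α : V3)) • (α : V3))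
      (stronglyMeasurable_ballConvGrad_integrand hm)).measurable.const_smul (σ ^ 2)
    exact this
  bounded := fun _ _ => ⟨_, fun X _ => norm_ballConvGrad_le hb X⟩
  test := fun _ h1 h2 e => integral_ballConv_mul_fderiv hm hb hσ h1 h2 e

end BallConv

/-! ### Isotropic potentials -/

/-- The gradient of `x ↦ Φ ‖x‖`. -/
noncomputable def forceKer (Φ : ℝ → ℝ) (x : V3) : V3 := (deriv Φ ‖x‖ * ‖x‖⁻¹) • x

/-- True even at radii where `Φ` is not differentiable: the radial function is not differentiable
there either, and both sides take the default value `0`. -/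
lemma gradient_radial (Φ : ℝ → ℝ) {x : V3} (hx : x ≠ 0) :
    gradient (fun y : V3 => Φ ‖y‖) x = forceKer Φ x := by
  refine ext_inner_left ℝ fun v => ?_
  rw [inner_gradient, forceKer, real_inner_smul_right]
  by_cases h : DifferentiableAt ℝ Φ ‖x‖
  · rw [(hasFDerivAt_radial hx h).fderiv]
    simp [real_inner_comm]
  · rw [deriv_zero_of_not_differentiableAt h,
      fderiv_zero_of_not_differentiableAt fun h2 => h (differentiableAt_profile hx h2)]
    simp

lemma gradient_radial_sub (Φ : ℝ → ℝ) {X Y : V3} (h : X ≠ Y) :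
    gradient (fun Z : V3 => Φ ‖Y - Z‖) X = forceKer Φ (X - Y) := by
  rw [← gradient_radial Φ (sub_ne_zero.2 h)]
  simp only [gradient, norm_sub_rev Y]
  congr 1
  exact fderiv_comp_sub (f := fun y : V3 => Φ ‖y‖) Y

lemma norm_forceKer_le (Φ : ℝ → ℝ) (x : V3) : ‖forceKer Φ x‖ ≤ |deriv Φ ‖x‖| := by
  rw [forceKer, norm_smul, norm_mul, norm_inv, norm_norm, Real.norm_eq_abs]
  rcases eq_or_ne x 0 with rfl | hx
  · simp
  · rw [mul_assoc, inv_mul_cancel₀ (norm_ne_zero_iff.2 hx), mul_one]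

lemma forceKer_neg (Φ : ℝ → ℝ) (x : V3) : forceKer Φ (-x) = -forceKer Φ x := by
  simp [forceKer]

lemma measurable_forceKer (Φ : ℝ → ℝ) : Measurable (forceKer Φ) :=
  ((((measurable_deriv Φ).comp measurable_norm)).mul measurable_norm.inv).smul measurable_id

section Potential

variable {Φ : ℝ → ℝ} (hΦ : IsPotential Φ)
include hΦ

lemma IsPotential.measurable_radial : Measurable fun x : V3 => Φ ‖x‖ := by
  refine measurable_of_continuousOn_compl_singleton (0 : V3) ?_
  exact hΦ.locallyLipschitz.continuousOn.comp continuous_norm.continuousOn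
    fun x hx => norm_pos_iff.2 hx

lemma IsPotential.integrableOn_deriv (r : ℝ) :
    IntegrableOn (fun x : V3 => deriv Φ ‖x‖) (ball 0 r) := by
  rw [integrableOn_fun_norm_addHaar volume (f := deriv Φ)]
  simp only [finrank_euclideanSpace, Fintype.card_fin, smul_eq_mul]
  rcases le_or_gt r 0 with hr | hr
  · rw [Ioo_eq_empty (not_lt.2 hr)]; exact integrableOn_empty
  · exact (hΦ.integrable_force r hr).mono_set Ioo_subset_Ioc_self

lemma IsPotential.integrableOn_forceKer (r : ℝ) : IntegrableOn (forceKer Φ) (ball 0 r) :=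
  Integrable.mono' (hΦ.integrableOn_deriv r).norm (measurable_forceKer Φ).aestronglyMeasurable
    (Eventually.of_forall fun x => norm_forceKer_le Φ x)

-- On the compact interval `[s, r]` a locally Lipschitz function is Lipschitz, hence absolutely
-- continuous and the integral of its derivative.
omit hΦ in
lemma abs_sub_le_integral_deriv (h : LocallyLipschitzOn (Ioi 0) Φ) {s r : ℝ} (hs : 0 < s)
    (hsr : s ≤ r) : |Φ r - Φ s| ≤ ∫ u in Ioc s r, |deriv Φ u| := by
  have hsub : uIcc s r ⊆ Ioi 0 := by
    rw [uIcc_of_le hsr]; exact fun x hx => hs.trans_le hx.1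
  obtain ⟨c, hc⟩ := (h.mono hsub).exists_lipschitzOnWith_of_compact isCompact_uIcc
  rw [← hc.absolutelyContinuousOnInterval.integral_deriv_eq_sub,
    intervalIntegral.integral_of_le hsr]
  exact norm_integral_le_integral_norm (deriv Φ)

/-- Between `s` and `r` the function changes by at most the integral of `|Φ'|`, and `s² ≤ u²` on
that range, so `s²` times this change is at most the integral of `u²|Φ'|`. A bound of order `s⁻²`
suffices because it is locally integrable in three dimensions. -/
lemma IsPotential.exists_bound {r : ℝ} (hr : 0 < r) :
    ∃ C, 0 ≤ C ∧ ∀ s ∈ Ioc 0 r, |Φ s| ≤ C / s ^ 2 := by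
  refine ⟨r ^ 2 * |Φ r| + ∫ u in Ioc 0 r, |u ^ 2 * deriv Φ u|,
    add_nonneg (by positivity) (integral_nonneg fun _ => abs_nonneg _), fun s hs => ?_⟩
  rw [le_div_iff₀ (pow_pos hs.1 2)]
  have hi : IntegrableOn (fun u => |u ^ 2 * deriv Φ u|) (Ioc 0 r) :=
    (hΦ.integrable_force r hr).norm
  have h1 := abs_sub_le_integral_deriv hΦ.locallyLipschitz hs.1 hs.2
  have h2 : |Φ s| ≤ |Φ r| + ∫ u in Ioc s r, |deriv Φ u| := by
    have := abs_sub_abs_le_abs_sub (Φ s) (Φ r)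
    rw [abs_sub_comm] at this
    linarith
  have h3 : s ^ 2 * ∫ u in Ioc s r, |deriv Φ u| ≤ ∫ u in Ioc 0 r, |u ^ 2 * deriv Φ u| := by
    rw [← integral_const_mul]
    refine le_trans ?_ (setIntegral_mono_set hi (Eventually.of_forall fun _ => abs_nonneg _)
      (Ioc_subset_Ioc_left hs.1.le).eventuallyLE)
    refine integral_mono_of_nonneg (Eventually.of_forall fun u => by positivity)
      (hi.mono_set (Ioc_subset_Ioc_left hs.1.le)) ?_
    filter_upwards [ae_restrict_mem measurableSet_Ioc] with u hu
    rw [abs_mul, abs_of_nonneg (sq_nonneg u)]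
    exact mul_le_mul_of_nonneg_right (pow_le_pow_left₀ hs.1.le hu.1.le 2) (abs_nonneg _)
  have h4 : s ^ 2 * |Φ r| ≤ r ^ 2 * |Φ r| :=
    mul_le_mul_of_nonneg_right (pow_le_pow_left₀ hs.1.le hs.2 2) (abs_nonneg _)
  nlinarith [sq_nonneg s, mul_le_mul_of_nonneg_left h2 (sq_nonneg s)]

omit hΦ in
lemma integrableOn_inv_norm_sq (C r : ℝ) :
    IntegrableOn (fun x : V3 => C / ‖x‖ ^ 2) (ball 0 r) := by
  rw [integrableOn_fun_norm_addHaar volume (f := fun s => C / s ^ 2)]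
  simp only [finrank_euclideanSpace, Fintype.card_fin, smul_eq_mul]
  refine IntegrableOn.congr_fun (f := fun _ => C)
    (integrableOn_const (by simp)) (fun s hs => ?_) measurableSet_Ioo
  have := hs.1.ne'
  simp only [Nat.add_one_sub_one]
  field_simp

lemma IsPotential.integrableOn_radial (r : ℝ) :
    IntegrableOn (fun x : V3 => Φ ‖x‖) (ball 0 r) := by
  rcases le_or_gt r 0 with hr | hr
  · rw [ball_eq_empty.2 hr]; exact integrableOn_empty
  obtain ⟨C, _, hC⟩ := hΦ.exists_bound hr
  refine Integrable.mono' (integrableOn_inv_norm_sq C r)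
    hΦ.measurable_radial.aestronglyMeasurable ?_
  filter_upwards [ae_restrict_mem measurableSet_ball, ae_restrict_of_ae ae_ne_zero] with x hx h0
  exact hC _ ⟨norm_pos_iff.2 h0, (mem_ball_zero_iff.1 hx).le⟩

/-- Integration by parts for the potential, across its singularity. -/
lemma IsPotential.integral_radial_mul_fderiv {Ψ : V3 → ℝ} (h : ContDiff ℝ 1 Ψ)
    (hc : HasCompactSupport Ψ) (e : V3) :
    ∫ x, Φ ‖x‖ * fderiv ℝ Ψ x e = -∫ x, inner ℝ (forceKer Φ x) e * Ψ x := by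
  have hcd : Continuous fun x => fderiv ℝ Ψ x e :=
    (h.continuous_fderiv (by simp)).clm_apply continuous_const
  obtain ⟨R, hR0, hR⟩ : ∃ R > 0, tsupport Ψ ⊆ ball (0 : V3) R :=
    hc.isBounded.subset_ball_lt 0 0
  have hRΨ : ∀ x : V3, x ∉ ball (0 : V3) R → Ψ x = 0 := fun x hx =>
    image_eq_zero_of_notMem_tsupport fun h1 => hx (hR h1)
  have hRd : ∀ x : V3, x ∉ ball (0 : V3) R → fderiv ℝ Ψ x e = 0 := fun x hx => by
    rw [image_eq_zero_of_notMem_tsupport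
      (fun h4 => hx (hR (tsupport_fderiv_subset ℝ h4)))]; rfl
  obtain ⟨C, hC0, hC⟩ := hΦ.exists_bound (r := R + 1) (by linarith)
  obtain ⟨M, hM⟩ := hc.exists_bound_of_continuous h.continuous
  have hM0 : 0 ≤ M := (norm_nonneg _).trans (hM 0)
  obtain ⟨M', hM'⟩ := (hc.fderiv_apply ℝ e).exists_bound_of_continuous hcd
  have hM0' : 0 ≤ M' := (norm_nonneg _).trans (hM' 0)
  let δ : ℕ → ℝ := fun n => 1 / (n + 1)
  have hδ0 : ∀ n, 0 < δ n := fun n => by positivity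
  have hδ1 : ∀ n, δ n ≤ R + 1 := fun n => by
    have : δ n ≤ 1 := by
      simp only [δ]
      rw [div_le_one (by positivity)]
      linarith [(Nat.cast_nonneg n : (0 : ℝ) ≤ n)]
    linarith
  have hδt : Tendsto δ atTop (𝓝 0) := tendsto_one_div_add_atTop_nhds_zero_nat
  -- Freezing the argument outside `[δ n, R + 1]` removes the singularity and makes the profile
  -- Lipschitz. As `Ψ` is supported in the ball of radius `R`, only the lower truncation is felt.
  let φ : ℕ → ℝ → ℝ := fun n r => Φ (projIcc (δ n) (R + 1) (hδ1 n) r)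
  have hφL : ∀ n, ∃ c, LipschitzWith c (φ n) := fun n => by
    obtain ⟨c, hcL⟩ := (hΦ.locallyLipschitz.mono (fun x hx => (hδ0 n).trans_le hx.1 :
      Icc (δ n) (R + 1) ⊆ Ioi 0)).exists_lipschitzOnWith_of_compact isCompact_Icc
    refine ⟨c * 1, ?_⟩
    exact (lipschitzOnWith_iff_restrict.1 hcL).comp (LipschitzWith.projIcc (hδ1 n))
  choose c hcL using hφL
  have hφeq : ∀ n r, r ∈ Icc (δ n) (R + 1) → φ n r = Φ r := fun n r hr => by
    simp only [φ, projIcc_of_mem (hδ1 n) hr]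
  have hφd : ∀ n r, r ∈ Ioo (δ n) (R + 1) → deriv (φ n) r = deriv Φ r := fun n r hr => by
    apply Filter.EventuallyEq.deriv_eq
    filter_upwards [Ioo_mem_nhds hr.1 hr.2] with s hs using hφeq n s ⟨hs.1.le, hs.2.le⟩
  have hφ0 : ∀ n r, r < δ n → deriv (φ n) r = 0 := fun n r hr => by
    have : φ n =ᶠ[𝓝 r] fun _ => Φ (δ n) := by
      filter_upwards [Iio_mem_nhds hr] with s hs
      simp only [φ, projIcc_of_le_left (hδ1 n) (le_of_lt hs)]
    rw [this.deriv_eq]; simp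
  have hev : ∀ x : V3, x ≠ 0 → x ∈ ball (0 : V3) R → ∀ᶠ n in atTop, ‖x‖ ∈ Ioo (δ n) (R + 1) := by
    intro x h0 hx
    filter_upwards [hδt.eventually_lt_const (norm_pos_iff.2 h0)] with n hn
    exact ⟨hn, by linarith [mem_ball_zero_iff.1 hx]⟩
  have t1 : Tendsto (fun n => ∫ x, φ n ‖x‖ * fderiv ℝ Ψ x e) atTop
      (𝓝 (∫ x, Φ ‖x‖ * fderiv ℝ Ψ x e)) := by
    refine tendsto_integral_of_dominated_convergence
      ((ball (0 : V3) R).indicator fun x => C / ‖x‖ ^ 2 * M') (fun n => ?_) ?_ (fun n => ?_) ?_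
    · exact (((hcL n).continuous.comp continuous_norm).mul hcd).aestronglyMeasurable
    · exact (integrable_indicator_iff measurableSet_ball).2
        ((integrableOn_inv_norm_sq C R).mul_const M')
    · filter_upwards [ae_ne_zero] with x h0
      by_cases hx : x ∈ ball (0 : V3) R
      · rw [indicator_of_mem hx, norm_mul]
        refine mul_le_mul ?_ (hM' x) (norm_nonneg _) (by positivity)
        have h1 : 0 < ‖x‖ := norm_pos_iff.2 h0
        have hp := (projIcc (δ n) (R + 1) (hδ1 n) ‖x‖).2
        -- The truncation raises small radii and leaves the others below `R + 1` alone, so the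
        -- single bound `C / ‖x‖²` dominates for every `n`.
        refine (hC _ ⟨(hδ0 n).trans_le hp.1, hp.2⟩).trans ?_
        refine div_le_div_of_nonneg_left hC0 (by positivity) (pow_le_pow_left₀ h1.le ?_ 2)
        rw [coe_projIcc]
        refine le_max_of_le_right (le_min ?_ le_rfl)
        linarith [mem_ball_zero_iff.1 hx]
      · rw [indicator_of_notMem hx, hRd x hx]; simp
    · filter_upwards [ae_ne_zero] with x h0
      by_cases hx : x ∈ ball (0 : V3) R
      · refine tendsto_const_nhds.congr' ?_
        filter_upwards [hev x h0 hx] with n hn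
        rw [hφeq n _ ⟨hn.1.le, hn.2.le⟩]
      · simp [hRd x hx]
  have t2 : Tendsto (fun n => ∫ x, deriv (φ n) ‖x‖ * ‖x‖⁻¹ * inner ℝ x e * Ψ x) atTop
      (𝓝 (∫ x, inner ℝ (forceKer Φ x) e * Ψ x)) := by
    refine tendsto_integral_of_dominated_convergence
      ((ball (0 : V3) R).indicator fun x => |deriv Φ ‖x‖| * (‖e‖ * M)) (fun n => ?_) ?_
      (fun n => ?_) ?_
    · exact ((((((measurable_deriv _).comp measurable_norm).mul measurable_norm.inv).mul
        measurable_id.inner_const).mul h.continuous.measurable)).aestronglyMeasurable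
    · exact (integrable_indicator_iff measurableSet_ball).2
        ((hΦ.integrableOn_deriv R).norm.mul_const _)
    -- On the sphere of radius `δ n` the truncated profile may have a kink; that sphere is a null
    -- set.
    · have hs : ∀ᵐ x : V3, ‖x‖ ≠ δ n := by
        have := Measure.addHaar_sphere (volume : Measure V3) 0 (δ n)
        refine (ae_iff.2 (le_antisymm ((measure_mono fun x hx => ?_).trans this.le) zero_le))
        simpa using hx
      filter_upwards [ae_ne_zero, hs] with x h0 hxs
      by_cases hx : x ∈ ball (0 : V3) R
      · have hxn : 0 < ‖x‖ := norm_pos_iff.2 h0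
        rw [indicator_of_mem hx, mul_assoc, mul_assoc, norm_mul, ← mul_assoc, norm_mul]
        refine mul_le_mul ?_ (mul_le_mul ?_ (hM x) (norm_nonneg _) (norm_nonneg _))
          (by positivity) (abs_nonneg _)
        · rcases lt_or_gt_of_ne hxs with h1 | h1
          · rw [hφ0 n _ h1]; simp
          · rw [hφd n _ ⟨h1, by linarith [mem_ball_zero_iff.1 hx]⟩]; rfl
        · rw [norm_mul, norm_inv, norm_norm, inv_mul_le_iff₀ hxn]
          exact norm_inner_le_norm _ _
      · rw [indicator_of_notMem hx, hRΨ x hx]; simp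
    · filter_upwards [ae_ne_zero] with x h0
      by_cases hx : x ∈ ball (0 : V3) R
      · refine tendsto_const_nhds.congr' ?_
        filter_upwards [hev x h0 hx] with n hn
        rw [hφd n _ hn, forceKer, real_inner_smul_left]
      · simp [hRΨ x hx]
  have t3 : ∀ n, ∫ x, φ n ‖x‖ * fderiv ℝ Ψ x e
      = -∫ x, deriv (φ n) ‖x‖ * ‖x‖⁻¹ * inner ℝ x e * Ψ x := fun n =>
    Enskog.integral_radial_mul_fderiv (hcL n) h hc e
  simp only [t3] at t1
  exact tendsto_nhds_unique t1 t2.neg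

end Potential

/-! ### Convolution with a locally integrable kernel -/

section KernelConv

variable {k h : V3 → ℝ} {c r : ℝ} (hk : Measurable k)
  (hki : ∀ R, IntegrableOn k (ball 0 R)) (hm : Measurable h) (hb : ∀ X, |h X| ≤ c)
  (hr : ∀ X, h X ≠ 0 → X ∈ ball (0 : V3) r)
include hk hki hm hb hr

/-- The bounded supports of `h` and `g` confine `z` to a ball of radius `r + R`, so local
integrability of the kernel is enough. -/
lemma integrable_kernelConv {g : V3 → ℝ} (hg : Continuous g) (hgc : HasCompactSupport g) :
    Integrable (fun p : V3 × V3 => k p.2 * h (p.1 + p.2) * g p.1) (volume.prod volume) := by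
  obtain ⟨R, hR⟩ := hgc.isBounded.subset_ball (0 : V3)
  refine Integrable.mono' (((hg.integrable_of_hasCompactSupport hgc).norm.mul_prod
    ((integrable_indicator_iff measurableSet_ball).2 (hki (r + R))).norm).const_mul c) ?_
    (Eventually.of_forall fun p => ?_)
  · exact (((hk.comp measurable_snd).mul (hm.comp (by fun_prop))).mul
      (hg.measurable.comp measurable_fst)).aestronglyMeasurable
  · have hc0 : 0 ≤ c := (abs_nonneg _).trans (hb 0)
    by_cases h1 : h (p.1 + p.2) * g p.1 = 0
    · rw [mul_assoc, h1, mul_zero, norm_zero]; positivity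
    · have h2 := mem_ball_zero_iff.1 (hr _ (left_ne_zero_of_mul h1))
      have h3 := mem_ball_zero_iff.1 (hR (subset_tsupport _ (right_ne_zero_of_mul h1)))
      have h4 : p.2 ∈ ball (0 : V3) (r + R) := by
        rw [mem_ball_zero_iff]
        have := norm_sub_le (p.1 + p.2) p.1
        rw [add_sub_cancel_left] at this
        linarith
      rw [indicator_of_mem h4, norm_mul, norm_mul]
      have := mul_le_mul_of_nonneg_left (hb (p.1 + p.2))
        (mul_nonneg (norm_nonneg (k p.2)) (norm_nonneg (g p.1)))
      calc _ = ‖k p.2‖ * ‖g p.1‖ * |h (p.1 + p.2)| := by rw [Real.norm_eq_abs (h _)]; ring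
        _ ≤ ‖k p.2‖ * ‖g p.1‖ * c := this
        _ = _ := by ring

/-- Exchange of integrals for convolutions with a locally integrable kernel. -/
lemma integral_kernelConv_mul {g : V3 → ℝ} (hg : Continuous g) (hgc : HasCompactSupport g) :
    ∫ X, (∫ z, k z * h (X + z)) * g X = ∫ Y, h Y * ∫ z, k z * g (Y - z) := by
  have i1 := integrable_kernelConv hk hki hm hb hr hg hgc
  let T : V3 × V3 → V3 × V3 := fun p => (p.1 - p.2, p.2)
  have hT : MeasurePreserving T (volume.prod volume) (volume.prod volume) := by
    have h1 : MeasurePreserving (fun p : V3 × V3 => (p.1, p.2 - p.1)) (volume.prod volume)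
        (volume.prod volume) := MeasurePreserving.skew_product (MeasurePreserving.id volume)
      (g := fun (z X : V3) => X - z) (by fun_prop)
      (Eventually.of_forall fun z => (measurePreserving_sub_right volume z).map_eq)
    have h2 : MeasurePreserving (Prod.swap : V3 × V3 → V3 × V3) (volume.prod volume)
      (volume.prod volume) := Measure.measurePreserving_swap
    exact h2.comp (h1.comp h2)
  have i2 := hT.integrable_comp_of_integrable i1
  have e1 : ∫ p, k p.2 * h (p.1 + p.2) * g p.1 ∂(volume.prod volume : Measure (V3 × V3))
      = ∫ p : V3 × V3, k p.2 * h p.1 * g (p.1 - p.2) ∂(volume.prod volume) := by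
    conv_lhs => rw [← hT.map_eq]
    rw [integral_map hT.measurable.aemeasurable (by rw [hT.map_eq]; exact i1.1)]
    simp only [T, sub_add_cancel]
  rw [integral_prod _ i1] at e1
  have i2' : Integrable (fun p : V3 × V3 => k p.2 * h p.1 * g (p.1 - p.2))
      (volume.prod volume) := by
    refine i2.congr (Eventually.of_forall fun p => ?_)
    simp only [T, Function.comp, sub_add_cancel]
  rw [integral_prod _ i2'] at e1
  simp only [← integral_mul_const, ← integral_const_mul]
  rw [e1]
  refine integral_congr_ae (Eventually.of_forall fun Y => ?_)
  simp only
  congr 1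
  ext z; ring

lemma abs_kernelConv_le {R : ℝ} {X : V3} (hX : X ∈ ball (0 : V3) R) :
    Integrable (fun z => k z * h (X + z)) ∧
    |∫ z, k z * h (X + z)| ≤ c * ∫ z in ball (0 : V3) (r + R), |k z| := by
  have hc0 : 0 ≤ c := (abs_nonneg _).trans (hb 0)
  have hi : Integrable ((ball (0 : V3) (r + R)).indicator fun z => c * |k z|) :=
    (integrable_indicator_iff measurableSet_ball).2 ((hki (r + R)).norm.const_mul c)
  have key : ∀ z, ‖k z * h (X + z)‖ ≤ (ball (0 : V3) (r + R)).indicator (fun z => c * |k z|) z := by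
    intro z
    by_cases h1 : h (X + z) = 0
    · rw [h1, mul_zero, norm_zero]
      exact indicator_nonneg (fun _ _ => by positivity) _
    · have h2 := mem_ball_zero_iff.1 (hr _ h1)
      have h4 : z ∈ ball (0 : V3) (r + R) := by
        rw [mem_ball_zero_iff] at *
        have := norm_sub_le (X + z) X
        rw [add_sub_cancel_left] at this
        linarith
      rw [indicator_of_mem h4, norm_mul, mul_comm]
      exact mul_le_mul_of_nonneg_right (hb _) (norm_nonneg _)
  refine ⟨Integrable.mono' hi (hk.mul (hm.comp (by fun_prop))).aestronglyMeasurable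
    (Eventually.of_forall key), ?_⟩
  refine (norm_integral_le_of_norm_le hi (Eventually.of_forall key)).trans ?_
  rw [integral_indicator measurableSet_ball, integral_const_mul]

end KernelConv

/-! ### Weak gradient of the potential of a density -/

section PotentialField

variable {Φ : ℝ → ℝ} (hΦ : IsPotential Φ) {h : V3 → ℝ} {c r : ℝ} (hm : Measurable h)
  (hb : ∀ X, |h X| ≤ c) (hr : ∀ X, h X ≠ 0 → X ∈ ball (0 : V3) r)
include hΦ hm hb hr

lemma integrable_forceConv (X : V3) : Integrable fun z => h (X + z) • forceKer Φ z := by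
  have h0 : Integrable (fun z => |deriv Φ ‖z‖| * h (X + z)) :=
    (abs_kernelConv_le (k := fun z => |deriv Φ ‖z‖|) (R := ‖X‖ + 1)
      ((measurable_deriv Φ).comp measurable_norm).abs
      (fun R => (hΦ.integrableOn_deriv R).norm) hm hb hr (by simp)).1
  refine Integrable.mono' h0.norm ?_ (Eventually.of_forall fun z => ?_)
  · exact ((hm.comp (by fun_prop)).smul (measurable_forceKer Φ)).aestronglyMeasurable
  · rw [norm_smul, norm_mul, mul_comm, Real.norm_eq_abs |_|, abs_abs]
    exact mul_le_mul_of_nonneg_right (norm_forceKer_le Φ z) (norm_nonneg _)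

/-- The potential of a bounded density of bounded support is weakly differentiable. -/
lemma hasWeakGrad_potential :
    HasWeakGrad (fun X => ∫ z, Φ ‖z‖ * h (X + z))
      (fun X => -∫ z, h (X + z) • forceKer Φ z) where
  measurable_fun := by
    refine (StronglyMeasurable.integral_prod_right
      (f := fun (X z : V3) => Φ ‖z‖ * h (X + z)) ?_).measurable
    exact ((hΦ.measurable_radial.comp measurable_snd).mul
      (hm.comp (f := fun p : V3 × V3 => p.1 + p.2) (by fun_prop))).stronglyMeasurable
  bounded_fun := fun L hL => by
    obtain ⟨R, hR⟩ := hL.isBounded.subset_ball (0 : V3)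
    exact ⟨_, fun X hX => (abs_kernelConv_le hΦ.measurable_radial hΦ.integrableOn_radial hm hb hr
      (hR hX)).2⟩
  measurable := by
    refine (StronglyMeasurable.integral_prod_right
      (f := fun (X z : V3) => h (X + z) • forceKer Φ z) ?_).measurable.neg
    exact ((hm.comp (f := fun p : V3 × V3 => p.1 + p.2) (by fun_prop)).smul
      ((measurable_forceKer Φ).comp measurable_snd)).stronglyMeasurable
  bounded := fun L hL => by
    obtain ⟨R, hR⟩ := hL.isBounded.subset_ball (0 : V3)
    refine ⟨abs (c * ∫ z in ball (0 : V3) (r + R), abs (abs (deriv Φ ‖z‖))), fun X hX => ?_⟩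
    · rw [norm_neg]
      refine (norm_integral_le_integral_norm _).trans ?_
      have h1 := abs_kernelConv_le (k := fun z => |deriv Φ ‖z‖|) (h := fun X => |h X|)
        ((measurable_deriv Φ).comp measurable_norm).abs
        (fun R => (hΦ.integrableOn_deriv R).norm) hm.abs (fun X => by rw [abs_abs]; exact hb X)
        (fun X hX => hr X (by simpa using hX)) (hR hX)
      refine le_trans ?_ (((le_abs_self _).trans h1.2).trans (le_abs_self _))
      refine integral_mono (integrable_forceConv hΦ hm hb hr X).norm h1.1 fun z => ?_
      simp only [norm_smul]
      rw [mul_comm]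
      exact mul_le_mul_of_nonneg_right (norm_forceKer_le Φ z) (norm_nonneg _)
  -- The convolution is moved onto the test function, where integration by parts across the
  -- singularity is known, and moved back afterwards.
  test := fun Ψ h1 h2 e => by
    have hcd : Continuous fun x => fderiv ℝ Ψ x e :=
      (h1.continuous_fderiv (by simp)).clm_apply continuous_const
    rw [integral_kernelConv_mul hΦ.measurable_radial hΦ.integrableOn_radial hm hb hr hcd
      (h2.fderiv_apply ℝ e)]
    have hN : Measurable fun z => inner ℝ (forceKer Φ z) e :=
      (measurable_forceKer Φ).inner_const
    have hNi : ∀ R, IntegrableOn (fun z => inner ℝ (forceKer Φ z) e) (ball 0 R) := fun R =>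
      (hΦ.integrableOn_forceKer R).inner_const e
    have e1 : ∀ Y, ∫ z, Φ ‖z‖ * fderiv ℝ Ψ (Y - z) e
        = ∫ z, inner ℝ (forceKer Φ z) e * Ψ (Y - z) := by
      intro Y
      have h3 : ContDiff ℝ 1 fun x => Ψ (Y - x) := h1.comp (contDiff_const.sub contDiff_id)
      have h4 : HasCompactSupport fun x => Ψ (Y - x) :=
        h2.comp_homeomorph (Homeomorph.subLeft Y)
      have h5 := hΦ.integral_radial_mul_fderiv h3 h4 e
      have h6 : ∀ z, fderiv ℝ (fun x => Ψ (Y - x)) z e = -fderiv ℝ Ψ (Y - z) e := by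
        intro z
        have h7 : HasFDerivAt (fun x : V3 => Y - x) (-ContinuousLinearMap.id ℝ V3) z :=
          (hasFDerivAt_id z).const_sub Y
        have h8 := (h1.differentiable (by simp) (Y - z)).hasFDerivAt.comp z h7
        rw [show (fun x => Ψ (Y - x)) = Ψ ∘ fun x => Y - x from rfl, h8.fderiv]
        simp
      simp only [h6, mul_neg, integral_neg] at h5
      linarith
    simp only [e1]
    rw [← integral_kernelConv_mul hN hNi hm hb hr h1.continuous h2, ← integral_neg]
    refine integral_congr_ae (Eventually.of_forall fun X => ?_)
    simp only
    rw [inner_neg_left, neg_mul, neg_neg, real_inner_comm,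
      ← integral_inner (integrable_forceConv hΦ hm hb hr X)]
    congr 1
    refine integral_congr_ae (Eventually.of_forall fun z => ?_)
    simp only
    rw [real_inner_smul_right, real_inner_comm, mul_comm]

end PotentialField

/-! ### Fields of moments -/

lemma contDiff_mul_of_tsupport {Ω : Set V3} (hΩ : IsOpen Ω) {φ g : V3 → ℝ} (hφ : ContDiff ℝ 1 φ)
    (hs : tsupport φ ⊆ Ω) (hg : ContDiffOn ℝ 1 g Ω) : ContDiff ℝ 1 fun X => φ X * g X := by
  rw [contDiff_iff_contDiffAt]
  intro X
  by_cases hX : X ∈ Ω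
  · exact hφ.contDiffAt.mul (hg.contDiffAt (hΩ.mem_nhds hX))
  · have h1 : φ =ᶠ[𝓝 X] fun _ => 0 :=
      notMem_tsupport_iff_eventuallyEq.1 fun h => hX (hs h)
    refine (contDiffAt_const (c := (0 : ℝ))).congr_of_eventuallyEq ?_
    filter_upwards [h1] with Y hY
    rw [hY, zero_mul]

section Slice

variable {Ω : Set V3} (hΩ : IsOpen Ω) {h : V3 → V3 → ℝ}
  (hC : ContDiffOn ℝ 1 (fun p : V3 × V3 => h p.1 p.2) (Ω ×ˢ univ))
include hΩ hC

omit hΩ in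
lemma contDiffOn_slice (ξ : V3) : ContDiffOn ℝ 1 (fun X => h X ξ) Ω :=
  hC.comp (f := fun X : V3 => (X, ξ)) (by fun_prop) fun _ hX => ⟨hX, mem_univ _⟩

lemma fderiv_slice {X : V3} (hX : X ∈ Ω) (ξ v : V3) :
    fderiv ℝ (fun Y => h Y ξ) X v = fderiv ℝ (fun p : V3 × V3 => h p.1 p.2) (X, ξ) (v, 0) := by
  have h1 : DifferentiableAt ℝ (fun p : V3 × V3 => h p.1 p.2) (X, ξ) :=
    (hC.contDiffAt ((hΩ.prod isOpen_univ).mem_nhds ⟨hX, mem_univ _⟩)).differentiableAt (by simp)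
  have h2 : HasFDerivAt (fun Y : V3 => (Y, ξ)) (ContinuousLinearMap.inl ℝ V3 V3) X :=
    hasFDerivAt_prodMk_left X ξ
  have h3 := h1.hasFDerivAt.comp X h2
  rw [show (fun Y => h Y ξ) = (fun p : V3 × V3 => h p.1 p.2) ∘ fun Y => (Y, ξ) from rfl,
    h3.fderiv]
  simp

lemma continuousOn_transport : ContinuousOn
    (fun p : V3 × V3 => (inner ℝ p.2 (gradient (fun Y => h Y p.2) p.1) : ℝ)) (Ω ×ˢ univ) := by
  have h1 : ContinuousOn (fun p : V3 × V3 =>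
      fderiv ℝ (fun p : V3 × V3 => h p.1 p.2) p (p.2, 0)) (Ω ×ˢ univ) :=
    (hC.continuousOn_fderiv_of_isOpen (hΩ.prod isOpen_univ) le_rfl).clm_apply (by fun_prop)
  refine h1.congr fun p hp => ?_
  simp only
  rw [inner_gradient, fderiv_slice hΩ hC hp.1]

end Slice

/-- One power of decay pays for one factor `ξ`: hence order 5 in the hypotheses and order 4 in the
integrals. -/
lemma norm_le_pow (n : ℕ) (ξ : V3) : ‖ξ‖ * wgt (n + 1) ξ ≤ wgt n ξ := by
  rw [← wgt_add_mul n 1 ξ, pow_one, mul_comm]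
  exact mul_le_mul_of_nonneg_left (by linarith) (wgt_pos _ _).le

lemma integrable_of_bound_of_support {L : Set V3} (hL : IsCompact L) {F : V3 × V3 → ℝ}
    (hF : Measurable F) {c : ℝ} (hb : ∀ p, p.1 ∈ L → |F p| ≤ c * wgt 4 p.2)
    (h0 : ∀ p, p.1 ∉ L → F p = 0) : Integrable F (volume.prod volume) := by
  refine Integrable.mono' ((((integrable_indicator_iff hL.measurableSet).2
    (integrableOn_const (C := (1 : ℝ)) hL.measure_lt_top.ne)).mul_prod
      (integrable_wgt le_rfl)).const_mul c) hF.aestronglyMeasurable (Eventually.of_forall fun p => ?_)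
  by_cases hp : p.1 ∈ L
  · rw [indicator_of_mem hp, one_mul]; exact hb p hp
  · rw [h0 p hp, indicator_of_notMem hp]; simp

lemma integrable_of_le_wgt {F : Type*} [NormedAddCommGroup F] {u : V3 → F}
    (hm : AEStronglyMeasurable u volume) {c : ℝ} {n : ℕ} (hn : 4 ≤ n)
    (hu : ∀ ξ, ‖u ξ‖ ≤ c * wgt n ξ) : Integrable u :=
  Integrable.mono' ((integrable_wgt hn).const_mul c) hm (Eventually.of_forall hu)

/-- The total mass of the weight `(1 + ‖ξ‖)⁻⁴`. -/
noncomputable def wgtMass : ℝ := ∫ ξ : V3, wgt 4 ξ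

lemma norm_integral_le_wgtMass {F : Type*} [NormedAddCommGroup F] [NormedSpace ℝ F] {u : V3 → F}
    {c : ℝ} (hu : ∀ ξ, ‖u ξ‖ ≤ c * wgt 4 ξ) : ‖∫ ξ, u ξ‖ ≤ c * wgtMass := by
  rw [wgtMass, ← integral_const_mul]
  exact norm_integral_le_of_norm_le ((integrable_wgt le_rfl).const_mul c) (Eventually.of_forall hu)

set_option maxHeartbeats 1000000 in
/-- Moments transported with the molecular velocity: `div (K ∫ ξ h dξ)`. -/
lemma weakDiv_transport {Ω : Set V3} (hΩ : IsOpen Ω) {K : V3 → ℝ} {B : V3 → V3}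
    (hK : HasWeakGrad K B) {h : V3 → V3 → ℝ}
    (hC : ContDiffOn ℝ 1 (fun p : V3 × V3 => h p.1 p.2) (Ω ×ˢ univ))
    (hd : ∀ L ⊆ Ω, IsCompact L → ∃ C, ∀ X ∈ L, ∀ ξ,
      |h X ξ| ≤ C * wgt 5 ξ ∧ ‖gradient (fun Y => h Y ξ) X‖ ≤ C * wgt 5 ξ) :
    WeakDiv Ω (fun X => K X • ∫ ξ, h X ξ • ξ)
      (fun X => inner ℝ (B X) (∫ ξ, h X ξ • ξ)
        + K X * ∫ ξ, inner ℝ ξ (gradient (fun Y => h Y ξ) X)) := by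
  set n : V3 → V3 → ℝ := fun X ξ => inner ℝ ξ (gradient (fun Y => h Y ξ) X) with hn
  -- Nothing is known of `h` outside `Ω`. The factor `χ` produces functions that are measurable on
  -- the whole space and unchanged in `Ω`; `WeakDiv.congr` returns to the original ones.
  have hmm : Measurable fun p : V3 × V3 => chi Ω p.1 * h p.1 p.2 :=
    measurable_chi_mul hΩ hC.continuousOn
  have hnm : Measurable fun p : V3 × V3 => chi Ω p.1 * n p.1 p.2 :=
    measurable_chi_mul hΩ (continuousOn_transport hΩ hC)
  have hMm : Measurable fun X => ∫ ξ, (chi Ω X * h X ξ) • ξ :=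
    (StronglyMeasurable.integral_prod_right (f := fun (X ξ : V3) => (chi Ω X * h X ξ) • ξ)
      (hmm.smul measurable_snd).stronglyMeasurable).measurable
  have hNm : Measurable fun X => ∫ ξ, chi Ω X * n X ξ :=
    (StronglyMeasurable.integral_prod_right (f := fun (X ξ : V3) => chi Ω X * n X ξ)
      hnm.stronglyMeasurable).measurable
  have hMe : ∀ X ∈ Ω, ∫ ξ, h X ξ • ξ = ∫ ξ, (chi Ω X * h X ξ) • ξ := fun X hX => by
    simp only [chi_of_mem hX, one_mul]
  have hNe : ∀ X ∈ Ω, ∫ ξ, n X ξ = ∫ ξ, chi Ω X * n X ξ := fun X hX => by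
    simp only [chi_of_mem hX, one_mul]
  have hbd : ∀ L ⊆ Ω, IsCompact L → ∃ C, 0 ≤ C ∧ ∀ X ∈ L, ∀ ξ,
      ‖h X ξ • ξ‖ ≤ C * wgt 4 ξ ∧ ‖n X ξ‖ ≤ C * wgt 4 ξ := by
    intro L hL hLc
    obtain ⟨C, hCb⟩ := hd L hL hLc
    refine ⟨|C|, abs_nonneg C, fun X hX ξ => ?_⟩
    have h1 := fun x (hx : x ≤ C * wgt 5 ξ) => show ‖ξ‖ * x ≤ |C| * wgt 4 ξ from
      calc ‖ξ‖ * x ≤ ‖ξ‖ * (|C| * wgt 5 ξ) := mul_le_mul_of_nonneg_left (hx.trans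
            (mul_le_mul_of_nonneg_right (le_abs_self C) (wgt_pos _ _).le)) (norm_nonneg _)
        _ = |C| * (‖ξ‖ * wgt (4 + 1) ξ) := by ring
        _ ≤ _ := mul_le_mul_of_nonneg_left (norm_le_pow 4 ξ) (abs_nonneg C)
    refine ⟨?_, (norm_inner_le_norm _ _).trans (h1 _ (hCb X hX ξ).2)⟩
    rw [norm_smul, mul_comm]
    exact h1 _ (hCb X hX ξ).1
  have hMi : ∀ X ∈ Ω, Integrable fun ξ => h X ξ • ξ := by
    intro X hX
    obtain ⟨C, _, hCb⟩ := hbd {X} (singleton_subset_iff.2 hX) isCompact_singleton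
    refine integrable_of_le_wgt ?_ le_rfl fun ξ => (hCb X rfl ξ).1
    have : Measurable fun ξ => (chi Ω X * h X ξ) • ξ :=
      (hmm.comp measurable_prodMk_left).smul measurable_id
    simpa only [chi_of_mem hX, one_mul] using this.aestronglyMeasurable
  have hMb : ∀ L ⊆ Ω, IsCompact L → ∃ C, ∀ X ∈ L,
      ‖∫ ξ, (chi Ω X * h X ξ) • ξ‖ ≤ C ∧ ‖∫ ξ, chi Ω X * n X ξ‖ ≤ C := by
    intro L hL hLc
    obtain ⟨C, _, hCb⟩ := hbd L hL hLc
    refine ⟨C * wgtMass, fun X hX => ?_⟩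
    rw [← hMe X (hL hX), ← hNe X (hL hX)]
    exact ⟨norm_integral_le_wgtMass fun ξ => (hCb X hX ξ).1,
      norm_integral_le_wgtMass fun ξ => (hCb X hX ξ).2⟩
  refine WeakDiv.congr hΩ.measurableSet (V := fun X => K X • ∫ ξ, (chi Ω X * h X ξ) • ξ)
    (d := fun X => inner ℝ (B X) (∫ ξ, (chi Ω X * h X ξ) • ξ)
        + K X * ∫ ξ, chi Ω X * n X ξ) ⟨?_, ?_, ?_⟩
    (fun X hX => by simp only [hMe X hX]) (fun X hX => by simp only [hMe X hX]; rw [hNe X hX])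
  · rw [locallyIntegrableOn_iff hΩ.isLocallyClosed]
    intro L hL hLc
    obtain ⟨C, hCb⟩ := hMb L hL hLc
    obtain ⟨c, hc⟩ := hK.bounded_fun L hLc
    refine Measure.integrableOn_of_bounded (M := c * C) hLc.measure_lt_top.ne
      (hK.measurable_fun.smul hMm).aestronglyMeasurable ?_
    filter_upwards [ae_restrict_mem hLc.measurableSet] with X hX
    rw [norm_smul]
    exact mul_le_mul (hc X hX) (hCb X hX).1 (norm_nonneg _) ((abs_nonneg _).trans (hc X hX))
  · rw [locallyIntegrableOn_iff hΩ.isLocallyClosed]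
    intro L hL hLc
    obtain ⟨C, hCb⟩ := hMb L hL hLc
    obtain ⟨c, hc⟩ := hK.bounded_fun L hLc
    obtain ⟨c', hc'⟩ := hK.bounded L hLc
    refine Measure.integrableOn_of_bounded (M := c' * C + c * C) hLc.measure_lt_top.ne
      ((hK.measurable.inner hMm).add (hK.measurable_fun.mul hNm)).aestronglyMeasurable ?_
    filter_upwards [ae_restrict_mem hLc.measurableSet] with X hX
    refine (norm_add_le _ _).trans (add_le_add ((norm_inner_le_norm _ _).trans ?_) ?_)
    · exact mul_le_mul (hc' X hX) (hCb X hX).1 (norm_nonneg _) ((norm_nonneg _).trans (hc' X hX))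
    · rw [norm_mul]
      exact mul_le_mul (hc X hX) (hCb X hX).2 (norm_nonneg _) ((abs_nonneg _).trans (hc X hX))
  · intro φ h1 h2 h3
    have hφd : Continuous (fderiv ℝ φ) := h1.continuous_fderiv (by simp)
    have hgm : Measurable (gradient φ) := (continuous_gradient h1).measurable
    set L := tsupport φ with hL
    have hLc : IsCompact L := h2
    have hφ0 : ∀ X, X ∉ L → φ X = 0 := fun X hX => image_eq_zero_of_notMem_tsupport hX
    have hD0 : ∀ X, X ∉ L → fderiv ℝ φ X = 0 := fun X hX =>
      image_eq_zero_of_notMem_tsupport fun h4 => hX (tsupport_fderiv_subset ℝ h4)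
    obtain ⟨C, hC0, hCb⟩ := hbd L h3 hLc
    obtain ⟨c, hc⟩ := hK.bounded_fun L hLc
    obtain ⟨c', hc'⟩ := hK.bounded L hLc
    obtain ⟨a, ha⟩ := h2.exists_bound_of_continuous h1.continuous
    obtain ⟨a', ha'⟩ := (h2.fderiv ℝ).exists_bound_of_continuous hφd
    have ha0 : 0 ≤ a := (norm_nonneg _).trans (ha 0)
    have ha0' : 0 ≤ a' := (norm_nonneg _).trans (ha' 0)
    have i1 : Integrable (fun p : V3 × V3 => K p.1 * fderiv ℝ φ p.1 ((chi Ω p.1 * h p.1 p.2) • p.2))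
        (volume.prod volume) := by
      refine integrable_of_bound_of_support hLc (c := c * (a' * C)) ?_ (fun p hp => ?_)
        fun p hp => by rw [hD0 p.1 hp]; simp
      · simp only [← inner_gradient]
        exact (hK.measurable_fun.comp measurable_fst).mul
          ((hmm.smul measurable_snd).inner (hgm.comp measurable_fst))
      · rw [abs_mul, mul_assoc, mul_assoc, chi_of_mem (h3 hp), one_mul]
        refine mul_le_mul (hc _ hp) ?_ (abs_nonneg _) ((abs_nonneg _).trans (hc _ hp))
        exact ((fderiv ℝ φ p.1).le_opNorm _).trans
          (mul_le_mul (ha' _) (hCb _ hp _).1 (norm_nonneg _) ha0')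
    have i2 : Integrable (fun p : V3 × V3 => φ p.1 * inner ℝ (B p.1) ((chi Ω p.1 * h p.1 p.2) • p.2))
        (volume.prod volume) := by
      refine integrable_of_bound_of_support hLc (c := a * (c' * C)) ?_ (fun p hp => ?_)
        fun p hp => by rw [hφ0 p.1 hp]; simp
      · exact (h1.continuous.measurable.comp measurable_fst).mul
          ((hK.measurable.comp measurable_fst).inner (hmm.smul measurable_snd))
      · rw [abs_mul, mul_assoc, mul_assoc, chi_of_mem (h3 hp), one_mul]
        refine mul_le_mul (ha _) ?_ (abs_nonneg _) ha0
        exact (abs_real_inner_le_norm _ _).trans (mul_le_mul (hc' _ hp) (hCb _ hp _).1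
          (norm_nonneg _) ((norm_nonneg _).trans (hc' _ hp)))
    have i3 : Integrable (fun p : V3 × V3 => φ p.1 * (K p.1 * (chi Ω p.1 * n p.1 p.2)))
        (volume.prod volume) := by
      refine integrable_of_bound_of_support hLc (c := a * (c * C)) ?_ (fun p hp => ?_)
        fun p hp => by rw [hφ0 p.1 hp]; simp
      · exact (h1.continuous.measurable.comp measurable_fst).mul
          ((hK.measurable_fun.comp measurable_fst).mul hnm)
      · rw [abs_mul, abs_mul, mul_assoc, mul_assoc, chi_of_mem (h3 hp), one_mul]
        exact mul_le_mul (ha _) (mul_le_mul (hc _ hp) (hCb _ hp _).2 (abs_nonneg _)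
          ((abs_nonneg _).trans (hc _ hp))) (by positivity) ha0
    -- For a fixed velocity, `φ` times the slice of `h` is an admissible `C¹` test function for the
    -- weak gradient of `K`, taken in the direction `ξ`. Integrating over `ξ` afterwards is a matter
    -- of Fubini.
    have slice : ∀ ξ, ∫ X, K X * fderiv ℝ φ X ((chi Ω X * h X ξ) • ξ)
          + φ X * (K X * (chi Ω X * n X ξ))
        = -∫ X, φ X * inner ℝ (B X) ((chi Ω X * h X ξ) • ξ) := by
      intro ξ
      have hΨ := contDiff_mul_of_tsupport hΩ h1 h3 (contDiffOn_slice hC ξ)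
      have ht := hK.test _ hΨ h2.mul_right ξ
      have e1 : ∀ X, K X * fderiv ℝ φ X ((chi Ω X * h X ξ) • ξ) + φ X * (K X * (chi Ω X * n X ξ))
          = K X * fderiv ℝ (fun X => φ X * h X ξ) X ξ := by
        intro X
        by_cases hX : X ∈ Ω
        · have d1 := (h1.differentiable (by simp) X)
          have d2 := ((contDiffOn_slice hC ξ).contDiffAt (hΩ.mem_nhds hX)).differentiableAt
            (by simp)
          rw [fderiv_fun_mul d1 d2, chi_of_mem hX, one_mul, one_mul, map_smul, smul_eq_mul]
          simp only [add_apply, FunLike.coe_smul, Pi.smul_apply, smul_eq_mul, hn, inner_gradient]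
          ring
        · have hX' : X ∉ L := fun h5 => hX (h3 h5)
          have hz : fderiv ℝ (fun X => φ X * h X ξ) X = 0 :=
            image_eq_zero_of_notMem_tsupport fun h4 => hX'
              ((tsupport_fderiv_subset ℝ).trans (tsupport_mul_subset_left) h4)
          rw [hz, hD0 X hX', hφ0 X hX']; simp
      simp only [e1]
      rw [ht]
      congr 1
      refine integral_congr_ae (Eventually.of_forall fun X => ?_)
      simp only
      by_cases hX : X ∈ L
      · rw [chi_of_mem (h3 hX), one_mul, real_inner_smul_right]; ring
      · rw [hφ0 X hX]; ring
    rw [setIntegral_inner_gradient h3, setIntegral_mul_of_tsupport h3]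
    have e1 : ∫ X, fderiv ℝ φ X (K X • ∫ ξ, (chi Ω X * h X ξ) • ξ)
        = ∫ ξ, (∫ X, K X * fderiv ℝ φ X ((chi Ω X * h X ξ) • ξ)) := by
      rw [← integral_integral_swap i1]
      refine integral_congr_ae (Eventually.of_forall fun X => ?_)
      simp only
      by_cases hX : X ∈ L
      · have hi := hMi X (h3 hX)
        simp only [chi_of_mem (h3 hX), one_mul]
        rw [map_smul, smul_eq_mul, ← ContinuousLinearMap.integral_comp_comm _ hi,
          integral_const_mul]
      · simp [hD0 X hX]
    have e2 : ∫ X, φ X * (inner ℝ (B X) (∫ ξ, (chi Ω X * h X ξ) • ξ)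
          + K X * ∫ ξ, chi Ω X * n X ξ)
        = ∫ ξ, ((∫ X, φ X * inner ℝ (B X) ((chi Ω X * h X ξ) • ξ))
          + ∫ X, φ X * (K X * (chi Ω X * n X ξ))) := by
      rw [integral_add i2.integral_prod_right i3.integral_prod_right,
        ← integral_integral_swap i2,
        ← integral_integral_swap (f := fun X ξ => φ X * (K X * (chi Ω X * n X ξ))) i3,
        ← integral_add i2.integral_prod_left i3.integral_prod_left]
      refine integral_congr_ae (Eventually.of_forall fun X => ?_)
      simp only
      by_cases hX : X ∈ L
      · have hi := hMi X (h3 hX)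
        simp only [chi_of_mem (h3 hX), one_mul]
        rw [integral_const_mul, integral_const_mul, integral_const_mul, integral_inner hi]
        ring
      · simp [hφ0 X hX]
    rw [e1, e2, ← integral_neg]
    refine integral_congr_ae ?_
    filter_upwards [i1.prod_left_ae, i3.prod_left_ae] with ξ j1 j3
    have := slice ξ
    rw [integral_add j1 j3] at this
    linarith

/-! ### Divergence integrals over a domain with `C¹` boundary -/

namespace IsC1Domain

variable {D : Set V3} {ψ : V3 → ℝ}

lemma mem_iff (h : IsC1Domain D ψ) {X : V3} : X ∈ D ↔ ψ X < 0 := by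
  rw [h.eq_sublevel]; rfl

lemma isOpen (h : IsC1Domain D ψ) : IsOpen D := by
  rw [h.eq_sublevel]; exact isOpen_lt h.contDiff.continuous continuous_const

lemma le_zero_of_mem_closure (h : IsC1Domain D ψ) {X : V3} (hX : X ∈ closure D) : ψ X ≤ 0 := by
  have h1 : closure D ⊆ {X | ψ X ≤ 0} :=
    closure_minimal (fun X hX => (h.mem_iff.1 hX).le)
      (isClosed_le h.contDiff.continuous continuous_const)
  exact h1 hX

lemma mem_frontier_iff (h : IsC1Domain D ψ) {X : V3} :
    X ∈ frontier D ↔ X ∈ closure D ∧ ψ X = 0 := by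
  rw [h.isOpen.frontier_eq, Set.mem_sdiff, h.mem_iff, not_lt]
  exact ⟨fun ⟨h1, h2⟩ => ⟨h1, le_antisymm (h.le_zero_of_mem_closure h1) h2⟩,
    fun ⟨h1, h2⟩ => ⟨h1, h2.ge⟩⟩

lemma isCompact_closure (h : IsC1Domain D ψ) : IsCompact (closure D) :=
  h.bounded.isCompact_closure

lemma isCompact_frontier (h : IsC1Domain D ψ) : IsCompact (frontier D) :=
  h.isCompact_closure.of_isClosed_subset isClosed_frontier frontier_subset_closure

lemma norm_normal (h : IsC1Domain D ψ) {X : V3} (hX : X ∈ frontier D) : ‖normal ψ X‖ = 1 := by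
  rw [normal, norm_smul, norm_inv, norm_norm]
  exact inv_mul_cancel₀ (norm_ne_zero_iff.2 (h.gradient_ne_zero X (h.mem_frontier_iff.1 hX).2))

/-- Points of `D` with small `|ψ|` are near the boundary. -/
lemma exists_layer_subset (h : IsC1Domain D ψ) {U : Set V3} (hU : IsOpen U) (hU' : frontier D ⊆ U) :
    ∃ ε > 0, ∀ X ∈ D, -ε < ψ X → X ∈ U := by
  have hc : IsCompact (closure D \ U) := h.isCompact_closure.diff hU
  rcases (closure D \ U).eq_empty_or_nonempty with he | hne
  · exact ⟨1, one_pos, fun X hX _ => by_contra fun hXU =>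
      (he ▸ (⟨subset_closure hX, hXU⟩ : X ∈ closure D \ U) : X ∈ (∅ : Set V3))⟩
  · obtain ⟨Z, hZ, hmax⟩ := hc.exists_isMaxOn hne h.contDiff.continuous.continuousOn
    have hZ0 : ψ Z < 0 := lt_of_le_of_ne (h.le_zero_of_mem_closure hZ.1) fun h0 =>
      hZ.2 (hU' (h.mem_frontier_iff.2 ⟨hZ.1, h0⟩))
    refine ⟨-ψ Z, by linarith, fun X hX hX' => by_contra fun hXU => ?_⟩
    have := hmax (⟨subset_closure hX, hXU⟩ : X ∈ closure D \ U)
    simp only [mem_ofPred_eq] at this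
    linarith

/-- Near a boundary point, the part of `D` in `{-ε < ψ}` has volume `O(ε)`: many of its
translates along the normal are disjoint. -/
lemma exists_layer_volume_le_local (h : IsC1Domain D ψ) {X₀ : V3} (hX₀ : X₀ ∈ frontier D) :
    ∃ r > 0, ∃ C : ℝ, 0 ≤ C ∧ ∀ ε > 0,
      volume.real (ball X₀ r ∩ {X | X ∈ D ∧ -ε < ψ X}) ≤ C * ε := by
  have hn := h.norm_normal hX₀
  set e := normal ψ X₀ with he
  have hg : 0 < ‖gradient ψ X₀‖ :=
    norm_pos_iff.2 (h.gradient_ne_zero X₀ (h.mem_frontier_iff.1 hX₀).2)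
  -- By continuity the derivative of `ψ` along the normal at `X₀` stays above half of its value
  -- there throughout some ball of radius `R`.
  set c := ‖gradient ψ X₀‖ / 2 with hc
  have hc0 : 0 < c := by positivity
  have hlim : c < fderiv ℝ ψ X₀ e := by
    rw [← inner_gradient, he, normal, real_inner_smul_left, real_inner_self_eq_norm_sq, hc]
    have : ‖gradient ψ X₀‖⁻¹ * ‖gradient ψ X₀‖ ^ 2 = ‖gradient ψ X₀‖ := by field_simp
    linarith
  have hcont : Continuous fun X => fderiv ℝ ψ X e :=
    (h.contDiff.continuous_fderiv (by simp)).clm_apply continuous_const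
  obtain ⟨R, hR, hRb⟩ := Metric.isOpen_iff.1 (isOpen_lt continuous_const hcont) X₀ hlim
  -- Half the radius leaves room for translations of length up to `r` inside the larger ball.
  set r := R / 2 with hr
  have hr0 : 0 < r := by positivity
  set b := volume.real (ball X₀ R) with hb
  have hb0 : 0 ≤ b := measureReal_nonneg
  refine ⟨r, hr0, 2 * b / (c * r), by positivity, fun ε hε => ?_⟩
  set A := ball X₀ r ∩ {X | X ∈ D ∧ -ε < ψ X} with hA
  have hAm : MeasurableSet A := measurableSet_ball.inter (h.isOpen.measurableSet.inter
    (isOpen_lt continuous_const h.contDiff.continuous).measurableSet)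
  have hAb : volume.real A ≤ b := measureReal_mono
    (fun X hX => ball_subset_ball (by linarith) hX.1) measure_ball_lt_top.ne
  -- For `ε` that is not small, the volume of the larger ball is already a bound of the required
  -- form.
  by_cases hεc : c * r ≤ 2 * ε
  · refine hAb.trans ?_
    rw [div_mul_eq_mul_div, le_div_iff₀ (by positivity)]
    nlinarith
  push Not at hεc
  have growth : ∀ X ∈ A, ∀ t, 0 < t → t ≤ r → ψ X + c * t ≤ ψ (X + t • e) := by
    intro X hX t ht htr
    have hd : ∀ s, HasDerivAt (fun s : ℝ => ψ (X + s • e)) (fderiv ℝ ψ (X + s • e) e) s := by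
      intro s
      have h1 := (h.contDiff.differentiable (by simp) (X + s • e)).hasFDerivAt
      have h2 : HasDerivAt (fun s : ℝ => X + s • e) e s := by
        simpa using ((hasDerivAt_id s).smul_const e).const_add X
      exact h1.comp_hasDerivAt s h2
    obtain ⟨s, hs, hs'⟩ := exists_hasDerivAt_eq_slope (fun s : ℝ => ψ (X + s • e)) _ ht
      (fun s _ => (hd s).continuousAt.continuousWithinAt) fun s _ => hd s
    have hin : c < fderiv ℝ ψ (X + s • e) e := hRb (by
      rw [mem_ball_iff_norm]
      have h1 := mem_ball_iff_norm.1 hX.1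
      calc ‖X + s • e - X₀‖ = ‖(X - X₀) + s • e‖ := by congr 1; abel
        _ ≤ ‖X - X₀‖ + ‖s • e‖ := norm_add_le _ _
        _ = ‖X - X₀‖ + s := by rw [norm_smul, hn, mul_one, Real.norm_of_nonneg hs.1.le]
        _ < R := by have := hs.2; linarith)
    rw [hs', zero_smul, add_zero, sub_zero, lt_div_iff₀ ht] at hin
    linarith
  -- A shift by `ε / c` along the normal raises `ψ` by at least `ε`, the width of the layer, so
  -- successive translates are disjoint. About `c r / ε` of them fit into the larger ball; rounding
  -- down loses at most a factor 2 because `c r / ε > 2`, and this is the 2 in the constant.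
  set N := ⌊c * r / ε⌋₊ with hN
  have hNle : (N : ℝ) * (ε / c) ≤ r := by
    have : (N : ℝ) ≤ c * r / ε := Nat.floor_le (by positivity)
    calc (N : ℝ) * (ε / c) ≤ c * r / ε * (ε / c) := by gcongr
      _ = r := by field_simp
  have hNge : c * r / (2 * ε) ≤ N := by
    have h1 : c * r / ε < N + 1 := Nat.lt_floor_add_one _
    have h2 : 2 < c * r / ε := by rw [lt_div_iff₀ hε]; linarith
    have h3 : c * r / (2 * ε) = c * r / ε / 2 := by field_simp
    linarith
  set δ := ε / c with hδ
  have hδ0 : 0 < δ := by positivity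
  set T : ℕ → Set V3 := fun k => (fun X => X + (k * δ) • e) '' A with hT
  have hTe : ∀ k, T k = (fun X => X + -(((k : ℕ) * δ) • e)) ⁻¹' A := by
    intro k; ext X
    simp only [hT, mem_image, mem_preimage]
    exact ⟨by rintro ⟨Y, hY, rfl⟩; simpa using hY, fun hX => ⟨_, hX, by simp⟩⟩
  have hTm : ∀ k, MeasurableSet (T k) := fun k => by
    rw [hTe]; exact (measurable_add_const _) hAm
  have hTv : ∀ k, volume (T k) = volume A := fun k => by
    rw [hTe, measure_preimage_add_right]
  have hkr : ∀ k : ℕ, k ≤ N → k * δ ≤ r := fun k hk =>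
    (mul_le_mul_of_nonneg_right (by exact_mod_cast hk) hδ0.le).trans hNle
  have hdisj : ∀ k l : ℕ, k < l → l < N → Disjoint (T k) (T l) := by
    intro k l hkl hl
    rw [Set.disjoint_left]
    rintro _ ⟨X, hX, rfl⟩ ⟨Y, hY, hXY⟩
    simp only at hXY
    have hX' : X = Y + (((l - k : ℕ) : ℝ) * δ) • e := by
      rw [Nat.cast_sub hkl.le, sub_mul, sub_smul]
      have : X = Y + (l * δ) • e - (k * δ) • e := by rw [hXY]; abel
      rw [this]; abel
    have h1 : (1 : ℝ) ≤ ((l - k : ℕ) : ℝ) := by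
      exact_mod_cast Nat.one_le_iff_ne_zero.2 (Nat.sub_ne_zero_of_lt hkl)
    have h2 := growth Y hY (((l - k : ℕ) : ℝ) * δ) (by positivity) (hkr _ (by omega))
    rw [← hX'] at h2
    have h3 : ψ X < 0 := h.mem_iff.1 hX.2.1
    have h4 : -ε < ψ Y := hY.2.2
    have h5 : ε ≤ c * (((l - k : ℕ) : ℝ) * δ) := by
      calc ε = c * (1 * δ) := by rw [hδ]; field_simp
        _ ≤ _ := by gcongr
    linarith
  have hsum : (N : ℝ) * volume.real A ≤ b := by
    have h1 : volume.real (⋃ k ∈ Finset.range N, T k) = ∑ k ∈ Finset.range N, volume.real (T k) := by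
      refine measureReal_biUnion_finset ?_ (fun k _ => hTm k) fun k _ => ?_
      · intro k hk l hl hkl
        rcases lt_or_gt_of_ne hkl with h' | h'
        · exact hdisj k l h' (Finset.mem_range.1 hl)
        · exact (hdisj l k h' (Finset.mem_range.1 hk)).symm
      · rw [hTv]; exact (measure_mono inter_subset_left).trans_lt measure_ball_lt_top |>.ne
    have h2 : ∑ k ∈ Finset.range N, volume.real (T k) = N * volume.real A := by
      simp [measureReal_def, hTv]
    rw [← h2, ← h1]
    refine measureReal_mono (iUnion₂_subset fun k hk => ?_) measure_ball_lt_top.ne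
    rintro _ ⟨X, hX, rfl⟩
    rw [mem_ball_iff_norm]
    have h3 := mem_ball_iff_norm.1 hX.1
    have h4 : ‖(k * δ) • e‖ ≤ r := by
      rw [norm_smul, hn, mul_one, Real.norm_of_nonneg (by positivity)]
      exact hkr k (Finset.mem_range.1 hk).le
    calc ‖X + (k * δ) • e - X₀‖ = ‖(X - X₀) + (k * δ) • e‖ := by congr 1; abel
      _ ≤ ‖X - X₀‖ + ‖(k * δ) • e‖ := norm_add_le _ _
      _ < R := by linarith
  have h6 : c * r / (2 * ε) * volume.real A ≤ b :=
    (mul_le_mul_of_nonneg_right hNge measureReal_nonneg).trans hsum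
  calc volume.real A = c * r / (2 * ε) * volume.real A * (2 * ε / (c * r)) := by field_simp
    _ ≤ b * (2 * ε / (c * r)) := by gcongr
    _ = _ := by ring

/-- Finitely many of the local balls cover the compact boundary, and for small `ε` the whole layer
lies in their union. -/
lemma exists_layer_volume_le (h : IsC1Domain D ψ) :
    ∃ C : ℝ, 0 ≤ C ∧ ∃ ε₀ > 0, ∀ ε > 0, ε ≤ ε₀ →
      volume.real {X | X ∈ D ∧ -ε < ψ X} ≤ C * ε := by
  choose! r hr C hC0 hC using fun X₀ (hX₀ : X₀ ∈ frontier D) => h.exists_layer_volume_le_local hX₀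
  obtain ⟨t, hcov⟩ := h.isCompact_frontier.elim_nhds_subcover' (fun X _ => ball X (r X))
    fun X hX => ball_mem_nhds X (hr X hX)
  obtain ⟨ε₀, hε₀, hU⟩ := h.exists_layer_subset (U := ⋃ x ∈ t, ball (x : V3) (r x))
    (isOpen_biUnion fun _ _ => isOpen_ball) hcov
  refine ⟨∑ x ∈ t, C x, Finset.sum_nonneg fun x _ => hC0 x x.2, ε₀, hε₀, fun ε hε hle => ?_⟩
  calc volume.real {X | X ∈ D ∧ -ε < ψ X}
      ≤ volume.real (⋃ x ∈ t, ball (x : V3) (r x) ∩ {X | X ∈ D ∧ -ε < ψ X}) := by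
        refine measureReal_mono (fun X hX => ?_) ?_
        · have := hU X hX.1 (by linarith [hX.2])
          simp only [mem_iUnion] at this ⊢
          obtain ⟨x, hx, hx'⟩ := this
          exact ⟨x, hx, hx', hX⟩
        · refine ((measure_biUnion_finset_le t _).trans_lt (ENNReal.sum_lt_top.2 fun x _ => ?_)).ne
          exact (measure_mono inter_subset_left).trans_lt measure_ball_lt_top
    _ ≤ ∑ x ∈ t, volume.real (ball (x : V3) (r x) ∩ {X | X ∈ D ∧ -ε < ψ X}) :=
        measureReal_biUnion_finset_le _ _
    _ ≤ ∑ x ∈ t, C x * ε := Finset.sum_le_sum fun x _ => hC x x.2 ε hε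
    _ = _ := by rw [Finset.sum_mul]

end IsC1Domain

/-! ### The divergence theorem by cutoff functions -/

lemma exists_deriv_smoothTransition_le :
    ∃ b : ℝ, ∀ x, deriv Real.smoothTransition x ≤ b := by
  have hc : Continuous (deriv Real.smoothTransition) :=
    (Real.smoothTransition.contDiff (n := 1)).continuous_deriv le_rfl
  obtain ⟨b, hb⟩ := (isCompact_Icc (a := (0 : ℝ)) (b := 1)).exists_bound_of_continuousOn
    hc.continuousOn
  have hb0 : 0 ≤ b := (norm_nonneg _).trans (hb 0 (by simp))
  refine ⟨b, fun x => ?_⟩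
  by_cases hx : x ∈ Icc (0 : ℝ) 1
  · exact (le_abs_self _).trans (hb x hx)
  rw [mem_Icc, not_and_or, not_le, not_le] at hx
  have : deriv Real.smoothTransition x = 0 := by
    rcases hx with hx | hx
    · have h1 : Real.smoothTransition =ᶠ[𝓝 x] fun _ => 0 := by
        filter_upwards [Iio_mem_nhds hx] with y hy
        exact Real.smoothTransition.zero_of_nonpos (le_of_lt hy)
      rw [h1.deriv_eq, deriv_const]
    · have h1 : Real.smoothTransition =ᶠ[𝓝 x] fun _ => 1 := by
        filter_upwards [Ioi_mem_nhds hx] with y hy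
        exact Real.smoothTransition.one_of_one_le (le_of_lt hy)
      rw [h1.deriv_eq, deriv_const]
  rw [this]; exact hb0

lemma deriv_smoothTransition_nonneg (x : ℝ) : 0 ≤ deriv Real.smoothTransition x :=
  (Real.smoothTransition.monotone).deriv_nonneg

lemma deriv_smoothTransition_eq_zero {x : ℝ} (hx : x < 0 ∨ 1 < x) :
    deriv Real.smoothTransition x = 0 := by
  rcases hx with hx | hx
  · have h1 : Real.smoothTransition =ᶠ[𝓝 x] fun _ => 0 := by
      filter_upwards [Iio_mem_nhds hx] with y hy
      exact Real.smoothTransition.zero_of_nonpos (le_of_lt hy)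
    rw [h1.deriv_eq, deriv_const]
  · have h1 : Real.smoothTransition =ᶠ[𝓝 x] fun _ => 1 := by
      filter_upwards [Ioi_mem_nhds hx] with y hy
      exact Real.smoothTransition.one_of_one_le (le_of_lt hy)
    rw [h1.deriv_eq, deriv_const]

section Domain

variable {D : Set V3} {ψ : V3 → ℝ}

/-- The cutoff functions `T(-2ψ/ε - 1)`. -/
noncomputable def cutoff (ψ : V3 → ℝ) (ε : ℝ) (X : V3) : ℝ :=
  Real.smoothTransition (-(2 / ε) * ψ X - 1)

lemma contDiff_cutoff (hψ : ContDiff ℝ 1 ψ) (ε : ℝ) : ContDiff ℝ 1 (cutoff ψ ε) :=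
  Real.smoothTransition.contDiff.comp ((contDiff_const.mul hψ).sub contDiff_const)

lemma cutoff_nonneg (ψ : V3 → ℝ) (ε : ℝ) (X : V3) : 0 ≤ cutoff ψ ε X :=
  Real.smoothTransition.nonneg _

lemma cutoff_le_one (ψ : V3 → ℝ) (ε : ℝ) (X : V3) : cutoff ψ ε X ≤ 1 :=
  Real.smoothTransition.le_one _

lemma cutoff_eq_one {ε : ℝ} (hε : 0 < ε) {X : V3} (h : ψ X ≤ -ε) : cutoff ψ ε X = 1 := by
  refine Real.smoothTransition.one_of_one_le ?_
  have : 2 ≤ -(2 / ε) * ψ X := by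
    rw [neg_mul, div_mul_eq_mul_div, ← neg_div, le_div_iff₀ hε]; linarith
  linarith

lemma tsupport_cutoff_subset (hψ : Continuous ψ) {ε : ℝ} (hε : 0 < ε) :
    tsupport (cutoff ψ ε) ⊆ {X | ψ X ≤ -(ε / 2)} := by
  refine closure_minimal (fun X hX => ?_) (isClosed_le hψ continuous_const)
  by_contra hn
  simp only [mem_ofPred_eq, not_le] at hn
  refine hX (Real.smoothTransition.zero_of_nonpos ?_)
  have : -(2 / ε) * ψ X ≤ 1 := by
    rw [neg_mul, div_mul_eq_mul_div, ← neg_div, div_le_iff₀ hε]; linarith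
  linarith

lemma inner_gradient_cutoff (hψ : ContDiff ℝ 1 ψ) (ε : ℝ) (X v : V3) :
    inner ℝ v (gradient (cutoff ψ ε) X)
      = -(2 / ε) * deriv Real.smoothTransition (-(2 / ε) * ψ X - 1) * inner ℝ v (gradient ψ X) := by
  rw [inner_gradient, inner_gradient]
  have h1 : HasFDerivAt (fun X => -(2 / ε) * ψ X - 1) (-(2 / ε) • fderiv ℝ ψ X) X :=
    ((hψ.differentiable (by simp) X).hasFDerivAt.const_mul _).sub_const 1
  have h2 : HasDerivAt Real.smoothTransition
      (deriv Real.smoothTransition (-(2 / ε) * ψ X - 1)) (-(2 / ε) * ψ X - 1) :=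
    ((Real.smoothTransition.contDiff (n := 1)).differentiable (by simp) _).hasDerivAt
  have h3 := h2.comp_hasFDerivAt X h1
  rw [show cutoff ψ ε = Real.smoothTransition ∘ fun X => -(2 / ε) * ψ X - 1 from rfl, h3.fderiv]
  simp only [FunLike.coe_smul, Pi.smul_apply, smul_eq_mul]
  ring

/-- If the normal component of `V` is asymptotically non-negative at the boundary, then its
divergence has a non-negative integral. -/
theorem setIntegral_div_nonneg (h : IsC1Domain D ψ) {V : V3 → V3} {d : V3 → ℝ} (hV : WeakDiv D V d)
    (hd : IntegrableOn d D)
    (hb : ∀ X₀ ∈ frontier D, ∀ δ > 0, ∀ᶠ X in 𝓝[D] X₀, -δ ≤ inner ℝ (V X) (gradient ψ X)) :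
    0 ≤ ∫ X in D, d X := by
  obtain ⟨C, hC0, ε₁, hε₁, hC⟩ := h.exists_layer_volume_le
  obtain ⟨b, hb'⟩ := exists_deriv_smoothTransition_le
  have hb0 : 0 ≤ b := (deriv_smoothTransition_nonneg 0).trans (hb' 0)
  have key : ∀ δ > 0, -(2 * b * δ * C) ≤ ∫ X in D, d X := by
    intro δ hδ
    have hnb : ∀ X₀ ∈ frontier D, ∃ U, IsOpen U ∧ X₀ ∈ U ∧
        ∀ X ∈ U ∩ D, -δ ≤ inner ℝ (V X) (gradient ψ X) := by
      intro X₀ hX₀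
      obtain ⟨U, hU1, hU2, hU3⟩ := mem_nhdsWithin.1 (hb X₀ hX₀ δ hδ)
      exact ⟨U, hU1, hU2, fun X hX => hU3 hX⟩
    choose! U hUo hUm hUb using hnb
    obtain ⟨ε₂, hε₂, hU⟩ := h.exists_layer_subset (U := ⋃ X₀ ∈ frontier D, U X₀)
      (isOpen_biUnion fun X hX => hUo X hX) fun X hX => mem_biUnion hX (hUm X hX)
    have hlow : ∀ X ∈ D, -ε₂ < ψ X → -δ ≤ inner ℝ (V X) (gradient ψ X) := by
      intro X hX hX'
      obtain ⟨X₀, hX₀, h1⟩ := mem_iUnion₂.1 (hU X hX hX')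
      exact hUb X₀ hX₀ X ⟨h1, hX⟩
    -- The gradient of the cutoff is of size `1/ε` and lives on a layer of volume `O(ε)`, where the
    -- outward component of `V` is at least `-δ`. The loss at the boundary is therefore `O(δ)` with
    -- a constant independent of `ε`.
    have step : ∀ ε > 0, ε ≤ ε₁ → ε ≤ ε₂ → -(2 * b * δ * C) ≤ ∫ X in D, cutoff ψ ε X * d X := by
      intro ε hε he1 he2
      have hsub := tsupport_cutoff_subset (ψ := ψ) h.contDiff.continuous hε
      have hsD : tsupport (cutoff ψ ε) ⊆ D := fun X hX => h.mem_iff.2 (by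
        have := hsub hX
        simp only [mem_ofPred_eq] at this
        linarith)
      have hcs : HasCompactSupport (cutoff ψ ε) :=
        Metric.isCompact_of_isClosed_isBounded (isClosed_tsupport _) (h.bounded.subset hsD)
      have hcd := contDiff_cutoff h.contDiff ε
      have ht := hV.test _ hcd hcs hsD
      set A := {X | X ∈ D ∧ -ε < ψ X} with hA
      have hAD : A ⊆ D := fun X hX => hX.1
      have hAm : MeasurableSet A := h.isOpen.measurableSet.inter
        (isOpen_lt continuous_const h.contDiff.continuous).measurableSet
      have hAf : volume A < ⊤ := h.bounded.subset hAD |>.measure_lt_top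
      have hle : ∀ X ∈ D, inner ℝ (V X) (gradient (cutoff ψ ε) X)
          ≤ A.indicator (fun _ => 2 / ε * b * δ) X := by
        intro X hX
        rw [inner_gradient_cutoff h.contDiff]
        by_cases hXA : X ∈ A
        · rw [indicator_of_mem hXA]
          have h1 := hlow X hX (by linarith [hXA.2])
          have h2 := hb' (-(2 / ε) * ψ X - 1)
          have h3 := deriv_smoothTransition_nonneg (-(2 / ε) * ψ X - 1)
          have h4 : 0 ≤ 2 / ε := by positivity
          have h5 : deriv Real.smoothTransition (-(2 / ε) * ψ X - 1) * -inner ℝ (V X) (gradient ψ X)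
              ≤ b * δ := (mul_le_mul_of_nonneg_left (neg_le.1 h1) h3).trans
                (mul_le_mul_of_nonneg_right h2 hδ.le)
          calc _ = 2 / ε * (deriv Real.smoothTransition (-(2 / ε) * ψ X - 1)
                * -inner ℝ (V X) (gradient ψ X)) := by ring
            _ ≤ 2 / ε * (b * δ) := mul_le_mul_of_nonneg_left h5 h4
            _ = _ := by ring
        · rw [indicator_of_notMem hXA]
          -- On the level `ψ X = -ε` the argument of the transition function is exactly `1`; its
          -- derivative vanishes there because the value `1` is a maximum.
          rcases eq_or_lt_of_le (not_lt.1 fun h' => hXA ⟨hX, h'⟩) with h1 | h1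
          · rw [h1]
            have : deriv Real.smoothTransition (-(2 / ε) * -ε - 1) = 0 := by
              rw [show -(2 / ε) * -ε - 1 = 1 by field_simp; ring]
              have hmax : IsLocalMax Real.smoothTransition 1 := Eventually.of_forall fun y => by
                rw [Real.smoothTransition.one]; exact Real.smoothTransition.le_one y
              exact hmax.deriv_eq_zero
            rw [this]; simp
          · rw [deriv_smoothTransition_eq_zero (Or.inr ?_)]
            · simp
            · have : 2 < -(2 / ε) * ψ X := by
                rw [neg_mul, div_mul_eq_mul_div, ← neg_div, lt_div_iff₀ hε]; linarith
              linarith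
      have hmono : ∫ X in D, inner ℝ (V X) (gradient (cutoff ψ ε) X)
          ≤ ∫ X in D, A.indicator (fun _ => 2 / ε * b * δ) X := by
        refine setIntegral_mono_on ?_ ?_ h.isOpen.measurableSet hle
        · exact integrableOn_inner_of_tsupport hV.field (continuous_gradient hcd)
            (gradient_hasCompactSupport hcs) ((tsupport_gradient_subset _).trans hsD)
        · exact ((integrable_indicator_iff hAm).2 (integrableOn_const hAf.ne)).integrableOn
      rw [ht, setIntegral_indicator hAm, inter_eq_self_of_subset_right hAD, setIntegral_const,
        smul_eq_mul] at hmono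
      have h7 : volume.real A * (2 / ε * b * δ) ≤ C * ε * (2 / ε * b * δ) :=
        mul_le_mul_of_nonneg_right (hC ε hε he1) (by positivity)
      have h8 : C * ε * (2 / ε * b * δ) = 2 * b * δ * C := by field_simp
      linarith
    have hlim : Tendsto (fun n : ℕ => ∫ X in D, cutoff ψ (1 / ((n : ℝ) + 1)) X * d X) atTop
        (𝓝 (∫ X in D, d X)) := by
      refine tendsto_integral_of_dominated_convergence (fun X => |d X|) (fun n => ?_) hd.abs
        (fun n => Eventually.of_forall fun X => ?_) ?_
      · exact (contDiff_cutoff h.contDiff _).continuous.aestronglyMeasurable.mul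
          hd.aestronglyMeasurable
      · rw [norm_mul, Real.norm_of_nonneg (cutoff_nonneg _ _ _)]
        exact mul_le_of_le_one_left (abs_nonneg _) (cutoff_le_one _ _ _)
      · filter_upwards [ae_restrict_mem h.isOpen.measurableSet] with X hX
        have hψ : 0 < -ψ X := by have := h.mem_iff.1 hX; linarith
        refine tendsto_const_nhds.congr' ?_
        filter_upwards [tendsto_one_div_add_atTop_nhds_zero_nat.eventually (gt_mem_nhds hψ)]
          with n hn
        rw [cutoff_eq_one (by positivity) (by linarith), one_mul]
    refine ge_of_tendsto hlim ?_
    filter_upwards [tendsto_one_div_add_atTop_nhds_zero_nat.eventually (gt_mem_nhds hε₁),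
      tendsto_one_div_add_atTop_nhds_zero_nat.eventually (gt_mem_nhds hε₂)] with n h1 h2
    exact step _ (by positivity) h1.le h2.le
  have hl : Tendsto (fun δ : ℝ => -(2 * b * δ * C)) (𝓝[>] 0) (𝓝 0) := by
    have : Continuous fun δ : ℝ => -(2 * b * δ * C) := by fun_prop
    simpa using (this.tendsto 0).mono_left nhdsWithin_le_nhds
  exact le_of_tendsto hl (eventually_nhdsWithin_of_forall key)

/-- The one-sided result applies both to `V` and to `-V`. -/
theorem setIntegral_div_eq_zero (h : IsC1Domain D ψ) {V : V3 → V3} {d : V3 → ℝ}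
    (hV : WeakDiv D V d) (hd : IntegrableOn d D)
    (hb : ∀ X₀ ∈ frontier D, Tendsto (fun X => inner ℝ (V X) (gradient ψ X)) (𝓝[D] X₀) (𝓝 0)) :
    ∫ X in D, d X = 0 := by
  refine le_antisymm ?_ (setIntegral_div_nonneg h hV hd fun X₀ hX₀ δ hδ =>
    (hb X₀ hX₀).eventually (le_mem_nhds (by linarith)))
  have := setIntegral_div_nonneg h (hV.const_smul (-1)) (Integrable.const_mul hd (-1)) fun X₀ hX₀ δ hδ => by
    filter_upwards [(hb X₀ hX₀).eventually (ge_mem_nhds hδ)] with X hX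
    rw [neg_one_smul, inner_neg_left]
    linarith
  simp only [neg_mul, one_mul, integral_neg] at this
  linarith

end Domain

/-! ### Divergence integrals of periodic fields -/

/-- The divergence of a periodic field has zero integral over a period cell. -/
theorem setIntegral_div_periodic (b : Module.Basis (Fin 3) ℝ V3) {V : V3 → V3} {d : V3 → ℝ}
    (h : WeakDiv univ V d) (hVp : ∀ i X, V (X + b i) = V X) (hdp : ∀ i X, d (X + b i) = d X)
    (hVm : Measurable V) (hdm : Measurable d) {c : ℝ} (hVb : ∀ X, ‖V X‖ ≤ c) (hdb : ∀ X, |d X| ≤ c) :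
    ∫ X in ZSpan.fundamentalDomain b, d X = 0 := by
  set Q := ZSpan.fundamentalDomain b with hQ
  have hQf : volume Q < ⊤ := (ZSpan.fundamentalDomain_isBounded b).measure_lt_top
  have : IsFiniteMeasure (volume.restrict Q) := ⟨by simpa using hQf⟩
  let η : ContDiffBump (0 : V3) := default
  have hη : ContDiff ℝ 1 (η : V3 → ℝ) := η.contDiff
  have hηc : HasCompactSupport (η : V3 → ℝ) := η.hasCompactSupport
  have hηi : Integrable (η : V3 → ℝ) := η.integrable
  have hgi : Integrable (fun Z => gradient (η : V3 → ℝ) Z) :=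
    (continuous_gradient hη).integrable_of_hasCompactSupport (gradient_hasCompactSupport hηc)
  have hg0 : ∀ v : V3, ∫ Z, inner ℝ v (gradient (η : V3 → ℝ) Z) = 0 := by
    intro v
    have := hasWeakGrad_one.test η hη hηc v
    simpa [inner_gradient] using this
  -- The bump translated by `y` is used as test function, and the identity is then integrated over
  -- `y` in the cell. By periodicity the left side becomes the constant `∫ V` paired with `∫ ∇η =
  -- 0`, and the right side becomes `-(∫ η)(∫ d)`.
  have shift : ∀ y : V3, ∫ Z, inner ℝ (V (Z + y)) (gradient (η : V3 → ℝ) Z)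
      = -∫ Z, η Z * d (Z + y) := by
    intro y
    have hφ : ContDiff ℝ 1 fun X => η (X - y) := hη.comp (contDiff_id.sub contDiff_const)
    have hφc : HasCompactSupport fun X => η (X - y) :=
      hηc.comp_homeomorph (Homeomorph.subRight y)
    have ht := h.test _ hφ hφc (subset_univ _)
    simp only [Measure.restrict_univ, inner_gradient] at ht
    rw [← integral_add_right_eq_self _ y, ← integral_add_right_eq_self (fun X => _ * d X) y] at ht
    simpa only [inner_gradient, add_sub_cancel_right, fderiv_comp_sub] using ht
  have i1 : Integrable (fun p : V3 × V3 => inner ℝ (V (p.2 + p.1)) (gradient (η : V3 → ℝ) p.2))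
      ((volume.restrict Q).prod volume) := by
    refine (((integrable_const c).mul_prod hgi.norm)).mono'
      (((hVm.comp (measurable_snd.add measurable_fst)).inner
        ((continuous_gradient hη).measurable.comp measurable_snd)).aestronglyMeasurable)
      (Eventually.of_forall fun p => ?_)
    exact (norm_inner_le_norm _ _).trans (mul_le_mul_of_nonneg_right (hVb _) (norm_nonneg _))
  have i2 : Integrable (fun p : V3 × V3 => η p.2 * d (p.2 + p.1))
      ((volume.restrict Q).prod volume) := by
    refine (((integrable_const c).mul_prod hηi.norm)).mono'
      ((hη.continuous.measurable.comp measurable_snd).mul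
        (hdm.comp (measurable_snd.add measurable_fst))).aestronglyMeasurable
      (Eventually.of_forall fun p => ?_)
    rw [norm_mul, mul_comm]
    exact mul_le_mul_of_nonneg_right (hdb _) (norm_nonneg _)
  have hVi : ∀ Z, IntegrableOn (fun y => V (Z + y)) Q := fun Z =>
    Integrable.mono' (integrable_const c) (hVm.comp (measurable_const_add Z)).aestronglyMeasurable
      (Eventually.of_forall fun y => hVb _)
  have e1 : ∫ y in Q, (∫ Z, inner ℝ (V (Z + y)) (gradient (η : V3 → ℝ) Z)) = 0 := by
    have s1 : ∀ Z, ∫ y in Q, inner ℝ (V (Z + y)) (gradient (η : V3 → ℝ) Z)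
        = inner ℝ (∫ y in Q, V y) (gradient (η : V3 → ℝ) Z) := fun Z => by
      rw [integral_congr_ae (Eventually.of_forall fun y =>
        real_inner_comm (gradient (η : V3 → ℝ) Z) (V (Z + y))), integral_inner (hVi Z),
        real_inner_comm, ← setIntegral_fundamentalDomain_add b hVp Z]
      simp only [add_comm Z]
      rfl
    rw [integral_integral_swap
      (f := fun y Z => inner ℝ (V (Z + y)) (gradient (η : V3 → ℝ) Z)) i1]
    simp only [s1]
    exact hg0 _
  have e2 : ∫ y in Q, (∫ Z, η Z * d (Z + y)) = (∫ Z, η Z) * ∫ y in Q, d y := by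
    rw [integral_integral_swap (f := fun y Z => η Z * d (Z + y)) i2]
    have : ∀ Z, ∫ y in Q, d (Z + y) = ∫ y in Q, d y := fun Z => by
      simp_rw [add_comm Z]; exact setIntegral_fundamentalDomain_add b hdp Z
    simp_rw [integral_const_mul, this, integral_mul_const]
  simp_rw [shift, integral_neg, e2] at e1
  have hpos : 0 < ∫ Z, η Z := η.integral_pos
  rw [neg_eq_zero] at e1
  exact (mul_eq_zero.1 e1).resolve_left hpos.ne'

/-! ### The inequality for scattering kernels -/

/-- The graph of the convex function `x log x` lies above its tangent at `y`. -/
lemma mul_one_add_log_sub_le {x y : ℝ} (hx : 0 ≤ x) (hy : 0 < y) :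
    x * (1 + Real.log y) - y ≤ x * Real.log x := by
  rcases hx.eq_or_lt with rfl | hx
  · simp [hy.le]
  have h1 := Real.log_le_sub_one_of_pos (div_pos hy hx)
  rw [Real.log_div hy.ne' hx.ne'] at h1
  have h2 := mul_le_mul_of_nonneg_left h1 hx.le
  have h3 : x * (y / x - 1) = y - x := by field_simp
  nlinarith

section Kernel

variable {α : Type*} [MeasurableSpace α] {μ ν : Measure α} [IsFiniteMeasure μ] {κ : Kernel α α}
  [IsMarkovKernel κ] {r : α → ℝ}

/-- In the joint law of the states before and after scattering, weighting by the first state and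
taking the second marginal amounts to scattering the weighted measure. -/
lemma map_snd_withDensity_compProd {f : α → ENNReal} (hf : Measurable f) :
    ((μ.compProd κ).withDensity fun p => f p.1).map Prod.snd = (μ.withDensity f).bind κ := by
  ext s hs
  rw [Measure.map_apply measurable_snd hs, Measure.bind_apply hs κ.aemeasurable,
    withDensity_apply _ (measurable_snd hs), lintegral_withDensity_eq_lintegral_mul _ hf
      (κ.measurable_coe hs), ← lintegral_indicator (measurable_snd hs),
    Measure.lintegral_compProd (f := (Prod.snd ⁻¹' s).indicator fun p : α × α => f p.1)
      ((hf.comp measurable_fst).indicator (measurable_snd hs))]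
  refine lintegral_congr fun x => ?_
  have : (fun y => (Prod.snd ⁻¹' s).indicator (fun p : α × α => f p.1) (x, y))
      = s.indicator fun _ => f x := by
    ext y; simp only [indicator, mem_preimage]; rfl
  simp only [this, Pi.mul_apply]
  rw [lintegral_indicator hs, setLIntegral_const]

/-- Jensen's inequality for `x log x` along a Markov kernel, for densities relative to an
invariant pair of measures. -/
theorem integral_mul_log_le_of_bind_eq (h : μ.bind κ = ν) (hm : Measurable r) (h0 : ∀ x, 0 ≤ r x)
    (hr : (μ.withDensity fun x => ENNReal.ofReal (r x)).bind κ
      = ν.withDensity fun x => ENNReal.ofReal (r x))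
    (hpos : ∀ᵐ x ∂ν, 0 < r x) (hν : Integrable r ν)
    (hμl : Integrable (fun x => r x * Real.log (r x)) μ)
    (hνl : Integrable (fun x => r x * Real.log (r x)) ν) :
    ∫ x, r x * Real.log (r x) ∂ν ≤ ∫ x, r x * Real.log (r x) ∂μ := by
  -- `P` is the joint law of the states before and after scattering. The tangent inequality at `r
  -- p.2` is integrated against it: the pure terms depend on the marginals only, and the mixed term
  -- `r p.1 * (1 + log (r p.2))` is evaluated by means of `hr`.
  obtain ⟨P, hP⟩ : ∃ P, P = μ.compProd κ := ⟨_, rfl⟩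
  have hfst : P.map Prod.fst = μ := by rw [hP]; exact Measure.fst_compProd μ κ
  have hsnd : P.map Prod.snd = ν := by rw [hP]; exact (Measure.snd_compProd μ κ).trans h
  have hρ : Measurable fun p : α × α => ENNReal.ofReal (r p.1) :=
    Measurable.ennreal_ofReal (hm.comp measurable_fst)
  have hρ' : (P.withDensity fun p => ENNReal.ofReal (r p.1)).map Prod.snd
      = ν.withDensity fun x => ENNReal.ofReal (r x) := by
    rw [← hr, hP, map_snd_withDensity_compProd hm.ennreal_ofReal]
  have hlm : Measurable fun x => 1 + Real.log (r x) := (Real.measurable_log.comp hm).const_add 1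
  have hνi : Integrable (fun x => r x * (1 + Real.log (r x))) ν := by
    simp only [mul_add, mul_one]
    exact hν.add hνl
  have i1 : Integrable (fun p : α × α => r p.1 * Real.log (r p.1)) P := by
    have : Integrable (fun x => r x * Real.log (r x)) (P.map Prod.fst) := by rwa [hfst]
    exact this.comp_measurable measurable_fst
  have i2 : Integrable (fun p : α × α => r p.2) P := by
    have : Integrable r (P.map Prod.snd) := by rwa [hsnd]
    exact this.comp_measurable measurable_snd
  have i3' : Integrable (fun x => 1 + Real.log (r x))
      ((P.withDensity fun p => ENNReal.ofReal (r p.1)).map Prod.snd) := by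
    rw [hρ', integrable_withDensity_iff (hm.ennreal_ofReal)
      (Eventually.of_forall fun _ => ENNReal.ofReal_lt_top)]
    simp only [ENNReal.toReal_ofReal (h0 _)]
    simpa only [mul_comm] using hνi
  have i3 : Integrable (fun p : α × α => r p.1 * (1 + Real.log (r p.2))) P := by
    have := i3'.comp_measurable measurable_snd
    rw [integrable_withDensity_iff hρ (Eventually.of_forall fun _ => ENNReal.ofReal_lt_top)] at this
    simp only [ENNReal.toReal_ofReal (h0 _), Function.comp_apply] at this
    simpa only [mul_comm] using this
  have e1 : ∫ p, r p.1 * Real.log (r p.1) ∂P = ∫ x, r x * Real.log (r x) ∂μ := by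
    rw [← hfst, integral_map measurable_fst.aemeasurable]
    exact (hm.mul (Real.measurable_log.comp hm)).aestronglyMeasurable
  have e2 : ∫ p, r p.2 ∂P = ∫ x, r x ∂ν := by
    rw [← hsnd, integral_map measurable_snd.aemeasurable hm.aestronglyMeasurable]
  have e3 : ∫ p, r p.1 * (1 + Real.log (r p.2)) ∂P = ∫ x, r x * (1 + Real.log (r x)) ∂ν := by
    have h1 : ∫ x, 1 + Real.log (r x) ∂((P.withDensity fun p => ENNReal.ofReal (r p.1)).map Prod.snd)
        = ∫ p, r p.1 * (1 + Real.log (r p.2)) ∂P := by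
      rw [integral_map measurable_snd.aemeasurable hlm.aestronglyMeasurable,
        integral_withDensity_eq_integral_toReal_smul hρ
          (Eventually.of_forall fun _ => ENNReal.ofReal_lt_top)]
      simp only [ENNReal.toReal_ofReal (h0 _), smul_eq_mul]
    rw [← h1, hρ', integral_withDensity_eq_integral_toReal_smul
      (hm.ennreal_ofReal) (Eventually.of_forall fun _ => ENNReal.ofReal_lt_top)]
    simp only [ENNReal.toReal_ofReal (h0 _), smul_eq_mul]
  have hpos' : ∀ᵐ p ∂P, 0 < r p.2 := by
    rw [← hsnd] at hpos
    exact ae_of_ae_map measurable_snd.aemeasurable hpos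
  have key : ∫ p, (r p.1 * (1 + Real.log (r p.2)) - r p.2) ∂P
      ≤ ∫ p, r p.1 * Real.log (r p.1) ∂P :=
    integral_mono_ae (i3.sub i2) i1 (hpos'.mono fun p hp => mul_one_add_log_sub_le (h0 _) hp)
  rw [integral_sub i3 i2, e1, e2, e3] at key
  simp only [mul_add, mul_one] at key
  rw [integral_add hν hνl] at key
  linarith

end Kernel

/-! ### Half-space flux measures -/

lemma wallMaxwellian_pos (Rg Tw : ℝ) (ξ : V3) : 0 < wallMaxwellian Rg Tw ξ := Real.exp_pos _

lemma continuous_wallMaxwellian (Rg Tw : ℝ) : Continuous (wallMaxwellian Rg Tw) := by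
  unfold wallMaxwellian; fun_prop

/-- Since `1 + x ≤ exp x`, the polynomial is dominated by an exponential; completing the square in
the exponent yields the constant. -/
lemma wallMaxwellian_le {Rg Tw : ℝ} (hR : 0 < Rg) (hT : 0 < Tw) (n : ℕ) :
    ∃ C, ∀ ξ : V3, wallMaxwellian Rg Tw ξ ≤ C * wgt n ξ := by
  set c := 2 * Rg * Tw with hc
  have hc0 : 0 < c := by positivity
  refine ⟨Real.exp (n ^ 2 * c / 4), fun ξ => ?_⟩
  rw [wgt, ← div_eq_mul_inv, le_div_iff₀ (pow_pos (one_add_norm_pos ξ) n)]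
  have h1 : (1 + ‖ξ‖) ^ n ≤ Real.exp (n * ‖ξ‖) := by
    rw [Real.exp_nat_mul]
    have := Real.add_one_le_exp ‖ξ‖
    exact pow_le_pow_left₀ (one_add_norm_pos ξ).le (by linarith) n
  refine (mul_le_mul_of_nonneg_left h1 (wallMaxwellian_pos _ _ ξ).le).trans ?_
  rw [wallMaxwellian, ← Real.exp_add, ← hc]
  refine Real.exp_le_exp.2 ?_
  have h2 : -‖ξ‖ ^ 2 / c + n * ‖ξ‖ = n ^ 2 * c / 4 - (‖ξ‖ - n * c / 2) ^ 2 / c := by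
    field_simp; ring
  rw [h2]
  have : 0 ≤ (‖ξ‖ - n * c / 2) ^ 2 / c := by positivity
  linarith

lemma log_wallMaxwellian (Rg Tw : ℝ) (ξ : V3) :
    Real.log (wallMaxwellian Rg Tw ξ) = -(1 / (2 * Rg * Tw) * ‖ξ‖ ^ 2) := by
  rw [wallMaxwellian, Real.log_exp]; ring

/-- Velocities tangent to the wall, for which no boundary values are assumed, form a plane and so a
null set. -/
lemma ae_inner_ne_zero {n : V3} (hn : n ≠ 0) : ∀ᵐ ξ : V3, (inner ℝ ξ n : ℝ) ≠ 0 := by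
  have h1 : LinearMap.ker (innerSL ℝ n).toLinearMap ≠ ⊤ := fun h => hn (by
    have : n ∈ LinearMap.ker (innerSL ℝ n).toLinearMap := h ▸ Submodule.mem_top
    simpa using this)
  have h2 := Measure.addHaar_submodule volume _ h1
  rw [ae_iff]
  refine measure_mono_null (fun ξ hξ => ?_) h2
  simp only [not_not, mem_ofPred_eq] at hξ
  simp only [SetLike.mem_coe, LinearMap.mem_ker]
  simpa [real_inner_comm] using hξ

section Flux

variable {n : V3} {φ w : V3 → ℝ}

lemma max_mul_congr {φ ψ : V3 → ℝ} (h : ∀ ξ, (inner ℝ ξ n : ℝ) ≠ 0 → φ ξ = ψ ξ) (ξ : V3) :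
    max (inner ℝ ξ n) 0 * φ ξ = max (inner ℝ ξ n) 0 * ψ ξ ∧
      max (-inner ℝ ξ n) 0 * φ ξ = max (-inner ℝ ξ n) 0 * ψ ξ := by
  by_cases h0 : (inner ℝ ξ n : ℝ) = 0
  · simp [h0]
  · rw [h ξ h0]; exact ⟨rfl, rfl⟩

lemma outFlux_congr {φ ψ : V3 → ℝ} (h : ∀ ξ, (inner ℝ ξ n : ℝ) ≠ 0 → φ ξ = ψ ξ) :
    outFlux n φ = outFlux n ψ ∧ inFlux n φ = inFlux n ψ := by
  unfold outFlux inFlux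
  simp only [fun ξ => (max_mul_congr h ξ).1, fun ξ => (max_mul_congr h ξ).2, and_self]

lemma integral_mul_inner_eq {g : V3 → ℝ} (hg : Integrable fun ξ => g ξ * inner ℝ ξ n)
    (hm : AEStronglyMeasurable g volume) :
    ∫ ξ, g ξ * inner ℝ ξ n
      = (∫ ξ, max (inner ℝ ξ n) 0 * g ξ) - ∫ ξ, max (-inner ℝ ξ n) 0 * g ξ := by
  have hc : Continuous fun ξ : V3 => (inner ℝ ξ n : ℝ) := by fun_prop
  rw [← integral_sub]
  · refine integral_congr_ae (Eventually.of_forall fun ξ => ?_)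
    simp only
    rw [← sub_mul, max_zero_sub_eq_self, mul_comm]
  · refine hg.mono ((hc.max continuous_const).aestronglyMeasurable.mul hm)
      (Eventually.of_forall fun ξ => ?_)
    rw [norm_mul, norm_mul, mul_comm]
    gcongr
    rw [Real.norm_of_nonneg (le_max_right _ _)]
    exact max_le (le_abs_self _) (abs_nonneg _)
  · refine hg.mono (((continuous_neg.comp hc).max continuous_const).aestronglyMeasurable.mul hm)
      (Eventually.of_forall fun ξ => ?_)
    rw [norm_mul, norm_mul, mul_comm]
    gcongr
    rw [Real.norm_of_nonneg (le_max_right _ _)]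
    exact max_le (neg_le_abs _) (abs_nonneg _)

lemma norm_mul_inner_le {g : V3 → ℝ} (hn : ‖n‖ = 1) {C : ℝ} {ξ : V3} (hg : |g ξ| ≤ C * wgt 5 ξ)
    {x : ℝ} (hx : |x| ≤ ‖ξ‖ * ‖n‖) :
    ‖x * g ξ‖ ≤ C * wgt 4 ξ := by
  rw [norm_mul, Real.norm_eq_abs, Real.norm_eq_abs]
  rw [hn, mul_one] at hx
  have hC : 0 ≤ C := by
    have := (abs_nonneg _).trans hg
    exact nonneg_of_mul_nonneg_left this (wgt_pos _ _)
  calc |x| * |g ξ| ≤ ‖ξ‖ * (C * wgt (4 + 1) ξ) := mul_le_mul hx hg (abs_nonneg _) (norm_nonneg _)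
    _ = C * (‖ξ‖ * wgt (4 + 1) ξ) := by ring
    _ ≤ _ := mul_le_mul_of_nonneg_left (norm_le_pow 4 ξ) hC

lemma abs_max_inner_le (ξ n : V3) :
    |max (inner ℝ ξ n) 0| ≤ ‖ξ‖ * ‖n‖ ∧ |max (-inner ℝ ξ n) 0| ≤ ‖ξ‖ * ‖n‖ := by
  have h1 := abs_real_inner_le_norm ξ n
  rw [abs_of_nonneg (le_max_right _ _), abs_of_nonneg (le_max_right _ _)]
  exact ⟨max_le ((le_abs_self _).trans h1) (by positivity),
    max_le ((neg_le_abs _).trans h1) (by positivity)⟩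

/-- Integral with respect to a flux measure. -/
lemma integral_withDensity_mul {m g : V3 → ℝ} (hm : Measurable m) (h0 : ∀ ξ, 0 ≤ m ξ)  :
    ∫ ξ, g ξ ∂(volume.withDensity fun ξ => ENNReal.ofReal (m ξ)) = ∫ ξ, m ξ * g ξ := by
  rw [integral_withDensity_eq_integral_toReal_smul (hm.ennreal_ofReal)
    (Eventually.of_forall fun _ => ENNReal.ofReal_lt_top)]
  simp only [ENNReal.toReal_ofReal (h0 _), smul_eq_mul]

lemma integrable_withDensity_mul {m g : V3 → ℝ} (hm : Measurable m) (h0 : ∀ ξ, 0 ≤ m ξ) :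
    Integrable g (volume.withDensity fun ξ => ENNReal.ofReal (m ξ))
      ↔ Integrable fun ξ => m ξ * g ξ := by
  rw [integrable_withDensity_iff (hm.ennreal_ofReal)
    (Eventually.of_forall fun _ => ENNReal.ofReal_lt_top)]
  simp only [ENNReal.toReal_ofReal (h0 _), mul_comm]

variable {κ : Kernel V3 V3} [IsMarkovKernel κ]

/-- An impermeable wall: the normal mass flux vanishes. -/
lemma integral_mul_inner_eq_zero_of_scattered (hn : ‖n‖ = 1)
    (hm : AEStronglyMeasurable φ volume) (h0 : ∀ᵐ ξ, 0 ≤ φ ξ) {C : ℝ}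
    (hC : ∀ᵐ ξ, |φ ξ| ≤ C * wgt 5 ξ)
    (h : (outFlux n φ).bind κ = inFlux n φ) : ∫ ξ, φ ξ * inner ℝ ξ n = 0 := by
  have hc : Continuous fun ξ : V3 => (inner ℝ ξ n : ℝ) := by fun_prop
  have hcm : Continuous fun ξ : V3 => max (-inner ℝ ξ n) (0 : ℝ) := by fun_prop
  have h1 := congrArg (fun m : Measure V3 => m univ) h
  simp only [Measure.bind_apply MeasurableSet.univ κ.aemeasurable, measure_univ, lintegral_one,
    outFlux, inFlux, withDensity_apply _ MeasurableSet.univ, Measure.restrict_univ] at h1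
  have hi : Integrable fun ξ => φ ξ * inner ℝ ξ n := by
    refine Integrable.mono' ((integrable_wgt le_rfl).const_mul C)
      (hm.mul hc.aestronglyMeasurable) (hC.mono fun ξ hξ => ?_)
    rw [mul_comm]
    exact norm_mul_inner_le hn hξ (abs_real_inner_le_norm _ _)
  rw [integral_mul_inner_eq hi hm,
    integral_eq_lintegral_of_nonneg_ae (h0.mono fun ξ h => mul_nonneg (le_max_right _ _) h)
      ((hc.max continuous_const).aestronglyMeasurable.mul hm),
    integral_eq_lintegral_of_nonneg_ae (h0.mono fun ξ h => mul_nonneg (le_max_right _ _) h)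
      (hcm.aestronglyMeasurable.mul hm), h1, sub_self]

/-- At the surface of a heat bath the normal component of `⟨ξ φ log (φ / w)⟩` is non-negative. -/
lemma integral_mul_log_mul_inner_nonneg (hn : ‖n‖ = 1)
    (hm : Measurable φ) (hw : Measurable w) (hw0 : ∀ ξ, 0 < w ξ)
    (hpos : ∀ ξ, (inner ℝ ξ n : ℝ) ≠ 0 → 0 < φ ξ) (h0 : ∀ ξ, 0 ≤ φ ξ) {C : ℝ}
    (hC : ∀ ξ, |φ ξ| ≤ C * wgt 5 ξ) (hCw : ∀ ξ, |w ξ| ≤ C * wgt 5 ξ)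
    (hCl : ∀ ξ, |φ ξ * Real.log (φ ξ / w ξ)| ≤ C * wgt 5 ξ)
    (hbw : (outFlux n w).bind κ = inFlux n w) (hb : (outFlux n φ).bind κ = inFlux n φ) :
    0 ≤ ∫ ξ, φ ξ * Real.log (φ ξ / w ξ) * inner ℝ ξ n := by
  have hc : Continuous fun ξ : V3 => (inner ℝ ξ n : ℝ) := by fun_prop
  have hcp : Measurable fun ξ : V3 => max (inner ℝ ξ n) (0 : ℝ) :=
    (hc.max continuous_const).measurable
  have hcm : Measurable fun ξ : V3 => max (-inner ℝ ξ n) (0 : ℝ) :=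
    ((continuous_neg.comp hc).max continuous_const).measurable
  -- Relative to the flux measures of `w`, those of `φ` have the common density `r`. The former are
  -- an invariant pair for the kernel, which is the situation of Jensen's inequality.
  set r : V3 → ℝ := fun ξ => φ ξ / w ξ with hr
  have hrm : Measurable r := hm.div hw
  have hr0 : ∀ ξ, 0 ≤ r ξ := fun ξ => div_nonneg (h0 ξ) (hw0 ξ).le
  have hwr : ∀ ξ, w ξ * r ξ = φ ξ := fun ξ => mul_div_cancel₀ _ (hw0 ξ).ne'
  have hint : ∀ (p : V3 → ℝ), Measurable p → (∀ ξ, |p ξ| ≤ ‖ξ‖ * ‖n‖) → ∀ g : V3 → ℝ, Measurable g →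
      (∀ ξ, |g ξ| ≤ C * wgt 5 ξ) → Integrable fun ξ => p ξ * g ξ := by
    intro p hp hp' g hg hg'
    exact Integrable.mono' ((integrable_wgt le_rfl).const_mul C) (hp.mul hg).aestronglyMeasurable
      (Eventually.of_forall fun ξ => norm_mul_inner_le hn (hg' ξ) (hp' ξ))
  have hwd : ∀ (p : V3 → ℝ), Measurable p → (∀ ξ, 0 ≤ p ξ) →
      ((volume : Measure V3).withDensity fun ξ => ENNReal.ofReal (p ξ * w ξ)).withDensity
        (fun ξ => ENNReal.ofReal (r ξ))
      = volume.withDensity fun ξ => ENNReal.ofReal (p ξ * φ ξ) := by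
    intro p hp hp0
    have hpw : Measurable fun ξ => p ξ * w ξ := hp.mul hw
    rw [← withDensity_mul _ hpw.ennreal_ofReal
      (hrm.ennreal_ofReal)]
    congr 1
    ext ξ
    rw [Pi.mul_apply, ← ENNReal.ofReal_mul (mul_nonneg (hp0 ξ) (hw0 ξ).le), mul_assoc, hwr]
  have hlm : Measurable fun ξ => φ ξ * Real.log (φ ξ / w ξ) :=
    hm.mul (Real.measurable_log.comp hrm)
  have hfin : IsFiniteMeasure (outFlux n w) := by
    refine isFiniteMeasure_withDensity_ofReal ?_
    exact (hint _ hcp (fun ξ => (abs_max_inner_le ξ n).1) w hw hCw).2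
  have eo : ∀ (p : V3 → ℝ) (g : V3 → ℝ), (fun ξ => p ξ * w ξ * (r ξ * g ξ))
      = fun ξ => p ξ * (φ ξ * g ξ) := fun p g => by
    ext ξ; rw [← hwr ξ]; ring
  have hcpw : Measurable fun ξ : V3 => max (inner ℝ ξ n) 0 * w ξ := hcp.mul hw
  have hcmw : Measurable fun ξ : V3 => max (-inner ℝ ξ n) 0 * w ξ := hcm.mul hw
  have key := integral_mul_log_le_of_bind_eq (μ := outFlux n w) (ν := inFlux n w) (κ := κ) (r := r)
    hbw hrm hr0 ?_ ?_ ?_ ?_ ?_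
  · rw [outFlux, inFlux, integral_withDensity_mul hcmw
        fun ξ => mul_nonneg (le_max_right _ _) (hw0 ξ).le,
      integral_withDensity_mul hcpw
        fun ξ => mul_nonneg (le_max_right _ _) (hw0 ξ).le,
      eo _ fun ξ => Real.log (r ξ), eo _ fun ξ => Real.log (r ξ)] at key
    rw [integral_mul_inner_eq ?_ hlm.aestronglyMeasurable]
    · linarith
    · have := hint _ hc.measurable (fun ξ => abs_real_inner_le_norm _ _) _ hlm hCl
      simpa only [mul_comm] using this
  · rw [outFlux, inFlux, hwd _ hcp fun ξ => le_max_right _ _,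
      hwd _ hcm fun ξ => le_max_right _ _]
    exact hb
  · rw [inFlux, ae_withDensity_iff (Measurable.ennreal_ofReal hcmw)]
    refine Eventually.of_forall fun ξ hξ => div_pos (hpos ξ fun h1 => hξ ?_) (hw0 ξ)
    simp [h1]
  · rw [inFlux, integrable_withDensity_mul hcmw
      fun ξ => mul_nonneg (le_max_right _ _) (hw0 ξ).le]
    simp only [mul_assoc, hwr]
    exact hint _ hcm (fun ξ => (abs_max_inner_le ξ n).2) _ hm hC
  · rw [outFlux, integrable_withDensity_mul hcpw
      fun ξ => mul_nonneg (le_max_right _ _) (hw0 ξ).le, eo]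
    exact hint _ hcp (fun ξ => (abs_max_inner_le ξ n).1) _ hlm hCl
  · rw [inFlux, integrable_withDensity_mul hcmw
      fun ξ => mul_nonneg (le_max_right _ _) (hw0 ξ).le, eo]
    exact hint _ hcm (fun ξ => (abs_max_inner_le ξ n).2) _ hlm hCl

end Flux

/-! ### States of the gas at a fixed time -/

/-- The properties of a classical solution at a fixed time, with periods `P`. -/
structure IsState (Ω P : Set V3) (u : V3 → V3 → ℝ) : Prop where
  pos : ∀ X ∈ Ω, ∀ ξ, 0 < u X ξ
  contDiffOn : ContDiffOn ℝ 1 (fun p : V3 × V3 => u p.1 p.2) (Ω ×ˢ univ)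
  decay : ∀ n : ℕ, ∃ C : ℝ, ∀ X ∈ Ω, ∀ ξ, u X ξ ≤ C * wgt n ξ
  decay_gradient : ∀ L ⊆ Ω, IsCompact L → ∀ n : ℕ, ∃ C : ℝ, ∀ X ∈ L, ∀ ξ,
    ‖gradient (fun Y => u Y ξ) X‖ ≤ C * wgt n ξ ∧ ‖gradient (fun η => u X η) ξ‖ ≤ C * wgt n ξ
  log_growth : ∃ (n : ℕ) (C : ℝ), ∀ X ∈ Ω, ∀ ξ, |Real.log (u X ξ)| ≤ C * (1 + ‖ξ‖) ^ n
  periodic : ∀ p ∈ P, ∀ X ξ, u (X + p) ξ = u X ξ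

/-- The density `u (log u + β |ξ|²)`. -/
noncomputable def entropyDensity (β : ℝ) (u : V3 → V3 → ℝ) (X ξ : V3) : ℝ :=
  u X ξ * (Real.log (u X ξ) + β * ‖ξ‖ ^ 2)

lemma continuous_entropy_profile (β : ℝ) (ξ : V3) :
    Continuous fun y : ℝ => y * (Real.log y + β * ‖ξ‖ ^ 2) := by
  simp only [mul_add]
  exact Real.continuous_mul_log.add (by fun_prop)

namespace IsState

variable {Ω P : Set V3} {u : V3 → V3 → ℝ}

/-- Decay of every order absorbs the polynomial growth of `log u`. -/
lemma exists_log_decay (h : IsState Ω P u) (N n : ℕ) : ∃ C, 0 ≤ C ∧ ∀ X ∈ Ω, ∀ ξ,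
    u X ξ * ((1 + |Real.log (u X ξ)|) * (1 + ‖ξ‖) ^ N) ≤ C * wgt n ξ := by
  obtain ⟨k, C₁, h1⟩ := h.log_growth
  obtain ⟨C₂, h2⟩ := h.decay (n + (k + N))
  refine ⟨|C₂| * (1 + |C₁|), by positivity, fun X hX ξ => ?_⟩
  have hp : 1 ≤ (1 + ‖ξ‖) ^ k := one_le_pow₀ (one_le_one_add_norm ξ)
  have hl : 1 + |Real.log (u X ξ)| ≤ (1 + |C₁|) * (1 + ‖ξ‖) ^ k := by
    have h3 := (h1 X hX ξ).trans (mul_le_mul_of_nonneg_right (le_abs_self C₁) (by positivity))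
    linarith
  calc u X ξ * ((1 + |Real.log (u X ξ)|) * (1 + ‖ξ‖) ^ N)
      ≤ (|C₂| * wgt (n + (k + N)) ξ) * ((1 + |C₁|) * (1 + ‖ξ‖) ^ k * (1 + ‖ξ‖) ^ N) := by
        refine mul_le_mul ((h2 X hX ξ).trans (mul_le_mul_of_nonneg_right (le_abs_self C₂)
          (wgt_pos _ _).le)) (mul_le_mul_of_nonneg_right hl (by positivity)) (by positivity) ?_
        exact mul_nonneg (abs_nonneg _) (wgt_pos _ _).le
    _ = |C₂| * (1 + |C₁|) * (wgt (n + (k + N)) ξ * (1 + ‖ξ‖) ^ (k + N)) := by rw [pow_add]; ring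
    _ = _ := by rw [wgt_add_mul]

lemma abs_entropy_factor_le (β x : ℝ) (ξ : V3) :
    |x + β * ‖ξ‖ ^ 2| ≤ (1 + |β|) * ((1 + |x|) * (1 + ‖ξ‖) ^ 2) := by
  have h1 : 1 ≤ (1 + ‖ξ‖) ^ 2 := one_le_pow₀ (one_le_one_add_norm ξ)
  have h2 : ‖ξ‖ ^ 2 ≤ (1 + ‖ξ‖) ^ 2 :=
    pow_le_pow_left₀ (norm_nonneg ξ) (by linarith) 2
  calc |x + β * ‖ξ‖ ^ 2| ≤ |x| + |β| * ‖ξ‖ ^ 2 := by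
        refine (abs_add_le _ _).trans ?_
        rw [abs_mul, abs_of_nonneg (sq_nonneg ‖ξ‖)]
    _ ≤ (1 + |x|) * (1 + ‖ξ‖) ^ 2 + |β| * ((1 + |x|) * (1 + ‖ξ‖) ^ 2) := by
        have h3 : |x| ≤ (1 + |x|) * (1 + ‖ξ‖) ^ 2 := by nlinarith [abs_nonneg x]
        have h4 : ‖ξ‖ ^ 2 ≤ (1 + |x|) * (1 + ‖ξ‖) ^ 2 := by nlinarith [abs_nonneg x]
        exact add_le_add h3 (mul_le_mul_of_nonneg_left h4 (abs_nonneg β))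
    _ = _ := by ring

lemma exists_entropy_decay (h : IsState Ω P u) (β : ℝ) (n : ℕ) : ∃ C, 0 ≤ C ∧ ∀ X ∈ Ω, ∀ ξ,
    |u X ξ| ≤ C * wgt n ξ ∧ |entropyDensity β u X ξ| ≤ C * wgt n ξ := by
  obtain ⟨C, hC0, hC⟩ := h.exists_log_decay 2 n
  refine ⟨(1 + |β|) * C, by positivity, fun X hX ξ => ?_⟩
  have hu := (h.pos X hX ξ).le
  have h1 := hC X hX ξ
  have h2 : 1 ≤ (1 + ‖ξ‖) ^ 2 := one_le_pow₀ (one_le_one_add_norm ξ)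
  have h3 : 1 ≤ (1 + |Real.log (u X ξ)|) * (1 + ‖ξ‖) ^ 2 := by
    nlinarith [abs_nonneg (Real.log (u X ξ))]
  have hw : 0 ≤ C * wgt n ξ := mul_nonneg hC0 (wgt_pos _ _).le
  constructor
  · rw [abs_of_nonneg hu]
    have h4 : u X ξ * 1 ≤ C * wgt n ξ := (mul_le_mul_of_nonneg_left h3 hu).trans h1
    nlinarith [abs_nonneg β]
  · rw [entropyDensity, abs_mul, abs_of_nonneg hu]
    calc u X ξ * |Real.log (u X ξ) + β * ‖ξ‖ ^ 2|
        ≤ u X ξ * ((1 + |β|) * ((1 + |Real.log (u X ξ)|) * (1 + ‖ξ‖) ^ 2)) :=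
          mul_le_mul_of_nonneg_left (abs_entropy_factor_le β _ ξ) hu
      _ = (1 + |β|) * (u X ξ * ((1 + |Real.log (u X ξ)|) * (1 + ‖ξ‖) ^ 2)) := by ring
      _ ≤ (1 + |β|) * (C * wgt n ξ) := by gcongr
      _ = _ := by ring

lemma contDiffOn_entropy (h : IsState Ω P u) (β : ℝ) :
    ContDiffOn ℝ 1 (fun p : V3 × V3 => entropyDensity β u p.1 p.2) (Ω ×ˢ univ) := by
  have h1 : ContDiffOn ℝ 1 (fun p : V3 × V3 => Real.log (u p.1 p.2)) (Ω ×ˢ univ) :=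
    h.contDiffOn.log fun p hp => (h.pos p.1 hp.1 p.2).ne'
  have h2 : ContDiff ℝ 1 fun p : V3 × V3 => β * ‖p.2‖ ^ 2 :=
    contDiff_const.mul (contDiff_snd.norm_sq ℝ)
  exact h.contDiffOn.mul (h1.add h2.contDiffOn)

lemma hasFDerivAt_slice (h : IsState Ω P u) (hΩ : IsOpen Ω) {X : V3} (hX : X ∈ Ω) (ξ : V3) :
    HasFDerivAt (fun Y => u Y ξ) (fderiv ℝ (fun Y => u Y ξ) X) X :=
  (((contDiffOn_slice h.contDiffOn ξ).contDiffAt (hΩ.mem_nhds hX)).differentiableAt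
    (by simp)).hasFDerivAt

lemma gradient_entropy (h : IsState Ω P u) (hΩ : IsOpen Ω) (β : ℝ) {X : V3} (hX : X ∈ Ω) (ξ : V3) :
    gradient (fun Y => entropyDensity β u Y ξ) X
      = (1 + Real.log (u X ξ) + β * ‖ξ‖ ^ 2) • gradient (fun Y => u Y ξ) X := by
  have h1 := h.hasFDerivAt_slice hΩ hX ξ
  have h2 := h1.mul ((h1.log (h.pos X hX ξ).ne').add_const (β * ‖ξ‖ ^ 2))
  have h3 : fderiv ℝ (fun Y => entropyDensity β u Y ξ) X
      = (1 + Real.log (u X ξ) + β * ‖ξ‖ ^ 2) • fderiv ℝ (fun Y => u Y ξ) X := by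
    rw [show (fun Y => entropyDensity β u Y ξ)
      = (fun Y => u Y ξ) * fun Y => Real.log (u Y ξ) + β * ‖ξ‖ ^ 2 from rfl, h2.fderiv, smul_smul,
      mul_inv_cancel₀ (h.pos X hX ξ).ne', ← add_smul]
    congr 1; ring
  rw [gradient, h3, map_smul, gradient]

lemma exists_gradient_decay (h : IsState Ω P u) (hΩ : IsOpen Ω) (β : ℝ) {L : Set V3} (hL : L ⊆ Ω)
    (hLc : IsCompact L) (n : ℕ) : ∃ C, ∀ X ∈ L, ∀ ξ, |u X ξ| ≤ C * wgt n ξ ∧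
      ‖gradient (fun Y => u Y ξ) X‖ ≤ C * wgt n ξ ∧ |entropyDensity β u X ξ| ≤ C * wgt n ξ ∧
      ‖gradient (fun Y => entropyDensity β u Y ξ) X‖ ≤ C * wgt n ξ := by
  obtain ⟨C₁, hC₁, h1⟩ := h.exists_entropy_decay β n
  obtain ⟨k, C₂, h2⟩ := h.log_growth
  obtain ⟨C₃, h3⟩ := h.decay_gradient L hL hLc (n + (k + 2))
  obtain ⟨C₄, h4⟩ := h.decay_gradient L hL hLc n
  set K := (1 + (1 + |β|) * (1 + |C₂|)) * |C₃| with hK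
  refine ⟨C₁ + |C₄| + K, fun X hX ξ => ?_⟩
  have hw := (wgt_pos n ξ).le
  have hK0 : 0 ≤ K := by positivity
  have hle : ∀ {x y : ℝ}, x ≤ y * wgt n ξ → y ≤ C₁ + |C₄| + K → x ≤ (C₁ + |C₄| + K) * wgt n ξ :=
    fun hx hy => hx.trans (mul_le_mul_of_nonneg_right hy hw)
  refine ⟨hle (h1 X (hL hX) ξ).1 (by linarith [abs_nonneg C₄]),
    hle (h4 X hX ξ).1 (by linarith [le_abs_self C₄]),
    hle (h1 X (hL hX) ξ).2 (by linarith [abs_nonneg C₄]), hle ?_ (le_add_of_nonneg_left ?_)⟩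
  · rw [h.gradient_entropy hΩ β (hL hX), norm_smul, Real.norm_eq_abs]
    have hp : 1 ≤ (1 + ‖ξ‖) ^ k := one_le_pow₀ (one_le_one_add_norm ξ)
    have hp2 : 1 ≤ (1 + ‖ξ‖) ^ 2 := one_le_pow₀ (one_le_one_add_norm ξ)
    have hl : 1 + |Real.log (u X ξ)| ≤ (1 + |C₂|) * (1 + ‖ξ‖) ^ k := by
      have h5 := (h2 X (hL hX) ξ).trans (mul_le_mul_of_nonneg_right (le_abs_self C₂) (by positivity))
      linarith
    have hf : |1 + Real.log (u X ξ) + β * ‖ξ‖ ^ 2|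
        ≤ (1 + (1 + |β|) * (1 + |C₂|)) * (1 + ‖ξ‖) ^ (k + 2) := by
      have h6 := abs_entropy_factor_le β (Real.log (u X ξ)) ξ
      have h7 : 1 ≤ (1 + ‖ξ‖) ^ (k + 2) := one_le_pow₀ (one_le_one_add_norm ξ)
      calc _ ≤ 1 + |Real.log (u X ξ) + β * ‖ξ‖ ^ 2| := by
            rw [add_assoc]; exact (abs_add_le _ _).trans (by rw [abs_one])
        _ ≤ (1 + ‖ξ‖) ^ (k + 2)
            + (1 + |β|) * ((1 + |C₂|) * (1 + ‖ξ‖) ^ k * (1 + ‖ξ‖) ^ 2) := by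
          refine add_le_add h7 (h6.trans ?_)
          gcongr
        _ = _ := by rw [pow_add]; ring
    calc _ ≤ (1 + (1 + |β|) * (1 + |C₂|)) * (1 + ‖ξ‖) ^ (k + 2) * (|C₃| * wgt (n + (k + 2)) ξ) := by
          refine mul_le_mul hf ((h3 X hX ξ).1.trans (mul_le_mul_of_nonneg_right (le_abs_self C₃)
            (wgt_pos _ _).le)) (norm_nonneg _) (by positivity)
      _ = K * (wgt (n + (k + 2)) ξ * (1 + ‖ξ‖) ^ (k + 2)) := by rw [hK]; ring
      _ = _ := by rw [wgt_add_mul]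
  · positivity

end IsState

/-! ### Fluxes through the boundary of the cell -/

/-- The flux of mass, weighted with a potential `K`, through the boundary of the cell `C` vanishes,
and that of `u (log u + β |ξ|²)` is directed outward. -/
structure NonnegFlux (Ω C P : Set V3) (u : V3 → V3 → ℝ) (β : ℝ) : Prop where
  -- The bound on the transport integral has to be assumed here, as gradients of `u` are controlled
  -- only on compact parts of `Ω`. It will be supplied by the kinetic equation.
  mass : ∀ (K : V3 → ℝ) (B : V3 → V3), HasWeakGrad K B →
    (∃ c, ∀ X ∈ Ω, |K X| ≤ c ∧ ‖B X‖ ≤ c) → (∀ p ∈ P, ∀ X, K (X + p) = K X ∧ B (X + p) = B X) →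
    (∃ c, ∀ X ∈ Ω, |∫ ξ, inner ℝ ξ (gradient (fun Y => u Y ξ) X)| ≤ c) →
    IntegrableOn (fun X => inner ℝ (B X) (∫ ξ, u X ξ • ξ)
        + K X * ∫ ξ, inner ℝ ξ (gradient (fun Y => u Y ξ) X)) C ∧
      ∫ X in C, (inner ℝ (B X) (∫ ξ, u X ξ • ξ)
        + K X * ∫ ξ, inner ℝ ξ (gradient (fun Y => u Y ξ) X)) = 0
  entropy : (∃ c, ∀ X ∈ Ω, |∫ ξ, inner ℝ ξ (gradient (fun Y => entropyDensity β u Y ξ) X)| ≤ c) →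
    0 ≤ ∫ X in C, ∫ ξ, inner ℝ ξ (gradient (fun Y => entropyDensity β u Y ξ) X)

lemma measurable_chi_smul_moment {Ω : Set V3} (hΩ : IsOpen Ω) {h : V3 → V3 → ℝ}
    (hC : ContinuousOn (fun p : V3 × V3 => h p.1 p.2) (Ω ×ˢ univ)) :
    Measurable fun X => chi Ω X • ∫ ξ, h X ξ • ξ := by
  have h1 : Measurable fun X => ∫ ξ, (chi Ω X * h X ξ) • ξ :=
    (StronglyMeasurable.integral_prod_right (f := fun (X ξ : V3) => (chi Ω X * h X ξ) • ξ)
      ((measurable_chi_mul hΩ hC).smul measurable_snd).stronglyMeasurable).measurable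
  simpa only [mul_smul, integral_smul] using h1

lemma measurable_chi_mul_integral {Ω : Set V3} (hΩ : IsOpen Ω) {h : V3 → V3 → ℝ}
    (hC : ContinuousOn (fun p : V3 × V3 => h p.1 p.2) (Ω ×ˢ univ)) :
    Measurable fun X => chi Ω X * ∫ ξ, h X ξ := by
  have h1 : Measurable fun X => ∫ ξ, chi Ω X * h X ξ :=
    (StronglyMeasurable.integral_prod_right (f := fun (X ξ : V3) => chi Ω X * h X ξ)
      (measurable_chi_mul hΩ hC).stronglyMeasurable).measurable
  simpa only [integral_const_mul] using h1

lemma norm_integral_smul_le {u : V3 → ℝ} {C : ℝ} (h : ∀ ξ, |u ξ| ≤ C * wgt 5 ξ) :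
    ‖∫ ξ, u ξ • ξ‖ ≤ C * wgtMass := by
  refine norm_integral_le_wgtMass fun ξ => ?_
  have hC : 0 ≤ C := nonneg_of_mul_nonneg_left ((abs_nonneg _).trans (h ξ)) (wgt_pos 5 ξ)
  rw [norm_smul, Real.norm_eq_abs]
  calc |u ξ| * ‖ξ‖ ≤ C * wgt (4 + 1) ξ * ‖ξ‖ := mul_le_mul_of_nonneg_right (h ξ) (norm_nonneg _)
    _ = C * (‖ξ‖ * wgt (4 + 1) ξ) := by ring
    _ ≤ _ := mul_le_mul_of_nonneg_left (norm_le_pow 4 ξ) hC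

lemma integrable_smul_of_le {u : V3 → ℝ} (hm : AEStronglyMeasurable u volume) {C : ℝ}
    (h : ∀ ξ, |u ξ| ≤ C * wgt 5 ξ) : Integrable fun ξ => u ξ • ξ := by
  refine integrable_of_le_wgt (c := C) (n := 4) (hm.smul aestronglyMeasurable_id) le_rfl fun ξ => ?_
  have hC : 0 ≤ C := nonneg_of_mul_nonneg_left ((abs_nonneg _).trans (h ξ)) (wgt_pos 5 ξ)
  rw [norm_smul, Real.norm_eq_abs]
  calc |u ξ| * ‖ξ‖ ≤ C * wgt (4 + 1) ξ * ‖ξ‖ := mul_le_mul_of_nonneg_right (h ξ) (norm_nonneg _)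
    _ = C * (‖ξ‖ * wgt (4 + 1) ξ) := by ring
    _ ≤ _ := mul_le_mul_of_nonneg_left (norm_le_pow 4 ξ) hC

/-! ### Bounds and measurability of transport terms -/

section Cell

variable {Ω C P : Set V3} {u : V3 → V3 → ℝ}

/-- The data of the transport of `h` in the cell. -/
lemma transport_data (hcell : IsCell Ω C P) {h : V3 → V3 → ℝ}
    (hC : ContDiffOn ℝ 1 (fun p : V3 × V3 => h p.1 p.2) (Ω ×ˢ univ))
    {c₀ : ℝ} (hb : ∀ X ∈ Ω, ∀ ξ, |h X ξ| ≤ c₀ * wgt 5 ξ)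
    {K : V3 → ℝ} {B : V3 → V3} (hK : HasWeakGrad K B)
    {c : ℝ} (hc : ∀ X ∈ Ω, |K X| ≤ c ∧ ‖B X‖ ≤ c) {c' : ℝ}
    (hc' : ∀ X ∈ Ω, |∫ ξ, inner ℝ ξ (gradient (fun Y => h Y ξ) X)| ≤ c') :
    (Measurable fun X => chi Ω X • K X • ∫ ξ, h X ξ • ξ) ∧
    (Measurable fun X => chi Ω X * (inner ℝ (B X) (∫ ξ, h X ξ • ξ)
        + K X * ∫ ξ, inner ℝ ξ (gradient (fun Y => h Y ξ) X))) ∧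
    (∃ a, ∀ X ∈ Ω, ‖K X • ∫ ξ, h X ξ • ξ‖ ≤ a ∧ |inner ℝ (B X) (∫ ξ, h X ξ • ξ)
        + K X * ∫ ξ, inner ℝ ξ (gradient (fun Y => h Y ξ) X)| ≤ a) ∧
    IntegrableOn (fun X => inner ℝ (B X) (∫ ξ, h X ξ • ξ)
        + K X * ∫ ξ, inner ℝ ξ (gradient (fun Y => h Y ξ) X)) C := by
  have m1 := measurable_chi_smul_moment hcell.isOpen hC.continuousOn
  have m2 := measurable_chi_mul_integral (h := fun X ξ => inner ℝ ξ (gradient (fun Y => h Y ξ) X))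
    hcell.isOpen (continuousOn_transport hcell.isOpen hC)
  have hm2 : Measurable fun X => chi Ω X * (inner ℝ (B X) (∫ ξ, h X ξ • ξ)
        + K X * ∫ ξ, inner ℝ ξ (gradient (fun Y => h Y ξ) X)) := by
    have h1 : Measurable fun X => inner ℝ (B X) (chi Ω X • ∫ ξ, h X ξ • ξ)
        + K X * (chi Ω X * ∫ ξ, inner ℝ ξ (gradient (fun Y => h Y ξ) X)) :=
      (hK.measurable.inner m1).add (hK.measurable_fun.mul m2)
    simpa only [real_inner_smul_right, mul_left_comm (K _), ← mul_add] using h1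
  have hbd : ∀ X ∈ Ω, ‖K X • ∫ ξ, h X ξ • ξ‖ ≤ |c| * (|c₀| * wgtMass) + |c| * |c'| ∧
      |inner ℝ (B X) (∫ ξ, h X ξ • ξ)
        + K X * ∫ ξ, inner ℝ ξ (gradient (fun Y => h Y ξ) X)|
        ≤ |c| * (|c₀| * wgtMass) + |c| * |c'| := by
    intro X hX
    have h1 : ‖∫ ξ, h X ξ • ξ‖ ≤ |c₀| * wgtMass := norm_integral_smul_le fun ξ =>
      (hb X hX ξ).trans (mul_le_mul_of_nonneg_right (le_abs_self _) (wgt_pos _ _).le)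
    have h2 := (hc X hX).1.trans (le_abs_self c)
    have h3 := (hc X hX).2.trans (le_abs_self c)
    have h4 := (hc' X hX).trans (le_abs_self c')
    have h5 : 0 ≤ |c| * |c'| := by positivity
    refine ⟨?_, (abs_add_le _ _).trans (add_le_add ?_ ?_)⟩
    · rw [norm_smul]
      have := mul_le_mul h2 h1 (norm_nonneg _) (abs_nonneg c)
      exact this.trans (by linarith)
    · exact (abs_real_inner_le_norm _ _).trans (mul_le_mul h3 h1 (norm_nonneg _) (abs_nonneg c))
    · rw [abs_mul]; exact mul_le_mul h2 h4 (abs_nonneg _) (abs_nonneg c)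
  refine ⟨?_, hm2, ⟨_, hbd⟩, ?_⟩
  · have h1 : Measurable fun X => K X • chi Ω X • ∫ ξ, h X ξ • ξ := hK.measurable_fun.smul m1
    simpa only [smul_comm (K _)] using h1
  · have h1 : IntegrableOn (fun X => chi Ω X * (inner ℝ (B X) (∫ ξ, h X ξ • ξ)
        + K X * ∫ ξ, inner ℝ ξ (gradient (fun Y => h Y ξ) X))) C := by
      refine Measure.integrableOn_of_bounded (M := |c| * (|c₀| * wgtMass) + |c| * |c'|)
        hcell.measure_lt_top.ne hm2.aestronglyMeasurable ?_
      filter_upwards [ae_restrict_mem hcell.measurableSet] with X hX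
      rw [chi_of_mem (hcell.subset hX), one_mul]
      exact (hbd X (hcell.subset hX)).2
    refine h1.congr_fun (fun X hX => ?_) hcell.measurableSet
    simp only
    rw [chi_of_mem (hcell.subset hX), one_mul]

end Cell

/-! ### Fluxes in a periodic gas -/

section Periodic

variable {u : V3 → V3 → ℝ}

lemma setIntegral_transport_periodic (b : Module.Basis (Fin 3) ℝ V3) {h : V3 → V3 → ℝ}
    (hC : ContDiffOn ℝ 1 (fun p : V3 × V3 => h p.1 p.2) (univ ×ˢ univ))
    (hp : ∀ i X ξ, h (X + b i) ξ = h X ξ)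
    {c₀ : ℝ} (hb : ∀ X ξ, |h X ξ| ≤ c₀ * wgt 5 ξ)
    (hd : ∀ L, IsCompact L → ∃ C, ∀ X ∈ L, ∀ ξ,
      |h X ξ| ≤ C * wgt 5 ξ ∧ ‖gradient (fun Y => h Y ξ) X‖ ≤ C * wgt 5 ξ)
    {K : V3 → ℝ} {B : V3 → V3} (hK : HasWeakGrad K B)
    {c : ℝ} (hc : ∀ X, |K X| ≤ c ∧ ‖B X‖ ≤ c)
    (hKp : ∀ i X, K (X + b i) = K X ∧ B (X + b i) = B X) {c' : ℝ}
    (hc' : ∀ X, |∫ ξ, inner ℝ ξ (gradient (fun Y => h Y ξ) X)| ≤ c') :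
    ∫ X in ZSpan.fundamentalDomain b, (inner ℝ (B X) (∫ ξ, h X ξ • ξ)
        + K X * ∫ ξ, inner ℝ ξ (gradient (fun Y => h Y ξ) X)) = 0 := by
  obtain ⟨m1, m2, ⟨a, ha⟩, _⟩ := transport_data (isCell_fundamentalDomain b) hC (fun X _ => hb X) hK
    (fun X _ => hc X) fun X _ => hc' X
  have hgp : ∀ i X ξ, gradient (fun Y => h Y ξ) (X + b i) = gradient (fun Y => h Y ξ) X := by
    intro i X ξ
    rw [gradient, gradient, ← fderiv_comp_add_right]
    simp only [hp]
  refine setIntegral_div_periodic b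
    (weakDiv_transport isOpen_univ hK hC fun L _ hL => hd L hL)
    (fun i X => by simp only [hp, hKp]) (fun i X => by simp only [hp, hKp, hgp])
    (by simpa [chi] using m1) (by simpa [chi] using m2) (c := a) (fun X => (ha X (mem_univ X)).1)
    fun X => (ha X (mem_univ X)).2

/-- A period cell has no boundary, so both fluxes vanish. The entropy flux is the case of the
constant potential `1`. -/
lemma nonnegFlux_periodic (b : Module.Basis (Fin 3) ℝ V3) (hu : IsState univ (range b) u) (β : ℝ) :
    NonnegFlux univ (ZSpan.fundamentalDomain b) (range b) u β where
  mass K B hK hc hp hc' := by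
    obtain ⟨c, hc⟩ := hc
    obtain ⟨c', hc'⟩ := hc'
    obtain ⟨C, _, hC⟩ := hu.exists_entropy_decay β 5
    refine ⟨(transport_data (isCell_fundamentalDomain b) hu.contDiffOn
      (fun X hX ξ => (hC X hX ξ).1) hK hc hc').2.2.2, ?_⟩
    refine setIntegral_transport_periodic b hu.contDiffOn
      (fun i X ξ => hu.periodic _ ⟨i, rfl⟩ X ξ) (fun X ξ => (hC X (mem_univ X) ξ).1)
      (fun L hL => ?_) hK (fun X => hc X (mem_univ X)) (fun i X => hp _ ⟨i, rfl⟩ X)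
      fun X => hc' X (mem_univ X)
    obtain ⟨C', h'⟩ := hu.exists_gradient_decay isOpen_univ β (subset_univ L) hL 5
    exact ⟨C', fun X hX ξ => ⟨(h' X hX ξ).1, (h' X hX ξ).2.1⟩⟩
  entropy hc' := by
    obtain ⟨c', hc'⟩ := hc'
    obtain ⟨C, _, hC⟩ := hu.exists_entropy_decay β 5
    have := setIntegral_transport_periodic b (hu.contDiffOn_entropy β)
      (fun i X ξ => by simp only [entropyDensity, hu.periodic _ ⟨i, rfl⟩ X ξ])
      (fun X ξ => (hC X (mem_univ X) ξ).2)
      (fun L hL => ?_) hasWeakGrad_one (c := 1) (fun X => by simp) (fun i X => by simp)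
      fun X => hc' X (mem_univ X)
    · simp only [inner_zero_left, zero_add, one_mul] at this
      exact this.ge
    · obtain ⟨C', h'⟩ := hu.exists_gradient_decay isOpen_univ β (subset_univ L) hL 5
      exact ⟨C', fun X hX ξ => (h' X hX ξ).2.2⟩

end Periodic

/-! ### Boundary conditions -/

section Boundary

variable {D : Set V3} {ψ : V3 → ℝ} {u : V3 → V3 → ℝ}

/-- Continuous boundary values at a fixed time. -/
def HasTrace (D : Set V3) (ψ : V3 → ℝ) (u : V3 → V3 → ℝ) : Prop :=
  ContinuousOn (fun p : V3 × V3 => u p.1 p.2)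
    {p | p.1 ∈ closure D ∧ (p.1 ∈ frontier D → inner ℝ p.2 (normal ψ p.1) ≠ 0)}

lemma HasTrace.tendsto (hb : HasTrace D ψ u) (hD : IsC1Domain D ψ) {X₀ : V3} (hX₀ : X₀ ∈ frontier D)
    {ξ : V3} (hξ : (inner ℝ ξ (normal ψ X₀) : ℝ) ≠ 0) :
    Tendsto (fun X => u X ξ) (𝓝[D] X₀) (𝓝 (u X₀ ξ)) := by
  have h1 := hb (X₀, ξ) ⟨frontier_subset_closure hX₀, fun _ => hξ⟩
  have h2 : Tendsto (fun X : V3 => (X, ξ)) (𝓝[D] X₀)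
      (𝓝[{p | p.1 ∈ closure D ∧ (p.1 ∈ frontier D → inner ℝ p.2 (normal ψ p.1) ≠ 0)}] (X₀, ξ)) := by
    refine tendsto_nhdsWithin_iff.2 ⟨?_, ?_⟩
    · exact ((Continuous.prodMk_left ξ).tendsto X₀).mono_left nhdsWithin_le_nhds
    · filter_upwards [self_mem_nhdsWithin] with X hX
      refine ⟨subset_closure hX, fun h => ?_⟩
      rw [hD.isOpen.frontier_eq] at h
      exact absurd hX h.2
  exact h1.tendsto.comp h2

-- At tangential velocities the boundary values are arbitrary. Cut off there, they are continuous on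
-- an open set and zero elsewhere, hence measurable.
open Classical in
lemma HasTrace.measurable_indicator (hb : HasTrace D ψ u) {X₀ : V3}
    (hX₀ : X₀ ∈ frontier D) :
    Measurable ({ξ : V3 | (inner ℝ ξ (normal ψ X₀) : ℝ) ≠ 0}.indicator (u X₀)) := by
  have hS : IsOpen {ξ : V3 | (inner ℝ ξ (normal ψ X₀) : ℝ) ≠ 0} :=
    isOpen_ne_fun (by fun_prop) continuous_const
  have hc : ContinuousOn (u X₀) {ξ : V3 | (inner ℝ ξ (normal ψ X₀) : ℝ) ≠ 0} :=
    ContinuousOn.comp (f := fun ξ : V3 => (X₀, ξ)) hb (by fun_prop)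
      fun ξ hξ => ⟨frontier_subset_closure hX₀, fun _ => hξ⟩
  have h := hc.measurable_piecewise (g := fun _ => (0 : ℝ)) continuousOn_const hS.measurableSet
  convert h using 1
  ext ξ
  simp only [indicator, Set.piecewise]
  congr

lemma HasTrace.aestronglyMeasurable (hb : HasTrace D ψ u) (hD : IsC1Domain D ψ) {X₀ : V3}
    (hX₀ : X₀ ∈ frontier D) : AEStronglyMeasurable (u X₀) volume := by
  refine ⟨_, (hb.measurable_indicator hX₀).stronglyMeasurable, ?_⟩
  have hn : normal ψ X₀ ≠ 0 := fun h => by have := hD.norm_normal hX₀; simp [h] at this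
  filter_upwards [ae_inner_ne_zero hn] with ξ hξ
  rw [indicator_of_mem (show ξ ∈ {ξ : V3 | (inner ℝ ξ (normal ψ X₀) : ℝ) ≠ 0} from hξ)]

lemma neBot_of_mem_frontier {X₀ : V3} (hX₀ : X₀ ∈ frontier D) : (𝓝[D] X₀).NeBot :=
  mem_closure_iff_nhdsWithin_neBot.1 (frontier_subset_closure hX₀)

lemma HasTrace.le_of_forall (hb : HasTrace D ψ u) (hD : IsC1Domain D ψ) {X₀ : V3}
    (hX₀ : X₀ ∈ frontier D) {ξ : V3} (hξ : (inner ℝ ξ (normal ψ X₀) : ℝ) ≠ 0) {Λ : ℝ → ℝ}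
    (hΛ : Continuous Λ) {c : ℝ} (h : ∀ X ∈ D, |Λ (u X ξ)| ≤ c) : |Λ (u X₀ ξ)| ≤ c := by
  have := neBot_of_mem_frontier hX₀
  refine le_of_tendsto ((hΛ.tendsto _).comp (hb.tendsto hD hX₀ hξ)).abs ?_
  filter_upwards [self_mem_nhdsWithin] with X hX using h X hX

/-- Strict positivity survives the limit because the bound on `log u` is uniform in `X`: the values
stay above `exp (-C (1 + ‖ξ‖)ⁿ)`. -/
lemma HasTrace.pos (hb : HasTrace D ψ u) (hD : IsC1Domain D ψ) (hu : IsState D ∅ u) {X₀ : V3}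
    (hX₀ : X₀ ∈ frontier D) {ξ : V3} (hξ : (inner ℝ ξ (normal ψ X₀) : ℝ) ≠ 0) : 0 < u X₀ ξ := by
  have := neBot_of_mem_frontier hX₀
  obtain ⟨n, C, hC⟩ := hu.log_growth
  refine (Real.exp_pos (-(C * (1 + ‖ξ‖) ^ n))).trans_le (ge_of_tendsto (hb.tendsto hD hX₀ hξ) ?_)
  filter_upwards [self_mem_nhdsWithin] with X hX
  rw [← Real.exp_log (hu.pos X hX ξ)]
  exact Real.exp_le_exp.2 (neg_le_of_abs_le (hC X hX ξ))

lemma IsState.continuous_slice {Ω P : Set V3} (hu : IsState Ω P u) {X : V3} (hX : X ∈ Ω) :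
    Continuous (u X) := by
  have : ContinuousOn (u X) univ :=
    ContinuousOn.comp (f := fun ξ : V3 => (X, ξ)) hu.contDiffOn.continuousOn (by fun_prop)
      fun ξ _ => ⟨hX, mem_univ _⟩
  exact continuousOn_univ.1 this

/-- The normal component of a moment at the boundary. -/
lemma HasTrace.tendsto_flux (hb : HasTrace D ψ u) (hD : IsC1Domain D ψ) (hu : IsState D ∅ u)
    {Λ : V3 → ℝ → ℝ} (hΛ : Continuous fun p : V3 × ℝ => Λ p.1 p.2) {C : ℝ}
    (hC : ∀ X ∈ D, ∀ ξ, |Λ ξ (u X ξ)| ≤ C * wgt 5 ξ) {X₀ : V3} (hX₀ : X₀ ∈ frontier D) :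
    Tendsto (fun X => inner ℝ (∫ ξ, Λ ξ (u X ξ) • ξ) (gradient ψ X)) (𝓝[D] X₀)
      (𝓝 (‖gradient ψ X₀‖ * ∫ ξ, Λ ξ (u X₀ ξ) * inner ℝ ξ (normal ψ X₀))) := by
  have hn : normal ψ X₀ ≠ 0 := fun h => by have := hD.norm_normal hX₀; simp [h] at this
  have hm : ∀ X ∈ D, Continuous fun ξ => Λ ξ (u X ξ) := fun X hX =>
    hΛ.comp (continuous_id.prodMk (hu.continuous_slice hX))
  have hC0 : 0 ≤ C := by
    obtain ⟨X, hX⟩ := (neBot_of_mem_frontier hX₀).nonempty_of_mem self_mem_nhdsWithin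
    exact nonneg_of_mul_nonneg_left ((abs_nonneg _).trans (hC X hX 0)) (wgt_pos 5 0)
  have hb4 : ∀ X ∈ D, ∀ ξ, ‖Λ ξ (u X ξ) • ξ‖ ≤ C * wgt 4 ξ := fun X hX ξ => by
    rw [norm_smul, Real.norm_eq_abs]
    calc _ ≤ C * wgt (4 + 1) ξ * ‖ξ‖ := mul_le_mul_of_nonneg_right (hC X hX ξ) (norm_nonneg _)
      _ = C * (‖ξ‖ * wgt (4 + 1) ξ) := by ring
      _ ≤ _ := mul_le_mul_of_nonneg_left (norm_le_pow 4 ξ) hC0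
  have hlim : Tendsto (fun X => ∫ ξ, Λ ξ (u X ξ) • ξ) (𝓝[D] X₀) (𝓝 (∫ ξ, Λ ξ (u X₀ ξ) • ξ)) := by
    refine tendsto_integral_filter_of_dominated_convergence (fun ξ => C * wgt 4 ξ) ?_ ?_
      ((integrable_wgt le_rfl).const_mul C) ?_
    · filter_upwards [self_mem_nhdsWithin] with X hX
      exact ((hm X hX).smul continuous_id).aestronglyMeasurable
    · filter_upwards [self_mem_nhdsWithin] with X hX
      exact Eventually.of_forall (hb4 X hX)
    · filter_upwards [ae_inner_ne_zero hn] with ξ hξ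
      have h1 : Continuous (Λ ξ) := hΛ.comp (Continuous.prodMk_right ξ)
      exact ((h1.tendsto _).comp (hb.tendsto hD hX₀ hξ)).smul_const ξ
  have hi : Integrable fun ξ => Λ ξ (u X₀ ξ) • ξ := by
    refine Integrable.mono' ((integrable_wgt le_rfl).const_mul C) ?_ ?_
    · have h2 : AEStronglyMeasurable (fun ξ => Λ ξ (u X₀ ξ)) volume := by
        obtain ⟨g, hg, hg'⟩ := hb.aestronglyMeasurable hD hX₀
        refine ⟨fun ξ => Λ ξ (g ξ), (hΛ.measurable.comp
          (measurable_id.prodMk hg.measurable)).stronglyMeasurable, ?_⟩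
        filter_upwards [hg'] with ξ h using by rw [h]
      exact h2.smul aestronglyMeasurable_id
    · filter_upwards [ae_inner_ne_zero hn] with ξ hξ
      have h1 : Continuous (Λ ξ) := hΛ.comp (Continuous.prodMk_right ξ)
      have h3 := hb.le_of_forall hD hX₀ hξ h1 fun X hX => hC X hX ξ
      rw [norm_smul, Real.norm_eq_abs]
      calc _ ≤ C * wgt (4 + 1) ξ * ‖ξ‖ := mul_le_mul_of_nonneg_right h3 (norm_nonneg _)
        _ = C * (‖ξ‖ * wgt (4 + 1) ξ) := by ring
        _ ≤ _ := mul_le_mul_of_nonneg_left (norm_le_pow 4 ξ) hC0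
  have hval : ‖gradient ψ X₀‖ * ∫ ξ, Λ ξ (u X₀ ξ) * inner ℝ ξ (normal ψ X₀)
      = inner ℝ (∫ ξ, Λ ξ (u X₀ ξ) • ξ) (gradient ψ X₀) := by
    rw [real_inner_comm, ← integral_inner hi, ← integral_const_mul]
    refine integral_congr_ae (Eventually.of_forall fun ξ => ?_)
    simp only
    have hg : ‖gradient ψ X₀‖ ≠ 0 :=
      norm_ne_zero_iff.2 (hD.gradient_ne_zero X₀ (hD.mem_frontier_iff.1 hX₀).2)
    rw [normal, real_inner_smul_right, real_inner_smul_right, real_inner_comm]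
    field_simp
  rw [hval]
  exact hlim.inner (((continuous_gradient hD.contDiff).tendsto X₀).mono_left nhdsWithin_le_nhds)

/-- The normal fluxes at the boundary determine those through the boundary. -/
lemma nonnegFlux_of_trace (hb : HasTrace D ψ u) (hD : IsC1Domain D ψ) (hu : IsState D ∅ u) {β : ℝ}
    (h0 : ∀ X₀ ∈ frontier D, ∫ ξ, u X₀ ξ * inner ℝ ξ (normal ψ X₀) = 0)
    (h1 : ∀ X₀ ∈ frontier D, 0 ≤ ∫ ξ, entropyDensity β u X₀ ξ * inner ℝ ξ (normal ψ X₀)) :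
    NonnegFlux D D ∅ u β where
  mass K B hK hc _ hc' := by
    obtain ⟨c, hc⟩ := hc
    obtain ⟨c', hc'⟩ := hc'
    obtain ⟨C, _, hC⟩ := hu.exists_entropy_decay β 5
    have hi := (transport_data (isCell_of_bounded hD.isOpen hD.bounded) hu.contDiffOn
      (fun X hX ξ => (hC X hX ξ).1) hK hc hc').2.2.2
    refine ⟨hi, setIntegral_div_eq_zero hD
      (weakDiv_transport hD.isOpen hK hu.contDiffOn fun L hL hLc => ?_) hi fun X₀ hX₀ => ?_⟩
    · obtain ⟨C', h'⟩ := hu.exists_gradient_decay hD.isOpen β hL hLc 5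
      exact ⟨C', fun X hX ξ => ⟨(h' X hX ξ).1, (h' X hX ξ).2.1⟩⟩
    · have h2 := hb.tendsto_flux hD hu (Λ := fun _ y => y) continuous_snd
        (fun X hX ξ => (hC X hX ξ).1) hX₀
      rw [h0 X₀ hX₀, mul_zero] at h2
      -- `K` need not have boundary values: the normal mass flux tends to zero, and `K` is bounded.
      rw [tendsto_zero_iff_abs_tendsto_zero]
      have h3 := (tendsto_zero_iff_abs_tendsto_zero _).1 h2 |>.const_mul c
      rw [mul_zero] at h3
      refine squeeze_zero' (Eventually.of_forall fun _ => abs_nonneg _) ?_ h3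
      filter_upwards [self_mem_nhdsWithin] with X hX
      simp only [Function.comp_apply, real_inner_smul_left, abs_mul]
      exact mul_le_mul_of_nonneg_right (hc X hX).1 (abs_nonneg _)
  entropy hc' := by
    obtain ⟨c', hc'⟩ := hc'
    obtain ⟨C, _, hC⟩ := hu.exists_entropy_decay β 5
    have hi := (transport_data (isCell_of_bounded hD.isOpen hD.bounded) (hu.contDiffOn_entropy β)
      (fun X hX ξ => (hC X hX ξ).2) hasWeakGrad_one (c := 1) (fun X _ => by simp) hc').2.2.2
    have := setIntegral_div_nonneg hD
      (weakDiv_transport hD.isOpen hasWeakGrad_one (hu.contDiffOn_entropy β) fun L hL hLc => ?_) hi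
      fun X₀ hX₀ δ hδ => ?_
    · simpa only [inner_zero_left, zero_add, one_mul] using this
    · obtain ⟨C', h'⟩ := hu.exists_gradient_decay hD.isOpen β hL hLc 5
      exact ⟨C', fun X hX ξ => (h' X hX ξ).2.2⟩
    · have hΛ : Continuous fun p : V3 × ℝ => p.2 * (Real.log p.2 + β * ‖p.1‖ ^ 2) := by
        simp only [mul_add]
        exact (Real.continuous_mul_log.comp continuous_snd).add (by fun_prop)
      have h2 := hb.tendsto_flux hD hu (Λ := fun ξ y => y * (Real.log y + β * ‖ξ‖ ^ 2)) hΛ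
        (fun X hX ξ => (hC X hX ξ).2) hX₀
      simp only [one_smul]
      refine h2.eventually (le_mem_nhds (lt_of_lt_of_le (neg_lt_zero.2 hδ) ?_))
      exact mul_nonneg (norm_nonneg _) (h1 X₀ hX₀)

/-- Specular reflection. -/
lemma nonnegFlux_specular (hb : HasTrace D ψ u) (hD : IsC1Domain D ψ) (hu : IsState D ∅ u) (β : ℝ)
    (h : ∀ X ∈ frontier D, ∀ ξ : V3, inner ℝ ξ (normal ψ X) < 0 →
      u X ξ = u X (ξ - (2 * inner ℝ ξ (normal ψ X)) • normal ψ X)) :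
    NonnegFlux D D ∅ u β := by
  have key : ∀ (Λ : ℝ → ℝ → ℝ) (X₀), X₀ ∈ frontier D →
      ∫ ξ, Λ ‖ξ‖ (u X₀ ξ) * inner ℝ ξ (normal ψ X₀) = 0 := by
    intro Λ X₀ hX₀
    have hn := hD.norm_normal hX₀
    set n := normal ψ X₀ with hn'
    -- Reflection in the tangent plane preserves Lebesgue measure, the speed and the boundary
    -- values, and reverses the normal velocity. The integrand is odd under it, so every such
    -- integral vanishes.
    set R := (Submodule.span ℝ {n})ᗮ.reflection with hR
    have hRe : ∀ ξ, R ξ = ξ - (2 * inner ℝ ξ n) • n := fun ξ => by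
      rw [hR, Submodule.reflection_orthogonal_apply, Submodule.reflection_singleton_apply, hn]
      simp only [RCLike.ofReal_real_eq_id, id, one_pow, div_one, real_inner_comm n ξ, neg_sub,
        two_smul, two_mul, add_smul]
    have hRi : ∀ ξ, inner ℝ (R ξ) n = -inner ℝ ξ n := fun ξ => by
      rw [hRe, inner_sub_left, real_inner_smul_left, real_inner_self_eq_norm_sq, hn]; ring
    have hRu : ∀ ξ, (inner ℝ ξ n : ℝ) ≠ 0 → u X₀ (R ξ) = u X₀ ξ := by
      intro ξ hξ
      rcases lt_or_gt_of_ne hξ with h1 | h1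
      · rw [hRe, ← h X₀ hX₀ ξ h1]
      · have h2 := h X₀ hX₀ (R ξ) (by rw [hRi]; linarith)
        rw [h2, ← hRe, hR, Submodule.reflection_reflection]
    have hi : ∫ ξ, Λ ‖R ξ‖ (u X₀ (R ξ)) * inner ℝ (R ξ) n = ∫ ξ, Λ ‖ξ‖ (u X₀ ξ) * inner ℝ ξ n :=
      R.measurePreserving.integral_comp R.toHomeomorph.measurableEmbedding
        (g := fun ξ => Λ ‖ξ‖ (u X₀ ξ) * inner ℝ ξ n)
    have hneg : ∫ ξ, Λ ‖R ξ‖ (u X₀ (R ξ)) * inner ℝ (R ξ) n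
        = -∫ ξ, Λ ‖ξ‖ (u X₀ ξ) * inner ℝ ξ n := by
      rw [← integral_neg]
      refine integral_congr_ae (Eventually.of_forall fun ξ => ?_)
      simp only
      by_cases h0 : (inner ℝ ξ n : ℝ) = 0
      · rw [hRi, h0]; simp
      · rw [hRi, hRu ξ h0, R.norm_map]; ring
    linarith
  exact nonnegFlux_of_trace hb hD hu (key fun _ y => y)
    fun X₀ hX₀ => (key (fun r y => y * (Real.log y + β * r ^ 2)) X₀ hX₀).ge

/-- The surface of a heat bath. -/
lemma nonnegFlux_scattered (hb : HasTrace D ψ u) (hD : IsC1Domain D ψ) (hu : IsState D ∅ u)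
    {Rg Tw : ℝ} (hR : 0 < Rg) (hT : 0 < Tw) {κ : V3 → Kernel V3 V3}
    (hκ : IsHeatBathWall Rg Tw D ψ κ)
    (h : ∀ X ∈ frontier D, (outFlux (normal ψ X) (u X)).bind (κ X) = inFlux (normal ψ X) (u X)) :
    NonnegFlux D D ∅ u (1 / (2 * Rg * Tw)) := by
  set β := 1 / (2 * Rg * Tw) with hβ
  obtain ⟨C₁, hC₁0, hC₁⟩ := hu.exists_entropy_decay β 5
  obtain ⟨C₂, hC₂⟩ := wallMaxwellian_le hR hT 5
  have hΛ : ∀ ξ : V3, Continuous fun y : ℝ => y * (Real.log y + β * ‖ξ‖ ^ 2) :=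
    continuous_entropy_profile β
  refine nonnegFlux_of_trace hb hD hu (fun X₀ hX₀ => ?_) fun X₀ hX₀ => ?_
  · have hn := hD.norm_normal hX₀
    have hn0 : normal ψ X₀ ≠ 0 := fun h => by simp [h] at hn
    have := (hκ X₀ hX₀).1
    refine integral_mul_inner_eq_zero_of_scattered (κ := κ X₀) (C := C₁) hn
      (hb.aestronglyMeasurable hD hX₀) ?_ ?_ (h X₀ hX₀)
    · filter_upwards [ae_inner_ne_zero hn0] with ξ hξ using (hb.pos hD hu hX₀ hξ).le
    · filter_upwards [ae_inner_ne_zero hn0] with ξ hξ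
      exact hb.le_of_forall hD hX₀ hξ (Λ := fun y => y) continuous_id fun X hX => (hC₁ X hX ξ).1
  · have hn := hD.norm_normal hX₀
    have := (hκ X₀ hX₀).1
    set n := normal ψ X₀ with hn'
    set S := {ξ : V3 | (inner ℝ ξ n : ℝ) ≠ 0} with hS
    -- Setting the boundary values to zero at tangential velocities makes them measurable,
    -- non-negative and bounded everywhere; the flux measures carry the factor `ξ · n` and do not
    -- notice.
    set φ := S.indicator (u X₀) with hφ
    have hφS : ∀ ξ, (inner ℝ ξ n : ℝ) ≠ 0 → φ ξ = u X₀ ξ := fun ξ hξ =>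
      indicator_of_mem (show ξ ∈ S from hξ) _
    have hφ0 : ∀ ξ, ¬ (inner ℝ ξ n : ℝ) ≠ 0 → φ ξ = 0 := fun ξ hξ =>
      indicator_of_notMem (show ξ ∉ S from hξ) _
    have hpos : ∀ ξ, (inner ℝ ξ n : ℝ) ≠ 0 → 0 < φ ξ := fun ξ hξ => by
      rw [hφS ξ hξ]; exact hb.pos hD hu hX₀ hξ
    have hlog : ∀ ξ, φ ξ * Real.log (φ ξ / wallMaxwellian Rg Tw ξ)
        = φ ξ * (Real.log (φ ξ) + β * ‖ξ‖ ^ 2) := by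
      intro ξ
      by_cases hξ : (inner ℝ ξ n : ℝ) ≠ 0
      · rw [Real.log_div (hpos ξ hξ).ne' (wallMaxwellian_pos _ _ _).ne', log_wallMaxwellian, hβ]
        ring
      · rw [hφ0 ξ hξ]; simp
    set M := max C₁ C₂ with hM
    have hM1 : ∀ {x : ℝ} {ξ}, x ≤ C₁ * wgt 5 ξ → x ≤ M * wgt 5 ξ := fun hx =>
      hx.trans (mul_le_mul_of_nonneg_right (le_max_left _ _) (wgt_pos _ _).le)
    have hM0 : ∀ ξ : V3, 0 ≤ M * wgt 5 ξ := fun ξ =>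
      mul_nonneg (hC₁0.trans (le_max_left _ _)) (wgt_pos _ _).le
    have key := integral_mul_log_mul_inner_nonneg (n := n) (φ := φ) (w := wallMaxwellian Rg Tw)
      (C := M) (κ := κ X₀) hn (hb.measurable_indicator hX₀)
      (continuous_wallMaxwellian Rg Tw).measurable (wallMaxwellian_pos Rg Tw) hpos ?_ ?_ ?_ ?_
      (hκ X₀ hX₀).2 ?_
    · refine key.trans_eq (integral_congr_ae (Eventually.of_forall fun ξ => ?_))
      simp only
      by_cases hξ : (inner ℝ ξ n : ℝ) ≠ 0
      · rw [hlog, hφS ξ hξ, entropyDensity]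
      · rw [not_not.1 hξ, mul_zero, mul_zero]
    · intro ξ
      by_cases hξ : (inner ℝ ξ n : ℝ) ≠ 0
      · exact (hpos ξ hξ).le
      · exact (hφ0 ξ hξ).ge
    · intro ξ
      by_cases hξ : (inner ℝ ξ n : ℝ) ≠ 0
      · rw [hφS ξ hξ]
        exact hM1 (hb.le_of_forall hD hX₀ hξ (Λ := fun y => y) continuous_id
          fun X hX => (hC₁ X hX ξ).1)
      · rw [hφ0 ξ hξ, abs_zero]; exact hM0 ξ
    · intro ξ
      rw [abs_of_pos (wallMaxwellian_pos _ _ _)]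
      exact (hC₂ ξ).trans (mul_le_mul_of_nonneg_right (le_max_right _ _) (wgt_pos _ _).le)
    · intro ξ
      rw [hlog]
      by_cases hξ : (inner ℝ ξ n : ℝ) ≠ 0
      · rw [hφS ξ hξ]
        exact hM1 (hb.le_of_forall hD hX₀ hξ (hΛ ξ) fun X hX => (hC₁ X hX ξ).2)
      · rw [hφ0 ξ hξ, zero_mul, abs_zero]; exact hM0 ξ
    · rw [(outFlux_congr hφS).1, (outFlux_congr hφS).2]
      exact h X₀ hX₀

end Boundary

/-! ### Two-point functions -/

instance : SFinite collMeas := Measure.prod.instSFinite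

/-- The integrand `V_α θ(V_α)`. -/
noncomputable def Vp (e : Coll) : ℝ := Va e.2.1 e.2.2 e.1 * theta (Va e.2.1 e.2.2 e.1)

lemma Vp_eq (e : Coll) : Vp e = max (Va e.2.1 e.2.2 e.1) 0 := by
  unfold Vp theta
  split_ifs with h
  · rw [mul_one, max_eq_left h]
  · rw [mul_zero, max_eq_right (not_le.1 h).le]

lemma Vp_nonneg (e : Coll) : 0 ≤ Vp e := by rw [Vp_eq]; exact le_max_right _ _

lemma Vp_le_pw (e : Coll) : Vp e ≤ pw e := by
  rw [Vp_eq]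
  exact max_le ((le_abs_self _).trans (abs_Va_le_pw e)) (pw_pos e).le

lemma continuous_Vp : Continuous Vp := by
  rw [show Vp = fun e => max (Va e.2.1 e.2.2 e.1) 0 from funext Vp_eq]
  exact continuous_Va.max continuous_const

/-- `max x 0 - max (-x) 0 = x`. The difference of gain and loss thereby becomes linear in the
relative velocity. -/
lemma Vp_sub_flip (e : Coll) : Vp e - Vp (flipMap e) = Va e.2.1 e.2.2 e.1 := by
  rw [Vp_eq, Vp_eq]
  simp only [flipMap, coe_neg_sphere, Va_neg]
  exact max_zero_sub_eq_self _

/-- The inverse collision `(α, ξ, ξ_*) ↦ (-α, ξ', ξ_*')`. -/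
noncomputable def invColl (e : Coll) : Coll := collMap (flipMap e)

lemma invColl_eq (e : Coll) :
    invColl e = (-e.1, post e.2.1 e.2.2 e.1, postStar e.2.1 e.2.2 e.1) := by
  simp only [invColl, collMap, flipMap, coe_neg_sphere, post_neg, postStar_neg]

lemma measurePreserving_invColl : MeasurePreserving invColl collMeas collMeas :=
  measurePreserving_collMap.comp measurePreserving_flipMap

lemma invColl_invColl (e : Coll) : invColl (invColl e) = e := by
  simp only [invColl_eq, coe_neg_sphere, post_neg, postStar_neg, post_post, postStar_postStar,
    neg_neg]

lemma Vp_invColl (e : Coll) : Vp (invColl e) = Vp e := by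
  rw [Vp_eq, Vp_eq, invColl_eq]
  simp only [coe_neg_sphere, Va_neg, Va_post, neg_neg]

lemma Vp_exchMap (e : Coll) : Vp (exchMap e) = Vp e := by
  rw [Vp_eq, Vp_eq]
  simp only [exchMap, coe_neg_sphere, Va_neg, Va_swap e.2.1, neg_neg]

/-- The collision map is an involution, so the bound of outgoing by incoming velocities may be read
backwards. Decay in the post-collisional velocities is thus decay in the original ones, at half the
order. -/
lemma pw_le_pw_invColl_sq (e : Coll) : pw e ≤ pw (invColl e) ^ 2 := by
  have h1 : pw e ≤ pw (collMap e) ^ 2 := by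
    have := pw_collMap_le (collMap e)
    rwa [collMap_collMap] at this
  have h2 : pw (invColl e) = pw (collMap e) := by rw [invColl_eq]; rfl
  rwa [h2]

/-- Two-point functions that depend on a collision configuration: measurable, bounded by an
integrable function of the configuration, periodic, and supported in `Ω`. -/
structure TwoPoint (Ω P : Set V3) (w : Coll → V3 → V3 → ℝ) : Prop where
  measurable : Measurable fun p : Coll × V3 × V3 => w p.1 p.2.1 p.2.2
  bound : ∃ c, ∀ e Y Z, |w e Y Z| ≤ c * (pw e ^ 4)⁻¹
  zero : ∀ e Y Z, Y ∉ Ω ∨ Z ∉ Ω → w e Y Z = 0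
  periodic : ∀ p ∈ P, ∀ e Y Z, w e (Y + p) (Z + p) = w e Y Z

namespace TwoPoint

variable {Ω C P : Set V3} {w : Coll → V3 → V3 → ℝ}

lemma integrable (h : TwoPoint Ω P w) (hcell : IsCell Ω C P) {y z : V3 × Coll → V3}
    (hy : Measurable y) (hz : Measurable z) :
    Integrable (fun p => w p.2 (y p) (z p)) ((volume.restrict C).prod collMeas) := by
  obtain ⟨c, hc⟩ := h.bound
  have : IsFiniteMeasure ((volume : Measure V3).restrict C) :=
    ⟨by simpa using hcell.measure_lt_top⟩
  refine Integrable.mono' (((integrable_const (1 : ℝ)).mul_prod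
    (integrable_pw_inv le_rfl)).const_mul c)
    (h.measurable.comp (measurable_snd.prodMk (hy.prodMk hz))).aestronglyMeasurable
    (Eventually.of_forall fun p => ?_)
  rw [one_mul]; exact hc _ _ _

lemma integrable_coll (h : TwoPoint Ω P w) {y z : Coll → V3} (hy : Measurable y)
    (hz : Measurable z) : Integrable (fun e => w e (y e) (z e)) collMeas := by
  obtain ⟨c, hc⟩ := h.bound
  exact Integrable.mono' ((integrable_pw_inv le_rfl).const_mul c)
    (h.measurable.comp (measurable_id.prodMk (hy.prodMk hz))).aestronglyMeasurable
    (Eventually.of_forall fun p => hc _ _ _)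

lemma integral_swap (h : TwoPoint Ω P w) (hcell : IsCell Ω C P) (σ : ℝ) :
    ∫ p, w p.2 (p.1 + σ • (p.2.1 : V3)) p.1 ∂((volume.restrict C).prod collMeas)
      = ∫ p, w p.2 p.1 (p.1 - σ • (p.2.1 : V3)) ∂((volume.restrict C).prod collMeas) := by
  have m1 : Measurable fun p : V3 × Coll => p.1 + σ • (p.2.1 : V3) := by fun_prop
  have m2 : Measurable fun p : V3 × Coll => p.1 - σ • (p.2.1 : V3) := by fun_prop
  rw [integral_prod_symm _ (h.integrable hcell m1 measurable_fst),
    integral_prod_symm _ (h.integrable hcell measurable_fst m2)]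
  refine integral_congr_ae (Eventually.of_forall fun e => ?_)
  exact hcell.swap (w e) (h.zero e) (fun p hp => h.periodic p hp e) (σ • (e.1 : V3))

end TwoPoint

lemma integral_comp_snd_involution {C : Set V3} {T : Coll → Coll}
    (hT : MeasurePreserving T collMeas collMeas) (hTT : ∀ e, T (T e) = e) (F : V3 → Coll → ℝ) :
    ∫ p, F p.1 (T p.2) ∂((volume.restrict C).prod collMeas)
      = ∫ p, F p.1 p.2 ∂((volume.restrict C).prod collMeas) :=
  integral_comp_involution (T := Prod.map id T) ((MeasurePreserving.id _).prod hT)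
    (fun p => by simp only [Prod.map_apply', id, hTT]) fun p => F p.1 p.2

/-! ### The collision operator -/

/-- Extended data of a state: `a = χ f`, `s = χ S(𝓡)`. -/
structure GasData (Ω P : Set V3) (a : V3 → V3 → ℝ) (s : V3 → ℝ) : Prop where
  measurable : Measurable fun p : V3 × V3 => a p.1 p.2
  pos : ∀ X ∈ Ω, ∀ ξ, 0 < a X ξ
  zero : ∀ X ∉ Ω, ∀ ξ, a X ξ = 0
  decay : ∀ n : ℕ, ∃ c, ∀ X ξ, a X ξ ≤ c * wgt n ξ
  log_growth : ∃ (n : ℕ) (c : ℝ), ∀ X ξ, |Real.log (a X ξ)| ≤ c * (1 + ‖ξ‖) ^ n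
  periodic : ∀ p ∈ P, ∀ X ξ, a (X + p) ξ = a X ξ
  measurable_s : Measurable s
  s_nonneg : ∀ X, 0 ≤ s X
  s_bound : ∃ c, ∀ X, s X ≤ c
  s_periodic : ∀ p ∈ P, ∀ X, s (X + p) = s X

namespace GasData

variable {Ω C P : Set V3} {a : V3 → V3 → ℝ} {s : V3 → ℝ}

lemma nonneg (h : GasData Ω P a s) (X ξ : V3) : 0 ≤ a X ξ := by
  by_cases hX : X ∈ Ω
  · exact (h.pos X hX ξ).le
  · exact (h.zero X hX ξ).ge

lemma exists_pair_bound (h : GasData Ω P a s) (n : ℕ) : ∃ c, 0 ≤ c ∧ ∀ Y Z (e : Coll),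
    a Y e.2.1 * a Z e.2.2 ≤ c * (pw e ^ n)⁻¹ := by
  obtain ⟨c, hc⟩ := h.decay n
  refine ⟨c ^ 2, sq_nonneg c, fun Y Z e => ?_⟩
  calc a Y e.2.1 * a Z e.2.2 ≤ (c * wgt n e.2.1) * (c * wgt n e.2.2) :=
        mul_le_mul (hc _ _) (hc _ _) (h.nonneg _ _) ((h.nonneg _ _).trans (hc Y _))
    _ = _ := by unfold wgt pw; rw [mul_pow, mul_inv]; ring

/-- Decay of order `N + 4` of the product of the two distributions absorbs a growth of order `N` and
leaves the integrable order 4. The same product makes `w` vanish outside `Ω`. -/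
lemma twoPoint_of_le (h : GasData Ω P a s) {w : Coll → V3 → V3 → ℝ}
    (hm : Measurable fun p : Coll × V3 × V3 => w p.1 p.2.1 p.2.2) {c : ℝ} {N : ℕ}
    (hb : ∀ e Y Z, |w e Y Z| ≤ c * pw e ^ N * (a Y e.2.1 * a Z e.2.2))
    (hp : ∀ p ∈ P, ∀ e Y Z, w e (Y + p) (Z + p) = w e Y Z) : TwoPoint Ω P w := by
  obtain ⟨c', hc', h1⟩ := h.exists_pair_bound (N + 4)
  refine ⟨hm, ⟨|c| * c', fun e Y Z => (hb e Y Z).trans ?_⟩, fun e Y Z hYZ => ?_, hp⟩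
  · have hpw := pw_pos e
    calc c * pw e ^ N * (a Y e.2.1 * a Z e.2.2)
        ≤ |c| * pw e ^ N * (c' * (pw e ^ (N + 4))⁻¹) := by
          refine mul_le_mul ?_ (h1 Y Z e) (mul_nonneg (h.nonneg _ _) (h.nonneg _ _)) (by positivity)
          exact mul_le_mul_of_nonneg_right (le_abs_self c) (by positivity)
      _ = _ := by rw [pow_add]; field_simp
  · have := hb e Y Z
    rcases hYZ with h' | h'
    · rw [h.zero Y h', zero_mul, mul_zero] at this
      exact abs_nonpos_iff.1 this
    · rw [h.zero Z h', mul_zero, mul_zero] at this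
      exact abs_nonpos_iff.1 this

/-- As before, with twice the order of decay: the outgoing velocities control only the square root
of `pw e`. -/
lemma twoPoint_of_le_post (h : GasData Ω P a s) {w : Coll → V3 → V3 → ℝ}
    (hm : Measurable fun p : Coll × V3 × V3 => w p.1 p.2.1 p.2.2) {c : ℝ} {N : ℕ}
    (hb : ∀ e Y Z, |w e Y Z| ≤ c * pw e ^ N
      * (a Y (post e.2.1 e.2.2 e.1) * a Z (postStar e.2.1 e.2.2 e.1)))
    (hp : ∀ p ∈ P, ∀ e Y Z, w e (Y + p) (Z + p) = w e Y Z) : TwoPoint Ω P w := by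
  obtain ⟨c', hc', h1⟩ := h.exists_pair_bound (2 * (N + 4))
  refine ⟨hm, ⟨|c| * c', fun e Y Z => (hb e Y Z).trans ?_⟩, fun e Y Z hYZ => ?_, hp⟩
  · have hpw := pw_pos e
    have h2 := h1 Y Z (invColl e)
    have h3 : (pw (invColl e) ^ (2 * (N + 4)))⁻¹ ≤ (pw e ^ (N + 4))⁻¹ := by
      rw [pow_mul]
      exact inv_anti₀ (by positivity) (pow_le_pow_left₀ hpw.le (pw_le_pw_invColl_sq e) _)
    rw [invColl_eq] at h2
    rw [invColl_eq] at h3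
    calc _ ≤ |c| * pw e ^ N * (c' * (pw e ^ (N + 4))⁻¹) := by
          refine mul_le_mul (mul_le_mul_of_nonneg_right (le_abs_self c) (by positivity))
            (h2.trans (mul_le_mul_of_nonneg_left h3 hc'))
            (mul_nonneg (h.nonneg _ _) (h.nonneg _ _)) (by positivity)
      _ = _ := by rw [pow_add]; field_simp
  · have := hb e Y Z
    rcases hYZ with h' | h'
    · rw [h.zero Y h', zero_mul, mul_zero] at this
      exact abs_nonpos_iff.1 this
    · rw [h.zero Z h', mul_zero, mul_zero] at this
      exact abs_nonpos_iff.1 this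

lemma measurable_comp (h : GasData Ω P a s) {β : Type*} [MeasurableSpace β] {y z : β → V3}
    (hy : Measurable y) (hz : Measurable z) : Measurable fun p => a (y p) (z p) :=
  h.measurable.comp (hy.prodMk hz)

/-- The rate of collisions. -/
lemma twoPoint_rate (h : GasData Ω P a s) {g : Coll → V3 → V3 → ℝ}
    (hg : Measurable fun p : Coll × V3 × V3 => g p.1 p.2.1 p.2.2) {c : ℝ} {N : ℕ}
    (hb : ∀ e Y Z, |g e Y Z| ≤ c * pw e ^ N)
    (hp : ∀ p ∈ P, ∀ e Y Z, g e (Y + p) (Z + p) = g e Y Z) :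
    TwoPoint Ω P fun e Y Z => (s Y + s Z) * (a Y e.2.1 * a Z e.2.2) * g e Y Z := by
  obtain ⟨S, hS⟩ := h.s_bound
  have hS0 : 0 ≤ S := (h.s_nonneg 0).trans (hS 0)
  refine h.twoPoint_of_le (c := 2 * S * c) (N := N) ?_ (fun e Y Z => ?_) fun p hp' e Y Z => ?_
  · exact (((h.measurable_s.comp (by fun_prop)).add (h.measurable_s.comp (by fun_prop))).mul
      ((h.measurable_comp (by fun_prop) (by fun_prop)).mul
        (h.measurable_comp (by fun_prop) (by fun_prop)))).mul hg
  · have h1 : 0 ≤ a Y e.2.1 * a Z e.2.2 := mul_nonneg (h.nonneg _ _) (h.nonneg _ _)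
    have h2 : 0 ≤ s Y + s Z := add_nonneg (h.s_nonneg _) (h.s_nonneg _)
    rw [abs_mul, abs_mul, abs_of_nonneg h1, abs_of_nonneg h2]
    calc _ ≤ (2 * S) * (a Y e.2.1 * a Z e.2.2) * (c * pw e ^ N) := by
          refine mul_le_mul (mul_le_mul_of_nonneg_right ?_ h1) (hb _ _ _) (abs_nonneg _)
            (by positivity)
          linarith [hS Y, hS Z]
      _ = _ := by ring
  · rw [h.s_periodic p hp', h.s_periodic p hp', h.periodic p hp', h.periodic p hp', hp p hp']

end GasData

/-! ### Entropy production by collisions -/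

/-- `log x ≤ x - 1` at `x = q / p`; the irreversibility of collisions comes from this inequality. -/
lemma mul_log_le_sub {p q : ℝ} (hp : 0 < p) (hq : 0 < q) :
    p * (Real.log q - Real.log p) ≤ q - p := by
  have h1 := Real.log_le_sub_one_of_pos (div_pos hq hp)
  rw [Real.log_div hq.ne' hp.ne'] at h1
  have h2 := mul_le_mul_of_nonneg_left h1 hp.le
  have h3 : p * (q / p - 1) = q - p := by field_simp
  linarith

namespace GasData

variable {Ω C P : Set V3} {a : V3 → V3 → ℝ} {s : V3 → ℝ}

/-- The factor `log a + β |ξ|²`. -/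
noncomputable def logFactor (β : ℝ) (a : V3 → V3 → ℝ) (X ξ : V3) : ℝ :=
  Real.log (a X ξ) + β * ‖ξ‖ ^ 2

lemma exists_logFactor_le (h : GasData Ω P a s) (β : ℝ) : ∃ (N : ℕ) (c : ℝ), 0 ≤ c ∧
    ∀ X ξ, |logFactor β a X ξ| ≤ c * (1 + ‖ξ‖) ^ N := by
  obtain ⟨n, c, hc⟩ := h.log_growth
  refine ⟨n + 2, |c| + |β|, by positivity, fun X ξ => ?_⟩
  have h1 : (1 + ‖ξ‖) ^ n ≤ (1 + ‖ξ‖) ^ (n + 2) :=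
    pow_le_pow_right₀ (one_le_one_add_norm ξ) (by omega)
  have h2 : ‖ξ‖ ^ 2 ≤ (1 + ‖ξ‖) ^ (n + 2) :=
    (pow_le_pow_left₀ (norm_nonneg ξ) (by linarith) 2).trans
      (pow_le_pow_right₀ (one_le_one_add_norm ξ) (by omega))
  calc |logFactor β a X ξ| ≤ |c| * (1 + ‖ξ‖) ^ n + |β| * ‖ξ‖ ^ 2 := by
        refine (abs_add_le _ _).trans (add_le_add ((hc X ξ).trans ?_) ?_)
        · exact mul_le_mul_of_nonneg_right (le_abs_self c) (by positivity)
        · rw [abs_mul, abs_of_nonneg (sq_nonneg ‖ξ‖)]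
    _ ≤ _ := by
        rw [add_mul]
        exact add_le_add (mul_le_mul_of_nonneg_left h1 (abs_nonneg c))
          (mul_le_mul_of_nonneg_left h2 (abs_nonneg β))

lemma measurable_logFactor (h : GasData Ω P a s) (β : ℝ) {γ : Type*} [MeasurableSpace γ]
    {y z : γ → V3} (hy : Measurable y) (hz : Measurable z) :
    Measurable fun p => logFactor β a (y p) (z p) :=
  (Real.measurable_log.comp (h.measurable_comp hy hz)).add ((hz.norm.pow_const 2).const_mul β)

lemma twoPoint_entropy (h : GasData Ω P a s) (β : ℝ) :
    TwoPoint Ω P fun e Y Z => (s Y + s Z) * (a Y e.2.1 * a Z e.2.2)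
      * (Vp e * (logFactor β a Y (post e.2.1 e.2.2 e.1) - logFactor β a Y e.2.1)) := by
  obtain ⟨N, c, hc0, hc⟩ := h.exists_logFactor_le β
  refine h.twoPoint_rate (g := fun e Y _ =>
    Vp e * (logFactor β a Y (post e.2.1 e.2.2 e.1) - logFactor β a Y e.2.1))
    (c := 2 * c) (N := N + 1) ?_ (fun e Y Z => ?_) fun p hp e Y Z => ?_
  · refine (continuous_Vp.measurable.comp measurable_fst).mul
      ((h.measurable_logFactor β (by fun_prop) ?_).sub
        (h.measurable_logFactor β (by fun_prop) (by fun_prop)))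
    exact continuous_post.measurable.comp measurable_fst
  · have h1 : |logFactor β a Y (post e.2.1 e.2.2 e.1)| ≤ c * pw e ^ N := (hc _ _).trans
      (mul_le_mul_of_nonneg_left (pow_le_pow_left₀ (one_add_norm_pos _).le
        (one_add_norm_post_le_pw e) N) hc0)
    have h2 : |logFactor β a Y e.2.1| ≤ c * pw e ^ N := (hc _ _).trans
      (mul_le_mul_of_nonneg_left (pow_le_pow_left₀ (one_add_norm_pos _).le
        (one_add_norm_le_pw e) N) hc0)
    rw [abs_mul, abs_of_nonneg (Vp_nonneg e)]
    calc _ ≤ pw e * (c * pw e ^ N + c * pw e ^ N) :=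
          mul_le_mul (Vp_le_pw e) ((abs_sub _ _).trans (add_le_add h1 h2)) (abs_nonneg _)
            (pw_pos e).le
      _ = _ := by ring
  · simp only [logFactor, h.periodic p hp]

lemma twoPoint_rate_fst (h : GasData Ω P a s) {g : Coll → ℝ} (hg : Measurable g) {c : ℝ} {N : ℕ}
    (hb : ∀ e, |g e| ≤ c * pw e ^ N) :
    TwoPoint Ω P fun e Y Z => (s Y + s Z) * (a Y e.2.1 * a Z e.2.2) * g e :=
  h.twoPoint_rate (g := fun e _ _ => g e) (hg.comp measurable_fst) (fun e _ _ => hb e)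
    fun _ _ _ _ _ => rfl

lemma twoPoint_Vp (h : GasData Ω P a s) :
    TwoPoint Ω P fun e Y Z => (s Y + s Z) * (a Y e.2.1 * a Z e.2.2) * Vp e :=
  h.twoPoint_rate_fst continuous_Vp.measurable (c := 1) (N := 1) fun e => by
    rw [abs_of_nonneg (Vp_nonneg e), pow_one, one_mul]; exact Vp_le_pw e

lemma abs_inner_S2_le (α : S2) (ξ : V3) : |inner ℝ ξ (α : V3)| ≤ 1 + ‖ξ‖ := by
  have := abs_real_inner_le_norm ξ (α : V3)
  rw [norm_coe_S2, mul_one] at this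
  linarith

lemma twoPoint_inner (h : GasData Ω P a s) :
    TwoPoint Ω P fun e Y Z => (s Y + s Z) * (a Y e.2.1 * a Z e.2.2) * inner ℝ e.2.1 (e.1 : V3) :=
  h.twoPoint_rate_fst (g := fun e : Coll => inner ℝ e.2.1 (e.1 : V3)) (by fun_prop)
    (c := 1) (N := 1) fun e => by
      rw [pow_one, one_mul]; exact (abs_inner_S2_le _ _).trans (one_add_norm_le_pw e)

lemma twoPoint_inner_star (h : GasData Ω P a s) :
    TwoPoint Ω P fun e Y Z => (s Y + s Z) * (a Y e.2.1 * a Z e.2.2) * inner ℝ e.2.2 (e.1 : V3) :=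
  h.twoPoint_rate_fst (g := fun e : Coll => inner ℝ e.2.2 (e.1 : V3)) (by fun_prop)
    (c := 1) (N := 1) fun e => by
      rw [pow_one, one_mul]; exact (abs_inner_S2_le _ _).trans (one_add_norm_star_le_pw e)

lemma twoPoint_post (h : GasData Ω P a s) :
    TwoPoint Ω P fun e Y Z => (s Y + s Z)
      * (a Y (post e.2.1 e.2.2 e.1) * a Z (postStar e.2.1 e.2.2 e.1)) * Vp e := by
  obtain ⟨S, hS⟩ := h.s_bound
  have hS0 : 0 ≤ S := (h.s_nonneg 0).trans (hS 0)
  refine h.twoPoint_of_le_post (c := 2 * S) (N := 1) ?_ (fun e Y Z => ?_) fun p hp e Y Z => ?_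
  · exact (((h.measurable_s.comp (by fun_prop)).add (h.measurable_s.comp (by fun_prop))).mul
      ((h.measurable_comp (by fun_prop) (continuous_post.measurable.comp measurable_fst)).mul
        (h.measurable_comp (by fun_prop) (continuous_postStar.measurable.comp measurable_fst)))).mul
      (continuous_Vp.measurable.comp measurable_fst)
  · have h1 := mul_nonneg (h.nonneg Y (post e.2.1 e.2.2 e.1)) (h.nonneg Z (postStar e.2.1 e.2.2 e.1))
    have h2 : 0 ≤ s Y + s Z := add_nonneg (h.s_nonneg _) (h.s_nonneg _)
    rw [abs_of_nonneg (mul_nonneg (mul_nonneg h2 h1) (Vp_nonneg e)), pow_one]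
    calc _ ≤ 2 * S * (a Y (post e.2.1 e.2.2 e.1) * a Z (postStar e.2.1 e.2.2 e.1)) * pw e := by
          refine mul_le_mul (mul_le_mul_of_nonneg_right ?_ h1) (Vp_le_pw e) (Vp_nonneg e)
            (by positivity)
          linarith [hS Y, hS Z]
      _ = _ := by ring
  · simp only [h.s_periodic p hp, h.periodic p hp]

/-- With `p` and `q` the products of the two distribution values before and after the collision, the
logarithms of both molecules together change by `log q - log p`, and the terms in `β` cancel by
conservation of energy. Outside `Ω` everything vanishes. -/
lemma entropy_pair_le (h : GasData Ω P a s) (β : ℝ) (X Y : V3) (e : Coll) :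
    (s X + s Y) * (a X e.2.1 * a Y e.2.2)
        * (Vp e * (logFactor β a X (post e.2.1 e.2.2 e.1) - logFactor β a X e.2.1))
      + (s Y + s X) * (a Y e.2.2 * a X e.2.1)
        * (Vp e * (logFactor β a Y (postStar e.2.1 e.2.2 e.1) - logFactor β a Y e.2.2))
      ≤ (s X + s Y) * (a X (post e.2.1 e.2.2 e.1) * a Y (postStar e.2.1 e.2.2 e.1)) * Vp e
        - (s X + s Y) * (a X e.2.1 * a Y e.2.2) * Vp e := by
  by_cases hX : X ∈ Ω
  swap
  · simp [h.zero X hX]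
  by_cases hY : Y ∈ Ω
  swap
  · simp [h.zero Y hY]
  have p1 := h.pos X hX e.2.1
  have p2 := h.pos Y hY e.2.2
  have p3 := h.pos X hX (post e.2.1 e.2.2 e.1)
  have p4 := h.pos Y hY (postStar e.2.1 e.2.2 e.1)
  have key := mul_log_le_sub (mul_pos p1 p2) (mul_pos p3 p4)
  rw [Real.log_mul p1.ne' p2.ne', Real.log_mul p3.ne' p4.ne'] at key
  have hE := norm_post_sq_add e.1 e.2.1 e.2.2
  have hc : 0 ≤ (s X + s Y) * Vp e :=
    mul_nonneg (add_nonneg (h.s_nonneg _) (h.s_nonneg _)) (Vp_nonneg e)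
  have := mul_le_mul_of_nonneg_left key hc
  unfold logFactor
  have hE' : ‖postStar e.2.1 e.2.2 e.1‖ ^ 2
      = ‖e.2.1‖ ^ 2 + ‖e.2.2‖ ^ 2 - ‖post e.2.1 e.2.2 e.1‖ ^ 2 := by linarith
  rw [hE']
  linarith

lemma add_smul_neg_coe (X : V3) (σ : ℝ) (α : S2) :
    X + σ • ((-α : S2) : V3) = X - σ • (α : V3) := by
  rw [coe_neg_sphere, smul_neg, sub_eq_add_neg]

lemma sub_smul_neg_coe (X : V3) (σ : ℝ) (α : S2) :
    X - σ • ((-α : S2) : V3) = X + σ • (α : V3) := by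
  rw [coe_neg_sphere, smul_neg, sub_neg_eq_add]

/-- Collisions produce at most as much `⟨f (log f + β |ξ|²)⟩` as the collisional transfer of mass
takes away from `H⁽ᶜ⁾`. -/
theorem collision_entropy_le (h : GasData Ω P a s) (hcell : IsCell Ω C P) (σ β : ℝ) :
    ∫ X in C, (∫ e : Coll, (s X + s (X - σ • (e.1 : V3)))
        * (a X e.2.1 * a (X - σ • (e.1 : V3)) e.2.2)
        * (Vp e * (logFactor β a X (post e.2.1 e.2.2 e.1) - logFactor β a X e.2.1)) ∂collMeas)
      ≤ -∫ X in C, (∫ e : Coll, (s X + s (X + σ • (e.1 : V3)))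
        * (a X e.2.1 * a (X + σ • (e.1 : V3)) e.2.2) * inner ℝ e.2.1 (e.1 : V3) ∂collMeas) := by
  have mp : Measurable fun p : V3 × Coll => p.1 + σ • (p.2.1 : V3) := by fun_prop
  have mn : Measurable fun p : V3 × Coll => p.1 - σ • (p.2.1 : V3) := by fun_prop
  set W : Coll → V3 → V3 → ℝ := fun e Y Z => (s Y + s Z) * (a Y e.2.1 * a Z e.2.2)
      * (Vp e * (logFactor β a Y (post e.2.1 e.2.2 e.1) - logFactor β a Y e.2.1)) with hW
  have tW : TwoPoint Ω P W := h.twoPoint_entropy β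
  have tV := h.twoPoint_Vp
  have t1 := h.twoPoint_inner
  have t2 := h.twoPoint_inner_star
  have tp := h.twoPoint_post
  -- The exchange of the molecules combined with the translation that interchanges their positions:
  -- the production may be averaged over both partners.
  have e1 : ∫ p, W (exchMap p.2) (p.1 - σ • (p.2.1 : V3)) p.1 ∂((volume.restrict C).prod collMeas)
      = ∫ p, W p.2 p.1 (p.1 - σ • (p.2.1 : V3)) ∂((volume.restrict C).prod collMeas) := by
    rw [← tW.integral_swap hcell σ, ← integral_comp_snd_involution measurePreserving_exchMap
      exchMap_exchMap fun X e => W e (X + σ • (e.1 : V3)) X]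
    simp only [exchMap, add_smul_neg_coe]
  have iex : Integrable (fun p : V3 × Coll => W (exchMap p.2) (p.1 - σ • (p.2.1 : V3)) p.1)
      ((volume.restrict C).prod collMeas) := by
    have h1 : MeasurePreserving (Prod.map id exchMap : V3 × Coll → V3 × Coll) ((volume.restrict C).prod collMeas)
        ((volume.restrict C).prod collMeas) :=
      (MeasurePreserving.id _).prod measurePreserving_exchMap
    have h2 := h1.integrable_comp_of_integrable (tW.integrable hcell mp measurable_fst)
    refine h2.congr (Eventually.of_forall fun p => ?_)
    simp only [Function.comp_apply, Prod.map_apply', id, exchMap, add_smul_neg_coe]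
  have i0 := tW.integrable hcell measurable_fst mn
  have e2 : 2 * ∫ p, W p.2 p.1 (p.1 - σ • (p.2.1 : V3)) ∂((volume.restrict C).prod collMeas)
      ≤ (∫ p, (s p.1 + s (p.1 - σ • (p.2.1 : V3))) * (a p.1 (post p.2.2.1 p.2.2.2 p.2.1)
          * a (p.1 - σ • (p.2.1 : V3)) (postStar p.2.2.1 p.2.2.2 p.2.1)) * Vp p.2 ∂((volume.restrict C).prod collMeas))
        - ∫ p, (s p.1 + s (p.1 - σ • (p.2.1 : V3))) * (a p.1 p.2.2.1
          * a (p.1 - σ • (p.2.1 : V3)) p.2.2.2) * Vp p.2 ∂((volume.restrict C).prod collMeas) := by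
    have j1 := tp.integrable hcell measurable_fst mn
    have j2 := tV.integrable hcell measurable_fst mn
    rw [← integral_sub j1 j2, two_mul]
    nth_rewrite 2 [← e1]
    rw [← integral_add i0 iex]
    refine integral_mono (i0.add iex) (j1.sub j2) fun p => ?_
    have := h.entropy_pair_le β p.1 (p.1 - σ • (p.2.1 : V3)) p.2
    simp only [hW, Vp_exchMap]
    simpa only [exchMap, coe_neg_sphere, post_neg, postStar_neg, post_swap] using this
  -- Inverse collisions express the post-collisional product by the original velocities; the partner
  -- now sits at `X + σα` instead of `X - σα`.
  have e3 : ∫ p, (s p.1 + s (p.1 - σ • (p.2.1 : V3))) * (a p.1 (post p.2.2.1 p.2.2.2 p.2.1)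
          * a (p.1 - σ • (p.2.1 : V3)) (postStar p.2.2.1 p.2.2.2 p.2.1)) * Vp p.2 ∂((volume.restrict C).prod collMeas)
      = ∫ p, (s p.1 + s (p.1 + σ • (p.2.1 : V3))) * (a p.1 p.2.2.1
          * a (p.1 + σ • (p.2.1 : V3)) p.2.2.2) * Vp p.2 ∂((volume.restrict C).prod collMeas) := by
    rw [← integral_comp_snd_involution measurePreserving_invColl invColl_invColl fun X e =>
      (s X + s (X + σ • (e.1 : V3))) * (a X e.2.1 * a (X + σ • (e.1 : V3)) e.2.2) * Vp e]
    simp only [Vp_invColl]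
    simp only [invColl_eq, add_smul_neg_coe]
  -- The loss term is brought to the same position by reversing `α`, at the price of the opposite
  -- sign of the normal velocity in `Vp`.
  have e4 : ∫ p, (s p.1 + s (p.1 - σ • (p.2.1 : V3))) * (a p.1 p.2.2.1
          * a (p.1 - σ • (p.2.1 : V3)) p.2.2.2) * Vp p.2 ∂((volume.restrict C).prod collMeas)
      = ∫ p, (s p.1 + s (p.1 + σ • (p.2.1 : V3))) * (a p.1 p.2.2.1
          * a (p.1 + σ • (p.2.1 : V3)) p.2.2.2) * Vp (flipMap p.2) ∂((volume.restrict C).prod collMeas) := by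
    rw [← integral_comp_snd_involution measurePreserving_flipMap flipMap_flipMap fun X e =>
      (s X + s (X - σ • (e.1 : V3))) * (a X e.2.1 * a (X - σ • (e.1 : V3)) e.2.2) * Vp e]
    simp only [flipMap, sub_smul_neg_coe]
  have iflip : Integrable (fun p : V3 × Coll => (s p.1 + s (p.1 + σ • (p.2.1 : V3))) * (a p.1 p.2.2.1
          * a (p.1 + σ • (p.2.1 : V3)) p.2.2.2) * Vp (flipMap p.2))
      ((volume.restrict C).prod collMeas) := by
    have h1 : MeasurePreserving (Prod.map id flipMap : V3 × Coll → V3 × Coll) ((volume.restrict C).prod collMeas)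
        ((volume.restrict C).prod collMeas) :=
      (MeasurePreserving.id _).prod measurePreserving_flipMap
    have h2 := h1.integrable_comp_of_integrable (tV.integrable hcell measurable_fst mn)
    refine h2.congr (Eventually.of_forall fun p => ?_)
    simp only [Function.comp_apply, Prod.map_apply', id, flipMap, sub_smul_neg_coe]
  have j1 := t1.integrable hcell measurable_fst mp
  have j2 := t2.integrable hcell measurable_fst mp
  have e5 : (∫ p, (s p.1 + s (p.1 + σ • (p.2.1 : V3))) * (a p.1 p.2.2.1
          * a (p.1 + σ • (p.2.1 : V3)) p.2.2.2) * Vp p.2 ∂((volume.restrict C).prod collMeas))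
        - ∫ p, (s p.1 + s (p.1 + σ • (p.2.1 : V3))) * (a p.1 p.2.2.1
          * a (p.1 + σ • (p.2.1 : V3)) p.2.2.2) * Vp (flipMap p.2) ∂((volume.restrict C).prod collMeas)
      = (∫ p, (s p.1 + s (p.1 + σ • (p.2.1 : V3))) * (a p.1 p.2.2.1
          * a (p.1 + σ • (p.2.1 : V3)) p.2.2.2) * inner ℝ p.2.2.2 (p.2.1 : V3) ∂((volume.restrict C).prod collMeas))
        - ∫ p, (s p.1 + s (p.1 + σ • (p.2.1 : V3))) * (a p.1 p.2.2.1
          * a (p.1 + σ • (p.2.1 : V3)) p.2.2.2) * inner ℝ p.2.2.1 (p.2.1 : V3) ∂((volume.restrict C).prod collMeas) := by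
    rw [← integral_sub (tV.integrable hcell measurable_fst mp) iflip, ← integral_sub j2 j1]
    refine integral_congr_ae (Eventually.of_forall fun p => ?_)
    simp only
    rw [← mul_sub, ← mul_sub, Vp_sub_flip, Va, inner_sub_left]
  -- A second exchange turns the partner's velocity into minus the molecule's own, because `α`
  -- changes sign. The resulting factor 2 cancels the one from the symmetrisation in `e2`.
  have e6 : ∫ p, (s p.1 + s (p.1 + σ • (p.2.1 : V3))) * (a p.1 p.2.2.1
          * a (p.1 + σ • (p.2.1 : V3)) p.2.2.2) * inner ℝ p.2.2.2 (p.2.1 : V3) ∂((volume.restrict C).prod collMeas)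
      = -∫ p, (s p.1 + s (p.1 + σ • (p.2.1 : V3))) * (a p.1 p.2.2.1
          * a (p.1 + σ • (p.2.1 : V3)) p.2.2.2) * inner ℝ p.2.2.1 (p.2.1 : V3) ∂((volume.restrict C).prod collMeas) := by
    have h1 := t1.integral_swap hcell (-σ)
    simp only [neg_smul, sub_neg_eq_add] at h1
    rw [← h1, ← integral_comp_snd_involution measurePreserving_exchMap exchMap_exchMap fun X e =>
      (s X + s (X + σ • (e.1 : V3))) * (a X e.2.1 * a (X + σ • (e.1 : V3)) e.2.2)
        * inner ℝ e.2.2 (e.1 : V3), ← integral_neg]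
    refine integral_congr_ae (Eventually.of_forall fun p => ?_)
    simp only [exchMap, coe_neg_sphere, smul_neg, inner_neg_right, ← sub_eq_add_neg]
    ring
  have e7 : ∫ p, W p.2 p.1 (p.1 - σ • (p.2.1 : V3)) ∂((volume.restrict C).prod collMeas)
      ≤ -∫ p, (s p.1 + s (p.1 + σ • (p.2.1 : V3))) * (a p.1 p.2.2.1
          * a (p.1 + σ • (p.2.1 : V3)) p.2.2.2) * inner ℝ p.2.2.1 (p.2.1 : V3) ∂((volume.restrict C).prod collMeas) := by
    rw [e3, e4, e5, e6] at e2
    linarith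
  rwa [integral_prod _ i0, integral_prod _ j1] at e7

end GasData

/-! ### The crowding function -/

/-- The density, extended by zero. -/
noncomputable def extDens (Ω : Set V3) (u : V3 → V3 → ℝ) (X : V3) : ℝ := chi Ω X * dens u X

lemma setIntegral_eq_integral_chi {E : Type*} [NormedAddCommGroup E] [NormedSpace ℝ E]
    {Ω : Set V3} (hΩ : MeasurableSet Ω) (g : V3 → E) : ∫ Y in Ω, g Y = ∫ Y, chi Ω Y • g Y := by
  rw [← integral_indicator hΩ]
  congr 1
  ext Y
  by_cases hY : Y ∈ Ω
  · rw [indicator_of_mem hY, chi_of_mem hY, one_smul]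
  · rw [indicator_of_notMem hY, chi_of_notMem hY, zero_smul]

lemma crowd_eq_ballConv (G : Gas) {Ω : Set V3} (hΩ : MeasurableSet Ω) (u : V3 → V3 → ℝ) :
    crowd G Ω u = ballConv G.σ fun Y => 1 / G.m * extDens Ω u Y := by
  ext X
  rw [crowd, setIntegral_eq_integral_chi hΩ, ballConv, ← integral_const_mul]
  simp only [extDens, smul_eq_mul, mul_assoc]

lemma chi_periodic {Ω C P : Set V3} (h : IsCell Ω C P) {p : V3} (hp : p ∈ P) (X : V3) :
    chi Ω (X + p) = chi Ω X := by
  by_cases hX : X ∈ Ω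
  · rw [chi_of_mem hX, chi_of_mem ((h.add_mem p hp X).2 hX)]
  · rw [chi_of_notMem hX, chi_of_notMem fun h' => hX ((h.add_mem p hp X).1 h')]

lemma ballConv_periodic {h : V3 → ℝ} {p : V3} (hp : ∀ X, h (X + p) = h X) (σ : ℝ) (X : V3) :
    ballConv σ h (X + p) = ballConv σ h X := by
  rw [ballConv, ← integral_add_right_eq_self _ p, ballConv]
  simp only [hp, add_sub_add_right_eq_sub]

lemma ballConvGrad_periodic {h : V3 → ℝ} {p : V3} (hp : ∀ X, h (X + p) = h X) (σ : ℝ) (X : V3) :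
    ballConvGrad σ h (X + p) = ballConvGrad σ h X := by
  simp only [ballConvGrad, add_right_comm X p, hp]

/-- `S` evaluated at the nearest point of `[0, r]`. -/
noncomputable def clampS (G : Gas) (r x : ℝ) : ℝ := G.S (max 0 (min x r))

/-- `r` is an upper bound of the crowding function, in the interval on which `S` is given. -/
structure CrowdLe (G : Gas) (Ω : Set V3) (u : V3 → V3 → ℝ) (r : ℝ) : Prop where
  mem : r ∈ G.dom
  nonneg : 0 ≤ r
  le : ∀ X ∈ Ω, 0 ≤ crowd G Ω u X ∧ crowd G Ω u X ≤ r

section Clamp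

variable {G : Gas} {r : ℝ} (hr : r ∈ G.dom) (h0 : 0 ≤ r)
include hr h0

lemma clamp_mem (x : ℝ) : max 0 (min x r) ∈ G.dom :=
  G.dom_ordConnected.out G.zero_mem hr ⟨le_max_left _ _, max_le h0 (min_le_right _ _)⟩

lemma continuous_clampS : Continuous (clampS G r) :=
  G.S_continuousOn.comp_continuous (by fun_prop) (clamp_mem hr h0)

lemma clampS_nonneg (x : ℝ) : 0 ≤ clampS G r x := G.S_nonneg _ (clamp_mem hr h0 x)

lemma exists_clampS_le : ∃ c, 0 ≤ c ∧ ∀ x, clampS G r x ≤ c := by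
  obtain ⟨c, hc⟩ := (isCompact_Icc (a := 0) (b := r)).exists_bound_of_continuousOn
    (G.S_continuousOn.mono (G.dom_ordConnected.out G.zero_mem hr))
  have hx : ∀ x, clampS G r x ≤ c := fun x => (le_abs_self _).trans
    (hc _ ⟨le_max_left _ _, max_le h0 (min_le_right _ _)⟩)
  exact ⟨c, (clampS_nonneg hr h0 0).trans (hx 0), hx⟩

end Clamp

lemma clampS_eq (G : Gas) {r x : ℝ} (h0 : 0 ≤ x) (hx : x ≤ r) : clampS G r x = G.S x := by
  rw [clampS, min_eq_left hx, max_eq_right h0]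

/-- The extension `χ S(𝓡)`. -/
noncomputable def extS (G : Gas) (Ω : Set V3) (u : V3 → V3 → ℝ) (X : V3) : ℝ :=
  chi Ω X * G.S (crowd G Ω u X)

/-- On `Ω` the crowding function lies in `[0, r]`, where clamping changes nothing. The gain is a
function of `𝓡` that is continuous on the whole line, which `G.S` need not be off `dom`. -/
lemma extS_eq {G : Gas} {Ω : Set V3} {u : V3 → V3 → ℝ} {r : ℝ} (h : CrowdLe G Ω u r) (X : V3) :
    extS G Ω u X = chi Ω X * clampS G r (crowd G Ω u X) := by
  by_cases hX : X ∈ Ω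
  · rw [extS, clampS_eq G (h.le X hX).1 (h.le X hX).2]
  · rw [extS, chi_of_notMem hX, zero_mul, zero_mul]

namespace IsState

variable {G : Gas} {Ω C P : Set V3} {u : V3 → V3 → ℝ} {r : ℝ}

lemma measurable_extDens (h : IsState Ω P u) (hΩ : IsOpen Ω) : Measurable (extDens Ω u) :=
  measurable_chi_mul_integral hΩ h.contDiffOn.continuousOn

lemma integrable_slice (h : IsState Ω P u) {X : V3} (hX : X ∈ Ω) : Integrable (u X) := by
  obtain ⟨C, _, hC⟩ := h.exists_entropy_decay 0 4
  exact integrable_of_le_wgt (c := C) (h.continuous_slice hX).aestronglyMeasurable le_rfl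
    fun ξ => (hC X hX ξ).1

lemma dens_pos (h : IsState Ω P u) {X : V3} (hX : X ∈ Ω) : 0 < dens u X := by
  refine (integral_pos_iff_support_of_nonneg (fun ξ => (h.pos X hX ξ).le)
    (h.integrable_slice hX)).2 ?_
  have : Function.support (u X) = univ := by
    ext ξ; simp [(h.pos X hX ξ).ne']
  rw [this]
  exact Measure.measure_univ_pos.2 (NeZero.ne _)

lemma extDens_nonneg (h : IsState Ω P u) (X : V3) : 0 ≤ extDens Ω u X := by
  by_cases hX : X ∈ Ω
  · rw [extDens, chi_of_mem hX, one_mul]; exact (h.dens_pos hX).le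
  · rw [extDens, chi_of_notMem hX, zero_mul]

lemma exists_extDens_le (h : IsState Ω P u) : ∃ c, 0 ≤ c ∧ ∀ X, |extDens Ω u X| ≤ c := by
  obtain ⟨C, hC0, hC⟩ := h.exists_entropy_decay 0 4
  have hw : 0 ≤ wgtMass := integral_nonneg fun ξ => (wgt_pos 4 ξ).le
  refine ⟨C * wgtMass, by positivity, fun X => ?_⟩
  by_cases hX : X ∈ Ω
  · rw [extDens, chi_of_mem hX, one_mul]
    exact norm_integral_le_wgtMass (u := u X) fun ξ => (hC X hX ξ).1
  · rw [extDens, chi_of_notMem hX, zero_mul, abs_zero]; positivity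

lemma extDens_periodic (h : IsState Ω P u) (hcell : IsCell Ω C P) {p : V3} (hp : p ∈ P) (X : V3) :
    extDens Ω u (X + p) = extDens Ω u X := by
  simp only [extDens, chi_periodic hcell hp, dens, h.periodic p hp]

lemma crowd_lipschitz (h : IsState Ω P u) (hΩ : IsOpen Ω) :
    ∃ a : NNReal, LipschitzWith a (crowd G Ω u) := by
  obtain ⟨c, hc0, hc⟩ := h.exists_extDens_le
  rw [crowd_eq_ballConv G hΩ.measurableSet]
  refine ballConv_lipschitz (c := |1 / G.m| * c) ((h.measurable_extDens hΩ).const_mul _)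
    (fun X => ?_) G.σ_pos
  rw [abs_mul]; exact mul_le_mul_of_nonneg_left (hc X) (abs_nonneg _)

lemma crowd_nonneg (h : IsState Ω P u) (hΩ : IsOpen Ω) (X : V3) : 0 ≤ crowd G Ω u X := by
  rw [crowd_eq_ballConv G hΩ.measurableSet]
  exact integral_nonneg fun Y => mul_nonneg (mul_nonneg (one_div_nonneg.2 G.m_pos.le)
    (h.extDens_nonneg Y)) (theta_nonneg _)

lemma crowd_periodic (h : IsState Ω P u) (hcell : IsCell Ω C P) {p : V3} (hp : p ∈ P) (X : V3) :
    crowd G Ω u (X + p) = crowd G Ω u X := by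
  rw [crowd_eq_ballConv G hcell.isOpen.measurableSet]
  exact ballConv_periodic (fun X => by rw [h.extDens_periodic hcell hp]) _ X

lemma gasData (h : IsState Ω P u) (hcell : IsCell Ω C P) (hr : CrowdLe G Ω u r) :
    GasData Ω P (fun X ξ => chi Ω X * u X ξ) (extS G Ω u) where
  measurable := measurable_chi_mul hcell.isOpen h.contDiffOn.continuousOn
  pos X hX ξ := by rw [chi_of_mem hX, one_mul]; exact h.pos X hX ξ
  zero X hX ξ := by rw [chi_of_notMem hX, zero_mul]
  decay n := by
    obtain ⟨c, hc⟩ := h.decay n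
    refine ⟨|c|, fun X ξ => ?_⟩
    by_cases hX : X ∈ Ω
    · rw [chi_of_mem hX, one_mul]
      exact (hc X hX ξ).trans (mul_le_mul_of_nonneg_right (le_abs_self c) (wgt_pos _ _).le)
    · rw [chi_of_notMem hX, zero_mul]; exact mul_nonneg (abs_nonneg _) (wgt_pos _ _).le
  log_growth := by
    obtain ⟨n, c, hc⟩ := h.log_growth
    refine ⟨n, |c|, fun X ξ => ?_⟩
    have hp : 0 ≤ (1 + ‖ξ‖) ^ n := (pow_pos (one_add_norm_pos ξ) n).le
    by_cases hX : X ∈ Ω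
    · rw [chi_of_mem hX, one_mul]
      exact (hc X hX ξ).trans (mul_le_mul_of_nonneg_right (le_abs_self c) hp)
    · rw [chi_of_notMem hX, zero_mul, Real.log_zero, abs_zero]; exact mul_nonneg (abs_nonneg _) hp
  periodic p hp X ξ := by rw [chi_periodic hcell hp, h.periodic p hp]
  measurable_s := by
    simp only [funext (extS_eq hr)]
    obtain ⟨_, ha⟩ := h.crowd_lipschitz (G := G) hcell.isOpen
    exact (measurable_chi hcell.isOpen.measurableSet).mul
      ((continuous_clampS hr.mem hr.nonneg).comp ha.continuous).measurable
  s_nonneg X := by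
    rw [extS_eq hr]
    refine mul_nonneg ?_ (clampS_nonneg hr.mem hr.nonneg _)
    by_cases hX : X ∈ Ω
    · rw [chi_of_mem hX]; exact zero_le_one
    · rw [chi_of_notMem hX]
  s_bound := by
    obtain ⟨c, hc0, hc⟩ := exists_clampS_le hr.mem hr.nonneg
    refine ⟨c, fun X => ?_⟩
    rw [extS_eq hr]
    by_cases hX : X ∈ Ω
    · rw [chi_of_mem hX, one_mul]; exact hc _
    · rw [chi_of_notMem hX, zero_mul]; exact hc0
  s_periodic p hp X := by rw [extS, extS, chi_periodic hcell hp, h.crowd_periodic hcell hp]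

end IsState

/-! ### Moments of the collision operator -/

lemma gFactor_mul (G : Gas) (Ω : Set V3) (u : V3 → V3 → ℝ) (X Y ξ η : V3) :
    gFactor G Ω u Y X * u Y η * u X ξ
      = (extS G Ω u X + extS G Ω u Y) * (chi Ω X * u X ξ * (chi Ω Y * u Y η)) := by
  unfold gFactor extS
  by_cases hX : X ∈ Ω
  · by_cases hY : Y ∈ Ω
    · rw [chi_of_mem hX, chi_of_mem hY]; ring
    · rw [chi_of_notMem hY]; ring
  · rw [chi_of_notMem hX]; ring

section Moments

variable {G : Gas} {Ω C P : Set V3} {u : V3 → V3 → ℝ} {a : V3 → V3 → ℝ} {s : V3 → ℝ}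

lemma integrable_iterated_coll {k : Coll → ℝ} (hk : Integrable k collMeas) :
    Integrable fun ξ : V3 => ∫ ξs : V3, ∫ α : S2, k (α, ξ, ξs) ∂solidAngle := by
  have h1 : Integrable (fun p : (V3 × V3) × S2 => k (p.2, p.1)) ((volume.prod volume).prod solidAngle) :=
    hk.swap
  exact h1.integral_prod_left.integral_prod_left

lemma GasData.integrable_loss_mul (h : GasData Ω P a s) (σ : ℝ) (X : V3) {g : Coll → ℝ}
    (hg : Measurable g) {c : ℝ} {N : ℕ} (hb : ∀ e, |g e| ≤ c * pw e ^ N) :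
    Integrable (fun e : Coll => (s X + s (X - σ • (e.1 : V3)))
      * (a X e.2.1 * a (X - σ • (e.1 : V3)) e.2.2) * (Vp e * g e)) collMeas := by
  have t := h.twoPoint_rate_fst (g := fun e => Vp e * g e) (c := c) (N := N + 1)
    (continuous_Vp.measurable.mul hg) fun e => by
      rw [abs_mul, abs_of_nonneg (Vp_nonneg e)]
      calc _ ≤ pw e * (c * pw e ^ N) := mul_le_mul (Vp_le_pw e) (hb e) (abs_nonneg _) (pw_pos e).le
        _ = _ := by ring
  exact t.integrable_coll (y := fun _ => X) (z := fun e => X - σ • (e.1 : V3)) measurable_const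
    (by fun_prop)

lemma abs_comp_le_pw {ψ : V3 → ℝ} {c : ℝ} {N : ℕ} (hc : ∀ ξ, |ψ ξ| ≤ c * (1 + ‖ξ‖) ^ N) (e : Coll) :
    |ψ e.2.1| ≤ |c| * pw e ^ N ∧ |ψ (post e.2.1 e.2.2 e.1)| ≤ |c| * pw e ^ N := by
  have h1 : ∀ {ξ}, 1 + ‖ξ‖ ≤ pw e → |ψ ξ| ≤ |c| * pw e ^ N := fun {ξ} hξ => (hc ξ).trans
    (mul_le_mul (le_abs_self c) (pow_le_pow_left₀ (one_add_norm_pos _).le hξ N)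
      (pow_pos (one_add_norm_pos _) _).le (abs_nonneg c))
  exact ⟨h1 (one_add_norm_le_pw e), h1 (one_add_norm_post_le_pw e)⟩

/-- Moments of the collision operator. -/
theorem integral_collision_mul
    (h : GasData Ω P (fun X ξ => chi Ω X * u X ξ) (extS G Ω u)) {X : V3}
    {ψ : V3 → ℝ} (hψ : Measurable ψ) {c : ℝ} {N : ℕ} (hc : ∀ ξ, |ψ ξ| ≤ c * (1 + ‖ξ‖) ^ N) :
    ∫ ξ, collision G Ω u X ξ * ψ ξ = G.σ ^ 2 / G.m * ∫ e : Coll,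
      (extS G Ω u X + extS G Ω u (X - G.σ • (e.1 : V3)))
        * (chi Ω X * u X e.2.1 * (chi Ω (X - G.σ • (e.1 : V3)) * u (X - G.σ • (e.1 : V3)) e.2.2))
        * (Vp e * (ψ (post e.2.1 e.2.2 e.1) - ψ e.2.1)) ∂collMeas := by
  set k : Coll → ℝ := fun e => (extS G Ω u X + extS G Ω u (X - G.σ • (e.1 : V3)))
        * (chi Ω X * u X e.2.1 * (chi Ω (X - G.σ • (e.1 : V3)) * u (X - G.σ • (e.1 : V3)) e.2.2))
    with hk
  have i1 : Integrable (fun e => k e * (Vp e * ψ e.2.1)) collMeas :=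
    h.integrable_loss_mul G.σ X (g := fun e => ψ e.2.1) (c := |c|) (N := N)
      (hψ.comp (by fun_prop)) fun e => (abs_comp_le_pw hc e).1
  have i2 : Integrable (fun e => k e * (Vp e * ψ (post e.2.1 e.2.2 e.1))) collMeas :=
    h.integrable_loss_mul G.σ X (g := fun e => ψ (post e.2.1 e.2.2 e.1)) (c := |c|) (N := N)
      (hψ.comp continuous_post.measurable) fun e => (abs_comp_le_pw hc e).2
  set k' : Coll → ℝ := fun e => (extS G Ω u X + extS G Ω u (X + G.σ • (e.1 : V3)))
        * (chi Ω X * u X (post e.2.1 e.2.2 e.1)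
          * (chi Ω (X + G.σ • (e.1 : V3)) * u (X + G.σ • (e.1 : V3)) (postStar e.2.1 e.2.2 e.1)))
    with hk'
  -- The inverse collision carries the gain integrand into the loss integrand with `ψ` taken at the
  -- post-collisional velocity.
  have hkk : ∀ e, k' e * (Vp e * ψ e.2.1)
      = (fun e : Coll => k e * (Vp e * ψ (post e.2.1 e.2.2 e.1))) (invColl e) := by
    intro e
    simp only [Vp_invColl]
    simp only [invColl_eq, hk, hk', coe_neg_sphere, post_neg, post_post,
      smul_neg, sub_neg_eq_add]
  have i3 : Integrable (fun e => k' e * (Vp e * ψ e.2.1)) collMeas := by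
    simp only [hkk]
    exact measurePreserving_invColl.integrable_comp_of_integrable i2
  have e3 : ∫ e, k' e * (Vp e * ψ e.2.1) ∂collMeas
      = ∫ e, k e * (Vp e * ψ (post e.2.1 e.2.2 e.1)) ∂collMeas := by
    simp only [hkk]
    exact integral_comp_involution measurePreserving_invColl invColl_invColl
      fun e => k e * (Vp e * ψ (post e.2.1 e.2.2 e.1))
  have hg : ∀ ξ, gain G Ω u X ξ * ψ ξ = G.σ ^ 2 / G.m * ∫ ξs : V3, ∫ α : S2,
      (fun e : Coll => k' e * (Vp e * ψ e.2.1)) (α, ξ, ξs) ∂solidAngle := by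
    intro ξ
    rw [gain, mul_assoc]
    simp only [← integral_mul_const, gFactor_mul, hk', Vp]
    simp only [mul_assoc]
  have hl : ∀ ξ, loss G Ω u X ξ * ψ ξ = G.σ ^ 2 / G.m * ∫ ξs : V3, ∫ α : S2,
      (fun e : Coll => k e * (Vp e * ψ e.2.1)) (α, ξ, ξs) ∂solidAngle := by
    intro ξ
    rw [loss, mul_assoc]
    simp only [← integral_mul_const, gFactor_mul, hk, Vp]
    simp only [mul_assoc]
  simp only [collision, sub_mul, hg, hl]
  rw [integral_sub ((integrable_iterated_coll i3).const_mul _)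
    ((integrable_iterated_coll i1).const_mul _), integral_const_mul, integral_const_mul,
    integral_iterated_coll i3, integral_iterated_coll i1, e3, ← mul_sub, ← integral_sub i2 i1]
  simp only [mul_sub, hk]

end Moments

/-! ### The collisional part of the balance -/

lemma abs_ballConv_le {h : V3 → ℝ} {c : ℝ} (hb : ∀ X, |h X| ≤ c) (σ : ℝ) (X : V3) :
    |ballConv σ h X| ≤ c * volume.real (closedBall (0 : V3) σ) := by
  have h1 : volume.real (closedBall X σ) = volume.real (closedBall (0 : V3) σ) := by
    simp only [measureReal_def, Measure.addHaar_closedBall_center]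
  have h2 : volume.real (closedBall X σ)
      = ∫ Y, (closedBall X σ).indicator (fun _ => (1 : ℝ)) Y := by
    rw [integral_indicator measurableSet_closedBall, setIntegral_const, smul_eq_mul, mul_one]
  rw [← h1, ballConv, h2, ← integral_const_mul, ← Real.norm_eq_abs]
  refine norm_integral_le_of_norm_le ?_ (Eventually.of_forall fun Y => ?_)
  · exact ((integrable_indicator_iff measurableSet_closedBall).2
      (integrableOn_const measure_closedBall_lt_top.ne)).const_mul c
  · rw [theta_sub_norm, norm_mul]
    by_cases hY : Y ∈ closedBall X σ
    · rw [indicator_of_mem hY, norm_one]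
      exact mul_le_mul_of_nonneg_right (hb Y) zero_le_one
    · rw [indicator_of_notMem hY, norm_zero, mul_zero, mul_zero]

section Transfer

variable {G : Gas} {Ω C P : Set V3} {u : V3 → V3 → ℝ} {r : ℝ}

/-- The potential `∫_Ω (ρ(Y)/m) θ(σ-|Y-X|) S(𝓡(Y)) dY`. -/
noncomputable def transferPot (G : Gas) (Ω : Set V3) (u : V3 → V3 → ℝ) : V3 → ℝ :=
  ballConv G.σ fun Y => 1 / G.m * (extS G Ω u Y * extDens Ω u Y)

/-- The gradient of the potential `∫₀^𝓡 S + ∫_Ω (ρ(Y)/m) θ(σ-|Y-X|) S(𝓡(Y)) dY`. -/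
noncomputable def transferGrad (G : Gas) (Ω : Set V3) (u : V3 → V3 → ℝ) (r : ℝ) (X : V3) : V3 :=
  clampS G r (crowd G Ω u X) • ballConvGrad G.σ (fun Y => 1 / G.m * extDens Ω u Y) X
    + ballConvGrad G.σ (fun Y => 1 / G.m * (extS G Ω u Y * extDens Ω u Y)) X

lemma IsState.exists_transfer_bound (h : IsState Ω P u) (hcell : IsCell Ω C P)
    (hr : CrowdLe G Ω u r) : ∃ c, 0 ≤ c ∧ (∀ X, |1 / G.m * extDens Ω u X| ≤ c) ∧
      ∀ X, |1 / G.m * (extS G Ω u X * extDens Ω u X)| ≤ c := by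
  obtain ⟨c₁, h10, h1⟩ := h.exists_extDens_le
  obtain ⟨c₂, h2⟩ := (h.gasData hcell hr).s_bound
  have hs := (h.gasData hcell hr).s_nonneg
  have h20 : 0 ≤ c₂ := (hs 0).trans (h2 0)
  have hm := G.m_pos
  have hm' : 0 ≤ 1 / G.m := by positivity
  refine ⟨1 / G.m * c₁ + 1 / G.m * (c₂ * c₁), by positivity, fun X => ?_, fun X => ?_⟩
  · rw [abs_mul, abs_of_nonneg hm']
    have := mul_le_mul_of_nonneg_left (h1 X) hm'
    have : 0 ≤ 1 / G.m * (c₂ * c₁) := by positivity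
    linarith
  · rw [abs_mul, abs_of_nonneg hm', abs_mul, abs_of_nonneg (hs X)]
    have := mul_le_mul_of_nonneg_left (mul_le_mul (h2 X) (h1 X) (abs_nonneg _) h20) hm'
    have : 0 ≤ 1 / G.m * c₁ := by positivity
    linarith

lemma IsState.measurable_transfer (h : IsState Ω P u) (hcell : IsCell Ω C P)
    (hr : CrowdLe G Ω u r) : (Measurable fun X => 1 / G.m * extDens Ω u X) ∧
      Measurable fun X => 1 / G.m * (extS G Ω u X * extDens Ω u X) :=
  ⟨(h.measurable_extDens hcell.isOpen).const_mul _,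
    ((h.gasData hcell hr).measurable_s.mul (h.measurable_extDens hcell.isOpen)).const_mul _⟩

lemma hasDerivAt_primitive_clampS (hr : r ∈ G.dom) (h0 : 0 ≤ r) (x : ℝ) :
    HasDerivAt (fun x => ∫ y in (0 : ℝ)..x, clampS G r y) (clampS G r x) x :=
  intervalIntegral.integral_hasDerivAt_right ((continuous_clampS hr h0).intervalIntegrable _ _)
    ((continuous_clampS hr h0).stronglyMeasurableAtFilter _ _) (continuous_clampS hr h0).continuousAt

lemma primitive_clampS_eq {x : ℝ} (h0 : 0 ≤ x) (hx : x ≤ r) :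
    ∫ y in (0 : ℝ)..x, clampS G r y = ∫ y in (0 : ℝ)..x, G.S y := by
  refine intervalIntegral.integral_congr fun y hy => ?_
  rw [uIcc_of_le h0] at hy
  exact clampS_eq G hy.1 (hy.2.trans hx)

/-- `∫₀^𝓡 S + ∫_Ω (ρ(Y)/m) θ(σ-|Y-X|) S(𝓡(Y)) dY` is weakly differentiable. -/
lemma IsState.hasWeakGrad_transfer (h : IsState Ω P u) (hcell : IsCell Ω C P)
    (hr : CrowdLe G Ω u r) : HasWeakGrad
      (fun X => (∫ y in (0 : ℝ)..crowd G Ω u X, clampS G r y) + transferPot G Ω u X)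
      (transferGrad G Ω u r) := by
  obtain ⟨c, hc0, hc1, hc2⟩ := h.exists_transfer_bound hcell hr
  obtain ⟨m1, m2⟩ := h.measurable_transfer hcell hr
  obtain ⟨S, hS0, hS⟩ := exists_clampS_le hr.mem hr.nonneg
  obtain ⟨L, hL⟩ := h.crowd_lipschitz (G := G) hcell.isOpen
  have w1 : HasWeakGrad (crowd G Ω u) (ballConvGrad G.σ fun Y => 1 / G.m * extDens Ω u Y) := by
    rw [crowd_eq_ballConv G hcell.isOpen.measurableSet]
    exact hasWeakGrad_ballConv m1 hc1 G.σ_pos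
  refine (w1.comp hL (P := fun x => ∫ y in (0 : ℝ)..x, clampS G r y) (p := clampS G r)
    (hasDerivAt_primitive_clampS hr.mem hr.nonneg) (continuous_clampS hr.mem hr.nonneg)
    (a := S.toNNReal) fun x => ?_).add (hasWeakGrad_ballConv m2 hc2 G.σ_pos)
  rw [← NNReal.coe_le_coe, coe_nnnorm, Real.coe_toNNReal S hS0,
    Real.norm_of_nonneg (clampS_nonneg hr.mem hr.nonneg x)]
  exact hS x

lemma IsState.exists_transfer_le (h : IsState Ω P u) (hcell : IsCell Ω C P)
    (hr : CrowdLe G Ω u r) : ∃ c, ∀ X ∈ Ω,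
      |(∫ y in (0 : ℝ)..crowd G Ω u X, clampS G r y) + transferPot G Ω u X| ≤ c ∧
        ‖transferGrad G Ω u r X‖ ≤ c := by
  obtain ⟨c, hc0, hc1, hc2⟩ := h.exists_transfer_bound hcell hr
  obtain ⟨m1, m2⟩ := h.measurable_transfer hcell hr
  obtain ⟨S, hS0, hS⟩ := exists_clampS_le hr.mem hr.nonneg
  set g := G.σ ^ 2 * (c * solidAngle.real univ) with hg
  have hr0 := hr.nonneg
  have hk : ∀ X, |transferPot G Ω u X| ≤ c * volume.real (closedBall (0 : V3) G.σ) :=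
    abs_ballConv_le hc2 G.σ
  refine ⟨S * r + c * volume.real (closedBall (0 : V3) G.σ) + (S * g + g), fun X hX => ?_⟩
  have hg0 : 0 ≤ g := by positivity
  have hv : 0 ≤ c * volume.real (closedBall (0 : V3) G.σ) := by positivity
  have hSr : 0 ≤ S * r := by positivity
  have hSg : 0 ≤ S * g := by positivity
  constructor
  · have h1 := intervalIntegral.norm_integral_le_of_norm_le_const (a := (0 : ℝ))
      (b := crowd G Ω u X) (f := clampS G r) (C := S) fun y _ => by
        rw [Real.norm_of_nonneg (clampS_nonneg hr.mem hr0 y)]; exact hS y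
    have h2 : |crowd G Ω u X - 0| ≤ r := by
      rw [sub_zero, abs_of_nonneg (hr.le X hX).1]; exact (hr.le X hX).2
    have h3 := h1.trans (mul_le_mul_of_nonneg_left h2 hS0)
    exact (abs_add_le _ _).trans (by linarith [hk X, Real.norm_eq_abs (∫ y in (0 : ℝ)..crowd G Ω u X, clampS G r y)])
  · refine (norm_add_le _ _).trans ?_
    rw [norm_smul, Real.norm_of_nonneg (clampS_nonneg hr.mem hr0 _)]
    have h1 := mul_le_mul (hS (crowd G Ω u X)) (norm_ballConvGrad_le (σ := G.σ) hc1 X)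
      (norm_nonneg _) hS0
    have h2 := norm_ballConvGrad_le (σ := G.σ) hc2 X
    linarith

lemma IsState.transfer_periodic (h : IsState Ω P u) (hcell : IsCell Ω C P)
    (hr : CrowdLe G Ω u r) {p : V3} (hp : p ∈ P) (X : V3) :
    ((∫ y in (0 : ℝ)..crowd G Ω u (X + p), clampS G r y) + transferPot G Ω u (X + p)
      = (∫ y in (0 : ℝ)..crowd G Ω u X, clampS G r y) + transferPot G Ω u X) ∧
    transferGrad G Ω u r (X + p) = transferGrad G Ω u r X := by
  have h1 : ∀ X, extDens Ω u (X + p) = extDens Ω u X := h.extDens_periodic hcell hp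
  have h2 : ∀ X, extS G Ω u (X + p) = extS G Ω u X := (h.gasData hcell hr).s_periodic p hp
  have h3 := h.crowd_periodic (G := G) hcell hp X
  rw [transferPot, transferGrad, transferGrad, h3,
    ballConv_periodic (fun X => by rw [h1, h2]), ballConvGrad_periodic (fun X => by rw [h1]),
    ballConvGrad_periodic (fun X => by rw [h1, h2])]
  exact ⟨rfl, rfl⟩

lemma inner_ballConvGrad {h : V3 → ℝ} (hm : Measurable h) {c : ℝ} (hb : ∀ X, |h X| ≤ c) (σ : ℝ)
    (X M : V3) : inner ℝ M (ballConvGrad σ h X)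
      = σ ^ 2 * ∫ α : S2, h (X + σ • (α : V3)) * inner ℝ M (α : V3) ∂solidAngle := by
  rw [ballConvGrad, real_inner_smul_right, ← integral_inner (integrable_ballConvGrad hm hb X)]
  simp only [real_inner_smul_right]

/-- The collisional transfer in terms of gradients. -/
lemma IsState.integral_transfer (h : IsState Ω P u) (hcell : IsCell Ω C P)
    (hr : CrowdLe G Ω u r) {X : V3} (hX : X ∈ Ω) :
    G.σ ^ 2 / G.m * ∫ e : Coll, (extS G Ω u X + extS G Ω u (X + G.σ • (e.1 : V3)))
        * (chi Ω X * u X e.2.1 * (chi Ω (X + G.σ • (e.1 : V3)) * u (X + G.σ • (e.1 : V3)) e.2.2))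
        * inner ℝ e.2.1 (e.1 : V3) ∂collMeas
      = inner ℝ (∫ ξ, u X ξ • ξ) (transferGrad G Ω u r X) := by
  obtain ⟨c, hc0, hc1, hc2⟩ := h.exists_transfer_bound hcell hr
  obtain ⟨m1, m2⟩ := h.measurable_transfer hcell hr
  set M := ∫ ξ, u X ξ • ξ with hM
  have hi := (h.gasData hcell hr).twoPoint_inner.integrable_coll (y := fun _ => X)
    (z := fun e => X + G.σ • (e.1 : V3)) measurable_const (by fun_prop)
  have hMi : Integrable fun ξ => u X ξ • ξ := by
    obtain ⟨C, _, hC⟩ := h.exists_entropy_decay 0 5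
    exact integrable_smul_of_le (h.continuous_slice hX).aestronglyMeasurable fun ξ => (hC X hX ξ).1
  rw [integral_prod _ hi]
  -- Integration over the velocities leaves the momentum at `X` and the density at `X + σα`. The two
  -- values of `S(𝓡)` in the sum then produce the two sphere averages that make up `transferGrad`.
  have e1 : ∀ α : S2, ∫ p : V3 × V3, (extS G Ω u X + extS G Ω u (X + G.σ • (α : V3)))
        * (chi Ω X * u X p.1 * (chi Ω (X + G.σ • (α : V3)) * u (X + G.σ • (α : V3)) p.2))
        * inner ℝ p.1 (α : V3) ∂(volume.prod volume)
      = (extS G Ω u X + extS G Ω u (X + G.σ • (α : V3))) * extDens Ω u (X + G.σ • (α : V3))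
        * inner ℝ M (α : V3) := by
    intro α
    have h1 : ∀ p : V3 × V3, (extS G Ω u X + extS G Ω u (X + G.σ • (α : V3)))
        * (chi Ω X * u X p.1 * (chi Ω (X + G.σ • (α : V3)) * u (X + G.σ • (α : V3)) p.2))
        * inner ℝ p.1 (α : V3) = (extS G Ω u X + extS G Ω u (X + G.σ • (α : V3)))
          * ((u X p.1 * inner ℝ p.1 (α : V3))
            * (chi Ω (X + G.σ • (α : V3)) * u (X + G.σ • (α : V3)) p.2)) := fun p => by
      rw [chi_of_mem hX]; ring
    simp only [h1]
    rw [integral_const_mul, integral_prod_mul (f := fun ξ => u X ξ * inner ℝ ξ (α : V3))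
      (g := fun ξ => chi Ω (X + G.σ • (α : V3)) * u (X + G.σ • (α : V3)) ξ), integral_const_mul]
    have h2 : ∫ ξ, u X ξ * inner ℝ ξ (α : V3) = inner ℝ M (α : V3) := by
      rw [real_inner_comm, hM, ← integral_inner hMi]
      simp only [real_inner_smul_right, real_inner_comm]
    rw [h2, extDens, dens]; ring
  have e2 := inner_ballConvGrad m1 hc1 G.σ X M
  have e3 := inner_ballConvGrad m2 hc2 G.σ X M
  have i2 : Integrable (fun α : S2 => 1 / G.m * extDens Ω u (X + G.σ • (α : V3))
      * inner ℝ M (α : V3)) solidAngle := by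
    have := (integrable_ballConvGrad (σ := G.σ) m1 hc1 X).const_inner (𝕜 := ℝ) M
    simpa only [real_inner_smul_right] using this
  have i3 : Integrable (fun α : S2 => 1 / G.m * (extS G Ω u (X + G.σ • (α : V3))
      * extDens Ω u (X + G.σ • (α : V3))) * inner ℝ M (α : V3)) solidAngle := by
    have := (integrable_ballConvGrad (σ := G.σ) m2 hc2 X).const_inner (𝕜 := ℝ) M
    simpa only [real_inner_smul_right] using this
  rw [transferGrad, inner_add_right, real_inner_smul_right, e2, e3]
  have e4 : clampS G r (crowd G Ω u X) = extS G Ω u X := by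
    rw [extS_eq hr, chi_of_mem hX, one_mul]
  rw [e4, mul_left_comm, ← mul_add, ← integral_const_mul (extS G Ω u X),
    ← integral_add (i2.const_mul _) i3, div_eq_mul_one_div, mul_assoc, ← integral_const_mul]
  congr 1
  refine integral_congr_ae (Eventually.of_forall fun α => ?_)
  simp only
  rw [e1 α]
  ring

end Transfer

/-! ### Moments of the kinetic equation -/

lemma abs_mul_le_wgt {a b C c : ℝ} {n N : ℕ} {ξ : V3} (ha : |a| ≤ C * wgt (n + N) ξ)
    (hb : |b| ≤ c * (1 + ‖ξ‖) ^ N) : |a * b| ≤ C * c * wgt n ξ := by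
  rw [abs_mul]
  calc |a| * |b| ≤ (C * wgt (n + N) ξ) * (c * (1 + ‖ξ‖) ^ N) :=
        mul_le_mul ha hb (abs_nonneg _) ((abs_nonneg _).trans ha)
    _ = C * c * (wgt (n + N) ξ * (1 + ‖ξ‖) ^ N) := by ring
    _ = _ := by rw [wgt_add_mul]

lemma integral_fderiv_eq_zero {g : V3 → ℝ} (hg : Differentiable ℝ g) (hi : Integrable g) {v : V3}
    (hi' : Integrable fun ξ => fderiv ℝ g ξ v) : ∫ ξ, fderiv ℝ g ξ v = 0 := by
  have := integral_mul_fderiv_eq_neg_fderiv_mul_of_integrable (μ := (volume : Measure V3))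
    (f := fun _ => (1 : ℝ)) (g := g) (v := v) (by simp) (by simpa using hi') (by simpa using hi)
    (fun _ _ => differentiableAt_const _) fun x _ => hg x
  simpa using this

/-- `w` is the rate of change of the state `u` under the force `A`. -/
structure IsRate (G : Gas) (Ω : Set V3) (u w : V3 → V3 → ℝ) (A : V3 → V3) : Prop where
  continuousOn : ContinuousOn (fun p : V3 × V3 => w p.1 p.2) (Ω ×ˢ univ)
  decay : ∀ n : ℕ, ∃ C : ℝ, ∀ X ∈ Ω, ∀ ξ, |w X ξ| ≤ C * wgt n ξ
  force_le : ∃ c, ∀ X ∈ Ω, ‖A X‖ ≤ c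
  equation : ∀ X ∈ Ω, ∀ ξ, w X ξ + inner ℝ ξ (gradient (fun Y => u Y ξ) X)
      + inner ℝ (A X) (gradient (fun η => u X η) ξ) = collision G Ω u X ξ

lemma IsCell.integrableOn {Ω C P : Set V3} (h : IsCell Ω C P) {g : V3 → ℝ}
    (hg : Measurable fun X => chi Ω X * g X) (hb : ∃ a, ∀ X ∈ Ω, |g X| ≤ a) :
    IntegrableOn g C := by
  obtain ⟨a, ha⟩ := hb
  refine (Measure.integrableOn_of_bounded (M := a) (s := C) h.measure_lt_top.ne
    hg.aestronglyMeasurable ?_).congr_fun (fun X hX => ?_) h.measurableSet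
  · filter_upwards [ae_restrict_mem h.measurableSet] with X hX
    rw [chi_of_mem (h.subset hX), one_mul]; exact ha X (h.subset hX)
  · simp only
    rw [chi_of_mem (h.subset hX), one_mul]

section Balance

variable {G : Gas} {Ω C P : Set V3} {u w : V3 → V3 → ℝ} {A : V3 → V3} {r : ℝ}

lemma IsState.contDiff_velocity (h : IsState Ω P u) {X : V3} (hX : X ∈ Ω) :
    ContDiff ℝ 1 (u X) := by
  rw [← contDiffOn_univ]
  exact h.contDiffOn.comp (f := fun ξ : V3 => (X, ξ)) (by fun_prop) fun _ _ => ⟨hX, mem_univ _⟩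

lemma IsState.integrable_mul_moments (h : IsState Ω P u) (hw : IsRate G Ω u w A)
    (hΩ : IsOpen Ω) {X : V3} (hX : X ∈ Ω) {ψ : V3 → ℝ} (hψ : Continuous ψ) {c : ℝ} {N : ℕ}
    (hc : ∀ ξ, |ψ ξ| ≤ c * (1 + ‖ξ‖) ^ N) :
    Integrable (fun ξ => w X ξ * ψ ξ) ∧
    Integrable (fun ξ => inner ℝ ξ (gradient (fun Y => u Y ξ) X) * ψ ξ) ∧
    ∀ v : V3, Integrable (fun ξ => inner ℝ v (gradient (fun η => u X η) ξ) * ψ ξ) := by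
  have hs : ∀ {g : V3 × V3 → ℝ}, ContinuousOn g (Ω ×ˢ univ) → Continuous fun ξ => g (X, ξ) :=
    fun {g} hg => by
      rw [← continuousOn_univ]
      exact hg.comp (f := fun ξ : V3 => (X, ξ)) (by fun_prop) fun _ _ => ⟨hX, mem_univ _⟩
  obtain ⟨C₁, h1⟩ := hw.decay (4 + N)
  obtain ⟨C₂, h2⟩ := h.decay_gradient {X} (singleton_subset_iff.2 hX) isCompact_singleton (4 + N + 1)
  obtain ⟨C₃, h3⟩ := h.decay_gradient {X} (singleton_subset_iff.2 hX) isCompact_singleton (4 + N)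
  refine ⟨?_, ?_, fun v => ?_⟩
  · exact integrable_of_le_wgt (c := C₁ * c) ((hs hw.continuousOn).mul hψ).aestronglyMeasurable le_rfl
      fun ξ => abs_mul_le_wgt (h1 X hX ξ) (hc ξ)
  · refine integrable_of_le_wgt (c := C₂ * c)
      ((hs (continuousOn_transport hΩ h.contDiffOn)).mul hψ).aestronglyMeasurable le_rfl
      fun ξ => abs_mul_le_wgt ?_ (hc ξ)
    have h4 := (h2 X rfl ξ).1
    have h5 : 0 ≤ C₂ := nonneg_of_mul_nonneg_left ((norm_nonneg _).trans h4) (wgt_pos _ ξ)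
    calc _ ≤ ‖ξ‖ * ‖gradient (fun Y => u Y ξ) X‖ := abs_real_inner_le_norm _ _
      _ ≤ ‖ξ‖ * (C₂ * wgt (4 + N + 1) ξ) := mul_le_mul_of_nonneg_left h4 (norm_nonneg _)
      _ = C₂ * (‖ξ‖ * wgt (4 + N + 1) ξ) := by ring
      _ ≤ _ := mul_le_mul_of_nonneg_left (norm_le_pow _ ξ) h5
  · refine integrable_of_le_wgt (c := ‖v‖ * C₃ * c)
      ((continuous_const.inner (continuous_gradient (h.contDiff_velocity hX))).mul
        hψ).aestronglyMeasurable le_rfl fun ξ => abs_mul_le_wgt ?_ (hc ξ)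
    calc _ ≤ ‖v‖ * ‖gradient (fun η => u X η) ξ‖ := abs_real_inner_le_norm _ _
      _ ≤ ‖v‖ * (C₃ * wgt (4 + N) ξ) := mul_le_mul_of_nonneg_left (h3 X rfl ξ).2 (norm_nonneg _)
      _ = _ := by ring

lemma IsState.moment_balance (h : IsState Ω P u) (hw : IsRate G Ω u w A)
    (hΩ : IsOpen Ω) {X : V3} (hX : X ∈ Ω) {ψ : V3 → ℝ} (hψ : Continuous ψ) {c : ℝ} {N : ℕ}
    (hc : ∀ ξ, |ψ ξ| ≤ c * (1 + ‖ξ‖) ^ N) :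
    ∫ ξ, collision G Ω u X ξ * ψ ξ = (∫ ξ, w X ξ * ψ ξ)
      + (∫ ξ, inner ℝ ξ (gradient (fun Y => u Y ξ) X) * ψ ξ)
      + ∫ ξ, inner ℝ (A X) (gradient (fun η => u X η) ξ) * ψ ξ := by
  obtain ⟨i1, i2, i3⟩ := h.integrable_mul_moments hw hΩ hX hψ hc
  have i4 : Integrable fun ξ => w X ξ * ψ ξ + inner ℝ ξ (gradient (fun Y => u Y ξ) X) * ψ ξ :=
    i1.add i2
  rw [← integral_add i1 i2, ← integral_add i4 (i3 (A X))]
  simp only [← hw.equation X hX, add_mul]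

/-- Conservation of mass. -/
lemma IsState.mass_balance (h : IsState Ω P u) (hw : IsRate G Ω u w A) (hcell : IsCell Ω C P)
    (hr : CrowdLe G Ω u r) {X : V3} (hX : X ∈ Ω) :
    ∫ ξ, inner ℝ ξ (gradient (fun Y => u Y ξ) X) = -∫ ξ, w X ξ := by
  -- The constant `1` is a collision invariant, and the force term is a divergence in velocity
  -- space; both integrate to zero.
  have hc : ∀ ξ : V3, |(1 : ℝ)| ≤ 1 * (1 + ‖ξ‖) ^ 0 := fun ξ => by simp
  have h1 := h.moment_balance hw hcell.isOpen hX continuous_const hc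
  rw [integral_collision_mul (h.gasData hcell hr) measurable_const hc] at h1
  have h2 : ∫ ξ, inner ℝ (A X) (gradient (fun η => u X η) ξ) = 0 := by
    have := ((h.integrable_mul_moments hw hcell.isOpen hX continuous_const hc).2.2 (A X))
    simp only [mul_one, inner_gradient] at this ⊢
    exact integral_fderiv_eq_zero ((h.contDiff_velocity hX).differentiable (by simp))
      (h.integrable_slice hX) this
  simp only [sub_self, mul_zero, integral_zero, mul_one, h2] at h1
  linarith

lemma abs_log_factor_le (β : ℝ) {x c : ℝ} {n : ℕ} {ξ : V3} (hx : |x| ≤ c * (1 + ‖ξ‖) ^ n) :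
    1 + |x + β * ‖ξ‖ ^ 2| ≤ (1 + (1 + |β|) * (1 + |c|)) * (1 + ‖ξ‖) ^ (n + 2) := by
  have h1 : 1 ≤ (1 + ‖ξ‖) ^ (n + 2) := one_le_pow₀ (one_le_one_add_norm ξ)
  have h2 : 1 ≤ (1 + ‖ξ‖) ^ n := one_le_pow₀ (one_le_one_add_norm ξ)
  have h3 : 1 + |x| ≤ (1 + |c|) * (1 + ‖ξ‖) ^ n := by
    have := hx.trans (mul_le_mul_of_nonneg_right (le_abs_self c) (by positivity))
    linarith
  calc _ ≤ (1 + ‖ξ‖) ^ (n + 2) + (1 + |β|) * ((1 + |c|) * (1 + ‖ξ‖) ^ n * (1 + ‖ξ‖) ^ 2) := by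
        refine add_le_add h1 ((IsState.abs_entropy_factor_le β _ ξ).trans ?_)
        gcongr
    _ = _ := by rw [pow_add]; ring

lemma IsState.abs_entropyFactor_le (h : IsState Ω P u) (β : ℝ) : ∃ (N : ℕ) (c : ℝ),
    ∀ X ∈ Ω, ∀ ξ, |1 + GasData.logFactor β u X ξ| ≤ c * (1 + ‖ξ‖) ^ N := by
  obtain ⟨n, c, hc⟩ := h.log_growth
  exact ⟨n + 2, _, fun X hX ξ => ((abs_add_le _ _).trans (by rw [abs_one]; rfl)).trans
    (abs_log_factor_le β (hc X hX ξ))⟩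

lemma IsState.continuous_logFactor (h : IsState Ω P u) (β : ℝ) {X : V3} (hX : X ∈ Ω) :
    Continuous fun ξ => 1 + GasData.logFactor β u X ξ :=
  continuous_const.add (((h.continuous_slice hX).log fun ξ => (h.pos X hX ξ).ne').add (by fun_prop))

/-- The integrand is the derivative of `u (log u + β‖ξ‖²)` in the direction `v` minus `2β u ⟨v, ξ⟩`,
and the derivative of a decaying function integrates to zero. -/
lemma IsState.integral_force_mul (h : IsState Ω P u) (hw : IsRate G Ω u w A) (hΩ : IsOpen Ω)
    (β : ℝ) {X : V3} (hX : X ∈ Ω) (v : V3) :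
    ∫ ξ, inner ℝ v (gradient (fun η => u X η) ξ) * (1 + GasData.logFactor β u X ξ)
      = -(2 * β * inner ℝ v (∫ ξ, u X ξ • ξ)) := by
  obtain ⟨N, c, hc⟩ := h.abs_entropyFactor_le β
  have i1 := (h.integrable_mul_moments hw hΩ hX (h.continuous_logFactor β hX) (hc X hX)).2.2 v
  obtain ⟨C, hC0, hC⟩ := h.exists_entropy_decay β 5
  have iM := integrable_smul_of_le (h.continuous_slice hX).aestronglyMeasurable
    fun ξ => (hC X hX ξ).1
  have i2 : Integrable fun ξ => 2 * β * inner ℝ v (u X ξ • ξ) :=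
    (iM.const_inner (𝕜 := ℝ) v).const_mul _
  have hd := (h.contDiff_velocity hX).differentiable (by simp)
  have h1 : ∀ ξ, fderiv ℝ (entropyDensity β u X) ξ v
      = inner ℝ v (gradient (fun η => u X η) ξ) * (1 + GasData.logFactor β u X ξ)
        + 2 * β * inner ℝ v (u X ξ • ξ) := by
    intro ξ
    have h2 := (hd ξ).hasFDerivAt
    have h3 : HasFDerivAt (fun η : V3 => ‖η‖ ^ 2) (2 • (innerSL ℝ) ξ) ξ :=
      (hasStrictFDerivAt_norm_sq ξ).hasFDerivAt
    have h4 := h2.mul ((h2.log (h.pos X hX ξ).ne').add (h3.const_mul β))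
    rw [show entropyDensity β u X = u X * ((fun η => Real.log (u X η)) + fun η => β * ‖η‖ ^ 2)
      from rfl, h4.fderiv, inner_gradient]
    have := (h.pos X hX ξ).ne'
    simp only [GasData.logFactor, _root_.add_apply, _root_.smul_apply,
      smul_eq_mul, Pi.add_apply, innerSL_apply_apply, real_inner_smul_right, real_inner_comm v ξ,
      nsmul_eq_mul, Nat.cast_ofNat]
    field_simp
    ring
  have h5 := integral_fderiv_eq_zero (g := entropyDensity β u X) (v := v)
    (by
      refine hd.mul (Differentiable.add (hd.log fun ξ => (h.pos X hX ξ).ne') ?_)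
      exact (differentiable_id.norm_sq ℝ).const_mul β)
    (integrable_of_le_wgt (c := C) (n := 5) ((h.continuous_slice hX).mul
      (((h.continuous_slice hX).log fun ξ => (h.pos X hX ξ).ne').add
        (by fun_prop))).aestronglyMeasurable (by norm_num) fun ξ => (hC X hX ξ).2)
    ((i1.add i2).congr (Eventually.of_forall fun ξ => (h1 ξ).symm))
  simp only [h1] at h5
  rw [integral_add i1 i2, integral_const_mul, integral_inner iM] at h5
  linarith

/-- The potential `∫₀^𝓡 S + ∫_Ω (ρ(Y)/m) θ(σ-|Y-X|) S(𝓡(Y)) dY`. -/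
noncomputable def entropyPot (G : Gas) (Ω : Set V3) (u : V3 → V3 → ℝ) (r : ℝ) (X : V3) : ℝ :=
  (∫ y in (0 : ℝ)..crowd G Ω u X, clampS G r y) + transferPot G Ω u X

/-- The balance of `⟨f (ln f + β |ξ|²)⟩ + H⁽ᶜ⁾` in the cell. -/
theorem IsState.entropy_balance (h : IsState Ω P u) (hw : IsRate G Ω u w A)
    (hcell : IsCell Ω C P) (hr : CrowdLe G Ω u r) {β : ℝ} (hflux : NonnegFlux Ω C P u β) :
    IntegrableOn (fun X => ∫ ξ, w X ξ * (1 + GasData.logFactor β u X ξ)) C ∧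
    IntegrableOn (fun X => entropyPot G Ω u r X * ∫ ξ, w X ξ) C ∧
    (∫ X in C, ∫ ξ, w X ξ * (1 + GasData.logFactor β u X ξ))
      + ∫ X in C, entropyPot G Ω u r X * ∫ ξ, w X ξ
      ≤ ∫ X in C, 2 * β * inner ℝ (A X) (∫ ξ, u X ξ • ξ) := by
  have hg := h.gasData hcell hr
  have hΩ := hcell.isOpen
  have hm2 : 0 ≤ G.σ ^ 2 / G.m := div_nonneg (sq_nonneg _) G.m_pos.le
  obtain ⟨N, c₀, hc⟩ := h.abs_entropyFactor_le β
  obtain ⟨cA, hA⟩ := hw.force_le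
  obtain ⟨C₅, hC50, hC5⟩ := h.exists_entropy_decay β 5
  have hwm : 0 ≤ wgtMass := integral_nonneg fun ξ => (wgt_pos 4 ξ).le
  have key : ∀ {g : V3 → ℝ}, Measurable (fun X => chi Ω X * g X) → (∃ a, ∀ X ∈ Ω, |g X| ≤ a) →
      IntegrableOn g C := fun hgm hg => hcell.integrableOn hgm hg
  -- the rate of change
  have hb1 : ∃ a, ∀ X ∈ Ω, |∫ ξ, w X ξ * (1 + GasData.logFactor β u X ξ)| ≤ a := by
    obtain ⟨C₁, h1⟩ := hw.decay (4 + N)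
    exact ⟨_, fun X hX => norm_integral_le_wgtMass
      (u := fun ξ => w X ξ * (1 + GasData.logFactor β u X ξ)) fun ξ => abs_mul_le_wgt (h1 X hX ξ) (hc X hX ξ)⟩
  have hb0 : ∃ a, ∀ X ∈ Ω, |∫ ξ, w X ξ| ≤ a := by
    obtain ⟨C₁, h1⟩ := hw.decay 4
    exact ⟨_, fun X hX => norm_integral_le_wgtMass (u := w X) (h1 X hX)⟩
  have hl : ContinuousOn (fun p : V3 × V3 => w p.1 p.2 * (1 + GasData.logFactor β u p.1 p.2))
      (Ω ×ˢ univ) := by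
    refine hw.continuousOn.mul (continuousOn_const.add (ContinuousOn.add ?_ (by fun_prop)))
    exact h.contDiffOn.continuousOn.log fun p hp => (h.pos p.1 hp.1 p.2).ne'
  have T1 := key (measurable_chi_mul_integral (h := fun X ξ =>
    w X ξ * (1 + GasData.logFactor β u X ξ)) hΩ hl) hb1
  -- the collision term
  have tW := hg.twoPoint_entropy β
  have tV := hg.twoPoint_inner
  have hb3 : ∃ a, ∀ X ∈ Ω, |∫ ξ, collision G Ω u X ξ * (1 + GasData.logFactor β u X ξ)| ≤ a ∧
      ∫ ξ, collision G Ω u X ξ * (1 + GasData.logFactor β u X ξ) = G.σ ^ 2 / G.m * ∫ e : Coll,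
        (extS G Ω u X + extS G Ω u (X - G.σ • (e.1 : V3)))
        * (chi Ω X * u X e.2.1 * (chi Ω (X - G.σ • (e.1 : V3)) * u (X - G.σ • (e.1 : V3)) e.2.2))
        * (Vp e * (GasData.logFactor β (fun X ξ => chi Ω X * u X ξ) X (post e.2.1 e.2.2 e.1)
          - GasData.logFactor β (fun X ξ => chi Ω X * u X ξ) X e.2.1)) ∂collMeas := by
    obtain ⟨a, ha⟩ := tW.bound
    refine ⟨G.σ ^ 2 / G.m * ∫ e : Coll, a * (pw e ^ 4)⁻¹ ∂collMeas, fun X hX => ?_⟩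
    have h1 := integral_collision_mul (X := X) hg (h.continuous_logFactor β hX).measurable (hc X hX)
    simp only [add_sub_add_left_eq_sub] at h1
    have h2 : ∀ ξ, GasData.logFactor β u X ξ
        = GasData.logFactor β (fun X ξ => chi Ω X * u X ξ) X ξ := fun ξ => by
      simp only [GasData.logFactor, chi_of_mem hX, one_mul]
    simp only [h2] at h1 ⊢
    refine ⟨?_, h1⟩
    rw [h1, abs_mul, abs_of_nonneg hm2, ← Real.norm_eq_abs (∫ _, _ ∂_)]
    exact mul_le_mul_of_nonneg_left (norm_integral_le_of_norm_le
      ((integrable_pw_inv le_rfl).const_mul a) (Eventually.of_forall fun e => ha _ _ _)) hm2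
  obtain ⟨a₃, hb3⟩ := hb3
  have T3 : IntegrableOn (fun X => ∫ ξ, collision G Ω u X ξ * (1 + GasData.logFactor β u X ξ)) C := by
    have h1 := ((tW.integrable hcell (y := fun p => p.1) (z := fun p => p.1 - G.σ • (p.2.1 : V3))
      (by fun_prop) (by fun_prop)).integral_prod_left).const_mul (G.σ ^ 2 / G.m)
    exact IntegrableOn.congr_fun h1 (fun X hX => (hb3 X (hcell.subset hX)).2.symm)
      hcell.measurableSet
  -- the flux term
  have hpt : ∀ X ∈ Ω, ∫ ξ, inner ℝ ξ (gradient (fun Y => entropyDensity β u Y ξ) X)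
      = (∫ ξ, collision G Ω u X ξ * (1 + GasData.logFactor β u X ξ))
        - (∫ ξ, w X ξ * (1 + GasData.logFactor β u X ξ))
        + 2 * β * inner ℝ (A X) (∫ ξ, u X ξ • ξ) := by
    intro X hX
    rw [h.moment_balance hw hΩ hX (h.continuous_logFactor β hX) (hc X hX),
      h.integral_force_mul hw hΩ β hX]
    have : ∀ ξ, inner ℝ ξ (gradient (fun Y => entropyDensity β u Y ξ) X)
        = inner ℝ ξ (gradient (fun Y => u Y ξ) X) * (1 + GasData.logFactor β u X ξ) := fun ξ => by
      rw [h.gradient_entropy hΩ β hX, real_inner_smul_right, GasData.logFactor]; ring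
    simp only [this]
    ring
  -- Near the boundary the gradients of `u` are not controlled. This uniform bound is read off from
  -- the other terms of the equation by `hpt`.
  have hb2 : ∃ a, ∀ X ∈ Ω,
      |∫ ξ, inner ℝ ξ (gradient (fun Y => entropyDensity β u Y ξ) X)| ≤ a := by
    obtain ⟨a₁, ha₁⟩ := hb1
    refine ⟨a₃ + a₁ + |2 * β| * (cA * (C₅ * wgtMass)), fun X hX => ?_⟩
    rw [hpt X hX]
    have h1 : |2 * β * inner ℝ (A X) (∫ ξ, u X ξ • ξ)| ≤ |2 * β| * (cA * (C₅ * wgtMass)) := by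
      rw [abs_mul]
      refine mul_le_mul_of_nonneg_left ((abs_real_inner_le_norm _ _).trans ?_) (abs_nonneg _)
      exact mul_le_mul (hA X hX) (norm_integral_smul_le fun ξ => (hC5 X hX ξ).1) (norm_nonneg _)
        ((norm_nonneg _).trans (hA X hX))
    exact (abs_add_le _ _).trans (add_le_add ((abs_sub _ _).trans
      (add_le_add (hb3 X hX).1 (ha₁ X hX))) h1)
  have T2 : IntegrableOn (fun X =>
      ∫ ξ, inner ℝ ξ (gradient (fun Y => entropyDensity β u Y ξ) X)) C :=
    key (measurable_chi_mul_integral (h := fun X ξ =>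
      inner ℝ ξ (gradient (fun Y => entropyDensity β u Y ξ) X)) hΩ
      (continuousOn_transport hΩ (h.contDiffOn_entropy β))) hb2
  have hfl := hflux.entropy hb2
  -- the potential
  have hK := h.hasWeakGrad_transfer hcell hr
  obtain ⟨cK, hcK⟩ := h.exists_transfer_le hcell hr
  have hmass : ∃ c, ∀ X ∈ Ω, |∫ ξ, inner ℝ ξ (gradient (fun Y => u Y ξ) X)| ≤ c := by
    obtain ⟨a, ha⟩ := hb0
    exact ⟨a, fun X hX => by rw [h.mass_balance hw hcell hr hX, abs_neg]; exact ha X hX⟩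
  obtain ⟨-, hm⟩ := hflux.mass _ _ hK ⟨cK, hcK⟩ (fun p hp X => h.transfer_periodic hcell hr hp X)
    hmass
  have T4 : IntegrableOn (fun X => entropyPot G Ω u r X * ∫ ξ, w X ξ) C := by
    refine key ?_ ?_
    · have h1 : Measurable fun X => entropyPot G Ω u r X * (chi Ω X * ∫ ξ, w X ξ) :=
        hK.measurable_fun.mul (measurable_chi_mul_integral (h := w) hΩ hw.continuousOn)
      simpa only [mul_left_comm (entropyPot _ _ _ _ _)] using h1
    · obtain ⟨a, ha⟩ := hb0
      refine ⟨cK * a, fun X hX => ?_⟩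
      rw [abs_mul]
      exact mul_le_mul (hcK X hX).1 (ha X hX) (abs_nonneg _) ((abs_nonneg _).trans (hcK X hX).1)
  have T5 : IntegrableOn (fun X => inner ℝ (∫ ξ, u X ξ • ξ) (transferGrad G Ω u r X)) C := by
    refine key ?_ ⟨C₅ * wgtMass * cK, fun X hX => ?_⟩
    · have h1 := (measurable_chi_smul_moment hΩ h.contDiffOn.continuousOn).inner (𝕜 := ℝ) hK.measurable
      simpa only [real_inner_smul_left] using h1
    · exact (abs_real_inner_le_norm _ _).trans (mul_le_mul (norm_integral_smul_le
        fun ξ => (hC5 X hX ξ).1) (hcK X hX).2 (norm_nonneg _) (by positivity))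
  -- The divergence of the potential times the momentum integrates to zero. Together with
  -- conservation of mass this trades the collisional transfer for the change of `H⁽ᶜ⁾`.
  have e1 : ∫ X in C, inner ℝ (∫ ξ, u X ξ • ξ) (transferGrad G Ω u r X)
      = ∫ X in C, entropyPot G Ω u r X * ∫ ξ, w X ξ := by
    rw [← sub_eq_zero, ← integral_sub T5 T4, ← hm]
    refine setIntegral_congr_fun hcell.measurableSet fun X hX => ?_
    rw [h.mass_balance hw hcell hr (hcell.subset hX), entropyPot, real_inner_comm]
    ring
  have e2 : ∫ X in C, (∫ ξ, collision G Ω u X ξ * (1 + GasData.logFactor β u X ξ))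
      ≤ -∫ X in C, inner ℝ (∫ ξ, u X ξ • ξ) (transferGrad G Ω u r X) := by
    have h1 := mul_le_mul_of_nonneg_left (hg.collision_entropy_le hcell G.σ β) hm2
    rw [mul_neg, ← integral_const_mul, ← integral_const_mul] at h1
    rw [setIntegral_congr_fun hcell.measurableSet fun X hX => (hb3 X (hcell.subset hX)).2]
    refine h1.trans (neg_le_neg (le_of_eq ?_))
    exact setIntegral_congr_fun hcell.measurableSet fun X hX =>
      (h.integral_transfer hcell hr (hcell.subset hX)).symm
  refine ⟨T1, T4, ?_⟩
  have e3 : ∫ X in C, 2 * β * inner ℝ (A X) (∫ ξ, u X ξ • ξ)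
      = (∫ X in C, ∫ ξ, inner ℝ ξ (gradient (fun Y => entropyDensity β u Y ξ) X))
        - (∫ X in C, (∫ ξ, collision G Ω u X ξ * (1 + GasData.logFactor β u X ξ)))
        + ∫ X in C, ∫ ξ, w X ξ * (1 + GasData.logFactor β u X ξ) := by
    have T6 : IntegrableOn (fun X =>
        (∫ ξ, inner ℝ ξ (gradient (fun Y => entropyDensity β u Y ξ) X))
          - ∫ ξ, collision G Ω u X ξ * (1 + GasData.logFactor β u X ξ)) C := T2.sub T3
    rw [← integral_sub T2 T3, ← integral_add T6 T1]
    refine setIntegral_congr_fun hcell.measurableSet fun X hX => ?_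
    rw [hpt X (hcell.subset hX)]
    ring
  linarith

end Balance

/-! ### Fluxes of zero divergence integral -/

/-- The weak divergence of `V` in `Ω` has zero integral over `C`. -/
def HasZeroFlux (Ω C : Set V3) (V : V3 → V3) : Prop :=
  ∃ d, WeakDiv Ω V d ∧ IntegrableOn d C ∧ ∫ X in C, d X = 0

namespace HasZeroFlux

variable {Ω C P : Set V3} {V V' : V3 → V3}

lemma zeroDivergenceIntegral (h : HasZeroFlux Ω C V) (hcell : IsCell Ω C P) :
    ZeroDivergenceIntegral Ω C V := by
  obtain ⟨d, h1, h2, h3⟩ := h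
  exact h1.zeroDivergenceIntegral hcell.isOpen hcell.measurableSet hcell.subset h2 h3

lemma congr (h : HasZeroFlux Ω C V) (hΩ : MeasurableSet Ω) (hV : ∀ X ∈ Ω, V' X = V X) :
    HasZeroFlux Ω C V' := by
  obtain ⟨d, h1, h2, h3⟩ := h
  exact ⟨d, h1.congr hΩ hV fun _ _ => rfl, h2, h3⟩

lemma add (h : HasZeroFlux Ω C V) (h' : HasZeroFlux Ω C V') :
    HasZeroFlux Ω C fun X => V X + V' X := by
  obtain ⟨d, h1, h2, h3⟩ := h
  obtain ⟨d', h1', h2', h3'⟩ := h'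
  exact ⟨_, h1.add h1', h2.add h2', by rw [integral_add h2 h2', h3, h3', add_zero]⟩

lemma const_smul (h : HasZeroFlux Ω C V) (c : ℝ) : HasZeroFlux Ω C fun X => c • V X := by
  obtain ⟨d, h1, h2, h3⟩ := h
  exact ⟨_, h1.const_smul c, h2.const_mul c, by rw [integral_const_mul, h3, mul_zero]⟩

end HasZeroFlux

/-- For each parameter the divergence is `w(X + r, X) - w(X, X - r)`, and the two terms have equal
integrals over the cell by `IsCell.swap`. -/
lemma hasZeroFlux_lineAvg {Ω C P : Set V3} (hcell : IsCell Ω C P) {E : Type*} [MeasurableSpace E]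
    {μ : Measure E} [SFinite μ] {r : E → V3} {w : E → V3 → V3 → ℝ} {b : E → ℝ}
    (hr : Measurable r) (hw : Measurable fun p : E × V3 × V3 => w p.1 p.2.1 p.2.2)
    (hb : Integrable b μ) (hbr : Integrable (fun e => b e * ‖r e‖) μ)
    (hwb : ∀ e Y Z, |w e Y Z| ≤ b e) (h0 : ∀ e Y Z, Y ∉ Ω ∨ Z ∉ Ω → w e Y Z = 0)
    (hp : ∀ p ∈ P, ∀ e Y Z, w e (Y + p) (Z + p) = w e Y Z) :
    HasZeroFlux Ω C fun X => ∫ e, lineAvg r w e X • r e ∂μ := by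
  have : IsFiniteMeasure ((volume : Measure V3).restrict C) :=
    ⟨by simpa using hcell.measure_lt_top⟩
  have hi := integrable_lineDiv hr hw hb hwb (ν := volume.restrict C) (integrable_const (1 : ℝ))
  simp only [one_mul] at hi
  refine ⟨_, weakDiv_lineAvg hr hw hb hbr hwb Ω, hi.integral_prod_left, ?_⟩
  rw [integral_integral_swap hi]
  refine integral_eq_zero_of_ae (Eventually.of_forall fun e => ?_)
  have key : ∀ {y z : V3 → V3}, Measurable y → Measurable z →
      IntegrableOn (fun X => w e (y X) (z X)) C := fun {y z} hy hz => by
    refine Measure.integrableOn_of_bounded (M := b e) hcell.measure_lt_top.ne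
      (hw.comp (measurable_const.prodMk (hy.prodMk hz))).aestronglyMeasurable
      (Eventually.of_forall fun X => hwb e _ _)
  simp only [Pi.zero_apply]
  rw [integral_sub (key (z := fun X => X) (by fun_prop) measurable_id)
    (key (y := fun X => X) measurable_id (by fun_prop)),
    hcell.swap (w e) (h0 e) (fun p hp' => hp p hp' e), sub_self]

section Collisional

variable {G : Gas} {Ω C P : Set V3} {u : V3 → V3 → ℝ} {A : V3 → V3} {r : ℝ}
  {w : Coll → V3 → V3 → ℝ}

/-- Segment averages over collision configurations as iterated integrals. -/
lemma TwoPoint.integral_lineAvg (h : TwoPoint Ω P w) (σ : ℝ) (X : V3) {F : Type*}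
    [NormedAddCommGroup F] [NormedSpace ℝ F] [CompleteSpace F] {q : Coll → F} (hq : StronglyMeasurable q) {c : ℝ} (hqc : ∀ e, ‖q e‖ ≤ c) :
    Integrable (fun e => lineAvg (fun e => σ • (e.1 : V3)) w e X • q e) collMeas ∧
    ∫ ξ : V3, ∫ ξs : V3, ∫ α : S2, (∫ τ in (0 : ℝ)..1,
      w (α, ξ, ξs) (X + (τ * σ) • (α : V3)) (X + ((τ - 1) * σ) • (α : V3)) • q (α, ξ, ξs)) ∂solidAngle
      = ∫ e : Coll, lineAvg (fun e => σ • (e.1 : V3)) w e X • q e ∂collMeas := by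
  obtain ⟨a, ha⟩ := h.bound
  have hi : Integrable (fun e => lineAvg (fun e => σ • (e.1 : V3)) w e X • q e) collMeas := by
    refine Integrable.mono' ((integrable_pw_inv le_rfl).const_mul (a * c)) ?_
      (Eventually.of_forall fun e => ?_)
    · have hm : StronglyMeasurable fun e : Coll => lineAvg (fun e => σ • (e.1 : V3)) w e X :=
        (measurable_lineAvg (r := fun e : Coll => σ • (e.1 : V3)) (by fun_prop)
          h.measurable).comp_measurable (g := fun e : Coll => (X, e)) (by fun_prop)
      exact (hm.smul hq).aestronglyMeasurable
    · rw [norm_smul]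
      have h1 := abs_lineAvg_le (r := fun e : Coll => σ • (e.1 : V3)) ha e X
      calc _ ≤ (a * (pw e ^ 4)⁻¹) * c := mul_le_mul h1 (hqc e) (norm_nonneg _)
            ((abs_nonneg _).trans h1)
        _ = _ := by ring
  refine ⟨hi, ?_⟩
  rw [← integral_iterated_coll hi]
  simp only [lineAvg, intervalIntegral.integral_smul_const, smul_smul]

lemma TwoPoint.hasZeroFlux (h : TwoPoint Ω P w) (hcell : IsCell Ω C P) {σ : ℝ} (hσ : 0 < σ) :
    HasZeroFlux Ω C fun X => ∫ ξ : V3, ∫ ξs : V3, ∫ α : S2, (∫ τ in (0 : ℝ)..1,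
      w (α, ξ, ξs) (X + (τ * σ) • (α : V3)) (X + ((τ - 1) * σ) • (α : V3)) • (α : V3)) ∂solidAngle := by
  obtain ⟨a, ha⟩ := h.bound
  have hb : Integrable (fun e => a * (pw e ^ 4)⁻¹) collMeas := (integrable_pw_inv le_rfl).const_mul a
  have h1 := hasZeroFlux_lineAvg hcell (μ := collMeas) (r := fun e => σ • (e.1 : V3)) (by fun_prop)
    h.measurable hb (by simpa [norm_smul] using hb.mul_const |σ|) ha h.zero h.periodic
  refine (h1.const_smul σ⁻¹).congr hcell.isOpen.measurableSet fun X _ => ?_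
  rw [(h.integral_lineAvg σ X (q := fun e => (e.1 : V3))
    (Measurable.stronglyMeasurable (by fun_prop)) (fun e => (norm_coe_S2 _).le)).2, ← integral_smul]
  refine integral_congr_ae (Eventually.of_forall fun e => ?_)
  simp only [smul_smul]
  congr 1
  field_simp

/-- Exhibits `J⁽ᵏ⁾` as a segment average of the two-point function of entropy production with `β =
0`. If a point falls outside `Ω`, the indicators in `gFactor` annihilate the meaningless values of
`u`. -/
lemma IsState.Jk_eq (h : IsState Ω P u) (X : V3) :
    Jk G Ω u X = (G.σ ^ 3 / (2 * G.m)) • ∫ ξ : V3, ∫ ξs : V3, ∫ α : S2, (∫ τ in (0 : ℝ)..1,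
      (fun (e : Coll) Y Z => (extS G Ω u Y + extS G Ω u Z)
        * (chi Ω Y * u Y e.2.1 * (chi Ω Z * u Z e.2.2))
        * (Vp e * (GasData.logFactor 0 (fun X ξ => chi Ω X * u X ξ) Y (post e.2.1 e.2.2 e.1)
          - GasData.logFactor 0 (fun X ξ => chi Ω X * u X ξ) Y e.2.1))) (α, ξ, ξs)
        (X + (τ * G.σ) • (α : V3)) (X + ((τ - 1) * G.σ) • (α : V3)) • (α : V3)) ∂solidAngle := by
  have key : ∀ (ξ ξs Y Z : V3) (α : S2), gFactor G Ω u Y Z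
      * (Real.log (u Y (post ξ ξs α) / u Y ξ) * u Y ξ * u Z ξs) * (Va ξ ξs α * theta (Va ξ ξs α))
      = (extS G Ω u Y + extS G Ω u Z) * (chi Ω Y * u Y ξ * (chi Ω Z * u Z ξs))
        * (Vp (α, ξ, ξs) * (GasData.logFactor 0 (fun X ξ => chi Ω X * u X ξ) Y (post ξ ξs α)
          - GasData.logFactor 0 (fun X ξ => chi Ω X * u X ξ) Y ξ)) := by
    intro ξ ξs Y Z α
    by_cases hY : Y ∈ Ω
    · by_cases hZ : Z ∈ Ω
      · simp only [gFactor, extS, GasData.logFactor, Vp, chi_of_mem hY, chi_of_mem hZ, one_mul,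
          mul_one, zero_mul, add_zero, Real.log_div (h.pos Y hY _).ne' (h.pos Y hY _).ne']
        ring
      · simp only [gFactor, chi_of_notMem hZ, mul_zero, zero_mul]
    · simp only [gFactor, chi_of_notMem hY, mul_zero, zero_mul]
  simp only [Jk, key]

lemma IsState.hasZeroFlux_Jk (h : IsState Ω P u) (hcell : IsCell Ω C P) (hr : CrowdLe G Ω u r) :
    HasZeroFlux Ω C (Jk G Ω u) :=
  ((((h.gasData hcell hr).twoPoint_entropy 0).hasZeroFlux hcell G.σ_pos).const_smul _).congr
    hcell.isOpen.measurableSet fun X _ => h.Jk_eq X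

/-- The second part of `J⁽ᶜ⁾`. -/
lemma IsState.hasZeroFlux_transfer (h : IsState Ω P u) (hcell : IsCell Ω C P)
    (hr : CrowdLe G Ω u r) : HasZeroFlux Ω C fun X => ∫ α : S2, (∫ τ in (0 : ℝ)..1,
    (inner ℝ (vel u (X + (τ * G.σ) • (α : V3)) - vel u (X + ((τ - 1) * G.σ) • (α : V3))) (α : V3)
      * dens u (X + (τ * G.σ) • (α : V3)) * dens u (X + ((τ - 1) * G.σ) • (α : V3))
      * G.S (crowd G Ω u (X + (τ * G.σ) • (α : V3)))
      * chi Ω (X + ((τ - 1) * G.σ) • (α : V3)) * chi Ω (X + (τ * G.σ) • (α : V3)))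
      • (α : V3)) ∂solidAngle := by
  have hg := h.gasData hcell hr
  have hΩ := hcell.isOpen
  set M : V3 → V3 := fun X => chi Ω X • ∫ ξ, u X ξ • ξ with hM
  have hMm : Measurable M := measurable_chi_smul_moment hΩ h.contDiffOn.continuousOn
  have hdm := h.measurable_extDens hΩ
  obtain ⟨C₅, hC50, hC5⟩ := h.exists_entropy_decay 0 5
  obtain ⟨cρ, hρ0, hρ⟩ := h.exists_extDens_le
  obtain ⟨cS, hS⟩ := hg.s_bound
  have hS0 : 0 ≤ cS := (hg.s_nonneg 0).trans (hS 0)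
  have hwm : 0 ≤ wgtMass := integral_nonneg fun ξ => (wgt_pos 4 ξ).le
  have hMb : ∀ X, ‖M X‖ ≤ C₅ * wgtMass := by
    intro X
    by_cases hX : X ∈ Ω
    · simp only [hM, chi_of_mem hX, one_smul]
      exact norm_integral_smul_le fun ξ => (hC5 X hX ξ).1
    · simp only [hM, chi_of_notMem hX, zero_smul, norm_zero]; positivity
  have hMp : ∀ p ∈ P, ∀ X, M (X + p) = M X := fun p hp X => by
    simp only [hM, chi_periodic hcell hp, h.periodic p hp]
  have hρM : ∀ X ∈ Ω, dens u X • vel u X = M X := fun X hX => by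
    simp only [hM, vel, chi_of_mem hX, smul_smul, mul_inv_cancel₀ (h.dens_pos hX).ne']
  -- Written with the momentum density in place of the velocity, the two-point function is bounded
  -- and vanishes as soon as either point is outside `Ω`.
  set w : S2 → V3 → V3 → ℝ := fun α Y Z => extS G Ω u Y
    * (extDens Ω u Z * inner ℝ (M Y) (α : V3) - extDens Ω u Y * inner ℝ (M Z) (α : V3)) with hw
  have hMα : ∀ X (α : S2), |inner ℝ (M X) (α : V3)| ≤ C₅ * wgtMass := fun X α => by
    have := abs_real_inner_le_norm (M X) (α : V3)
    rw [norm_coe_S2, mul_one] at this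
    exact this.trans (hMb X)
  have h1 := hasZeroFlux_lineAvg hcell (μ := solidAngle) (r := fun α : S2 => G.σ • (α : V3))
    (w := w) (b := fun _ => cS * (cρ * (C₅ * wgtMass) + cρ * (C₅ * wgtMass))) (by fun_prop)
    (by
      refine (hg.measurable_s.comp (by fun_prop)).mul (((hdm.comp (by fun_prop)).mul ?_).sub
        ((hdm.comp (by fun_prop)).mul ?_))
      · exact (hMm.comp (measurable_fst.comp measurable_snd)).inner
          (measurable_subtype_coe.comp measurable_fst)
      · exact (hMm.comp (measurable_snd.comp measurable_snd)).inner
          (measurable_subtype_coe.comp measurable_fst))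
    (integrable_const _) (by simpa [norm_smul] using integrable_const _)
    (fun α Y Z => by
      simp only [hw]
      rw [abs_mul, abs_of_nonneg (hg.s_nonneg Y)]
      refine mul_le_mul (hS Y) ((abs_sub _ _).trans (add_le_add ?_ ?_)) (abs_nonneg _) hS0
      · rw [abs_mul]; exact mul_le_mul (hρ Z) (hMα Y α) (abs_nonneg _) hρ0
      · rw [abs_mul]; exact mul_le_mul (hρ Y) (hMα Z α) (abs_nonneg _) hρ0)
    (fun α Y Z hYZ => by
      simp only [hw, extS, extDens, hM]
      rcases hYZ with h' | h' <;> simp [chi_of_notMem h'])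
    (fun p hp α Y Z => by
      simp only [hw, hg.s_periodic p hp, h.extDens_periodic hcell hp, hMp p hp])
  refine (h1.const_smul G.σ⁻¹).congr hΩ.measurableSet fun X _ => ?_
  rw [← integral_smul]
  refine integral_congr_ae (Eventually.of_forall fun α => ?_)
  have key : ∀ Y Z, inner ℝ (vel u Y - vel u Z) (α : V3) * dens u Y * dens u Z
      * G.S (crowd G Ω u Y) * chi Ω Z * chi Ω Y = w α Y Z := by
    intro Y Z
    by_cases hY : Y ∈ Ω
    · by_cases hZ : Z ∈ Ω
      · simp only [hw, ← hρM Y hY, ← hρM Z hZ, extS, extDens, chi_of_mem hY, chi_of_mem hZ,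
          inner_sub_left, real_inner_smul_left]
        ring
      · simp only [hw, hM, extS, extDens, chi_of_notMem hZ, mul_zero, zero_mul, zero_smul,
          inner_zero_left, sub_zero]
    · simp only [hw, extS, chi_of_notMem hY, mul_zero, zero_mul]
  have hσ := G.σ_pos.ne'
  simp only [key, lineAvg, intervalIntegral.integral_smul_const, smul_smul]
  rw [mul_comm _ G.σ, inv_mul_cancel_left₀ hσ]

/-- A potential times the momentum density. -/
lemma IsState.hasZeroFlux_potential {w : V3 → V3 → ℝ} (h : IsState Ω P u) (hw : IsRate G Ω u w A)
    (hcell : IsCell Ω C P) (hr : CrowdLe G Ω u r) {β : ℝ} (hflux : NonnegFlux Ω C P u β)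
    {K : V3 → ℝ} {B : V3 → V3} (hK : HasWeakGrad K B) (hb : ∃ c, ∀ X ∈ Ω, |K X| ≤ c ∧ ‖B X‖ ≤ c)
    (hp : ∀ p ∈ P, ∀ X, K (X + p) = K X ∧ B (X + p) = B X) :
    HasZeroFlux Ω C (fun X => K X • ∫ ξ, u X ξ • ξ) ∧
    IntegrableOn (fun X => inner ℝ (B X) (∫ ξ, u X ξ • ξ)) C ∧
    IntegrableOn (fun X => K X * ∫ ξ, w X ξ) C ∧
    ∫ X in C, inner ℝ (B X) (∫ ξ, u X ξ • ξ) = ∫ X in C, K X * ∫ ξ, w X ξ := by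
  have hΩ := hcell.isOpen
  obtain ⟨C₁, h1⟩ := hw.decay 4
  obtain ⟨C₅, hC50, hC5⟩ := h.exists_entropy_decay β 5
  obtain ⟨c, hc⟩ := hb
  have hm := hflux.mass K B hK ⟨c, hc⟩ hp ⟨C₁ * wgtMass, fun X hX => by
    rw [h.mass_balance hw hcell hr hX, abs_neg]
    exact norm_integral_le_wgtMass (u := w X) (h1 X hX)⟩
  have i1 : IntegrableOn (fun X => inner ℝ (B X) (∫ ξ, u X ξ • ξ)) C := by
    refine hcell.integrableOn ?_ ⟨c * (C₅ * wgtMass), fun X hX => ?_⟩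
    · have h2 := hK.measurable.inner (𝕜 := ℝ)
        (measurable_chi_smul_moment hΩ h.contDiffOn.continuousOn)
      simpa only [real_inner_smul_right] using h2
    · exact (abs_real_inner_le_norm _ _).trans (mul_le_mul (hc X hX).2 (norm_integral_smul_le
        fun ξ => (hC5 X hX ξ).1) (norm_nonneg _) ((norm_nonneg _).trans (hc X hX).2))
  have i2 : IntegrableOn (fun X => K X * ∫ ξ, w X ξ) C := by
    refine hcell.integrableOn ?_ ⟨c * (C₁ * wgtMass), fun X hX => ?_⟩
    · have h2 : Measurable fun X => K X * (chi Ω X * ∫ ξ, w X ξ) :=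
        hK.measurable_fun.mul (measurable_chi_mul_integral (h := w) hΩ hw.continuousOn)
      simpa only [mul_left_comm (K _)] using h2
    · rw [abs_mul]
      exact mul_le_mul (hc X hX).1 (norm_integral_le_wgtMass (u := w X) (h1 X hX)) (abs_nonneg _)
        ((abs_nonneg _).trans (hc X hX).1)
  refine ⟨⟨_, weakDiv_transport hΩ hK h.contDiffOn fun L hL hLc => ?_, hm.1, hm.2⟩, i1, i2, ?_⟩
  · obtain ⟨C', h'⟩ := h.exists_gradient_decay hΩ β hL hLc 5
    exact ⟨C', fun X hX ξ => ⟨(h' X hX ξ).1, (h' X hX ξ).2.1⟩⟩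
  · rw [← sub_eq_zero, ← integral_sub i1 i2, ← hm.2]
    refine setIntegral_congr_fun hcell.measurableSet fun X hX => ?_
    rw [h.mass_balance hw hcell hr (hcell.subset hX)]
    ring

/-- The terms `⟨ξ f ln f⟩` and `H⁽ᶜ⁾v` are common to both fluxes. What remains are two segment
averages and the transfer potential times the momentum density. -/
theorem IsState.hasZeroFlux_fluxDiff {w : V3 → V3 → ℝ} (h : IsState Ω P u)
    (hw : IsRate G Ω u w A) (hcell : IsCell Ω C P) (hr : CrowdLe G Ω u r) {β : ℝ}
    (hflux : NonnegFlux Ω C P u β) : HasZeroFlux Ω C (fluxDiff G Ω u) := by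
  obtain ⟨c, hc0, hc1, hc2⟩ := h.exists_transfer_bound hcell hr
  obtain ⟨m1, m2⟩ := h.measurable_transfer hcell hr
  have h3 := (h.hasZeroFlux_potential hw hcell hr hflux (hasWeakGrad_ballConv m2 hc2 G.σ_pos)
    ⟨max (c * volume.real (closedBall (0 : V3) G.σ)) _, fun X _ =>
      ⟨(abs_ballConv_le hc2 G.σ X).trans (le_max_left _ _),
        (norm_ballConvGrad_le hc2 X).trans (le_max_right _ _)⟩⟩ fun p hp X => by
    have h1 : ∀ X, extDens Ω u (X + p) = extDens Ω u X := h.extDens_periodic hcell hp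
    have h2 : ∀ X, extS G Ω u (X + p) = extS G Ω u X := (h.gasData hcell hr).s_periodic p hp
    exact ⟨ballConv_periodic (fun X => by rw [h1, h2]) _ X,
      ballConvGrad_periodic (fun X => by rw [h1, h2]) _ X⟩).1
  refine (((h.hasZeroFlux_Jk hcell hr).add ((h.hasZeroFlux_transfer hcell hr).const_smul
    (-(G.σ ^ 3 / (2 * G.m))))).add (h3.const_smul (-1))).congr hcell.isOpen.measurableSet
    fun X hX => ?_
  have hK : ∫ Y in Ω, dens u Y / G.m * theta (G.σ - ‖Y - X‖) * G.S (crowd G Ω u Y)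
      = ballConv G.σ (fun Y => 1 / G.m * (extS G Ω u Y * extDens Ω u Y)) X := by
    rw [setIntegral_eq_integral_chi hcell.isOpen.measurableSet, ballConv]
    refine integral_congr_ae (Eventually.of_forall fun Y => ?_)
    simp only [extS, extDens, smul_eq_mul]
    by_cases hY : Y ∈ Ω
    · rw [chi_of_mem hY]; ring
    · rw [chi_of_notMem hY]; ring
  have hM : (dens u X * ballConv G.σ (fun Y => 1 / G.m * (extS G Ω u Y * extDens Ω u Y)) X)
      • vel u X = ballConv G.σ (fun Y => 1 / G.m * (extS G Ω u Y * extDens Ω u Y)) X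
        • ∫ ξ, u X ξ • ξ := by
    rw [vel, smul_smul, mul_right_comm, mul_inv_cancel₀ (h.dens_pos hX).ne', one_mul]
  rw [fluxDiff, JH, globalFlux, hK, hM, Jc]
  module

end Collisional

/-! ### The remainder of the flux of free energy -/

lemma applyStress_add (p q : Fin 3 → Fin 3 → ℝ) (v : V3) :
    applyStress (fun i j => p i j + q i j) v = applyStress p v + applyStress q v := by
  ext i
  simp [applyStress, add_mul, Finset.sum_add_distrib]

lemma applyStress_const_mul (c : ℝ) (p : Fin 3 → Fin 3 → ℝ) (v : V3) :
    applyStress (fun i j => c * p i j) v = c • applyStress p v := by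
  ext i
  simp [applyStress, mul_assoc, Finset.mul_sum]

lemma applyStress_integral {E : Type*} [MeasurableSpace E] {μ : Measure E} {k : E → ℝ}
    {q : E → V3} (v : V3) (hi : ∀ i j, Integrable (fun x => k x * (q x i * q x j)) μ)
    (hv : Integrable (fun x => (k x * inner ℝ v (q x)) • q x) μ) :
    applyStress (fun i j => ∫ x, k x * (q x i * q x j) ∂μ) v
      = ∫ x, (k x * inner ℝ v (q x)) • q x ∂μ := by
  ext i
  have h1 : ∫ x, ((k x * inner ℝ v (q x)) • q x) i ∂μ
      = (∫ x, (k x * inner ℝ v (q x)) • q x ∂μ) i :=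
    (EuclideanSpace.proj i : V3 →L[ℝ] ℝ).integral_comp_comm hv
  rw [← h1]
  simp only [applyStress, ← integral_mul_const]
  rw [← integral_finsetSum _ fun j _ => (hi i j).mul_const _]
  refine integral_congr_ae (Eventually.of_forall fun x => ?_)
  simp only [PiLp.smul_apply, smul_eq_mul, PiLp.inner_apply, RCLike.inner_apply, conj_trivial,
    Finset.mul_sum, Finset.sum_mul]
  exact Finset.sum_congr rfl fun j _ => by ring

section FreeFlux

variable {G : Gas} {Ω C P : Set V3} {u : V3 → V3 → ℝ} {r : ℝ}

lemma IsState.integrable_growth (h : IsState Ω P u) {X : V3} (hX : X ∈ Ω) {F : Type*}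
    [NormedAddCommGroup F] [NormedSpace ℝ F] {g : V3 → F}
    (hg : Continuous g) {c : ℝ} {N : ℕ} (hc : ∀ ξ, ‖g ξ‖ ≤ c * (1 + ‖ξ‖) ^ N) :
    Integrable fun ξ => u X ξ • g ξ := by
  obtain ⟨C, hC0, hC⟩ := h.exists_entropy_decay 0 (4 + N)
  have : SecondCountableTopologyEither V3 F := inferInstance
  refine integrable_of_le_wgt (c := C * c) (n := 4)
    ((h.continuous_slice hX).smul hg).aestronglyMeasurable le_rfl fun ξ => ?_
  have h1 := abs_mul_le_wgt (hC X hX ξ).1 (b := ‖g ξ‖) (by rw [abs_norm]; exact hc ξ)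
  rwa [abs_mul, abs_norm, ← Real.norm_eq_abs, ← norm_smul] at h1

/-- The kinetic part of the flux of energy. -/
lemma IsState.kinetic_energy_flux (h : IsState Ω P u) {X : V3} (hX : X ∈ Ω) :
    (dens u X * (kinEnergy u X + ‖vel u X‖ ^ 2 / 2)) • vel u X + applyStress (kinStress u X) (vel u X)
      + kinHeatFlux u X = (1 / 2 : ℝ) • ∫ ξ, u X ξ • (‖ξ‖ ^ 2 • ξ) := by
  set v := vel u X with hv
  have hρ := (h.dens_pos hX).ne'
  have hb : ∀ ξ, ‖ξ - v‖ ≤ (1 + ‖v‖) * (1 + ‖ξ‖) := fun ξ => (norm_sub_le _ _).trans (by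
    nlinarith [norm_nonneg ξ, norm_nonneg v])
  have hpow : ∀ (n : ℕ) ξ, ‖ξ - v‖ ^ n ≤ (1 + ‖v‖) ^ n * (1 + ‖ξ‖) ^ n := fun n ξ => by
    rw [← mul_pow]; exact pow_le_pow_left₀ (norm_nonneg _) (hb ξ) n
  have i0 := h.integrable_slice hX
  have i1 : Integrable fun ξ => u X ξ • (ξ - v) := h.integrable_growth hX (by fun_prop)
    (c := (1 + ‖v‖) ^ 1) (N := 1) fun ξ => by simpa using hpow 1 ξ
  have i2 : Integrable fun ξ => u X ξ • ‖ξ - v‖ ^ 2 := h.integrable_growth hX (by fun_prop)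
    (N := 2) fun ξ => by simpa using hpow 2 ξ
  have i3 : Integrable fun ξ => u X ξ • (‖ξ - v‖ ^ 2 • (ξ - v)) :=
    h.integrable_growth hX (by fun_prop) (N := 3) fun ξ => by
      rw [norm_smul, norm_pow, norm_norm, ← pow_succ]; exact hpow 3 ξ
  have i4 : Integrable fun ξ => u X ξ • (inner ℝ v (ξ - v) • (ξ - v)) :=
    h.integrable_growth hX (by fun_prop) (c := ‖v‖ * (1 + ‖v‖) ^ 2) (N := 2) fun ξ => by
      rw [norm_smul]
      calc _ ≤ ‖v‖ * ‖ξ - v‖ * ‖ξ - v‖ :=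
            mul_le_mul_of_nonneg_right (norm_inner_le_norm (𝕜 := ℝ) _ _) (norm_nonneg _)
        _ = ‖v‖ * ‖ξ - v‖ ^ 2 := by ring
        _ ≤ _ := by rw [mul_assoc]; exact mul_le_mul_of_nonneg_left (hpow 2 ξ) (norm_nonneg v)
  have e1 : ∫ ξ, u X ξ • (ξ - v) = 0 := by
    have iM : Integrable fun ξ => u X ξ • ξ := h.integrable_growth hX (g := fun ξ => ξ)
      continuous_id (c := 1) (N := 1) fun ξ => by linarith [pow_one (1 + ‖ξ‖)]
    simp only [smul_sub]
    rw [integral_sub iM (i0.smul_const v), integral_smul_const, hv, vel, smul_smul, sub_eq_zero]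
    change _ = (dens u X * _) • _
    rw [mul_inv_cancel₀ hρ, one_smul]
  have e2 : ∫ ξ, u X ξ * inner ℝ v (ξ - v) = 0 := by
    have := integral_inner (𝕜 := ℝ) i1 v
    simp only [real_inner_smul_right] at this
    rw [this, e1, inner_zero_right]
  have i5 : Integrable fun ξ => u X ξ * inner ℝ v (ξ - v) := by
    simpa only [real_inner_smul_right] using i1.const_inner (𝕜 := ℝ) v
  have hS : applyStress (kinStress u X) v = ∫ ξ, u X ξ • (inner ℝ v (ξ - v) • (ξ - v)) := by
    have := applyStress_integral (k := u X) (q := fun ξ => ξ - v) (μ := volume) v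
      (fun i j => h.integrable_growth hX (g := fun ξ => (ξ - v) i * (ξ - v) j) (by fun_prop)
        (N := 2) fun ξ => by
          rw [norm_mul]
          refine le_trans ?_ (hpow 2 ξ)
          rw [sq]
          exact mul_le_mul (PiLp.norm_apply_le _ i) (PiLp.norm_apply_le _ j) (norm_nonneg _)
            (norm_nonneg _)) (by simpa only [smul_smul] using i4)
    simp only [smul_smul]
    rw [← this]
    congr 1
    ext i j
    simp only [kinStress, ← hv, PiLp.sub_apply]
    exact integral_congr_ae (Eventually.of_forall fun ξ => by simp only; ring)
  have hQ : kinHeatFlux u X = (1 / 2 : ℝ) • ∫ ξ, u X ξ • (‖ξ - v‖ ^ 2 • (ξ - v)) := by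
    simp only [kinHeatFlux, ← hv, smul_smul, mul_comm]
  have hE : dens u X * kinEnergy u X = 1 / 2 * ∫ ξ, u X ξ • ‖ξ - v‖ ^ 2 := by
    simp only [kinEnergy, ← hv, smul_eq_mul, mul_comm (u X _)]
    field_simp
  have hd : ∀ ξ, u X ξ • (‖ξ‖ ^ 2 • ξ) = (u X ξ • (‖ξ - v‖ ^ 2 • (ξ - v))
      + (2 : ℝ) • (u X ξ • (inner ℝ v (ξ - v) • (ξ - v))))
      + (‖v‖ ^ 2 • (u X ξ • (ξ - v)) + ((u X ξ • ‖ξ - v‖ ^ 2 + 2 * (u X ξ * inner ℝ v (ξ - v)))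
        + ‖v‖ ^ 2 * u X ξ) • v) := by
    intro ξ
    have h1 : ‖ξ‖ ^ 2 = ‖ξ - v‖ ^ 2 + 2 * inner ℝ v (ξ - v) + ‖v‖ ^ 2 := by
      have := norm_add_sq_real (ξ - v) v
      rw [sub_add_cancel, real_inner_comm] at this
      linarith
    rw [h1, smul_eq_mul]
    module
  have j1 : Integrable fun ξ => u X ξ • ‖ξ - v‖ ^ 2 + 2 * (u X ξ * inner ℝ v (ξ - v)) :=
    i2.add (i5.const_mul 2)
  have j2 : Integrable fun ξ => (u X ξ • ‖ξ - v‖ ^ 2 + 2 * (u X ξ * inner ℝ v (ξ - v)))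
      + ‖v‖ ^ 2 * u X ξ := j1.add (i0.const_mul (‖v‖ ^ 2))
  have j3 : Integrable fun ξ => (2 : ℝ) • (u X ξ • (inner ℝ v (ξ - v) • (ξ - v))) := i4.smul (2 : ℝ)
  have j4 : Integrable fun ξ => ‖v‖ ^ 2 • (u X ξ • (ξ - v)) := i1.smul (‖v‖ ^ 2)
  have j5 : Integrable fun ξ => u X ξ • (‖ξ - v‖ ^ 2 • (ξ - v))
      + (2 : ℝ) • (u X ξ • (inner ℝ v (ξ - v) • (ξ - v))) := i3.add j3
  have j6 : Integrable fun ξ => ‖v‖ ^ 2 • (u X ξ • (ξ - v))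
      + ((u X ξ • ‖ξ - v‖ ^ 2 + 2 * (u X ξ * inner ℝ v (ξ - v))) + ‖v‖ ^ 2 * u X ξ) • v :=
    j4.add (j2.smul_const v)
  simp only [hd]
  rw [integral_add j5 j6, integral_add i3 j3, integral_add j4 (j2.smul_const v),
    integral_smul_const, integral_add j1 (i0.const_mul (‖v‖ ^ 2)), integral_add i2 (i5.const_mul 2),
    integral_const_mul, integral_const_mul, integral_smul, integral_smul, e1, e2, hS, hQ, mul_add,
    hE, ← dens]
  module

lemma mul_theta_sq_eq_Vp (ξ ξs : V3) (α : S2) :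
    Va ξ ξs α ^ 2 * theta (Va ξ ξs α) = Vp (α, ξ, ξs) * Va ξ ξs α := by
  rw [Vp]; ring

/-- `p⁽ᶜ⁾` and `q⁽ᶜ⁾` measure the position on the segment by length, the other collisional fluxes by
a fraction in `[0, 1]`. -/
lemma integral_segment_scale {F : Type*} [NormedAddCommGroup F] [NormedSpace ℝ F] (σ : ℝ)
    (g : ℝ → F) : ∫ l in (0 : ℝ)..σ, g l = σ • ∫ τ in (0 : ℝ)..1, g (τ * σ) := by
  rw [intervalIntegral.smul_integral_comp_mul_right, zero_mul, one_mul]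

/-- The weight of the collisional fluxes of momentum and energy. -/
noncomputable def colRate (G : Gas) (Ω : Set V3) (u : V3 → V3 → ℝ) (g : Coll → ℝ)
    (e : Coll) (Y Z : V3) : ℝ :=
  (extS G Ω u Y + extS G Ω u Z) * (chi Ω Y * u Y e.2.1 * (chi Ω Z * u Z e.2.2))
    * (Vp e * Va e.2.1 e.2.2 e.1 * g e)

lemma IsState.twoPoint_colRate (h : IsState Ω P u) (hcell : IsCell Ω C P) (hr : CrowdLe G Ω u r)
    {g : Coll → ℝ} (hg : Measurable g) {c : ℝ} (hc : ∀ e, |g e| ≤ c * pw e) :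
    TwoPoint Ω P (colRate G Ω u g) :=
  (h.gasData hcell hr).twoPoint_rate_fst (c := c) (N := 3)
    ((continuous_Vp.mul continuous_Va).measurable.mul hg) fun e => by
      rw [abs_mul, abs_mul, abs_of_nonneg (Vp_nonneg e)]
      calc _ ≤ pw e * pw e * (c * pw e) := mul_le_mul (mul_le_mul (Vp_le_pw e) (abs_Va_le_pw e)
            (abs_nonneg _) (pw_pos e).le) (hc e) (abs_nonneg _)
              (mul_nonneg (pw_pos e).le (pw_pos e).le)
        _ = _ := by ring

lemma IsState.gFactor_mul_rate (X Y ξ ξs : V3) (α : S2) (k : ℝ) :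
    k * Va ξ ξs α ^ 2 * theta (Va ξ ξs α) * gFactor G Ω u Y X * u X ξs * u Y ξ
      = colRate G Ω u (fun _ => 1) (α, ξ, ξs) Y X * k := by
  have h1 := gFactor_mul G Ω u X Y ξs ξ
  have h2 := mul_theta_sq_eq_Vp ξ ξs α
  calc _ = (gFactor G Ω u Y X * u Y ξ * u X ξs) * (Va ξ ξs α ^ 2 * theta (Va ξ ξs α)) * k := by ring
    _ = _ := by rw [h1, h2, colRate]; ring

/-- The remainder of the flux of free energy is an average along segments. -/
lemma IsState.freeFluxRemainder_eq (h : IsState Ω P u) (hcell : IsCell Ω C P)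
    (hr : CrowdLe G Ω u r) {Rg Tw : ℝ} (hR : 0 < Rg) (hT : 0 < Tw) {X : V3} (hX : X ∈ Ω) :
    freeFluxRemainder G Rg Tw Ω u X = (G.σ ^ 3 / (4 * G.m)) • ∫ ξ : V3, ∫ ξs : V3, ∫ α : S2,
      (∫ τ in (0 : ℝ)..1, colRate G Ω u (fun e => inner ℝ (e.2.1 + e.2.2) (e.1 : V3)) (α, ξ, ξs)
        (X + (τ * G.σ) • (α : V3)) (X + ((τ - 1) * G.σ) • (α : V3)) • (α : V3)) ∂solidAngle := by
  set v := vel u X with hv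
  have hm := G.m_pos.ne'
  -- kinetic part
  have hkin := h.kinetic_energy_flux hX
  have hlog : (Rg * Tw) • ∫ ξ, (u X ξ * Real.log (wallMaxwellian Rg Tw ξ)) • ξ
      = -((1 / 2 : ℝ) • ∫ ξ, u X ξ • (‖ξ‖ ^ 2 • ξ)) := by
    rw [← integral_smul, ← integral_smul, ← integral_neg]
    refine integral_congr_ae (Eventually.of_forall fun ξ => ?_)
    simp only [log_wallMaxwellian, smul_smul, ← neg_smul]
    congr 1
    field_simp
  -- collisional part
  have t0 := h.twoPoint_colRate hcell hr (g := fun _ => 1) measurable_const (c := 1)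
    fun e => by rw [abs_one, one_mul]; exact one_le_pw e
  have hin : ∀ e : Coll, |inner ℝ (e.2.1 + e.2.2) (e.1 : V3)| ≤ 2 * pw e := fun e => by
    rw [inner_add_left]
    have h1 := (GasData.abs_inner_S2_le e.1 e.2.1).trans (one_add_norm_le_pw e)
    have h2 := (GasData.abs_inner_S2_le e.1 e.2.2).trans (one_add_norm_star_le_pw e)
    exact (abs_add_le _ _).trans (by linarith)
  have hvα : ∀ α : S2, |inner ℝ v (α : V3)| ≤ ‖v‖ := fun α => by
    have := abs_real_inner_le_norm v (α : V3)
    rwa [norm_coe_S2, mul_one] at this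
  have th := h.twoPoint_colRate hcell hr (g := fun e => inner ℝ (e.2.1 + e.2.2) (e.1 : V3))
    (by fun_prop) hin
  have tv := h.twoPoint_colRate hcell hr
    (g := fun e => inner ℝ ((e.2.1 - v) + (e.2.2 - v)) (e.1 : V3)) (by fun_prop)
    (c := 2 + 2 * ‖v‖) fun e => by
      have h1 : inner ℝ ((e.2.1 - v) + (e.2.2 - v)) (e.1 : V3)
          = inner ℝ (e.2.1 + e.2.2) (e.1 : V3) - 2 * inner ℝ v (e.1 : V3) := by
        simp only [inner_add_left, inner_sub_left]; ring
      rw [h1]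
      have h2 := hvα e.1
      have h3 : |2 * inner ℝ v (e.1 : V3)| ≤ 2 * ‖v‖ * pw e := by
        rw [abs_mul, abs_two]
        nlinarith [one_le_pw e, norm_nonneg v]
      exact (abs_sub _ _).trans (by linarith [hin e])
  set L : (Coll → ℝ) → Coll → ℝ :=
    fun g e => lineAvg (fun e : Coll => G.σ • (e.1 : V3)) (colRate G Ω u g) e X with hL
  -- The factor `g` depends on the collision configuration only, so it can be taken out of the
  -- average along the segment.
  have hLg : ∀ g e, L g e = L (fun _ => 1) e * g e := fun g e => by
    simp only [hL, lineAvg]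
    rw [← intervalIntegral.integral_mul_const]
    refine intervalIntegral.integral_congr fun τ _ => ?_
    simp only [colRate]; ring
  have hseg : ∀ (τ : ℝ) (α : V3), (τ * G.σ - G.σ) • α = ((τ - 1) * G.σ) • α := fun τ α => by
    rw [sub_mul, one_mul]
  have hα : StronglyMeasurable fun e : Coll => (e.1 : V3) := Measurable.stronglyMeasurable (by fun_prop)
  have sQ : colHeatFlux G Ω u X = (G.σ ^ 3 / (4 * G.m)) • ∫ e : Coll,
      L (fun e => inner ℝ ((e.2.1 - v) + (e.2.2 - v)) (e.1 : V3)) e • (e.1 : V3) ∂collMeas := by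
    rw [← (tv.integral_lineAvg G.σ X hα (fun e => (norm_coe_S2 _).le)).2, colHeatFlux, ← hv]
    simp only [integral_segment_scale G.σ, integral_smul, smul_smul, IsState.gFactor_mul_rate, hseg]
    congr 1
    · field_simp
    · simp only [colRate, mul_one, mul_assoc]
  have iS : ∀ i j, Integrable (fun e : Coll => L (fun _ => 1) e * ((e.1 : V3) i * (e.1 : V3) j))
      collMeas ∧ colStress G Ω u X i j = G.σ ^ 3 / (2 * G.m) *
        ∫ e : Coll, L (fun _ => 1) e * ((e.1 : V3) i * (e.1 : V3) j) ∂collMeas := by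
    intro i j
    have h1 := t0.integral_lineAvg G.σ X (q := fun e : Coll => (e.1 : V3) i * (e.1 : V3) j)
      (Measurable.stronglyMeasurable (by fun_prop)) (c := 1) fun e => by
        rw [norm_mul]
        have h2 := PiLp.norm_apply_le (e.1 : V3) i
        have h3 := PiLp.norm_apply_le (e.1 : V3) j
        rw [norm_coe_S2] at h2 h3
        exact mul_le_one₀ h2 (norm_nonneg _) h3
    refine ⟨h1.1, ?_⟩
    have h2 := h1.2
    simp only [smul_eq_mul] at h2
    rw [← h2, colStress]
    simp only [integral_segment_scale G.σ, IsState.gFactor_mul_rate, hseg, smul_eq_mul,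
      integral_const_mul]
    rw [← mul_assoc]
    congr 1
    field_simp
  have iV : Integrable (fun e : Coll => (L (fun _ => 1) e * inner ℝ v (e.1 : V3)) • (e.1 : V3))
      collMeas := by
    have h1 := (t0.integral_lineAvg G.σ X (q := fun e : Coll => inner ℝ v (e.1 : V3) • (e.1 : V3))
      (Measurable.stronglyMeasurable (by fun_prop)) (c := ‖v‖) fun e => by
        rw [norm_smul, norm_coe_S2, mul_one]; exact hvα e.1).1
    simpa only [smul_smul] using h1
  have sS : applyStress (colStress G Ω u X) v = (G.σ ^ 3 / (2 * G.m)) • ∫ e : Coll,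
      (L (fun _ => 1) e * inner ℝ v (e.1 : V3)) • (e.1 : V3) ∂collMeas := by
    rw [← applyStress_integral v (fun i j => (iS i j).1) iV, ← applyStress_const_mul]
    congr 1
    ext i j
    exact (iS i j).2
  have iV2 : Integrable (fun e : Coll => (2 : ℝ) • (L (fun _ => 1) e * inner ℝ v (e.1 : V3))
      • (e.1 : V3)) collMeas := iV.smul (2 : ℝ)
  have iQ : Integrable (fun e : Coll => L (fun e => inner ℝ ((e.2.1 - v) + (e.2.2 - v)) (e.1 : V3)) e
      • (e.1 : V3)) collMeas := (tv.integral_lineAvg G.σ X hα (fun e => (norm_coe_S2 _).le)).1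
  have e1 : freeFluxRemainder G Rg Tw Ω u X
      = applyStress (colStress G Ω u X) v + colHeatFlux G Ω u X := by
    rw [freeFluxRemainder, JF, hlog, ← hkin, ← hv, applyStress_add]
    abel
  -- In `p⁽ᶜ⁾v + q⁽ᶜ⁾` the velocity `v(X)` drops out: `2 ⟨v, α⟩ + ⟨ξ + ξ_* - 2v, α⟩ = ⟨ξ + ξ_*, α⟩`.
  -- This is essential, since the midpoint value `v(X)` would not fit into a two-point function of
  -- the ends of the segment.
  rw [e1, sS, sQ, (th.integral_lineAvg G.σ X hα (fun e => (norm_coe_S2 _).le)).2,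
    show G.σ ^ 3 / (2 * G.m) = G.σ ^ 3 / (4 * G.m) * 2 by field_simp; norm_num, mul_smul, ← smul_add,
    ← integral_smul, ← integral_add iV2 iQ]
  congr 1
  refine integral_congr_ae (Eventually.of_forall fun e => ?_)
  change (2 : ℝ) • (L (fun _ => 1) e * inner ℝ v (e.1 : V3)) • (e.1 : V3) + L _ e • (e.1 : V3)
    = L _ e • (e.1 : V3)
  rw [hLg (fun e => inner ℝ ((e.2.1 - v) + (e.2.2 - v)) (e.1 : V3)),
    hLg (fun e => inner ℝ (e.2.1 + e.2.2) (e.1 : V3)), smul_smul, ← add_smul]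
  congr 1
  simp only [inner_add_left, inner_sub_left]
  ring

theorem IsState.hasZeroFlux_freeFluxRemainder (h : IsState Ω P u) (hcell : IsCell Ω C P)
    (hr : CrowdLe G Ω u r) {Rg Tw : ℝ} (hR : 0 < Rg) (hT : 0 < Tw) :
    HasZeroFlux Ω C (freeFluxRemainder G Rg Tw Ω u) := by
  have th := h.twoPoint_colRate hcell hr (g := fun e => inner ℝ (e.2.1 + e.2.2) (e.1 : V3))
    (by fun_prop) (c := 2) fun e => by
      rw [inner_add_left]
      have h1 := (GasData.abs_inner_S2_le e.1 e.2.1).trans (one_add_norm_le_pw e)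
      have h2 := (GasData.abs_inner_S2_le e.1 e.2.2).trans (one_add_norm_star_le_pw e)
      exact (abs_add_le _ _).trans (by linarith)
  exact ((th.hasZeroFlux hcell G.σ_pos).const_smul _).congr hcell.isOpen.measurableSet
    fun X hX => h.freeFluxRemainder_eq hcell hr hR hT hX

end FreeFlux

/-! ### The Vlasov term -/

/-- The potential `∫_Ω Φ(|Y - X|) ρ(Y) dY`. -/
noncomputable def vlasovPot (Ω : Set V3) (Φ : ℝ → ℝ) (u : V3 → V3 → ℝ) (X : V3) : ℝ :=
  ∫ z, Φ ‖z‖ * extDens Ω u (X + z)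

section Vlasov

variable {G : Gas} {Ω D C P : Set V3} {u w : V3 → V3 → ℝ} {A : V3 → V3} {r β : ℝ} {Φ : ℝ → ℝ}

lemma vlasovEnergy_eq (hΩ : MeasurableSet Ω) (X : V3) :
    vlasovEnergy Ω Φ u X = 1 / 2 * vlasovPot Ω Φ u X := by
  rw [vlasovEnergy, setIntegral_eq_integral_chi hΩ, vlasovPot,
    ← integral_add_left_eq_self (fun Y => chi Ω Y • (Φ ‖Y - X‖ * dens u Y)) X]
  simp only [add_sub_cancel_left, extDens, smul_eq_mul, mul_left_comm]

lemma vlasovForce_eq (hΩ : MeasurableSet Ω) (X : V3) :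
    vlasovForce Ω Φ u X = ∫ z, extDens Ω u (X + z) • forceKer Φ z := by
  rw [vlasovForce, setIntegral_eq_integral_chi hΩ, ← integral_neg,
    ← integral_add_left_eq_self (fun Y => -(chi Ω Y • dens u Y • gradient (fun Z => Φ ‖Y - Z‖) X)) X]
  refine integral_congr_ae ?_
  filter_upwards [ae_ne_zero] with z hz
  rw [gradient_radial_sub Φ (by simpa using hz), sub_add_cancel_left, forceKer_neg, smul_neg, smul_neg,
    neg_neg, smul_smul, extDens]

/-- A periodic density does not have bounded support, so the bound on the force rests on the
integrability of `r²Φ'` up to infinity. -/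
lemma IsState.exists_vlasovForce_le_of_integrable (h : IsState Ω P u) (hΩ : MeasurableSet Ω)
    (hi : IntegrableOn (fun r => r ^ 2 * deriv Φ r) (Ioi 0)) :
    ∃ c, ∀ X, ‖vlasovForce Ω Φ u X‖ ≤ c := by
  obtain ⟨c, hc0, hc⟩ := h.exists_extDens_le
  have h1 : Integrable fun x : V3 => deriv Φ ‖x‖ := by
    rw [integrable_fun_norm_addHaar volume (f := deriv Φ)]
    simpa only [finrank_euclideanSpace, Fintype.card_fin, smul_eq_mul] using hi
  refine ⟨∫ z : V3, c * ‖deriv Φ ‖z‖‖, fun X => ?_⟩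
  rw [vlasovForce_eq hΩ]
  refine norm_integral_le_of_norm_le (h1.norm.const_mul c) (Eventually.of_forall fun z => ?_)
  rw [norm_smul]
  exact mul_le_mul (hc _) (norm_forceKer_le Φ z) (norm_nonneg _) hc0

/-- The density of a gas in a bounded domain is bounded with bounded support, so local integrability
of `Φ(|x|)` and of its gradient suffices. -/
lemma IsState.hasWeakGrad_vlasov (h : IsState D P u) (hD : IsOpen D)
    (hb : Bornology.IsBounded D) (hΦ : IsPotential Φ) :
    HasWeakGrad (vlasovPot D Φ u) (fun X => -vlasovForce D Φ u X) ∧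
    ∃ c, ∀ X ∈ D, |vlasovPot D Φ u X| ≤ c ∧ ‖vlasovForce D Φ u X‖ ≤ c := by
  obtain ⟨c, hc0, hc⟩ := h.exists_extDens_le
  have hm := h.measurable_extDens hD
  obtain ⟨R, hR⟩ := hb.subset_ball (0 : V3)
  have hs : ∀ X, extDens D u X ≠ 0 → X ∈ ball (0 : V3) R := fun X hX => hR (by
    by_contra hn; exact hX (by rw [extDens, chi_of_notMem hn, zero_mul]))
  simp only [vlasovForce_eq hD.measurableSet]
  refine ⟨hasWeakGrad_potential hΦ hm hc hs, max (c * ∫ z in ball (0 : V3) (R + R), |Φ ‖z‖|)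
    (c * ∫ z in ball (0 : V3) (R + R), |(|deriv Φ ‖z‖|)|), fun X hX =>
    ⟨(abs_kernelConv_le hΦ.measurable_radial hΦ.integrableOn_radial hm hc hs (hR hX)).2.trans
      (le_max_left _ _), ?_⟩⟩
  have hk := abs_kernelConv_le (k := fun z => |deriv Φ ‖z‖|)
    ((measurable_deriv Φ).comp measurable_norm).abs (fun R => (hΦ.integrableOn_deriv R).norm) hm hc hs
    (hR hX)
  refine le_trans ?_ (hk.2.trans (le_max_right _ _))
  refine (norm_integral_le_of_norm_le hk.1 (Eventually.of_forall fun z => ?_)).trans (le_abs_self _)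
  rw [norm_smul, Real.norm_of_nonneg (h.extDens_nonneg _), mul_comm]
  exact mul_le_mul_of_nonneg_right (norm_forceKer_le Φ z) (h.extDens_nonneg _)

lemma exists_extDens_rate_le (hw : IsRate G Ω u w A) :
    ∃ c, 0 ≤ c ∧ ∀ X, |extDens Ω w X| ≤ c := by
  obtain ⟨C₁, h1⟩ := hw.decay 4
  have hwm : 0 ≤ wgtMass := integral_nonneg fun ξ => (wgt_pos 4 ξ).le
  refine ⟨|C₁| * wgtMass, by positivity, fun X => ?_⟩
  by_cases hX : X ∈ Ω
  · rw [extDens, chi_of_mem hX, one_mul]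
    exact norm_integral_le_wgtMass (u := w X) fun ξ => (h1 X hX ξ).trans
      (mul_le_mul_of_nonneg_right (le_abs_self _) (wgt_pos _ _).le)
  · rw [extDens, chi_of_notMem hX, zero_mul, abs_zero]; positivity

/-- The stress terms cancel between `p⁽ᵛ⁾v` and `q⁽ᵛ⁾`. There remain `2ρe⁽ᵛ⁾v`, which is the Vlasov
potential times the momentum density, and a segment average with `ρ` at one end and `∂ₜρ` at the
other. -/
theorem IsState.hasZeroFlux_vlasovFlux {f : ℝ → V3 → V3 → ℝ} {t : ℝ} (h : IsState D ∅ (f t))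
    (hw : IsRate G D (f t) w A) (hD : IsOpen D) (hb : Bornology.IsBounded D)
    (hr : CrowdLe G D (f t) r) (hflux : NonnegFlux D D ∅ (f t) β) (hΦ : IsPotential Φ)
    (hd : ∀ Y ∈ D, deriv (fun s => dens (f s) Y) t = dens w Y) :
    HasZeroFlux D D (vlasovFlux D Φ f t) := by
  have hcell := isCell_of_bounded hD hb
  obtain ⟨hK, c, hc⟩ := h.hasWeakGrad_vlasov hD hb hΦ
  have h1 := (h.hasZeroFlux_potential hw hcell hr hflux hK ⟨c, fun X hX => by
    rw [norm_neg]; exact hc X hX⟩ fun p hp => absurd hp (notMem_empty p)).1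
  obtain ⟨c₁, hc10, hc1⟩ := h.exists_extDens_le
  obtain ⟨c₂, hc20, hc2⟩ := exists_extDens_rate_le hw
  obtain ⟨R, hR⟩ := hb.subset_ball (0 : V3)
  -- Two points of `D` are less than `2R` apart, so truncating `Φ` at that distance changes nothing
  -- and makes the kernel integrable on the whole space.
  have hki : Integrable ((ball (0 : V3) (R + R)).indicator fun z => Φ ‖z‖) :=
    (integrable_indicator_iff measurableSet_ball).2 (hΦ.integrableOn_radial _)
  set k := (ball (0 : V3) (R + R)).indicator fun z => Φ ‖z‖ with hk
  have hkm : Measurable k := hΦ.measurable_radial.indicator measurableSet_ball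
  have hρ := h.measurable_extDens hD
  have hρ' : Measurable (extDens D w) := measurable_chi_mul_integral hD hw.continuousOn
  have h2 := hasZeroFlux_lineAvg hcell (μ := (volume : Measure V3)) (r := fun z => z)
    (w := fun z Y Z => k z * extDens D w Z * extDens D (f t) Y)
    (b := fun z => ‖k z‖ * c₂ * c₁) measurable_id
    (((hkm.comp measurable_fst).mul (hρ'.comp (by fun_prop))).mul (hρ.comp (by fun_prop)))
    ((hki.norm.mul_const c₂).mul_const c₁)
    (by
      refine Integrable.mono' (((hki.norm.mul_const c₂).mul_const c₁).mul_const (R + R))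
        (((hkm.norm.mul_const c₂).mul_const c₁).mul measurable_norm).aestronglyMeasurable
        (Eventually.of_forall fun z => ?_)
      rw [Real.norm_of_nonneg (by positivity)]
      by_cases hz : z ∈ ball (0 : V3) (R + R)
      · exact mul_le_mul_of_nonneg_left (mem_ball_zero_iff.1 hz).le (by positivity)
      · simp only [hk, indicator_of_notMem hz, norm_zero, zero_mul, le_refl])
    (fun z Y Z => by
      rw [abs_mul, abs_mul]
      exact mul_le_mul (mul_le_mul_of_nonneg_left (hc2 Z) (abs_nonneg _)) (hc1 Y) (abs_nonneg _)
        (by positivity))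
    (fun z Y Z hYZ => by
      rcases hYZ with h' | h'
      · rw [extDens.eq_def D (f t), chi_of_notMem h', zero_mul, mul_zero]
      · rw [extDens.eq_def D w, chi_of_notMem h', zero_mul, mul_zero, zero_mul])
    fun p hp => absurd hp (notMem_empty p)
  refine (h1.add (h2.const_smul (1 / 2))).congr hD.measurableSet fun X hX => ?_
  have hM : (dens (f t) X * vlasovEnergy D Φ (f t) X) • vel (f t) X
      = (1 / 2 : ℝ) • (vlasovPot D Φ (f t) X • ∫ ξ, f t X ξ • ξ) := by
    rw [vlasovEnergy_eq hD.measurableSet, vel, smul_smul, mul_right_comm,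
      mul_inv_cancel₀ (h.dens_pos hX).ne', one_mul, mul_smul]
  have key : ∀ (l : ℝ) (z : V3), Φ ‖z‖ * deriv (fun s => dens (f s) (X + (l - 1) • z)) t
      * dens (f t) (X + l • z) * chi D (X + (l - 1) • z) * chi D (X + l • z)
      = k z * extDens D w (X + (l - 1) • z) * extDens D (f t) (X + l • z) := by
    intro l z
    by_cases hY : X + l • z ∈ D
    · by_cases hZ : X + (l - 1) • z ∈ D
      · have hz : z ∈ ball (0 : V3) (R + R) := by
          have h3 := norm_sub_le (X + l • z) (X + (l - 1) • z)
          rw [show X + l • z - (X + (l - 1) • z) = z by module] at h3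
          have h4 := mem_ball_zero_iff.1 (hR hY)
          have h5 := mem_ball_zero_iff.1 (hR hZ)
          rw [mem_ball_zero_iff]; linarith
        rw [hk, indicator_of_mem hz, extDens, extDens, chi_of_mem hY, chi_of_mem hZ, hd _ hZ]
        ring
      · rw [extDens, chi_of_notMem hZ]; ring
    · rw [extDens.eq_def D (f t), chi_of_notMem hY]; ring
  rw [vlasovFlux, vlasovHeatFlux, hM]
  simp only [key, intervalIntegral.integral_smul_const, lineAvg]
  module

end Vlasov

/-! ### Bounded differentiable functions of time -/

/-- `ρ` is a function of time and position with bounded time derivative `ρ'`. -/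
structure BoundedPath (T : Set ℝ) (ρ ρ' : ℝ → V3 → ℝ) : Prop where
  hasDerivAt : ∀ t ∈ T, ∀ X, HasDerivAt (fun s => ρ s X) (ρ' t X) t
  measurable : ∀ t ∈ T, Measurable (ρ t)
  measurable_deriv : ∀ t ∈ T, Measurable (ρ' t)
  bound : ∃ c, 0 ≤ c ∧ ∀ t ∈ T, ∀ X, |ρ t X| ≤ c ∧ |ρ' t X| ≤ c

namespace BoundedPath

variable {T : Set ℝ} {ρ ρ' η η' : ℝ → V3 → ℝ}

lemma mono (h : BoundedPath T ρ ρ') {T' : Set ℝ} (hT : T' ⊆ T) : BoundedPath T' ρ ρ' := by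
  obtain ⟨c, h0, hc⟩ := h.bound
  exact ⟨fun t ht => h.hasDerivAt t (hT ht), fun t ht => h.measurable t (hT ht),
    fun t ht => h.measurable_deriv t (hT ht), c, h0, fun t ht => hc t (hT ht)⟩

lemma add (h : BoundedPath T ρ ρ') (h' : BoundedPath T η η') :
    BoundedPath T (fun t X => ρ t X + η t X) (fun t X => ρ' t X + η' t X) := by
  obtain ⟨c, h0, hc⟩ := h.bound
  obtain ⟨c', h0', hc'⟩ := h'.bound
  exact ⟨fun t ht X => (h.hasDerivAt t ht X).add (h'.hasDerivAt t ht X),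
    fun t ht => (h.measurable t ht).add (h'.measurable t ht),
    fun t ht => (h.measurable_deriv t ht).add (h'.measurable_deriv t ht), c + c', by positivity,
    fun t ht X => ⟨(abs_add_le _ _).trans (add_le_add (hc t ht X).1 (hc' t ht X).1),
      (abs_add_le _ _).trans (add_le_add (hc t ht X).2 (hc' t ht X).2)⟩⟩

lemma mul (h : BoundedPath T ρ ρ') (h' : BoundedPath T η η') :
    BoundedPath T (fun t X => ρ t X * η t X) (fun t X => ρ' t X * η t X + ρ t X * η' t X) := by
  obtain ⟨c, h0, hc⟩ := h.bound
  obtain ⟨c', h0', hc'⟩ := h'.bound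
  have hm : ∀ {a b : ℝ}, |a| ≤ c → |b| ≤ c' → |a * b| ≤ c * c' := fun ha hb => by
    rw [abs_mul]; exact mul_le_mul ha hb (abs_nonneg _) h0
  have hcc : 0 ≤ c * c' := by positivity
  refine ⟨fun t ht X => (h.hasDerivAt t ht X).mul (h'.hasDerivAt t ht X),
    fun t ht => (h.measurable t ht).mul (h'.measurable t ht),
    fun t ht => ((h.measurable_deriv t ht).mul (h'.measurable t ht)).add
      ((h.measurable t ht).mul (h'.measurable_deriv t ht)), c * c' + c * c', by positivity,
    fun t ht X => ⟨(hm (hc t ht X).1 (hc' t ht X).1).trans (by linarith),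
      (abs_add_le _ _).trans (add_le_add (hm (hc t ht X).2 (hc' t ht X).1)
        (hm (hc t ht X).1 (hc' t ht X).2))⟩⟩

lemma comp (h : BoundedPath T ρ ρ') {p P : ℝ → ℝ} (hP : ∀ x, HasDerivAt P (p x) x)
    (hp : Continuous p) : BoundedPath T (fun t X => P (ρ t X)) (fun t X => p (ρ t X) * ρ' t X) := by
  obtain ⟨c, h0, hc⟩ := h.bound
  have hPc : Continuous P := continuous_iff_continuousAt.2 fun x => (hP x).continuousAt
  obtain ⟨a, ha⟩ := (isCompact_Icc (a := -c) (b := c)).exists_bound_of_continuousOn hp.continuousOn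
  obtain ⟨b, hb⟩ := (isCompact_Icc (a := -c) (b := c)).exists_bound_of_continuousOn hPc.continuousOn
  have ha0 : 0 ≤ a := (norm_nonneg _).trans (ha 0 ⟨by linarith, h0⟩)
  have hb0 : 0 ≤ b := (norm_nonneg _).trans (hb 0 ⟨by linarith, h0⟩)
  have hac : 0 ≤ a * c := by positivity
  refine ⟨fun t ht X => (hP _).comp t (h.hasDerivAt t ht X),
    fun t ht => hPc.measurable.comp (h.measurable t ht),
    fun t ht => (hp.measurable.comp (h.measurable t ht)).mul (h.measurable_deriv t ht), b + a * c,
    by positivity, fun t ht X => ⟨(hb _ (abs_le.1 (hc t ht X).1)).trans (by linarith), ?_⟩⟩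
  rw [abs_mul]
  have := mul_le_mul (ha _ (abs_le.1 (hc t ht X).1)) (hc t ht X).2 (abs_nonneg _) ha0
  exact this.trans (by linarith)

lemma conv (h : BoundedPath T ρ ρ') (hT : IsOpen T) {k : V3 → ℝ} (hk : Integrable k)
    (hkm : Measurable k) :
    BoundedPath T (fun t X => ∫ z, k z * ρ t (X + z)) (fun t X => ∫ z, k z * ρ' t (X + z)) := by
  obtain ⟨c, h0, hc⟩ := h.bound
  have hle : ∀ {z b : ℝ}, |b| ≤ c → |z * b| ≤ c * |z| := fun hb => by
    rw [abs_mul, mul_comm]; exact mul_le_mul_of_nonneg_right hb (abs_nonneg _)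
  have hm : ∀ {q : V3 → ℝ}, Measurable q → Measurable fun X => ∫ z, k z * q (X + z) := fun hq =>
    (StronglyMeasurable.integral_prod_right (f := fun X z => k z * _)
      ((hkm.comp measurable_snd).mul (hq.comp (measurable_fst.add measurable_snd))
        ).stronglyMeasurable).measurable
  have hb : ∀ {q : V3 → ℝ}, (∀ X, |q X| ≤ c) → ∀ X, |∫ z, k z * q (X + z)| ≤ c * ∫ z, |k z| :=
    fun {q} hq X => by
      rw [← integral_const_mul]
      exact norm_integral_le_of_norm_le (f := fun z => k z * q (X + z)) (hk.norm.const_mul c) (Eventually.of_forall fun z => hle (hq _))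
  refine ⟨fun t ht X => ?_, fun t ht => hm (h.measurable t ht), fun t ht =>
    hm (h.measurable_deriv t ht), c * ∫ z, |k z|,
    mul_nonneg h0 (integral_nonneg fun _ => abs_nonneg _), fun t ht X =>
    ⟨hb (fun X => (hc t ht X).1) X, hb (fun X => (hc t ht X).2) X⟩⟩
  refine (hasDerivAt_integral_of_dominated_loc_of_deriv_le (bound := fun z => c * |k z|)
    (hT.mem_nhds ht) ?_ ?_ ?_ (Eventually.of_forall fun z s hs => hle (hc s hs _).2)
    (hk.norm.const_mul c) (Eventually.of_forall fun z s hs =>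
      (h.hasDerivAt s hs _).const_mul (k z))).2
  · filter_upwards [hT.mem_nhds ht] with s hs
    exact (hkm.mul ((h.measurable s hs).comp (by fun_prop))).aestronglyMeasurable
  · exact Integrable.mono' (hk.norm.const_mul c)
      (hkm.mul ((h.measurable t ht).comp (by fun_prop))).aestronglyMeasurable
      (Eventually.of_forall fun z => hle (hc t ht _).1)
  · exact (hkm.mul ((h.measurable_deriv t ht).comp (by fun_prop))).aestronglyMeasurable

lemma integrableOn (h : BoundedPath T ρ ρ') {C : Set V3} (hC : volume C ≠ ⊤) {t : ℝ} (ht : t ∈ T) :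
    IntegrableOn (ρ t) C ∧ IntegrableOn (ρ' t) C := by
  obtain ⟨c, h0, hc⟩ := h.bound
  exact ⟨Measure.integrableOn_of_bounded (M := c) hC (h.measurable t ht).aestronglyMeasurable
    (Eventually.of_forall fun X => (hc t ht X).1),
    Measure.integrableOn_of_bounded (M := c) hC (h.measurable_deriv t ht).aestronglyMeasurable
    (Eventually.of_forall fun X => (hc t ht X).2)⟩

lemma hasDerivAt_integral (h : BoundedPath T ρ ρ') (hT : IsOpen T) {C : Set V3}
    (hC : volume C ≠ ⊤) {t : ℝ} (ht : t ∈ T) :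
    HasDerivAt (fun s => ∫ X in C, ρ s X) (∫ X in C, ρ' t X) t := by
  obtain ⟨c, h0, hc⟩ := h.bound
  refine (hasDerivAt_integral_of_dominated_loc_of_deriv_le (bound := fun _ => c)
    (hT.mem_nhds ht) ?_ (h.integrableOn hC ht).1 (h.measurable_deriv t ht).aestronglyMeasurable
    (Eventually.of_forall fun z s hs => (hc s hs _).2) (integrableOn_const hC)
    (Eventually.of_forall fun z s hs => h.hasDerivAt s hs z)).2
  filter_upwards [hT.mem_nhds ht] with s hs
  exact (h.measurable s hs).aestronglyMeasurable

lemma integrableOn_mul_deriv (h : BoundedPath T ρ ρ') (h' : BoundedPath T η η') {C : Set V3}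
    (hC : volume C ≠ ⊤) {t : ℝ} (ht : t ∈ T) : IntegrableOn (fun X => ρ t X * η' t X) C := by
  obtain ⟨c, h0, hc⟩ := h.bound
  obtain ⟨c', h0', hc'⟩ := h'.bound
  refine Measure.integrableOn_of_bounded (M := c * c') hC
    ((h.measurable t ht).mul (h'.measurable_deriv t ht)).aestronglyMeasurable
    (Eventually.of_forall fun X => ?_)
  rw [norm_mul]
  exact mul_le_mul (hc t ht X).1 (hc' t ht X).2 (abs_nonneg _) h0

end BoundedPath

/-- Moments of velocity distributions are bounded paths. -/
lemma boundedPath_moment {T : Set ℝ} (hT : IsOpen T) {Ω : Set V3} (hΩ : IsOpen Ω)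
    {F F' : ℝ → V3 → V3 → ℝ}
    (hd : ∀ t ∈ T, ∀ X ∈ Ω, ∀ ξ, HasDerivAt (fun s => F s X ξ) (F' t X ξ) t)
    (hc : ∀ t ∈ T, ContinuousOn (fun p : V3 × V3 => F t p.1 p.2) (Ω ×ˢ univ))
    (hc' : ∀ t ∈ T, ContinuousOn (fun p : V3 × V3 => F' t p.1 p.2) (Ω ×ˢ univ)) {c : ℝ}
    (hb : ∀ t ∈ T, ∀ X ∈ Ω, ∀ ξ, |F t X ξ| ≤ c * wgt 4 ξ ∧ |F' t X ξ| ≤ c * wgt 4 ξ) :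
    BoundedPath T (fun t X => chi Ω X * ∫ ξ, F t X ξ) (fun t X => chi Ω X * ∫ ξ, F' t X ξ) := by
  have hwm : 0 ≤ wgtMass := integral_nonneg fun ξ => (wgt_pos 4 ξ).le
  have hs : ∀ {g : V3 → V3 → ℝ}, ContinuousOn (fun p : V3 × V3 => g p.1 p.2) (Ω ×ˢ univ) →
      ∀ X ∈ Ω, Continuous (g X) := fun {g} hg X hX => by
    rw [← continuousOn_univ]
    exact hg.comp (f := fun ξ : V3 => (X, ξ)) (by fun_prop) fun _ _ => ⟨hX, mem_univ _⟩
  have hbd : ∀ {g : V3 → V3 → ℝ}, (∀ X ∈ Ω, ∀ ξ, |g X ξ| ≤ c * wgt 4 ξ) → ∀ X,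
      |chi Ω X * ∫ ξ, g X ξ| ≤ |c| * wgtMass := fun {g} hg X => by
    by_cases hX : X ∈ Ω
    · rw [chi_of_mem hX, one_mul]
      exact (norm_integral_le_wgtMass (u := g X) (hg X hX)).trans
        (mul_le_mul_of_nonneg_right (le_abs_self c) hwm)
    · rw [chi_of_notMem hX, zero_mul, abs_zero]; positivity
  refine ⟨fun t ht X => ?_, fun t ht => measurable_chi_mul_integral hΩ (hc t ht),
    fun t ht => measurable_chi_mul_integral hΩ (hc' t ht), |c| * wgtMass, by positivity,
    fun t ht X => ⟨hbd (fun X hX ξ => (hb t ht X hX ξ).1) X,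
      hbd (fun X hX ξ => (hb t ht X hX ξ).2) X⟩⟩
  by_cases hX : X ∈ Ω
  · refine HasDerivAt.const_mul _ (hasDerivAt_integral_of_dominated_loc_of_deriv_le
      (bound := fun ξ => c * wgt 4 ξ) (hT.mem_nhds ht) ?_ ?_
      (hs (hc' t ht) X hX).aestronglyMeasurable
      (Eventually.of_forall fun ξ s hs => (hb s hs X hX ξ).2) ((integrable_wgt le_rfl).const_mul c)
      (Eventually.of_forall fun ξ s hs => hd s hs X hX ξ)).2
    · filter_upwards [hT.mem_nhds ht] with s hs'
      exact (hs (hc s hs') X hX).aestronglyMeasurable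
    · exact integrable_of_le_wgt (hs (hc t ht) X hX).aestronglyMeasurable le_rfl
        fun ξ => (hb t ht X hX ξ).1
  · simp only [chi_of_notMem hX, zero_mul]
    exact hasDerivAt_const _ _

/-- Symmetry of convolutions with even kernels. -/
lemma IsCell.integral_conv_swap {Ω C P : Set V3} (hcell : IsCell Ω C P) {k p q : V3 → ℝ}
    (hk : Integrable k) (hkm : Measurable k) (hke : ∀ z, k (-z) = k z) (hp : Measurable p)
    (hq : Measurable q) {c : ℝ} (hpc : ∀ X, |p X| ≤ c) (hqc : ∀ X, |q X| ≤ c)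
    (hp0 : ∀ X ∉ Ω, p X = 0) (hq0 : ∀ X ∉ Ω, q X = 0) (hpp : ∀ a ∈ P, ∀ X, p (X + a) = p X)
    (hqp : ∀ a ∈ P, ∀ X, q (X + a) = q X) :
    ∫ X in C, p X * ∫ z, k z * q (X + z) = ∫ X in C, q X * ∫ z, k z * p (X + z) := by
  have hc0 : 0 ≤ c := (abs_nonneg _).trans (hpc 0)
  have : IsFiniteMeasure ((volume : Measure V3).restrict C) :=
    ⟨by simpa using hcell.measure_lt_top⟩
  have key : ∀ {f g : V3 → ℝ} {y : V3 × V3 → V3}, Measurable f → Measurable g → (∀ X, |f X| ≤ c) →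
      (∀ X, |g X| ≤ c) → Measurable y → Integrable (fun x : V3 × V3 => f x.1 * (k x.2 * g (y x)))
        ((volume.restrict C).prod volume) := fun {f g y} hf hg hfc hgc hy => by
    refine Integrable.mono' (((integrable_const (1 : ℝ)).mul_prod hk.norm).const_mul (c * c))
      ((hf.comp measurable_fst).mul ((hkm.comp measurable_snd).mul
        (hg.comp hy))).aestronglyMeasurable (Eventually.of_forall fun x => ?_)
    rw [norm_mul, norm_mul]
    calc _ ≤ c * (‖k x.2‖ * c) := mul_le_mul (hfc _) (mul_le_mul_of_nonneg_left (hgc _)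
          (norm_nonneg _)) (by positivity) hc0
      _ = _ := by ring
  have h1 : ∀ X, ∫ z, k z * p (X + z) = ∫ z, k z * p (X - z) := fun X => by
    rw [← integral_neg_eq_self]; simp only [hke, sub_eq_add_neg]
  simp only [h1, ← integral_const_mul]
  rw [integral_integral_swap (f := fun X z => p X * (k z * q (X + z)))
      (key (y := fun x => x.1 + x.2) hp hq hpc hqc (by fun_prop)),
    integral_integral_swap (f := fun X z => q X * (k z * p (X - z)))
      (key (y := fun x => x.1 - x.2) hq hp hqc hpc (by fun_prop))]
  refine integral_congr_ae (Eventually.of_forall fun z => ?_)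
  have h2 := hcell.swap (fun Y Z => p Z * (k z * q Y)) (fun Y Z hYZ => by
    rcases hYZ with h' | h'
    · simp only [hq0 Y h', mul_zero]
    · simp only [hp0 Z h', zero_mul]) (fun a ha Y Z => by simp only [hpp a ha, hqp a ha]) z
  simp only [h2]
  exact integral_congr_ae (Eventually.of_forall fun X => by simp only; ring)

/-! ### Classical solutions in time -/

/-- The time derivative of a distribution. -/
noncomputable def rate (f : ℝ → V3 → V3 → ℝ) (t : ℝ) (X ξ : V3) : ℝ := deriv (fun s => f s X ξ) t

/-- The kernel of the crowding function. -/
noncomputable def crowdKer (G : Gas) (z : V3) : ℝ := 1 / G.m * theta (G.σ - ‖z‖)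

lemma measurable_crowdKer (G : Gas) : Measurable (crowdKer G) :=
  (measurable_theta.comp (measurable_const.sub measurable_norm)).const_mul _

lemma integrable_crowdKer (G : Gas) : Integrable (crowdKer G) := by
  refine Integrable.const_mul ?_ _
  have h1 : (fun z : V3 => theta (G.σ - ‖z‖))
      = (closedBall (0 : V3) G.σ).indicator fun _ => (1 : ℝ) := by
    ext z
    have := theta_sub_norm G.σ (0 : V3) z
    rwa [sub_zero] at this
  rw [h1]
  exact (integrable_indicator_iff measurableSet_closedBall).2
    (integrableOn_const measure_closedBall_lt_top.ne)

lemma ballConv_eq_conv (G : Gas) (q : V3 → ℝ) (X : V3) :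
    ballConv G.σ (fun Y => 1 / G.m * q Y) X = ∫ z, crowdKer G z * q (X + z) := by
  rw [ballConv, ← integral_add_left_eq_self _ X]
  refine integral_congr_ae (Eventually.of_forall fun z => ?_)
  simp only [crowdKer, add_sub_cancel_left]
  ring

lemma antitoneOn_of_hasDerivAt {I : Set ℝ} (hI : I.OrdConnected) {g : ℝ → ℝ}
    (h : ∀ t ∈ I, ∃ d, HasDerivAt g d t ∧ d ≤ 0) : AntitoneOn g I := by
  refine antitoneOn_of_deriv_nonpos hI.convex (fun t ht => ?_) (fun t ht => ?_) fun t ht => ?_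
  · obtain ⟨d, hd, -⟩ := h t ht
    exact hd.continuousAt.continuousWithinAt
  · obtain ⟨d, hd, -⟩ := h t (interior_subset ht)
    exact hd.differentiableAt.differentiableWithinAt
  · obtain ⟨d, hd, hd0⟩ := h t (interior_subset ht)
    rwa [hd.deriv]

namespace IsClassicalSolution

variable {G : Gas} {I : Set ℝ} {Ω C P : Set V3} {F : ℝ → V3 → V3} {f : ℝ → V3 → V3 → ℝ}
  (hs : IsClassicalSolution G I Ω F f)
include hs

lemma hasDerivAt (hI : IsOpen I) (hΩ : IsOpen Ω) {t : ℝ} (ht : t ∈ I) {X : V3} (hX : X ∈ Ω)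
    (ξ : V3) : HasDerivAt (fun s => f s X ξ) (rate f t X ξ) t ∧ rate f t X ξ
      = fderiv ℝ (fun p : ℝ × V3 × V3 => f p.1 p.2.1 p.2.2) (t, X, ξ) (1, 0) := by
  have h1 := ((hs.contDiffOn.contDiffAt ((hI.prod (hΩ.prod isOpen_univ)).mem_nhds
    (show (t, X, ξ) ∈ I ×ˢ Ω ×ˢ univ from ⟨ht, hX, mem_univ ξ⟩))).differentiableAt (by simp)).hasFDerivAt
  have h2 : HasDerivAt (fun s : ℝ => (s, X, ξ)) ((1 : ℝ), (0 : V3 × V3)) t :=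
    (hasDerivAt_id t).prodMk (hasDerivAt_const t (X, ξ))
  have h3 := h1.comp_hasDerivAt t h2
  have h4 : rate f t X ξ = _ := h3.deriv
  exact ⟨h4 ▸ h3, h4⟩

lemma continuousOn_rate (hI : IsOpen I) (hΩ : IsOpen Ω) {t : ℝ} (ht : t ∈ I) :
    ContinuousOn (fun p : V3 × V3 => rate f t p.1 p.2) (Ω ×ˢ univ) := by
  have h1 := (hs.contDiffOn.continuousOn_fderiv_of_isOpen (hI.prod (hΩ.prod isOpen_univ))
    le_rfl).clm_apply (continuousOn_const (c := ((1 : ℝ), (0 : V3 × V3))))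
  refine (h1.comp (f := fun p : V3 × V3 => (t, p)) (by fun_prop)
    fun p hp => ⟨ht, hp⟩).congr fun p hp => ?_
  exact (hs.hasDerivAt hI hΩ ht hp.1 p.2).2

lemma isState {t : ℝ} (ht : t ∈ I) (hp : ∀ p ∈ P, ∀ X ξ, f t (X + p) ξ = f t X ξ) :
    IsState Ω P (f t) where
  pos := hs.pos t ht
  contDiffOn := hs.contDiffOn.comp (f := fun p : V3 × V3 => (t, p)) (by fun_prop)
    fun p hp => ⟨ht, hp⟩
  decay n := by
    obtain ⟨c, hc⟩ := hs.decay {t} (singleton_subset_iff.2 ht) isCompact_singleton n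
    exact ⟨c, fun X hX ξ => le_wgt_of_mul_le (hc t rfl X hX ξ).1⟩
  decay_gradient L hL hLc n := by
    obtain ⟨c, hc⟩ := hs.decay_gradient {t} (singleton_subset_iff.2 ht) isCompact_singleton L hL hLc n
    exact ⟨c, fun X hX ξ => ⟨le_wgt_of_mul_le (hc t rfl X hX ξ).1,
      le_wgt_of_mul_le (hc t rfl X hX ξ).2⟩⟩
  log_growth := by
    obtain ⟨n, c, hc⟩ := hs.log_growth {t} (singleton_subset_iff.2 ht) isCompact_singleton
    exact ⟨n, c, hc t rfl⟩
  periodic := hp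

lemma isRate (hI : IsOpen I) (hΩ : IsOpen Ω) {t : ℝ} (ht : t ∈ I)
    (hF : ∃ c, ∀ X ∈ Ω, ‖F t X‖ ≤ c) : IsRate G Ω (f t) (rate f t) (F t) where
  continuousOn := hs.continuousOn_rate hI hΩ ht
  decay n := by
    obtain ⟨c, hc⟩ := hs.decay {t} (singleton_subset_iff.2 ht) isCompact_singleton n
    exact ⟨c, fun X hX ξ => le_wgt_of_mul_le (hc t rfl X hX ξ).2⟩
  force_le := hF
  equation := hs.equation t ht

/-- On a compact time interval the bounds on `f`, `∂ₜf` and `ln f` are uniform, which permits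
differentiation of the density and of the entropy under the velocity integral. -/
lemma exists_paths (hI : IsOpen I) (hΩ : IsOpen Ω) (β : ℝ) {t₀ : ℝ} (ht₀ : t₀ ∈ I) :
    ∃ δ > 0, ball t₀ δ ⊆ I ∧
      BoundedPath (ball t₀ δ) (fun t => extDens Ω (f t)) (fun t => extDens Ω (rate f t)) ∧
      BoundedPath (ball t₀ δ) (fun t X => chi Ω X * ∫ ξ, entropyDensity β (f t) X ξ)
        (fun t X => chi Ω X * ∫ ξ, rate f t X ξ * (1 + GasData.logFactor β (f t) X ξ)) := by
  obtain ⟨δ, hδ, hδI⟩ := Metric.nhds_basis_closedBall.mem_iff.1 (hI.mem_nhds ht₀)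
  have hK : IsCompact (closedBall t₀ δ) := isCompact_closedBall _ _
  have hbI : ball t₀ δ ⊆ I := ball_subset_closedBall.trans hδI
  obtain ⟨n, c, hc⟩ := hs.log_growth _ hδI hK
  obtain ⟨C₀, h0⟩ := hs.decay _ hδI hK 4
  obtain ⟨C₁, h1⟩ := hs.decay _ hδI hK (4 + (n + 2))
  have hdec : ∀ {m : ℕ} {B : ℝ} {t : ℝ} {X ξ : V3}, t ∈ ball t₀ δ → X ∈ Ω →
      (1 + ‖ξ‖) ^ m * f t X ξ ≤ B ∧ (1 + ‖ξ‖) ^ m * |deriv (fun s => f s X ξ) t| ≤ B →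
      |f t X ξ| ≤ B * wgt m ξ ∧ |rate f t X ξ| ≤ B * wgt m ξ := fun ht hX h => by
    rw [abs_of_pos (hs.pos _ (hbI ht) _ hX _)]
    exact ⟨le_wgt_of_mul_le h.1, le_wgt_of_mul_le h.2⟩
  refine ⟨δ, hδ, hbI, boundedPath_moment isOpen_ball hΩ
      (fun t ht X hX ξ => (hs.hasDerivAt hI hΩ (hbI ht) hX ξ).1)
      (fun t ht => (hs.isState (P := ∅) (hbI ht) (by simp)).contDiffOn.continuousOn)
      (fun t ht => hs.continuousOn_rate hI hΩ (hbI ht))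
      fun t ht X hX ξ => hdec ht hX (h0 t (ball_subset_closedBall ht) X hX ξ),
    boundedPath_moment (c := C₁ * ((1 + (1 + |β|) * (1 + |c|)))) isOpen_ball hΩ
      (fun t ht X hX ξ => ?_)
      (fun t ht => ((hs.isState (P := ∅) (hbI ht) (by simp)).contDiffOn_entropy β).continuousOn)
      (fun t ht => (hs.continuousOn_rate hI hΩ (hbI ht)).mul
        (continuousOn_const.add (ContinuousOn.add
          ((hs.isState (P := ∅) (hbI ht) (by simp)).contDiffOn.continuousOn.log
            fun p hp => (hs.pos t (hbI ht) p.1 hp.1 p.2).ne') (by fun_prop))))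
      fun t ht X hX ξ => ?_⟩
  · have h2 := (hs.hasDerivAt hI hΩ (hbI ht) hX ξ).1
    have h3 := (hs.pos t (hbI ht) X hX ξ).ne'
    refine (h2.mul ((h2.log h3).add_const (β * ‖ξ‖ ^ 2))).congr_deriv ?_
    rw [GasData.logFactor]
    field_simp
    ring
  · obtain ⟨h2, h3⟩ := hdec ht hX (h1 t (ball_subset_closedBall ht) X hX ξ)
    have h4 := abs_log_factor_le β (hc t (ball_subset_closedBall ht) X hX ξ)
    exact ⟨abs_mul_le_wgt h2 (by linarith), abs_mul_le_wgt h3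
      (((abs_add_le _ _).trans (by rw [abs_one]; rfl)).trans h4)⟩

/-- `dom` may be open on the right, so a bound of `𝓡` that still belongs to it has to be a value of
`𝓡`. It is the maximum over a compact time interval and the compact set of representatives; that set
may touch the boundary, which is where membership on the closure of `Ω` is needed. -/
lemma exists_crowdLe (hI : IsOpen I) (hcell : IsCell Ω C P)
    (hp : ∀ t ∈ I, ∀ p ∈ P, ∀ X ξ, f t (X + p) ξ = f t X ξ) {t₀ : ℝ} (ht₀ : t₀ ∈ I) :
    ∃ δ > 0, ∃ r, ball t₀ δ ⊆ I ∧ (∀ t ∈ ball t₀ δ, CrowdLe G Ω (f t) r) ∧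
      BoundedPath (ball t₀ δ) (fun t => crowd G Ω (f t))
        (fun t X => ∫ z, crowdKer G z * extDens Ω (rate f t) (X + z)) := by
  obtain ⟨δ, hδ, hδI, hρ, -⟩ := hs.exists_paths hI hcell.isOpen 0 ht₀
  have hst : ∀ t ∈ ball t₀ δ, IsState Ω P (f t) := fun t ht => hs.isState (hδI ht) (hp t (hδI ht))
  have hcr : BoundedPath (ball t₀ δ) (fun t => crowd G Ω (f t))
      (fun t X => ∫ z, crowdKer G z * extDens Ω (rate f t) (X + z)) := by
    have h1 := hρ.conv isOpen_ball (integrable_crowdKer G) (measurable_crowdKer G)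
    simp only [← ballConv_eq_conv G (extDens Ω (f _)),
      ← crowd_eq_ballConv G hcell.isOpen.measurableSet] at h1
    exact h1
  have hKT : closedBall t₀ (δ / 2) ⊆ ball t₀ δ := closedBall_subset_ball (by linarith)
  have hbK : ball t₀ (δ / 2) ⊆ closedBall t₀ (δ / 2) := ball_subset_closedBall
  obtain ⟨Q, hQ, hQs, hQc⟩ := hcell.cover
  suffices h : ∃ r ∈ G.dom, 0 ≤ r ∧ ∀ t ∈ closedBall t₀ (δ / 2), ∀ X ∈ Q, crowd G Ω (f t) X ≤ r by
    obtain ⟨r, hr1, hr2, hr3⟩ := h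
    refine ⟨δ / 2, by linarith, r, (hbK.trans hKT).trans hδI, fun t ht => ⟨hr1, hr2, fun X hX => ?_⟩,
      hcr.mono (hbK.trans hKT)⟩
    have h1 := hst t (hKT (hbK ht))
    obtain ⟨Y, hY, hYe⟩ := hQc X hX
    refine ⟨h1.crowd_nonneg hcell.isOpen X, ?_⟩
    rw [hYe (crowd G Ω (f t)) fun p hp' X => h1.crowd_periodic hcell hp' X]
    exact hr3 t (hbK ht) Y hY
  rcases Q.eq_empty_or_nonempty with hQe | hQn
  · exact ⟨0, G.zero_mem, le_rfl, fun t _ X hX => by simp [hQe] at hX⟩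
  obtain ⟨c, hc0, hc⟩ := hcr.bound
  have hcont : ContinuousOn (fun p : ℝ × V3 => crowd G Ω (f p.1) p.2)
      (closedBall t₀ (δ / 2) ×ˢ Q) := by
    -- Joint continuity: `𝓡` is continuous in `X` at each time, and Lipschitz in time with a
    -- constant independent of `X`.
    refine continuousOn_prod_of_continuousOn_lipschitzOnWith _ c.toNNReal (fun t ht => ?_)
      fun X hX => ?_
    · obtain ⟨_, h1⟩ := (hst t (hKT ht)).crowd_lipschitz (G := G) hcell.isOpen
      exact h1.continuous.continuousOn
    · refine (convex_closedBall _ _).lipschitzOnWith_of_nnnorm_hasDerivWithin_le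
        (fun t ht => (hcr.hasDerivAt t (hKT ht) X).hasDerivWithinAt) fun t ht => ?_
      rw [← NNReal.coe_le_coe, coe_nnnorm, Real.coe_toNNReal c hc0]
      exact (hc t (hKT ht) X).2
  obtain ⟨p, hpm, hpx⟩ := ((isCompact_closedBall t₀ (δ / 2)).prod hQ).exists_isMaxOn
    ((nonempty_closedBall.2 (by linarith)).prod hQn) hcont
  exact ⟨crowd G Ω (f p.1) p.2, hs.crowd_mem _ (hδI (hKT hpm.1)) _ (hQs hpm.2),
    (hst _ (hKT hpm.1)).crowd_nonneg hcell.isOpen _, fun t ht X hX =>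
      isMaxOn_iff.1 hpx (t, X) ⟨ht, hX⟩⟩

/-- The rate of change of `⟨f (ln f + β |ξ|²)⟩ + H⁽ᶜ⁾`, integrated over the cell. -/
theorem hasDerivAt_entropy (hI : IsOpen I) (hcell : IsCell Ω C P)
    (hp : ∀ t ∈ I, ∀ p ∈ P, ∀ X ξ, f t (X + p) ξ = f t X ξ) {β t₀ : ℝ} (ht₀ : t₀ ∈ I)
    (hF : ∃ c, ∀ X ∈ Ω, ‖F t₀ X‖ ≤ c) (hflux : NonnegFlux Ω C P (f t₀) β) :
    IntegrableOn (fun X => (∫ ξ, entropyDensity β (f t₀) X ξ) + Hc G Ω (f t₀) X) C ∧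
    ∃ d, HasDerivAt (fun t => ∫ X in C, ((∫ ξ, entropyDensity β (f t) X ξ) + Hc G Ω (f t) X)) d t₀ ∧
      d ≤ ∫ X in C, 2 * β * inner ℝ (F t₀ X) (∫ ξ, f t₀ X ξ • ξ) := by
  have hΩ := hcell.isOpen
  have hC : volume C ≠ ⊤ := hcell.measure_lt_top.ne
  obtain ⟨δ₁, hδ₁, -, hρ, hE⟩ := hs.exists_paths hI hΩ β ht₀
  obtain ⟨δ₂, hδ₂, r, hδI, hr, hcr⟩ := hs.exists_crowdLe hI hcell hp ht₀
  have ht := mem_ball_self (x := t₀) (lt_min hδ₁ hδ₂)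
  have hT : IsOpen (ball t₀ (min δ₁ δ₂)) := isOpen_ball
  have hT2 : ball t₀ (min δ₁ δ₂) ⊆ ball t₀ δ₂ := ball_subset_ball (min_le_right _ _)
  have h := hs.isState ht₀ (hp t₀ ht₀)
  have hw := hs.isRate hI hΩ ht₀ hF
  have hr₀ := hr t₀ (mem_ball_self hδ₂)
  replace hρ := hρ.mono (ball_subset_ball (min_le_left δ₁ δ₂))
  replace hE := hE.mono (ball_subset_ball (min_le_left δ₁ δ₂))
  -- `S` is merely continuous, but `H⁽ᶜ⁾` contains only its primitive, which is `C¹`.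
  have hP := (hcr.mono hT2).comp (hasDerivAt_primitive_clampS hr₀.mem hr₀.nonneg)
    (continuous_clampS hr₀.mem hr₀.nonneg)
  have hA := hE.add (hρ.mul hP)
  have hval : ∀ t ∈ ball t₀ (min δ₁ δ₂), EqOn (fun X => chi Ω X * (∫ ξ, entropyDensity β (f t) X ξ)
      + extDens Ω (f t) X * ∫ y in (0 : ℝ)..crowd G Ω (f t) X, clampS G r y)
      (fun X => (∫ ξ, entropyDensity β (f t) X ξ) + Hc G Ω (f t) X) C := fun t ht X hX => by
    have hX' := hcell.subset hX
    have hl := (hr t (hT2 ht)).le X hX'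
    simp only [extDens, chi_of_mem hX', one_mul, Hc, primitive_clampS_eq hl.1 hl.2]
  refine ⟨(hA.integrableOn hC ht).1.congr_fun (hval t₀ ht) hcell.measurableSet, _,
    (hA.hasDerivAt_integral hT hC ht).congr_of_eventuallyEq ?_, ?_⟩
  · filter_upwards [hT.mem_nhds ht] with t ht'
    exact (setIntegral_congr_fun hcell.measurableSet (hval t ht')).symm
  obtain ⟨T1, T4, hle⟩ := h.entropy_balance hw hcell hr₀ hflux
  refine le_trans (le_of_eq ?_) hle
  have hg := h.gasData hcell hr₀
  obtain ⟨c₁, h10, h1⟩ := h.exists_extDens_le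
  obtain ⟨c₂, h20, h2⟩ := exists_extDens_rate_le hw
  obtain ⟨S, hS⟩ := hg.s_bound
  have hS0 : 0 ≤ S := (hg.s_nonneg 0).trans (hS 0)
  have hSc : 0 ≤ S * c₁ := by positivity
  have hwp : ∀ p ∈ P, ∀ X, extDens Ω (rate f t₀) (X + p) = extDens Ω (rate f t₀) X :=
    fun p hp' X => by
      have : ∀ ξ, rate f t₀ (X + p) ξ = rate f t₀ X ξ := fun ξ =>
        EventuallyEq.deriv_eq (by
          filter_upwards [hI.mem_nhds ht₀] with s hs'
          exact hp s hs' p hp' X ξ)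
      simp only [extDens, dens, chi_periodic hcell hp', this]
  -- Symmetry of the crowding kernel: the change of `𝓡` weighted with `ρ S(𝓡)` equals the transfer
  -- potential weighted with the change of `ρ`. Hence the derivative of `∫ H⁽ᶜ⁾` is `entropyPot`
  -- integrated against `∂ₜρ`.
  have hswap := hcell.integral_conv_swap (k := crowdKer G)
    (p := fun X => extS G Ω (f t₀) X * extDens Ω (f t₀) X) (q := extDens Ω (rate f t₀))
    (c := S * c₁ + c₂) (integrable_crowdKer G) (measurable_crowdKer G)
    (fun z => by rw [crowdKer, crowdKer, norm_neg]) (hg.measurable_s.mul (h.measurable_extDens hΩ))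
    (measurable_chi_mul_integral hΩ hw.continuousOn)
    (fun X => by
      rw [abs_mul, abs_of_nonneg (hg.s_nonneg X)]
      exact (mul_le_mul (hS X) (h1 X) (abs_nonneg _) hS0).trans (by linarith))
    (fun X => (h2 X).trans (by linarith))
    (fun X hX => by rw [extDens, chi_of_notMem hX, zero_mul, mul_zero])
    (fun X hX => by rw [extDens, chi_of_notMem hX, zero_mul])
    (fun p hp' X => by rw [hg.s_periodic p hp', h.extDens_periodic hcell hp']) hwp
  have iρP := hρ.integrableOn_mul_deriv hP hC ht
  have iPρ := hP.integrableOn_mul_deriv hρ hC ht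
  have iρP' : IntegrableOn (fun X => extDens Ω (rate f t₀) X
      * ∫ y in (0 : ℝ)..crowd G Ω (f t₀) X, clampS G r y) C :=
    iPρ.congr_fun (fun X _ => mul_comm _ _) hcell.measurableSet
  have iP : IntegrableOn (fun X => extDens Ω (rate f t₀) X
      * (∫ y in (0 : ℝ)..crowd G Ω (f t₀) X, clampS G r y) + extDens Ω (f t₀) X
      * (clampS G r (crowd G Ω (f t₀) X) * ∫ z, crowdKer G z * extDens Ω (rate f t₀) (X + z))) C :=
    iρP'.add iρP
  rw [integral_add (hE.integrableOn hC ht).2 iP, integral_add iρP' iρP]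
  have e1 : ∫ X in C, chi Ω X * (∫ ξ, rate f t₀ X ξ * (1 + GasData.logFactor β (f t₀) X ξ))
      = ∫ X in C, ∫ ξ, rate f t₀ X ξ * (1 + GasData.logFactor β (f t₀) X ξ) :=
    setIntegral_congr_fun hcell.measurableSet fun X hX => by
      simp only [chi_of_mem (hcell.subset hX), one_mul]
  have e2 : ∫ X in C, extDens Ω (f t₀) X * (clampS G r (crowd G Ω (f t₀) X)
        * ∫ z, crowdKer G z * extDens Ω (rate f t₀) (X + z))
      = ∫ X in C, transferPot G Ω (f t₀) X * ∫ ξ, rate f t₀ X ξ := by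
    refine Eq.trans (setIntegral_congr_fun hcell.measurableSet fun X hX => ?_)
      (hswap.trans (setIntegral_congr_fun hcell.measurableSet fun X hX => ?_))
    · simp only [extS_eq hr₀, chi_of_mem (hcell.subset hX)]
      ring
    · simp only [← ballConv_eq_conv G fun X => extS G Ω (f t₀) X * extDens Ω (f t₀) X,
        transferPot, extDens.eq_def Ω (rate f t₀),
        chi_of_mem (hcell.subset hX), one_mul, dens]
      rw [mul_comm]
  have e3 : ∫ X in C, entropyPot G Ω (f t₀) r X * ∫ ξ, rate f t₀ X ξ
      = (∫ X in C, extDens Ω (rate f t₀) X * ∫ y in (0 : ℝ)..crowd G Ω (f t₀) X, clampS G r y)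
        + ∫ X in C, transferPot G Ω (f t₀) X * ∫ ξ, rate f t₀ X ξ := by
    have h3 : EqOn (fun X => entropyPot G Ω (f t₀) r X * ∫ ξ, rate f t₀ X ξ)
        (fun X => (extDens Ω (rate f t₀) X * ∫ y in (0 : ℝ)..crowd G Ω (f t₀) X, clampS G r y)
          + transferPot G Ω (f t₀) X * ∫ ξ, rate f t₀ X ξ) C := fun X hX => by
      simp only [entropyPot, extDens, chi_of_mem (hcell.subset hX), one_mul, dens]
      ring
    have h4 : IntegrableOn (fun X => transferPot G Ω (f t₀) X * ∫ ξ, rate f t₀ X ξ) C := by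
      refine (T4.sub iρP').congr_fun (fun X hX => ?_) hcell.measurableSet
      have := h3 hX
      simp only [Pi.sub_apply] at this ⊢
      rw [this]; ring
    rw [setIntegral_congr_fun hcell.measurableSet h3, integral_add iρP' h4]
  rw [e1, e2, e3]

end IsClassicalSolution

/-! ### The H-theorem -/

lemma Hfun_eq (G : Gas) (Ω : Set V3) (u : V3 → V3 → ℝ) (X : V3) :
    Hfun G Ω u X = (∫ ξ, entropyDensity 0 u X ξ) + Hc G Ω u X := by
  simp only [Hfun, Hk, entropyDensity, zero_mul, add_zero]

lemma IsState.freeEnergy_eq {G : Gas} {Ω P : Set V3} {u : V3 → V3 → ℝ} (h : IsState Ω P u)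
    (Rg Tw : ℝ) {X : V3} (hX : X ∈ Ω) : freeEnergy G Rg Tw Ω u X
      = Rg * Tw * ((∫ ξ, entropyDensity (1 / (2 * Rg * Tw)) u X ξ) + Hc G Ω u X) := by
  have h1 : ∀ ξ, u X ξ * Real.log (u X ξ / wallMaxwellian Rg Tw ξ)
      = entropyDensity (1 / (2 * Rg * Tw)) u X ξ := fun ξ => by
    rw [Real.log_div (h.pos X hX ξ).ne' (wallMaxwellian_pos Rg Tw ξ).ne', log_wallMaxwellian,
      sub_neg_eq_add, entropyDensity]
  simp only [freeEnergy, h1]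

lemma HasBoundaryValues.hasTrace {I : Set ℝ} {D : Set V3} {ψ : V3 → ℝ} {f : ℝ → V3 → V3 → ℝ}
    (h : HasBoundaryValues I D ψ f) {t : ℝ} (ht : t ∈ I) : HasTrace D ψ (f t) :=
  ContinuousOn.comp (f := fun p : V3 × V3 => (t, p)) h (by fun_prop) fun _ hp => ⟨ht, hp⟩

namespace IsClassicalSolution

variable {G : Gas} {I : Set ℝ} {Ω C P D : Set V3} {F : ℝ → V3 → V3} {f : ℝ → V3 → V3 → ℝ} {Φ : ℝ → ℝ}

lemma hasZeroFlux_fluxDiff (hs : IsClassicalSolution G I Ω F f) (hI : IsOpen I)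
    (hcell : IsCell Ω C P) (hp : ∀ t ∈ I, ∀ p ∈ P, ∀ X ξ, f t (X + p) ξ = f t X ξ) {β t : ℝ}
    (ht : t ∈ I) (hF : ∃ c, ∀ X ∈ Ω, ‖F t X‖ ≤ c) (hflux : NonnegFlux Ω C P (f t) β) :
    HasZeroFlux Ω C (fluxDiff G Ω (f t)) := by
  obtain ⟨δ, hδ, r, -, hr, -⟩ := hs.exists_crowdLe hI hcell hp ht
  exact (hs.isState ht (hp t ht)).hasZeroFlux_fluxDiff (hs.isRate hI hcell.isOpen ht hF) hcell
    (hr t (mem_ball_self hδ)) hflux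

/-- The case `β = 0`, in which the bound on the derivative is zero for every force that is bounded
in position. -/
theorem entropy_antitone (hs : IsClassicalSolution G I Ω F f) (hI : IsOpen I) (hI' : I.OrdConnected)
    (hcell : IsCell Ω C P) (hp : ∀ t ∈ I, ∀ p ∈ P, ∀ X ξ, f t (X + p) ξ = f t X ξ)
    (hF : ∀ t ∈ I, ∃ c, ∀ X ∈ Ω, ‖F t X‖ ≤ c) (hflux : ∀ t ∈ I, NonnegFlux Ω C P (f t) 0) :
    (∀ t ∈ I, ZeroDivergenceIntegral Ω C (fluxDiff G Ω (f t))) ∧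
      (∀ t ∈ I, IntegrableOn (Hfun G Ω (f t)) C) ∧
      AntitoneOn (fun t => ∫ X in C, Hfun G Ω (f t) X) I := by
  refine ⟨fun t ht => (hs.hasZeroFlux_fluxDiff hI hcell hp ht (hF t ht)
    (hflux t ht)).zeroDivergenceIntegral hcell, fun t ht => ?_, antitoneOn_of_hasDerivAt hI' fun t ht => ?_⟩
  · exact (hs.hasDerivAt_entropy hI hcell hp ht (hF t ht) (hflux t ht)).1.congr_fun
      (fun X _ => (Hfun_eq G Ω (f t) X).symm) hcell.measurableSet
  · obtain ⟨-, d, hd, hle⟩ := hs.hasDerivAt_entropy hI hcell hp ht (hF t ht) (hflux t ht)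
    simp only [mul_zero, zero_mul, integral_zero] at hle
    simp only [Hfun_eq]
    exact ⟨d, hd, hle⟩

/-- The rate of change of the free energy without its potential part. -/
lemma hasDerivAt_freeEnergy (hs : IsClassicalSolution G I Ω F f) (hI : IsOpen I)
    (hcell : IsCell Ω C P) (hp : ∀ t ∈ I, ∀ p ∈ P, ∀ X ξ, f t (X + p) ξ = f t X ξ)
    {Rg Tw t₀ : ℝ} (hR : 0 < Rg) (hT : 0 < Tw) (ht₀ : t₀ ∈ I)
    (hF : ∃ c, ∀ X ∈ Ω, ‖F t₀ X‖ ≤ c) (hflux : NonnegFlux Ω C P (f t₀) (1 / (2 * Rg * Tw))) :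
    IntegrableOn (freeEnergy G Rg Tw Ω (f t₀)) C ∧
    ∃ d, HasDerivAt (fun t => ∫ X in C, freeEnergy G Rg Tw Ω (f t) X) d t₀ ∧
      d ≤ ∫ X in C, inner ℝ (F t₀ X) (∫ ξ, f t₀ X ξ • ξ) := by
  obtain ⟨hi, d, hd, hle⟩ := hs.hasDerivAt_entropy hI hcell hp ht₀ hF hflux
  have heq : ∀ t ∈ I, EqOn (fun X => Rg * Tw
      * ((∫ ξ, entropyDensity (1 / (2 * Rg * Tw)) (f t) X ξ) + Hc G Ω (f t) X))
      (freeEnergy G Rg Tw Ω (f t)) C := fun t ht X hX =>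
    ((hs.isState ht (hp t ht)).freeEnergy_eq Rg Tw (hcell.subset hX)).symm
  refine ⟨IntegrableOn.congr_fun (hi.const_mul (Rg * Tw)) (heq t₀ ht₀) hcell.measurableSet,
    Rg * Tw * d,
    (hd.const_mul (Rg * Tw)).congr_of_eventuallyEq ?_, ?_⟩
  · filter_upwards [hI.mem_nhds ht₀] with t ht
    rw [← integral_const_mul]
    exact (setIntegral_congr_fun hcell.measurableSet (heq t ht)).symm
  · have h1 := mul_le_mul_of_nonneg_left hle (mul_pos hR hT).le
    rw [integral_const_mul, ← mul_assoc] at h1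
    -- The value `β = 1/(2RT_w)` is just what gives the work of the force the coefficient `RT_w · 2β
    -- = 1`.
    rwa [show Rg * Tw * (2 * (1 / (2 * Rg * Tw))) = 1 by field_simp, one_mul] at h1

/-- As the kernel is even, the two ways of differentiating `½ ∫∫ Φ ρ ρ` agree and give the potential
integrated against `∂ₜρ`. Conservation of mass without flux through the boundary turns this into
minus the work of the force, since the force is minus the gradient of the potential. -/
lemma hasDerivAt_vlasovEnergy (hs : IsClassicalSolution G I D F f) (hI : IsOpen I)
    (hD : IsOpen D) (hb : Bornology.IsBounded D) (hΦ : IsPotential Φ) {β t₀ : ℝ} (ht₀ : t₀ ∈ I)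
    (hF : ∃ c, ∀ X ∈ D, ‖F t₀ X‖ ≤ c) (hflux : NonnegFlux D D ∅ (f t₀) β) :
    IntegrableOn (fun X => dens (f t₀) X * vlasovEnergy D Φ (f t₀) X) D ∧
    HasDerivAt (fun t => ∫ X in D, dens (f t) X * vlasovEnergy D Φ (f t) X)
      (-∫ X in D, inner ℝ (vlasovForce D Φ (f t₀) X) (∫ ξ, f t₀ X ξ • ξ)) t₀ := by
  have hcell := isCell_of_bounded hD hb
  have hp : ∀ t ∈ I, ∀ p ∈ (∅ : Set V3), ∀ X ξ, f t (X + p) ξ = f t X ξ := by simp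
  have hC : volume D ≠ ⊤ := hcell.measure_lt_top.ne
  have h := hs.isState ht₀ (hp t₀ ht₀)
  have hw := hs.isRate hI hD ht₀ hF
  obtain ⟨δ, hδ, hδI, hρ, -⟩ := hs.exists_paths hI hD 0 ht₀
  obtain ⟨δ', hδ', r, -, hr, -⟩ := hs.exists_crowdLe hI hcell hp ht₀
  have ht := mem_ball_self (x := t₀) hδ
  obtain ⟨hK, c, hc⟩ := h.hasWeakGrad_vlasov hD hb hΦ
  obtain ⟨-, -, -, hbal⟩ := h.hasZeroFlux_potential hw hcell (hr t₀ (mem_ball_self hδ')) hflux hK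
    ⟨c, fun X hX => by rw [norm_neg]; exact hc X hX⟩ fun p hp => absurd hp (notMem_empty p)
  obtain ⟨R, hR⟩ := hb.subset_ball (0 : V3)
  -- The same truncation as for the flux: distances in `D` stay below `2R`.
  have hki : Integrable ((ball (0 : V3) (R + R)).indicator fun z => Φ ‖z‖) :=
    (integrable_indicator_iff measurableSet_ball).2 (hΦ.integrableOn_radial _)
  set k := (ball (0 : V3) (R + R)).indicator fun z => Φ ‖z‖ with hk
  have hkm : Measurable k := hΦ.measurable_radial.indicator measurableSet_ball
  have hke : ∀ z, k (-z) = k z := fun z => by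
    by_cases hz : z ∈ ball (0 : V3) (R + R)
    · rw [hk, indicator_of_mem hz, indicator_of_mem (by simpa using hz), norm_neg]
    · rw [hk, indicator_of_notMem hz, indicator_of_notMem (by simpa using hz)]
  have hpot : ∀ t, ∀ X ∈ D, ∫ z, k z * extDens D (f t) (X + z) = vlasovPot D Φ (f t) X :=
    fun t X hX => integral_congr_ae (Eventually.of_forall fun z => by
      by_cases hY : X + z ∈ D
      · have hz : z ∈ ball (0 : V3) (R + R) := by
          have h3 := norm_sub_le (X + z) X
          rw [add_sub_cancel_left] at h3
          have h4 := mem_ball_zero_iff.1 (hR hY)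
          have h5 := mem_ball_zero_iff.1 (hR hX)
          rw [mem_ball_zero_iff]; linarith
        simp only [hk, indicator_of_mem hz]
      · simp only [extDens, chi_of_notMem hY, zero_mul, mul_zero])
  have hkρ := hρ.conv isOpen_ball hki hkm
  have hA := hρ.mul hkρ
  have hval : ∀ t, EqOn (fun X => 1 / 2 * (extDens D (f t) X * ∫ z, k z * extDens D (f t) (X + z)))
      (fun X => dens (f t) X * vlasovEnergy D Φ (f t) X) D := fun t X hX => by
    simp only [hpot t X hX, vlasovEnergy_eq hD.measurableSet]
    rw [extDens, chi_of_mem hX]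
    ring
  refine ⟨IntegrableOn.congr_fun ((hA.integrableOn hC ht).1.const_mul (1 / 2)) (hval t₀)
    hD.measurableSet, ?_⟩
  refine (((hA.hasDerivAt_integral isOpen_ball hC ht).const_mul (1 / 2)).congr_of_eventuallyEq
    (Eventually.of_forall fun t => ?_)).congr_deriv ?_
  · beta_reduce
    rw [← integral_const_mul]
    exact (setIntegral_congr_fun hD.measurableSet (hval t)).symm
  obtain ⟨c₁, h10, h1⟩ := hρ.bound
  have hswap := hcell.integral_conv_swap (p := extDens D (f t₀)) (q := extDens D (rate f t₀))
    hki hkm hke (hρ.measurable t₀ ht) (hρ.measurable_deriv t₀ ht) (fun X => (h1 t₀ ht X).1)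
    (fun X => (h1 t₀ ht X).2) (fun X hX => by rw [extDens, chi_of_notMem hX, zero_mul])
    (fun X hX => by rw [extDens, chi_of_notMem hX, zero_mul])
    (fun p hp => absurd hp (notMem_empty p)) fun p hp => absurd hp (notMem_empty p)
  have i1 := hρ.integrableOn_mul_deriv hkρ hC ht
  have i2 : IntegrableOn (fun X => extDens D (rate f t₀) X * ∫ z, k z * extDens D (f t₀) (X + z)) D :=
    (hkρ.integrableOn_mul_deriv hρ hC ht).congr_fun (fun X _ => mul_comm _ _) hD.measurableSet
  have e1 : ∫ X in D, extDens D (rate f t₀) X * ∫ z, k z * extDens D (f t₀) (X + z)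
      = ∫ X in D, vlasovPot D Φ (f t₀) X * ∫ ξ, rate f t₀ X ξ :=
    setIntegral_congr_fun hD.measurableSet fun X hX => by
      simp only [hpot t₀ X hX]
      rw [extDens, chi_of_mem hX, one_mul, mul_comm, dens]
  rw [integral_add i2 i1, hswap, e1, ← hbal]
  simp only [inner_neg_left, integral_neg]
  ring

lemma deriv_dens (hs : IsClassicalSolution G I Ω F f) (hI : IsOpen I) (hΩ : IsOpen Ω) {t : ℝ}
    (ht : t ∈ I) {X : V3} (hX : X ∈ Ω) :
    deriv (fun s => dens (f s) X) t = dens (rate f t) X := by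
  obtain ⟨δ, hδ, -, hρ, -⟩ := hs.exists_paths hI hΩ 0 ht
  have h1 := hρ.hasDerivAt t (mem_ball_self hδ) X
  simp only [extDens, chi_of_mem hX, one_mul] at h1
  exact h1.deriv

end IsClassicalSolution

end Enskog

/-! ### The three boundary conditions -/

theorem mainTheorem4 (G : Gas) (Rg Tw : ℝ) (hRg : 0 < Rg) (hTw : 0 < Tw)
    (I : Set ℝ) (hI : IsOpen I) (hI' : I.OrdConnected) :
    -- (i) periodic domains, without or with Vlasov term
    (∀ (b : Module.Basis (Fin 3) ℝ V3) (F : ℝ → V3 → V3) (f : ℝ → V3 → V3 → ℝ),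
      (F = 0 ∨ ∃ Φ : ℝ → ℝ, IsPotential Φ ∧ IntegrableOn (fun r => r ^ 2 * deriv Φ r) (Ioi 0) ∧
        F = fun t => vlasovForce univ Φ (f t)) →
      IsClassicalSolution G I univ F f →
      (∀ t ∈ I, ∀ X ξ i, f t (X + b i) ξ = f t X ξ) →
      (∀ t ∈ I, ZeroDivergenceIntegral univ (ZSpan.fundamentalDomain b) (fluxDiff G univ (f t))) ∧
      (∀ t ∈ I, IntegrableOn (Hfun G univ (f t)) (ZSpan.fundamentalDomain b)) ∧
      AntitoneOn (fun t => ∫ X in ZSpan.fundamentalDomain b, Hfun G univ (f t) X) I) ∧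
    -- (ii) specular reflection, without or with Vlasov term
    (∀ (D : Set V3) (ψ : V3 → ℝ) (F : ℝ → V3 → V3) (f : ℝ → V3 → V3 → ℝ),
      IsC1Domain D ψ →
      (F = 0 ∨ ∃ Φ : ℝ → ℝ, IsPotential Φ ∧ F = fun t => vlasovForce D Φ (f t)) →
      IsClassicalSolution G I D F f → HasBoundaryValues I D ψ f → IsSpecular I D ψ f →
      (∀ t ∈ I, ZeroDivergenceIntegral D D (fluxDiff G D (f t))) ∧
      (∀ t ∈ I, IntegrableOn (Hfun G D (f t)) D) ∧
      AntitoneOn (fun t => ∫ X in D, Hfun G D (f t) X) I) ∧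
    -- (iii) impermeable surface of a heat bath, without Vlasov term
    (∀ (D : Set V3) (ψ : V3 → ℝ) (κ : V3 → ProbabilityTheory.Kernel V3 V3)
        (f : ℝ → V3 → V3 → ℝ),
      IsC1Domain D ψ → IsHeatBathWall Rg Tw D ψ κ →
      IsClassicalSolution G I D 0 f → HasBoundaryValues I D ψ f → IsScattered I D ψ κ f →
      (∀ t ∈ I, ZeroDivergenceIntegral D D (fluxDiff G D (f t)) ∧
        ZeroDivergenceIntegral D D (freeFluxRemainder G Rg Tw D (f t))) ∧
      (∀ t ∈ I, IntegrableOn (freeEnergy G Rg Tw D (f t)) D) ∧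
      AntitoneOn (fun t => ∫ X in D, freeEnergy G Rg Tw D (f t) X) I) ∧
    -- (iii) impermeable surface of a heat bath, with Vlasov term
    (∀ (D : Set V3) (ψ : V3 → ℝ) (κ : V3 → ProbabilityTheory.Kernel V3 V3) (Φ : ℝ → ℝ)
        (f : ℝ → V3 → V3 → ℝ),
      IsC1Domain D ψ → IsHeatBathWall Rg Tw D ψ κ → IsPotential Φ →
      IsClassicalSolution G I D (fun t => vlasovForce D Φ (f t)) f →
      HasBoundaryValues I D ψ f → IsScattered I D ψ κ f →
      (∀ t ∈ I, ZeroDivergenceIntegral D D (fluxDiff G D (f t)) ∧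
        ZeroDivergenceIntegral D D (freeFluxRemainder G Rg Tw D (f t)) ∧
        ZeroDivergenceIntegral D D (vlasovFlux D Φ f t)) ∧
      (∀ t ∈ I, IntegrableOn (freeEnergyVlasov G Rg Tw D Φ (f t)) D) ∧
      AntitoneOn (fun t => ∫ X in D, freeEnergyVlasov G Rg Tw D Φ (f t) X) I) := by
  have hp : ∀ {f : ℝ → V3 → V3 → ℝ}, ∀ t ∈ I, ∀ p ∈ (∅ : Set V3), ∀ X ξ, f t (X + p) ξ = f t X ξ :=
    fun t _ p hp => absurd hp (notMem_empty p)
  refine ⟨fun b F f hF hs hper => ?_, fun D ψ F f hD hF hs hb hsp => ?_,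
    fun D ψ κ f hD hκ hs hb hsc => ?_, fun D ψ κ Φ f hD hκ hΦ hs hb hsc => ?_⟩
  · have hp : ∀ t ∈ I, ∀ p ∈ range b, ∀ X ξ, f t (X + p) ξ = f t X ξ := by
      rintro t ht _ ⟨i, rfl⟩ X ξ
      exact hper t ht X ξ i
    refine hs.entropy_antitone hI hI' (isCell_fundamentalDomain b) hp (fun t ht => ?_)
      fun t ht => nonnegFlux_periodic b (hs.isState ht (hp t ht)) 0
    rcases hF with rfl | ⟨Φ, -, hi, rfl⟩
    · exact ⟨0, by simp⟩
    · obtain ⟨c, hc⟩ := (hs.isState ht (hp t ht)).exists_vlasovForce_le_of_integrable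
        MeasurableSet.univ hi
      exact ⟨c, fun X _ => hc X⟩
  · refine hs.entropy_antitone hI hI' (isCell_of_bounded hD.isOpen hD.bounded) hp (fun t ht => ?_)
      fun t ht => nonnegFlux_specular (hb.hasTrace ht) hD (hs.isState ht (hp t ht)) 0 (hsp t ht)
    rcases hF with rfl | ⟨Φ, hΦ, rfl⟩
    · exact ⟨0, by simp⟩
    · obtain ⟨-, c, hc⟩ := (hs.isState ht (hp t ht)).hasWeakGrad_vlasov hD.isOpen hD.bounded hΦ
      exact ⟨c, fun X hX => (hc X hX).2⟩
  · have hcell := isCell_of_bounded hD.isOpen hD.bounded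
    have hF : ∀ t ∈ I, ∃ c, ∀ X ∈ D, ‖(0 : ℝ → V3 → V3) t X‖ ≤ c := fun t _ => ⟨0, by simp⟩
    have hst : ∀ t ∈ I, IsState D ∅ (f t) := fun t ht => hs.isState ht (hp t ht)
    have hflux := fun t ht => nonnegFlux_scattered (hb.hasTrace ht) hD (hst t ht) hRg hTw hκ (hsc t ht)
    refine ⟨fun t ht => ?_, fun t ht =>
      (hs.hasDerivAt_freeEnergy hI hcell hp hRg hTw ht (hF t ht) (hflux t ht)).1,
      antitoneOn_of_hasDerivAt hI' fun t ht => ?_⟩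
    · obtain ⟨δ, hδ, r, -, hr, -⟩ := hs.exists_crowdLe hI hcell hp ht
      exact ⟨(hs.hasZeroFlux_fluxDiff hI hcell hp ht (hF t ht) (hflux t ht)).zeroDivergenceIntegral hcell,
        ((hst t ht).hasZeroFlux_freeFluxRemainder hcell (hr t (mem_ball_self hδ)) hRg
          hTw).zeroDivergenceIntegral hcell⟩
    · obtain ⟨-, d, hd, hle⟩ :=
        hs.hasDerivAt_freeEnergy hI hcell hp hRg hTw ht (hF t ht) (hflux t ht)
      simp only [Pi.zero_apply, inner_zero_left, integral_zero] at hle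
      exact ⟨d, hd, hle⟩
  · have hcell := isCell_of_bounded hD.isOpen hD.bounded
    have hst : ∀ t ∈ I, IsState D ∅ (f t) := fun t ht => hs.isState ht (hp t ht)
    have hF : ∀ t ∈ I, ∃ c, ∀ X ∈ D, ‖vlasovForce D Φ (f t) X‖ ≤ c := fun t ht => by
      obtain ⟨-, c, hc⟩ := (hst t ht).hasWeakGrad_vlasov hD.isOpen hD.bounded hΦ
      exact ⟨c, fun X hX => (hc X hX).2⟩
    have hflux := fun t ht => nonnegFlux_scattered (hb.hasTrace ht) hD (hst t ht) hRg hTw hκ (hsc t ht)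
    have hfree := fun t ht => hs.hasDerivAt_freeEnergy hI hcell hp hRg hTw ht (hF t ht) (hflux t ht)
    have hpot := fun t ht => hs.hasDerivAt_vlasovEnergy hI hD.isOpen hD.bounded hΦ ht (hF t ht)
      (hflux t ht)
    refine ⟨fun t ht => ?_, fun t ht => (hfree t ht).1.add (hpot t ht).1,
      antitoneOn_of_hasDerivAt hI' fun t ht => ?_⟩
    · obtain ⟨δ, hδ, r, -, hr, -⟩ := hs.exists_crowdLe hI hcell hp ht
      exact ⟨(hs.hasZeroFlux_fluxDiff hI hcell hp ht (hF t ht) (hflux t ht)).zeroDivergenceIntegral hcell,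
        ((hst t ht).hasZeroFlux_freeFluxRemainder hcell (hr t (mem_ball_self hδ)) hRg
          hTw).zeroDivergenceIntegral hcell,
        ((hst t ht).hasZeroFlux_vlasovFlux (hs.isRate hI hD.isOpen ht (hF t ht)) hD.isOpen hD.bounded
          (hr t (mem_ball_self hδ)) (hflux t ht) hΦ
          fun Y hY => hs.deriv_dens hI hD.isOpen ht hY).zeroDivergenceIntegral hcell⟩
    · obtain ⟨-, d, hd, hle⟩ := hfree t ht
      -- The work of the Vlasov force, which bounds the derivative of `F`, cancels against the
      -- derivative of the potential energy.
      refine ⟨_, (hd.add (hpot t ht).2).congr_of_eventuallyEq ?_, by linarith⟩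
      filter_upwards [hI.mem_nhds ht] with s hs'
      exact integral_add (hfree s hs').1 (hpot s hs').1
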